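/- **Definitions.** Let $\mathcal I$ be the independent sets of a matroid. For bases $B,B'$ and reals $\delta,\delta'\ge 0$, the procedure *merge-bases*$(\delta,B,\delta',B')$ repeats the following while $B\setminus B'\neq\emptyset$: choose a valid exchange pair, that is $e\in B\setminus B'$ and $e'\in B'\setminus B$ with $B-e+e'\in\mathcal I$ and $B'-e'+e\in\mathcal I$; with probability $\delta/(\delta+\delta')$ (read as $0$ if $\delta=\delta'=0$) replace $B'$ by $B'-e'+e$, otherwise replace $B$ by $B-e+e'$. It returns the common base. *Swap-round*$(\delta_1,B_1,\dots,\delta_h,B_h)$ merges the bases in some order until one is left, where a base that was obtained from a group of the $B_i$ carries the sum of the group's coefficients. We write $X\overset{d}{=}\text{swap-round}(\delta_1,B_1,\dots,\delta_h,B_h)$ if $X$ has the law of the output of this process for some choice of the merging order and some choices of valid exchange pairs, and similarly for the other procedures. An implicit representation of a convex combination $\sum_{i=1}^h\delta_i\mathbf 1_{B_i}$ of bases ($\delta_i\ge 0$, $\sum_i\delta_i=1$) consists of $B_1$, the coefficients, and sets $E_i,E_i'$ with $E_i\cap E_i'=\emptyset$ and $B_{i+1}=(B_i\setminus E_i)\cup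 E_i'$ for $1\le i<h$. *Divide-swap*$(B,(E_i,E_i')_{i=s}^{t-1},(\delta_i)_{i=s}^{t})$ returns $B$ if $s=t$. Otherwise let $U=\bigcup_{i=s}^{t-1}(E_i\cup E_i')$ and let $\ell$ be the largest $\ell\in\{s,\dots,t-1\}$ with $\sum_{i=s}^{\ell-1}|E_i|\le\frac12\sum_{i=s}^{t-1}|E_i|$. Contract $B\setminus U$ in the matroid; call divide-swap in the contracted matroid on $B\cap U$ with the indices $s,\dots,\ell$, and on the set obtained from $B\cap U$ by the exchanges $s,\dots,\ell$ with the indices $\ell+1,\dots,t$; merge the two resulting bases by merge-bases in the contracted matroid, with coefficients $\sum_{i=s}^{\ell}\delta_i$ and $\sum_{i=\ell+1}^{t}\delta_i$; return the result together with $B\setminus U$. **Theorem.** 1. For every matroid and every implicit representation of a convex combination of (finite) bases $B_1,\dots,B_h$, divide-swap can be carried out, and the output $X$ of divide-swap, for any choices of valid exchange pairs, satisfies $X\overset{d}{=}\text{swap-round}(\delta_1,B_1,\dots,\delta_h,B_h)$. 2. There is a randomized algorithm that takes as input an implicit representation $T_1$, $(E_i,E_i')_{i=1}^{h-1}$, $(\delta_i)_{i=1}^h$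 of a convex combination of spanning trees of a multigraph $G$ with $n$ vertices (edges are given by an identifier and two endpoints) and outputs a spanning tree $T_S$ of $G$ with $T_S\overset{d}{=}\text{swap-round}(\delta_1,T_1,\dots,\delta_h,T_h)$. If moreover $E_i\subseteq T_i$ and $E_i'\cap T_i=\emptyset$ for all $i$ (so that $E_i=T_i\setminus T_{i+1}$ and $E_i'=T_{i+1}\setminus T_i$), then $T_S$ is the output of divide-swap on the input for some choices of valid exchange pairs. For all outcomes of the coin flips the running time is at most $C\,N(\lfloor\log_2 N\rfloor+1)^{c}$, with absolute constants $C,c$ and $N=n+\gamma+z$, where $\gamma=\sum_{i=1}^{h-1}(|E_i|+|E_i'|)$ and $z$ is the number of indices $i$ with $E_i=E_i'=\emptyset$. In particular it is $\tilde O(n+\gamma)$ if no exchange is trivial. Running time is counted on a unit-cost list-processing machine, whose data are trees built from pointers, labels and real weights. Its elementary operations build and take apart pairs; compare, increment and decrement labels; add two weights; and flip a coin that shows heads with probability $a/(a+b)$ for two given weights $a,b$. Each of them takes constant time on a random access machine. -/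

import Mathlib

open scoped NNReal ENNReal

namespace SwapRounding

/-! ### Randomized swap rounding as a family of laws

Sets of elements are `Finset`s. The matroid (or graph) enters through its family of independent
sets `Indep`. The algorithms are non-deterministic in the choice of exchange pairs and in the
order in which bases are merged, so each of them is described by the collection of the output
laws that it can produce. -/

section Laws

variable {α : Type*} [DecidableEq α]

/-- The law of a bit that is `true` with probability `a / (a + b)` (probability `0` if
`a = b = 0`). -/
noncomputable def coin (a b : ℝ≥0) : PMF Bool :=
  PMF.ofFintype (fun c => ((bif c then a / (a + b) else 1 - a / (a + b) : ℝ≥0) : ℝ≥0∞)) (by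
    have h : a / (a + b) ≤ 1 := div_le_one_of_le₀ le_self_add zero_le
    rw [Fintype.sum_bool]
    simp only [cond_true, cond_false]
    rw [← ENNReal.coe_add, add_tsub_cancel_of_le h, ENNReal.coe_one])

/-- `MergeLaw Indep a a' B B' μ`: `μ` is the law of the output of a run of the merging procedure
on the bases `B`, `B'` with coefficients `a`, `a'`, for some choices of valid exchange pairs.
As long as `B \ B'` is non-empty, a valid exchange pair `e, e'` is chosen. With probability
`a / (a + a')` the element `e` of `B` is kept in both bases, otherwise the element `e'` of `B'`
is. The choices may depend on the outcomes of the earlier coin flips. -/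
inductive MergeLaw (Indep : Finset α → Prop) (a a' : ℝ≥0) :
    Finset α → Finset α → PMF (Finset α) → Prop
  | done (B B' : Finset α) : B \ B' = ∅ → MergeLaw Indep a a' B B' (PMF.pure B)
  | swap (B B' : Finset α) (e e' : α) (μ μ' : PMF (Finset α)) :
      e ∈ B \ B' → e' ∈ B' \ B →
      Indep (insert e' (B.erase e)) → Indep (insert e (B'.erase e')) →
      MergeLaw Indep a a' B (insert e (B'.erase e')) μ →
      MergeLaw Indep a a' (insert e' (B.erase e)) B' μ' →
      MergeLaw Indep a a' B B' ((coin a a').bind fun keep => bif keep then μ else μ')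

/-- Total coefficient of a list of weighted bases. -/
noncomputable def totalWeight (L : List (ℝ≥0 × Finset α)) : ℝ≥0 := (L.map Prod.fst).sum

/-- `SwapRoundLaw Indep L μ`: `μ` is the law of the output of randomized swap rounding of the
weighted bases `L`, for some order in which the bases are merged and some choices of valid
exchange pairs. The bases are split into two groups, each group is swap rounded, and the two
resulting bases are merged with the total coefficients of the groups. Merging the bases one after
the other is the case where the second group is always a single base. -/
inductive SwapRoundLaw (Indep : Finset α → Prop) :
    List (ℝ≥0 × Finset α) → PMF (Finset α) → Prop
  | single (a : ℝ≥0) (B : Finset α) : SwapRoundLaw Indep [(a, B)] (PMF.pure B)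
  | merge (L R : List (ℝ≥0 × Finset α)) (μL μR : PMF (Finset α))
      (κ : Finset α → Finset α → PMF (Finset α)) :
      SwapRoundLaw Indep L μL → SwapRoundLaw Indep R μR →
      (∀ X ∈ μL.support, ∀ Y ∈ μR.support,
        MergeLaw Indep (totalWeight L) (totalWeight R) X Y (κ X Y)) →
      SwapRoundLaw Indep (L ++ R) (μL.bind fun X => μR.bind fun Y => κ X Y)
  | reorder (L L' : List (ℝ≥0 × Finset α)) (μ : PMF (Finset α)) :
      L.Perm L' → SwapRoundLaw Indep L μ → SwapRoundLaw Indep L' μ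

/-! ### Implicitly represented convex combinations -/

/-- `B - E + E'` for an exchange `p = (E, E')`. -/
def exchange (B : Finset α) (p : Finset α × Finset α) : Finset α := (B \ p.1) ∪ p.2

/-- The sequence `B₁ = B`, `B₍ᵢ₊₁₎ = Bᵢ - Eᵢ + E'ᵢ`. -/
def bases (B : Finset α) : List (Finset α × Finset α) → List (Finset α)
  | [] => [B]
  | p :: ex => B :: bases (exchange B p) ex

/-- `B`, the exchange sets `ex = [(E₁, E'₁), …]` and the coefficients `δ` represent a convex
combination of bases. -/
structure IsImplicitCombination (IsBase : Finset α → Prop) (B : Finset α)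
    (ex : List (Finset α × Finset α)) (δ : List ℝ≥0) : Prop where
  length_eq : δ.length = ex.length + 1
  sum_eq_one : δ.sum = 1
  isBase : ∀ X ∈ bases B ex, IsBase X
  disjoint : ∀ p ∈ ex, Disjoint p.1 p.2

/-- Every exchange only removes elements that are present and only adds elements that are
absent. -/
def IsTight (B : Finset α) : List (Finset α × Finset α) → Prop
  | [] => True
  | p :: ex => p.1 ⊆ B ∧ Disjoint p.2 B ∧ IsTight (exchange B p) ex

/-! ### The divide-and-conquer implementation -/

/-- Independent sets after contraction of an independent set `A`. -/
def contractIndep (Indep : Finset α → Prop) (A : Finset α) : Finset α → Prop :=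
  fun X => Disjoint X A ∧ Indep (X ∪ A)

/-- Total number of removed elements, `∑ |Eᵢ|`. -/
def removedSize (ex : List (Finset α × Finset α)) : ℕ := (ex.map fun p => p.1.card).sum

/-- All elements that take part in some exchange, `⋃ (Eᵢ ∪ E'ᵢ)`. -/
def touched : List (Finset α × Finset α) → Finset α
  | [] => ∅
  | p :: ex => p.1 ∪ p.2 ∪ touched ex

/-- The largest number `k < ex.length` of initial exchanges whose total size `∑ |Eᵢ|` is at most
half of the total size of all the exchanges. -/
def splitIndex (ex : List (Finset α × Finset α)) : ℕ :=
  Nat.findGreatest (fun k => 2 * removedSize (ex.take k) ≤ removedSize ex) (ex.length - 1)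

/-- `DivideSwapLaw Indep B ex δ μ`: `μ` is the law of the output of a run of the
divide-and-conquer implementation of swap rounding on the implicit representation `B, ex, δ`, for
some choices of valid exchange pairs in the calls of the merging procedure. With `U` the set of
the elements that take part in some exchange, the part `B \ U` common to all the bases is
contracted, the contracted bases are split at `k = splitIndex ex` (the exchange number `k`,
counted from `0`, leads from the last base on the left to the first base on the right), the two
halves are treated recursively, the two resulting bases are merged in the contracted matroid, and
`B \ U` is added again. -/
inductive DivideSwapLaw : (Finset α → Prop) → Finset α → List (Finset α × Finset α) →
    List ℝ≥0 → PMF (Finset α) → Prop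
  | single (Indep : Finset α → Prop) (B : Finset α) (a : ℝ≥0) :
      DivideSwapLaw Indep B [] [a] (PMF.pure B)
  | split (Indep : Finset α → Prop) (B : Finset α) (ex : List (Finset α × Finset α))
      (δ : List ℝ≥0) (k : ℕ) (U : Finset α) (μL μR : PMF (Finset α))
      (κ : Finset α → Finset α → PMF (Finset α)) :
      ex ≠ [] → k = splitIndex ex → U = touched ex →
      DivideSwapLaw (contractIndep Indep (B \ U)) (B ∩ U)
        (ex.take k) (δ.take (k + 1)) μL →
      DivideSwapLaw (contractIndep Indep (B \ U)) ((ex.take (k + 1)).foldl exchange (B ∩ U))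
        (ex.drop (k + 1)) (δ.drop (k + 1)) μR →
      (∀ X ∈ μL.support, ∀ Y ∈ μR.support,
        MergeLaw (contractIndep Indep (B \ U)) (δ.take (k + 1)).sum (δ.drop (k + 1)).sum
          X Y (κ X Y)) →
      DivideSwapLaw Indep B ex δ
        (μL.bind fun X => μR.bind fun Y => (κ X Y).map fun Z => Z ∪ (B \ U))

end Laws

/-! ### Spanning trees of multigraphs -/

section Graphs

variable {V E : Type*}

/-- The simple graph on the vertices of `G` in which two distinct vertices are adjacent if some
edge in `F` joins them. -/
def edgeGraph (G : Graph V E) (F : Set E) : SimpleGraph G.vertexSet where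
  Adj x y := x ≠ y ∧ ∃ e ∈ F, G.IsLink e x y
  symm := ⟨fun _ _ h => ⟨h.1.symm, h.2.imp fun _ he => ⟨he.1, he.2.symm⟩⟩⟩
  loopless := ⟨fun _ h => h.1 rfl⟩

/-- `F` is a set of edges of the multigraph `G` without cycles: no loops (cycles of length one), no
parallel edges (cycles of length two) and no longer cycles. -/
structure IsForest (G : Graph V E) (F : Finset E) : Prop where
  subset_edgeSet : ∀ e ∈ F, e ∈ G.edgeSet
  no_loop : ∀ e ∈ F, ∀ x, ¬ G.IsLink e x x
  no_parallel : ∀ e ∈ F, ∀ f ∈ F, ∀ x y, G.IsLink e x y → G.IsLink f x y → e = f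
  isAcyclic : (edgeGraph G (F : Set E)).IsAcyclic

/-- `T` is (the edge set of) a spanning tree of the multigraph `G`. -/
structure IsSpanningTree (G : Graph V E) (T : Finset E) : Prop where
  isForest : IsForest G T
  connected : (edgeGraph G (T : Set E)).Connected

end Graphs

/-! ### The machine model

A unit-cost machine for list processing. The data are immutable binary trees made of pointers, whose
leaves are `nil`, natural numbers (labels of vertices and edges, or counters) and real weights.
Numbers can be compared, incremented and decremented, and nothing else, so a number that arises in
`t` steps exceeds the numbers in the input by at most `t`. Weights can only be added and used as
the bias of a coin. Every elementary operation takes a constant number of steps of a random access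
machine with words of logarithmic length, so every time bound in this model is also one
for random access machines. -/

section Machine

/-- Data. -/
inductive Val : Type
  | nil : Val
  | num (k : ℕ) : Val
  | wt (a : ℝ≥0) : Val
  | pair (x y : Val) : Val

namespace Val

/-- `nil` stands for `false`. -/
def ofBool : Bool → Val
  | true => pair nil nil
  | false => nil

def isNil : Val → Bool
  | nil => true
  | _ => false

/-- A linked list. -/
def ofList : List Val → Val
  | [] => nil
  | x :: l => pair x (ofList l)

end Val

/-- Deterministic elementary operations. -/
inductive Op : Type
  | id
  | fst
  | snd
  | nil
  | zero
  | succ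
  | pred
  | lt
  | addWt

/-- The result of an elementary operation; it is `nil` on arguments of the wrong form. -/
noncomputable def Op.apply : Op → Val → Val
  | .id, v => v
  | .fst, .pair x _ => x
  | .snd, .pair _ y => y
  | .nil, _ => .nil
  | .zero, _ => .num 0
  | .succ, .num k => .num (k + 1)
  | .pred, .num k => .num (k - 1)
  | .lt, .pair (.num j) (.num k) => Val.ofBool (decide (j < k))
  | .addWt, .pair (.wt a) (.wt b) => .wt (a + b)
  | _, _ => .nil

/-- The law of the bit produced by a coin flip whose bias is given by two weights. -/
noncomputable def Val.flip : Val → PMF Bool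
  | .pair (.wt a) (.wt b) => coin a b
  | _ => PMF.pure false

/-- The code of a procedure, in a program with `k` procedures. Every code maps a value to a random
value. -/
inductive Code (k : ℕ) : Type
  /-- an elementary operation -/
  | op (o : Op) : Code k
  /-- a coin flip -/
  | flip : Code k
  /-- run `f` and `g` on the argument and make a pair of the results -/
  | pair (f g : Code k) : Code k
  /-- run `g` on the argument, then `f` on the result -/
  | comp (f g : Code k) : Code k
  /-- run `c` on the argument; then run `f` on the argument if the result was not `nil`, and `g`
  if it was -/
  | ite (c f g : Code k) : Code k
  /-- run the procedure number `i` on the argument -/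
  | call (i : Fin k) : Code k

/-- A randomized program: finitely many procedures that may call each other recursively. The
execution starts with a call of procedure number `0`. -/
structure Program : Type where
  last : ℕ
  body : Fin (last + 1) → Code (last + 1)

/-- `P.Eval c v μ`: for all outcomes of the coin flips the execution of the code `c` on the
value `v` stops, and `μ` is the joint law of the result and of the number of steps. -/
inductive Program.Eval (P : Program) : Code (P.last + 1) → Val → PMF (Val × ℕ) → Prop
  | op (o : Op) (v : Val) : P.Eval (.op o) v (PMF.pure (o.apply v, 1))
  | flip (v : Val) : P.Eval .flip v (v.flip.map fun b => (Val.ofBool b, 1))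
  | pair (f g : Code (P.last + 1)) (v : Val) (μ ν : PMF (Val × ℕ)) :
      P.Eval f v μ → P.Eval g v ν →
      P.Eval (.pair f g) v
        (μ.bind fun x => ν.map fun y => (Val.pair x.1 y.1, x.2 + y.2 + 1))
  | comp (f g : Code (P.last + 1)) (v : Val) (μ : PMF (Val × ℕ)) (κ : Val → PMF (Val × ℕ)) :
      P.Eval g v μ → (∀ x ∈ μ.support, P.Eval f x.1 (κ x.1)) →
      P.Eval (.comp f g) v
        (μ.bind fun x => (κ x.1).map fun y => (y.1, x.2 + y.2 + 1))
  | ite (c f g : Code (P.last + 1)) (v : Val) (μ : PMF (Val × ℕ)) (κ : Bool → PMF (Val × ℕ)) :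
      P.Eval c v μ →
      (∀ x ∈ μ.support, P.Eval (bif x.1.isNil then g else f) v (κ x.1.isNil)) →
      P.Eval (.ite c f g) v
        (μ.bind fun x => (κ x.1.isNil).map fun y => (y.1, x.2 + y.2 + 1))
  | call (i : Fin (P.last + 1)) (v : Val) (μ : PMF (Val × ℕ)) :
      P.Eval (P.body i) v μ → P.Eval (.call i) v (μ.map fun x => (x.1, x.2 + 1))

/-- `P.Runs v μ`: on input `v` the program `P` stops for all outcomes of its coin flips, and `μ`
is the joint law of its output and of its running time. -/
def Program.Runs (P : Program) (v : Val) (μ : PMF (Val × ℕ)) : Prop :=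
  P.Eval (.call 0) v μ

end Machine

/-! ### Input and output of the algorithm

The vertices and edges of the input graph are labelled by natural numbers. -/

section Encoding

/-- A list of edges, each given by its identifier and its two endpoints. -/
def encodeEdges (ends : ℕ → ℕ × ℕ) (l : List ℕ) : Val :=
  Val.ofList (l.map fun e =>
    Val.pair (Val.num e) (Val.pair (Val.num (ends e).1) (Val.num (ends e).2)))

/-- The input: the edges of the first tree, the list of the exchange sets, and the list of the
coefficients. -/
def encodeInput (ends : ℕ → ℕ × ℕ) (T : List ℕ) (ex : List (List ℕ × List ℕ))
    (δ : List ℝ≥0) : Val :=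
  Val.pair (encodeEdges ends T)
    (Val.pair
      (Val.ofList (ex.map fun p => Val.pair (encodeEdges ends p.1) (encodeEdges ends p.2)))
      (Val.ofList (δ.map Val.wt)))

/-- The output: a list of edge identifiers. -/
def encodeOutput (l : List ℕ) : Val := Val.ofList (l.map Val.num)

/-- The exchange sets listed in the input. -/
def exchangeSets (ex : List (List ℕ × List ℕ)) : List (Finset ℕ × Finset ℕ) :=
  ex.map fun p => (p.1.toFinset, p.2.toFinset)

/-- `γ = ∑ (|Eᵢ| + |E'ᵢ|)`. -/
def exchangeSize (ex : List (Finset ℕ × Finset ℕ)) : ℕ :=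
  (ex.map fun p => p.1.card + p.2.card).sum

/-- The number of the trivial exchanges, those with `Eᵢ = E'ᵢ = ∅`. -/
def trivialExchanges (ex : List (Finset ℕ × Finset ℕ)) : ℕ :=
  ex.countP fun p => decide (p.1 = ∅ ∧ p.2 = ∅)

end Encoding

end SwapRounding

open SwapRounding

/-! Contraction is harmless for the laws: adding a set `A` to all bases turns a run of the merging
procedure in the contraction of `A` into a run in the matroid (`MergeLaw.lift`,
`SwapRoundLaw.lift`). Hence the recursion of divide-swap is just a binary merging order
(`DivideSwapLaw.swapRoundLaw`). It never gets stuck, by symmetric exchange: for `e ∈ B \ B'` some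
`f` on the fundamental circuit of `e` in `B'` lies outside the closure of `B - e`
(`exists_symmetric_exchange`).

For spanning trees the core is to merge two trees `X`, `Y` in near-linear time. Root `X` and treat
its edges `e = vp` from the leaves to the root. Contract the set `K` of edges on which agreement has
been reached; then `v` is a leaf of what is left of `X`. As the partner of `e` take the first edge
`f` on the path from `v` to `p` in `Y`. Removing `e` from `X` isolates `v` and `f` leaves `v`, so `X
- e + f` is a tree; `f` lies on the cycle that `e` closes in `Y`, so `Y - f + e` is a tree.
Whichever edge is kept joins `K`, and the endpoints of the remaining edges stay in distinct
components of `K` (`Ready.step`). The partner exists and is unique (`exists_separating`,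
`separating_unique`).

All coins of one merging have the same bias. So they can be flipped in advance, one for each edge of
`X` in the order of treatment. What remains is deterministic: given the outcomes, find all the
partners. `Refines` specifies this problem, and `mergeLaw_flipFlags` turns any solution of it into a
law of the merging procedure.

The partners are found by a second divide-and-conquer, `solve`. For a list `ops` of edges, only
those edges of `Y` matter that lie on paths between endpoints of `ops` and touch one of these
endpoints modulo `K`. The others can be contracted without losing or changing a partner
(`Refines.of_union`), and at most `4 * ops.length` edges are left (`length_shrink_le`). Then the
first half of `ops` is solved, the tree is updated by the result, and the second half is solved.
When a single edge `vp` is left, root the tree at `p`: the partner is the edge above `v`. The trees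
of one level of this recursion have total size linear in the number of edges to be treated
(`det_solve`).

In divide-swap itself every call contracts the edges that take part in no exchange. This leaves
trees of a size linear in the size of the exchanges (`length_gather_mark_le`). Both halves contain
at most half of the removed edges (`splitExch_removed`), so the depth is logarithmic and each level
costs a near-linear amount (`rnd_divideSwap`). Once no edge is removed any more, each tree contains
the preceding one, so all of them are equal.

The machine has no arrays. Functions on vertices and edges are therefore stored in balanced search
trees over the sorted labels of the input, which the program builds first. Each algorithm exists
twice: as a function on abstract data, on which correctness is proved, and as a code, which is
compared with that function by symbolic execution (`WP`) together with a bound for the steps. For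
random codes only the law of the value and a worst-case bound are recorded (`Rnd`). The depths of
the search trees, of `solve` and of divide-swap give the three logarithmic factors. -/

namespace SwapRounding

set_option linter.unusedSimpArgs false

/-! ### Deterministic and random execution of codes -/

section Execution

variable (P : Program)

/-- The code `c` maps `v` to `w` in at most `t` steps, without randomness. -/
def Det (c : Code (P.last + 1)) (v w : Val) (t : ℕ) : Prop :=
  ∃ s ≤ t, P.Eval c v (PMF.pure (w, s))

/-- The code `c` maps `v` to a random value of law `m` in at most `t` steps. -/
def Rnd (c : Code (P.last + 1)) (v : Val) (m : PMF Val) (t : ℕ) : Prop :=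
  ∃ μ, P.Eval c v μ ∧ μ.map Prod.fst = m ∧ ∀ x ∈ μ.support, x.2 ≤ t

/-- Symbolic execution of deterministic codes: `c` maps `v` to some `w` in `t` steps
with `Q w t`. -/
def WP : Code (P.last + 1) → Val → (Val → ℕ → Prop) → Prop
  | .op o, v, Q => Q (o.apply v) 1
  | .flip, _, _ => False
  | .pair f g, v, Q => WP f v fun x s => WP g v fun y t => Q (.pair x y) (s + t + 1)
  | .comp f g, v, Q => WP g v fun x s => WP f x fun y t => Q y (s + t + 1)
  | .ite c f g, v, Q => WP c v fun x s =>
      bif x.isNil then WP g v (fun y t => Q y (s + t + 1))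
      else WP f v (fun y t => Q y (s + t + 1))
  | .call i, v, Q => ∃ w t, Det P (.call i) v w t ∧ Q w t

variable {P}

theorem WP.mono {c : Code (P.last + 1)} {v : Val} {Q R : Val → ℕ → Prop}
    (h : WP P c v Q) (hQ : ∀ w t, Q w t → R w t) : WP P c v R := by
  induction c generalizing v Q R with
  | op o => exact hQ _ _ h
  | flip => exact h
  | pair f g ihf ihg => exact ihf h fun x s hx => ihg hx fun y t => hQ _ _
  | comp f g ihf ihg => exact ihg h fun x s hx => ihf hx fun y t => hQ _ _
  | ite c f g ihc ihf ihg =>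
    refine ihc h fun x s hx => ?_
    cases hn : x.isNil
    · rw [hn] at hx
      exact ihf hx fun y t => hQ _ _
    · rw [hn] at hx
      exact ihg hx fun y t => hQ _ _
  | call i =>
    obtain ⟨w, t, hd, hq⟩ := h
    exact ⟨w, t, hd, hQ _ _ hq⟩

theorem Det.pair {f g : Code (P.last + 1)} {v x y : Val} {s t : ℕ}
    (hf : Det P f v x s) (hg : Det P g v y t) : Det P (.pair f g) v (.pair x y) (s + t + 1) := by
  obtain ⟨s', hs, hf⟩ := hf
  obtain ⟨t', ht, hg⟩ := hg
  refine ⟨s' + t' + 1, by omega, ?_⟩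
  have := Program.Eval.pair f g v _ _ hf hg
  rwa [PMF.pure_bind, PMF.pure_map] at this

theorem Det.comp {f g : Code (P.last + 1)} {v x y : Val} {s t : ℕ}
    (hg : Det P g v x s) (hf : Det P f x y t) : Det P (.comp f g) v y (s + t + 1) := by
  obtain ⟨s', hs, hf⟩ := hf
  obtain ⟨t', ht, hg⟩ := hg
  refine ⟨t' + s' + 1, by omega, ?_⟩
  have := Program.Eval.comp f g v _ (fun _ => PMF.pure (y, s')) hg (by
    intro z hz
    rw [PMF.support_pure, Set.mem_singleton_iff] at hz
    subst hz
    exact hf)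
  rwa [PMF.pure_bind, PMF.pure_map] at this

theorem Det.ite {c f g : Code (P.last + 1)} {v x y : Val} {s t : ℕ}
    (hc : Det P c v x s) (hf : Det P (bif x.isNil then g else f) v y t) :
    Det P (.ite c f g) v y (s + t + 1) := by
  obtain ⟨s', hs, hf⟩ := hf
  obtain ⟨t', ht, hc⟩ := hc
  refine ⟨t' + s' + 1, by omega, ?_⟩
  have := Program.Eval.ite c f g v _ (fun _ => PMF.pure (y, s')) hc (by
    intro z hz
    rw [PMF.support_pure, Set.mem_singleton_iff] at hz
    subst hz
    exact hf)
  rwa [PMF.pure_bind, PMF.pure_map] at this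

theorem Det.call {i : Fin (P.last + 1)} {v w : Val} {t : ℕ} (h : Det P (P.body i) v w t) :
    Det P (.call i) v w (t + 1) := by
  obtain ⟨s, hs, h⟩ := h
  refine ⟨s + 1, by omega, ?_⟩
  have := Program.Eval.call i v _ h
  rwa [PMF.pure_map] at this

theorem Det.mono {c : Code (P.last + 1)} {v w : Val} {s t : ℕ} (h : Det P c v w s) (hst : s ≤ t) :
    Det P c v w t := by
  obtain ⟨s', hs, h⟩ := h
  exact ⟨s', hs.trans hst, h⟩

/-- Induction on the code. At a call, `WP` by definition already carries a proof of determinism, so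
bodies are not unfolded here and recursive procedures cause no circularity. -/
theorem WP.exists_det {c : Code (P.last + 1)} {v : Val} {Q : Val → ℕ → Prop}
    (h : WP P c v Q) : ∃ w t, Det P c v w t ∧ Q w t := by
  induction c generalizing v Q with
  | op o => exact ⟨_, _, ⟨1, le_rfl, .op o v⟩, h⟩
  | flip => exact h.elim
  | pair f g ihf ihg =>
    obtain ⟨x, s, hx, h⟩ := ihf h
    obtain ⟨y, t, hy, h⟩ := ihg h
    exact ⟨_, _, hx.pair hy, h⟩
  | comp f g ihf ihg =>
    obtain ⟨x, s, hx, h⟩ := ihg h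
    obtain ⟨y, t, hy, h⟩ := ihf h
    exact ⟨_, _, hx.comp hy, h⟩
  | ite c f g ihc ihf ihg =>
    obtain ⟨x, s, hx, h⟩ := ihc h
    cases hn : x.isNil
    · rw [hn] at h
      obtain ⟨y, t, hy, h⟩ := ihf h
      exact ⟨_, _, hx.ite (by rw [hn]; exact hy), h⟩
    · rw [hn] at h
      obtain ⟨y, t, hy, h⟩ := ihg h
      exact ⟨_, _, hx.ite (by rw [hn]; exact hy), h⟩
  | call i => exact h

theorem WP.det {c : Code (P.last + 1)} {v w : Val} {t : ℕ}
    (h : WP P c v fun w' t' => w' = w ∧ t' ≤ t) : Det P c v w t := by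
  obtain ⟨w', t', hd, rfl, ht⟩ := h.exists_det
  exact hd.mono ht

theorem Det.wp {i : Fin (P.last + 1)} {v w : Val} {t : ℕ} {Q : Val → ℕ → Prop}
    (h : Det P (.call i) v w t) (hQ : Q w t) : WP P (.call i) v Q := ⟨w, t, h, hQ⟩

/-- Calling a procedure whose body is executed symbolically. -/
theorem det_call_of_wp {i : Fin (P.last + 1)} {c : Code (P.last + 1)} {v w : Val} {t : ℕ}
    (hi : P.body i = c) (h : WP P c v fun w' t' => w' = w ∧ t' + 1 ≤ t) :
    Det P (.call i) v w t := by
  obtain ⟨w', t', hd, rfl, ht⟩ := h.exists_det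
  exact (Det.call (hi ▸ hd)).mono ht

@[simp] theorem wp_op (o : Op) (v : Val) (Q : Val → ℕ → Prop) :
    WP P (.op o) v Q = Q (o.apply v) 1 := rfl

@[simp] theorem wp_pair (f g : Code (P.last + 1)) (v : Val) (Q : Val → ℕ → Prop) :
    WP P (.pair f g) v Q = WP P f v fun x s => WP P g v fun y t => Q (.pair x y) (s + t + 1) := rfl

@[simp] theorem wp_comp (f g : Code (P.last + 1)) (v : Val) (Q : Val → ℕ → Prop) :
    WP P (.comp f g) v Q = WP P g v fun x s => WP P f x fun y t => Q y (s + t + 1) := rfl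

@[simp] theorem wp_ite (c f g : Code (P.last + 1)) (v : Val) (Q : Val → ℕ → Prop) :
    WP P (.ite c f g) v Q = WP P c v fun x s =>
      bif x.isNil then WP P g v (fun y t => Q y (s + t + 1))
      else WP P f v (fun y t => Q y (s + t + 1)) := rfl

@[simp] theorem apply_id (v : Val) : Op.id.apply v = v := rfl
@[simp] theorem apply_fst (x y : Val) : Op.fst.apply (.pair x y) = x := rfl
@[simp] theorem apply_snd (x y : Val) : Op.snd.apply (.pair x y) = y := rfl
@[simp] theorem apply_nil (v : Val) : Op.nil.apply v = .nil := rfl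
@[simp] theorem apply_zero (v : Val) : Op.zero.apply v = .num 0 := rfl
@[simp] theorem apply_succ (k : ℕ) : Op.succ.apply (.num k) = .num (k + 1) := rfl
@[simp] theorem apply_lt (j k : ℕ) :
    Op.lt.apply (.pair (.num j) (.num k)) = Val.ofBool (decide (j < k)) := rfl
@[simp] theorem apply_addWt (a b : ℝ≥0) : Op.addWt.apply (.pair (.wt a) (.wt b)) = .wt (a + b) :=
  rfl

@[simp] theorem isNil_nil : Val.nil.isNil = true := rfl
@[simp] theorem isNil_num (k : ℕ) : (Val.num k).isNil = false := rfl
@[simp] theorem isNil_pair (x y : Val) : (Val.pair x y).isNil = false := rfl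
@[simp] theorem isNil_ofBool (b : Bool) : (Val.ofBool b).isNil = !b := by cases b <;> rfl

/-! ### Random execution -/

theorem Det.rnd {c : Code (P.last + 1)} {v w : Val} {t : ℕ} (h : Det P c v w t) :
    Rnd P c v (PMF.pure w) t := by
  obtain ⟨s, hs, h⟩ := h
  refine ⟨_, h, by rw [PMF.pure_map], fun x hx => ?_⟩
  rw [PMF.support_pure, Set.mem_singleton_iff] at hx
  subst hx
  exact hs

theorem Rnd.mono {c : Code (P.last + 1)} {v : Val} {m : PMF Val} {s t : ℕ} (h : Rnd P c v m s)
    (hst : s ≤ t) : Rnd P c v m t := by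
  obtain ⟨μ, h, hm, hb⟩ := h
  exact ⟨μ, h, hm, fun x hx => (hb x hx).trans hst⟩

theorem Rnd.call {i : Fin (P.last + 1)} {c : Code (P.last + 1)} {v : Val} {m : PMF Val} {t : ℕ}
    (hi : P.body i = c) (h : Rnd P c v m t) : Rnd P (.call i) v m (t + 1) := by
  obtain ⟨μ, h, rfl, hb⟩ := h
  subst hi
  refine ⟨_, .call i v _ h, by rw [PMF.map_comp]; rfl, fun x hx => ?_⟩
  rw [PMF.support_map] at hx
  obtain ⟨y, hy, rfl⟩ := hx
  exact Nat.succ_le_succ (hb y hy)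

theorem Rnd.pair {f g : Code (P.last + 1)} {v : Val} {m n : PMF Val} {s t : ℕ}
    (hf : Rnd P f v m s) (hg : Rnd P g v n t) :
    Rnd P (.pair f g) v (m.bind fun x => n.map fun y => .pair x y) (s + t + 1) := by
  obtain ⟨μ, hf, rfl, hbf⟩ := hf
  obtain ⟨ν, hg, rfl, hbg⟩ := hg
  refine ⟨_, .pair f g v _ _ hf hg, ?_, fun x hx => ?_⟩
  · rw [PMF.map_bind, PMF.bind_map]
    congr 1
    funext x
    simp only [Function.comp_apply, PMF.map_comp]
    rfl
  · rw [PMF.mem_support_bind_iff] at hx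
    obtain ⟨y, hy, hx⟩ := hx
    rw [PMF.support_map] at hx
    obtain ⟨z, hz, rfl⟩ := hx
    have := hbf y hy
    have := hbg z hz
    show y.2 + z.2 + 1 ≤ _
    omega

theorem bind_congr_support {α β : Type*} {p : PMF α} {f g : α → PMF β}
    (h : ∀ x ∈ p.support, f x = g x) : p.bind f = p.bind g := by
  ext b
  rw [PMF.bind_apply, PMF.bind_apply]
  refine tsum_congr fun a => ?_
  by_cases ha : a ∈ p.support
  · rw [h a ha]
  · rw [PMF.mem_support_iff, not_not] at ha
    rw [ha, zero_mul, zero_mul]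

theorem Rnd.comp {f g : Code (P.last + 1)} {v : Val} {m : PMF Val} {k : Val → PMF Val} {s t : ℕ}
    (hg : Rnd P g v m s) (hf : ∀ x ∈ m.support, Rnd P f x (k x) t) :
    Rnd P (.comp f g) v (m.bind k) (s + t + 1) := by
  classical
  obtain ⟨μ, hg, rfl, hbg⟩ := hg
  -- In `Program.Eval.comp` the continuation depends on the value alone, not on the number of steps
  -- used so far, so one joint law is chosen per value.
  choose! κ hκ hm hb using hf
  have hs : ∀ x ∈ μ.support, x.1 ∈ (μ.map Prod.fst).support := fun x hx => by
    rw [PMF.support_map]; exact ⟨x, hx, rfl⟩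
  refine ⟨_, .comp f g v _ κ hg fun x hx => hκ _ (hs x hx), ?_, fun x hx => ?_⟩
  · rw [PMF.map_bind, PMF.bind_map]
    refine bind_congr_support fun x hx => ?_
    rw [Function.comp_apply, ← hm _ (hs x hx), PMF.map_comp]
    rfl
  · rw [PMF.mem_support_bind_iff] at hx
    obtain ⟨y, hy, hx⟩ := hx
    rw [PMF.support_map] at hx
    obtain ⟨z, hz, rfl⟩ := hx
    have := hbg y hy
    have := hb _ (hs y hy) z hz
    show y.2 + z.2 + 1 ≤ _
    omega

theorem Rnd.ite {c f g : Code (P.last + 1)} {v x : Val} {m : PMF Val} {s t : ℕ}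
    (hc : Det P c v x s) (hf : Rnd P (bif x.isNil then g else f) v m t) :
    Rnd P (.ite c f g) v m (s + t + 1) := by
  obtain ⟨s', hs, hc⟩ := hc
  obtain ⟨μ, hf, rfl, hb⟩ := hf
  have := Program.Eval.ite c f g v _ (fun _ => μ) hc (by
    intro z hz
    rw [PMF.support_pure, Set.mem_singleton_iff] at hz
    subst hz
    exact hf)
  rw [PMF.pure_bind] at this
  refine ⟨_, this, by rw [PMF.map_comp]; rfl, fun y hy => ?_⟩
  rw [PMF.support_map] at hy
  obtain ⟨z, hz, rfl⟩ := hy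
  have := hb z hz
  show s' + z.2 + 1 ≤ _
  omega

theorem Rnd.flip {v : Val} {a b : ℝ≥0} (hv : v = .pair (.wt a) (.wt b)) :
    Rnd P .flip v ((coin a b).map Val.ofBool) 1 := by
  subst hv
  refine ⟨_, .flip _, by rw [PMF.map_comp]; rfl, fun y hy => ?_⟩
  rw [PMF.support_map] at hy
  obtain ⟨z, hz, rfl⟩ := hy
  exact le_rfl

end Execution

/-! ### Encodings -/

/-- Types whose elements can be represented by data of the machine. -/
class Enc (α : Type*) where
  enc : α → Val

open Enc

instance : Enc Bool := ⟨Val.ofBool⟩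
instance : Enc ℝ≥0 := ⟨Val.wt⟩
instance {α β : Type*} [Enc α] [Enc β] : Enc (α × β) := ⟨fun x => .pair (enc x.1) (enc x.2)⟩
instance {α : Type*} [Enc α] : Enc (List α) := ⟨fun l => Val.ofList (l.map enc)⟩

section
variable {α β : Type*} [Enc α] [Enc β]

theorem enc_bool (b : Bool) : enc b = Val.ofBool b := rfl
theorem enc_weight (a : ℝ≥0) : enc a = Val.wt a := rfl
@[simp] theorem enc_true : enc true = Val.pair .nil .nil := rfl
@[simp] theorem enc_false : enc false = Val.nil := rfl
@[simp] theorem enc_pair (a : α) (b : β) : enc (a, b) = Val.pair (enc a) (enc b) := rfl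
@[simp] theorem enc_nil : enc ([] : List α) = Val.nil := rfl
@[simp] theorem enc_cons (a : α) (l : List α) : enc (a :: l) = Val.pair (enc a) (enc l) := rfl
@[simp] theorem isNil_enc_bool (b : Bool) : (enc b).isNil = !b := isNil_ofBool b
theorem enc_list (l : List α) : enc l = Val.ofList (l.map enc) := rfl
@[simp] theorem isNil_enc_list (l : List α) : (enc l).isNil = l.isEmpty := by cases l <;> rfl

/-- Rules for the symbolic execution of codes on encoded data. -/
theorem wp_rules {P : Program} :
    (∀ o v Q, WP P (.op o) v Q = Q (o.apply v) 1) ∧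
    (∀ f g v Q, WP P (.pair f g) v Q =
      WP P f v fun x s => WP P g v fun y t => Q (.pair x y) (s + t + 1)) ∧
    (∀ f g v Q, WP P (.comp f g) v Q =
      WP P g v fun x s => WP P f x fun y t => Q y (s + t + 1)) ∧
    ∀ c f g v Q, WP P (.ite c f g) v Q = WP P c v fun x s =>
      bif x.isNil then WP P g v (fun y t => Q y (s + t + 1))
      else WP P f v (fun y t => Q y (s + t + 1)) :=
  ⟨wp_op, wp_pair, wp_comp, wp_ite⟩

theorem apply_rules : (∀ x y, Op.fst.apply (.pair x y) = x) ∧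
    (∀ x y, Op.snd.apply (.pair x y) = y) ∧ (∀ v, Op.id.apply v = v) ∧
    (∀ v, Op.nil.apply v = .nil) ∧ (∀ x y, (Val.pair x y).isNil = false) ∧
    Val.nil.isNil = true ∧ (∀ x y : Prop, (bif true then x else y) = x) ∧
    ∀ x y : Prop, (bif false then x else y) = y :=
  ⟨apply_fst, apply_snd, apply_id, apply_nil, isNil_pair, isNil_nil, fun _ _ => rfl, fun _ _ => rfl⟩

end

/-! ### Codes -/

namespace Code
variable {k : ℕ}

/-- The components of an argument `(x₀, (x₁, (x₂, …)))`. -/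
abbrev π0 : Code k := .op .fst
abbrev τ1 : Code k := .op .snd
abbrev π1 : Code k := .comp .π0 .τ1
abbrev τ2 : Code k := .comp .τ1 .τ1
abbrev π2 : Code k := .comp .π1 .τ1
abbrev τ3 : Code k := .comp .τ2 .τ1
abbrev π3 : Code k := .comp .π2 .τ1
abbrev τ4 : Code k := .comp .τ3 .τ1
abbrev π4 : Code k := .comp .π3 .τ1
abbrev τ5 : Code k := .comp .τ4 .τ1
abbrev self : Code k := .op .id
abbrev nil : Code k := .op .nil
abbrev tt : Code k := .pair .nil .nil

/-- Run `f` on the pair of the value of `e` and the argument. -/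
abbrev letIn (e f : Code k) : Code k := .comp f (.pair e .self)

/-- The loop `foldl`, on an accumulator and a list. -/
def fold (i : Fin k) (step : Code k) : Code k :=
  .ite .τ1 (.comp (.call i) (.pair (.comp step (.pair .π0 .π1)) .τ2)) .π0

/-- The function `map`, on an environment and a list. -/
def mapList (i : Fin k) (f : Code k) : Code k :=
  .ite .τ1 (.pair (.comp f (.pair .π0 .π1)) (.comp (.call i) (.pair .π0 .τ2))) .nil

end Code

/-! ### Loops over lists: results and costs -/

section Loops
variable {P : Program} {α β σ : Type*} [Enc α] [Enc β] [Enc σ] {i : Fin (P.last + 1)}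
  {step : Code (P.last + 1)}

/-- Symbolic execution with a prescribed result and a bound for the cost. -/
abbrev Steps (P : Program) (c : Code (P.last + 1)) (v w : Val) (t : ℕ) : Prop :=
  WP P c v fun w' t' => w' = w ∧ t' ≤ t

theorem Steps.wp {c : Code (P.last + 1)} {v w : Val} {t : ℕ} {Q : Val → ℕ → Prop}
    (h : Steps P c v w t) (hQ : ∀ s ≤ t, Q w s) : WP P c v Q :=
  WP.mono h (by rintro _ s ⟨rfl, hs⟩; exact hQ s hs)

/-- The extra 20 per element absorbs the test, the rebuilding of the argument and the recursive
call; the extra 10 pays for the empty list. The cost of a step may depend on the element, as is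
needed for lists of exchanges. -/
theorem Det.fold_sum {f : σ → α → σ} (hi : P.body i = .fold i step) (t : α → ℕ) (l : List α)
    (hstep : ∀ a, ∀ x ∈ l, Steps P step (.pair (enc a) (enc x)) (enc (f a x)) (t x)) (a : σ) :
    Det P (.call i) (.pair (enc a) (enc l)) (enc (l.foldl f a))
      ((l.map fun x => t x + 20).sum + 10) := by
  induction l generalizing a with
  | nil =>
    refine det_call_of_wp hi ?_
    simp [Code.fold]
  | cons x l ih =>
    have h1 := hstep a x (by simp)
    have h2 := ih (fun a y hy => hstep a y (by simp [hy])) (f a x)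
    rw [List.map_cons, List.sum_cons, List.foldl_cons]
    refine det_call_of_wp hi ?_
    simp only [Code.fold, wp_ite, wp_op, apply_snd, apply_fst, enc_cons, isNil_pair, cond_false,
      wp_comp, wp_pair]
    exact h1.wp fun s hs => h2.wp ⟨rfl, by omega⟩

theorem Det.foldl {f : σ → α → σ} (hi : P.body i = .fold i step) {s c : ℕ} (l : List α)
    (hstep : ∀ a, ∀ x ∈ l, Steps P step (.pair (enc a) (enc x)) (enc (f a x)) s) (a : σ)
    (hc : s + 20 ≤ c) :
    Det P (.call i) (.pair (enc a) (enc l)) (enc (l.foldl f a)) (c * (l.length + 1)) := by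
  refine (Det.fold_sum hi (fun _ => s) l hstep a).mono ?_
  rw [List.map_const', List.sum_replicate, smul_eq_mul, mul_comm, Nat.mul_succ]
  have := Nat.mul_le_mul_right l.length hc
  omega

theorem Det.map_sum {ε : Type*} [Enc ε] {f : ε → α → β} (hi : P.body i = .mapList i step)
    (t : α → ℕ) (e : ε) (l : List α)
    (hstep : ∀ x ∈ l, Steps P step (.pair (enc e) (enc x)) (enc (f e x)) (t x)) :
    Det P (.call i) (.pair (enc e) (enc l)) (enc (l.map (f e)))
      ((l.map fun x => t x + 20).sum + 10) := by
  induction l with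
  | nil =>
    refine det_call_of_wp hi ?_
    simp [Code.mapList]
  | cons x l ih =>
    have h1 := hstep x (by simp)
    have h2 := ih (fun y hy => hstep y (by simp [hy]))
    have h3 : (List.map (fun x => t x + 20) (x :: l)).sum =
      t x + 20 + (List.map (fun x => t x + 20) l).sum := by simp
    rw [h3, List.map_cons]
    refine det_call_of_wp hi ?_
    simp only [Code.mapList, wp_ite, wp_op, apply_snd, apply_fst, enc_cons, isNil_pair, cond_false,
      wp_comp, wp_pair]
    exact h1.wp fun s hs => h2.wp ⟨rfl, by omega⟩

theorem Det.map {ε : Type*} [Enc ε] {f : ε → α → β} (hi : P.body i = .mapList i step)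
    {s c : ℕ} (e : ε) (l : List α)
    (hstep : ∀ x ∈ l, Steps P step (.pair (enc e) (enc x)) (enc (f e x)) s) (hc : s + 20 ≤ c) :
    Det P (.call i) (.pair (enc e) (enc l)) (enc (l.map (f e))) (c * (l.length + 1)) := by
  refine (Det.map_sum hi (fun _ => s) e l hstep).mono ?_
  rw [List.map_const', List.sum_replicate, smul_eq_mul, mul_comm, Nat.mul_succ]
  have := Nat.mul_le_mul_right l.length hc
  omega

end Loops

/-! ### Dictionaries -/

/-- Binary search trees that carry the keys at their leaves. -/
inductive SearchTree (κ : Type*) : Type _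
  | leaf (k : κ) : SearchTree κ
  | node (s : κ) (l r : SearchTree κ) : SearchTree κ

namespace SearchTree
variable {κ : Type*}

def depth : SearchTree κ → ℕ
  | leaf _ => 0
  | node _ l r => max l.depth r.depth + 1

def leaves : SearchTree κ → List κ
  | leaf k => [k]
  | node _ l r => l.leaves ++ r.leaves

/-- Keys below the separator are on the left, the others on the right. -/
def Valid (num : κ → ℕ) : SearchTree κ → Prop
  | leaf _ => True
  | node s l r => (∀ k ∈ l.leaves, num k < num s) ∧ (∀ k ∈ r.leaves, num s ≤ num k) ∧
      l.Valid num ∧ r.Valid num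

/-- The representation of a function on the keys, whose values are stored at the leaves. -/
def toVal {α : Type*} [Enc α] (num : κ → ℕ) (f : κ → α) : SearchTree κ → Val
  | leaf k => .pair .nil (enc (f k))
  | node s l r => .pair (.num (num s)) (.pair (l.toVal num f) (r.toVal num f))

end SearchTree

/-- The keys of dictionaries: natural numbers from a finite set that is given by a search tree. -/
class Keys (κ : Type*) where
  num : κ → ℕ
  num_injective : Function.Injective num
  tree : SearchTree κ
  valid : tree.Valid num
  complete : ∀ k, k ∈ tree.leaves
  /-- a bound for the cost of accessing a dictionary -/
  cost : ℕ
  depth_lt : tree.depth < cost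

section Dictionaries

variable {κ : Type*} [Keys κ]

instance : Enc κ := ⟨fun k => .num (Keys.num k)⟩
-- These dictionaries take the place of arrays. The shape of the tree is fixed by the keys, so a
-- function has exactly one representation and results of updates can be compared by equality.
instance {α : Type*} [Enc α] : Enc (κ → α) := ⟨fun f => Keys.tree.toVal Keys.num f⟩

theorem enc_key (k : κ) : enc k = .num (Keys.num k) := rfl
@[simp] theorem isNil_enc_key (k : κ) : (enc k).isNil = false := rfl

namespace Code
variable {k : ℕ}

/-- The argument is `(dictionary, key)`. A leaf is recognised by the `nil` in the place of the
separator. -/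
def get : Code (k + 1) :=
  .ite (.comp .π0 .π0)
    (.ite (.comp (.op .lt) (.pair .τ1 (.comp .π0 .π0)))
      (.comp (.call 1) (.pair (.comp .π1 .π0) .τ1))
      (.comp (.call 1) (.pair (.comp .τ2 .π0) .τ1)))
    (.comp .τ1 .π0)

/-- The argument is `(dictionary, (key, value))`. Data are immutable, so the nodes on the path to
the leaf are rebuilt and the other subtrees are shared. -/
def set : Code (k + 1) :=
  .ite (.comp .π0 .π0)
    (.ite (.comp (.op .lt) (.pair .π1 (.comp .π0 .π0)))
      (.pair (.comp .π0 .π0) (.pair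
        (.comp (.call 2) (.pair (.comp .π1 .π0) .τ1)) (.comp .τ2 .π0)))
      (.pair (.comp .π0 .π0) (.pair
        (.comp .π1 .π0) (.comp (.call 2) (.pair (.comp .τ2 .π0) .τ1)))))
    (.pair .nil .τ2)

/-- Equality test for two numbers. -/
def eqNum : Code (k + 1) :=
  .ite (.op .lt) .nil (.ite (.comp (.op .lt) (.pair .τ1 .π0)) .nil .tt)

/-- Puts the elements of a list in front of another one, in the reverse order. -/
def revAppend : Code (k + 1) := .fold 4 (.pair .τ1 .π0)

end Code

/-- The bodies are assumed by number. So each procedure is analysed without reference to the whole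
table, and only the final program has to satisfy all the assumptions. -/
class HasDict (P : Program) : Prop where
  get : P.body 1 = .get
  set : P.body 2 = .set
  eqNum : P.body 3 = .eqNum
  revAppend : P.body 4 = .revAppend

variable {P : Program} [HasDict P]

theorem SearchTree.det_get {α : Type*} [Enc α] (f : κ → α) (k : κ) (t : SearchTree κ)
    (ht : t.Valid Keys.num) (hk : k ∈ t.leaves) :
    Det P (.call 1) (.pair (t.toVal Keys.num f) (enc k)) (enc (f k)) (50 * (t.depth + 1)) := by
  induction t with
  | leaf k' =>
    rw [leaves, List.mem_singleton] at hk
    subst hk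
    refine det_call_of_wp HasDict.get ?_
    simp [Code.get, toVal, depth]
  | node s l r ihl ihr =>
    obtain ⟨h1, h2, hl, hr⟩ := ht
    rw [leaves, List.mem_append] at hk
    refine det_call_of_wp HasDict.get ?_
    simp only [Code.get, toVal, wp_ite, wp_comp, wp_op, wp_pair, apply_fst, apply_snd, isNil_num,
      cond_false, enc_key, apply_lt, isNil_ofBool, depth]
    by_cases h : Keys.num k < Keys.num s
    · have hk' : k ∈ l.leaves := hk.resolve_right fun hk => absurd (h2 k hk) (by omega)
      simp only [h, decide_true, Bool.not_true, cond_false]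
      refine (ihl hl hk').wp ⟨rfl, ?_⟩
      have := le_max_left l.depth r.depth
      omega
    · have hk' : k ∈ r.leaves := hk.resolve_left fun hk => h (h1 k hk)
      simp only [h, decide_false, Bool.not_false, cond_true]
      refine (ihr hr hk').wp ⟨rfl, ?_⟩
      have := le_max_right l.depth r.depth
      omega

omit [Keys κ] in
theorem SearchTree.toVal_congr {α : Type*} [Enc α] {num : κ → ℕ} {f g : κ → α} (t : SearchTree κ)
    (h : ∀ k ∈ t.leaves, f k = g k) : t.toVal num f = t.toVal num g := by
  induction t with
  | leaf k => rw [toVal, toVal, h k (by simp [leaves])]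
  | node s l r ihl ihr =>
    rw [toVal, toVal, ihl fun k hk => h k (by simp [leaves, hk]),
      ihr fun k hk => h k (by simp [leaves, hk])]

theorem SearchTree.det_set [DecidableEq κ] {α : Type*} [Enc α] (f : κ → α) (k : κ) (x : α)
    (t : SearchTree κ) (ht : t.Valid Keys.num) (hk : k ∈ t.leaves) :
    Det P (.call 2) (.pair (t.toVal Keys.num f) (.pair (enc k) (enc x)))
      (t.toVal Keys.num (Function.update f k x)) (80 * (t.depth + 1)) := by
  induction t with
  | leaf k' =>
    rw [leaves, List.mem_singleton] at hk
    subst hk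
    refine det_call_of_wp HasDict.set ?_
    simp [Code.set, toVal, depth]
  | node s l r ihl ihr =>
    obtain ⟨h1, h2, hl, hr⟩ := ht
    rw [leaves, List.mem_append] at hk
    refine det_call_of_wp HasDict.set ?_
    simp only [Code.set, toVal, wp_ite, wp_comp, wp_op, wp_pair, apply_fst, apply_snd, isNil_num,
      cond_false, enc_key, apply_lt, isNil_ofBool, depth]
    by_cases h : Keys.num k < Keys.num s
    · have hk' : k ∈ l.leaves := hk.resolve_right fun hk => absurd (h2 k hk) (by omega)
      simp only [h, decide_true, Bool.not_true, cond_false]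
      refine (ihl hl hk').wp ⟨?_, ?_⟩
      -- The subtree on the other side is not visited; it does not contain `k`, so the update leaves
      -- its representation unchanged.
      · rw [r.toVal_congr (g := Function.update f k x)]
        intro k' hk''
        have := h2 k' hk''
        rw [Function.update_of_ne]
        rintro rfl
        omega
      · have := le_max_left l.depth r.depth
        omega
    · have hk' : k ∈ r.leaves := hk.resolve_left fun hk => h (h1 k hk)
      simp only [h, decide_false, Bool.not_false, cond_true]
      refine (ihr hr hk').wp ⟨?_, ?_⟩
      · rw [l.toVal_congr (g := Function.update f k x)]
        intro k' hk''
        have := h1 k' hk''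
        rw [Function.update_of_ne]
        rintro rfl
        omega
      · have := le_max_right l.depth r.depth
        omega

variable (κ) in
/-- The unit of the costs. -/
def unitCost : ℕ := 1000 * Keys.cost κ

theorem Det.get {α : Type*} [Enc α] (f : κ → α) (k : κ) :
    Det P (.call 1) (.pair (enc f) (enc k)) (enc (f k)) (unitCost κ) := by
  refine (SearchTree.det_get f k _ Keys.valid (Keys.complete k)).mono ?_
  have := Keys.depth_lt (κ := κ)
  show _ ≤ 1000 * Keys.cost κ
  omega

theorem Det.set [DecidableEq κ] {α : Type*} [Enc α] (f : κ → α) (k : κ) (x : α) :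
    Det P (.call 2) (.pair (enc f) (.pair (enc k) (enc x))) (enc (Function.update f k x))
      (unitCost κ) := by
  refine (SearchTree.det_set f k x _ Keys.valid (Keys.complete k)).mono ?_
  have := Keys.depth_lt (κ := κ)
  show _ ≤ 1000 * Keys.cost κ
  omega

variable (κ) in
theorem le_unitCost : 1000 ≤ unitCost κ := by
  have := Keys.depth_lt (κ := κ)
  show _ ≤ 1000 * Keys.cost κ
  omega

theorem Det.eqNum [DecidableEq κ] (j k : κ) :
    Det P (.call 3) (.pair (enc j) (enc k)) (enc (decide (j = k))) 20 := by
  refine det_call_of_wp HasDict.eqNum ?_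
  simp only [Code.eqNum, wp_ite, wp_comp, wp_op, wp_pair, apply_fst, apply_snd, enc_key, apply_lt,
    isNil_ofBool, apply_nil]
  rcases lt_trichotomy (Keys.num j) (Keys.num k) with h | h | h
  · have : j ≠ k := by rintro rfl; omega
    simp [h, this]
  · have := Keys.num_injective h
    subst this
    simp
  · have : j ≠ k := by rintro rfl; omega
    simp [h, this, h.not_gt]

omit [Keys κ] in
theorem Det.revAppend {α : Type*} [Enc α] (l l' : List α) :
    Det P (.call 4) (.pair (enc l') (enc l)) (enc (l.reverse ++ l')) (25 * (l.length + 1)) := by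
  have := Det.foldl (f := fun (a : List α) x => x :: a) (s := 5) (c := 25)
    (HasDict.revAppend (P := P)) l (fun a x _ => by simp) l' le_rfl
  rwa [List.foldl_flip_cons_eq_append, List.map_id'] at this

end Dictionaries

/-! ### The algorithm on abstract data -/

section Algorithm

variable {κ : Type*} [DecidableEq κ]

/-- An edge with a flag, an identifier and two endpoints. In a rooted tree the first endpoint is
the child. -/
abbrev Edge (κ : Type*) := Bool × κ × κ × κ

/-- Entries of an adjacency list: flag, identifier and other endpoint. -/
abbrev Arc (κ : Type*) := Bool × κ × κ

/-- The second update reads the result of the first one. This matters only for a loop, which is then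
entered twice, so that the degrees always add up to twice the number of edges. -/
def addEdge (adj : κ → List (Arc κ)) : Edge κ → κ → List (Arc κ)
  | (fl, e, x, y) =>
    Function.update (Function.update adj x ((fl, e, y) :: adj x)) y
      ((fl, e, x) :: Function.update adj x ((fl, e, y) :: adj x) y)

def adjacency (T : List (Edge κ)) : κ → List (Arc κ) :=
  T.foldl addEdge fun _ => []

/-- The adjacency lists, the visited vertices, a worklist, and the edges of the search tree. -/
abbrev SearchState (κ : Type*) :=
  (κ → List (Arc κ)) × (κ → Bool) × List (κ × List (Arc κ)) × List (Edge κ)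

/-- Depth-first search with the recursion stack as worklist. A discovered edge goes to the front of
the output with the new vertex as child; hence the output lists children before parents. -/
def searchStep : SearchState κ → SearchState κ
  | (adj, vis, [], out) => (adj, vis, [], out)
  | (adj, vis, (_, []) :: W, out) => (adj, vis, W, out)
  | (adj, vis, (v, (fl, e, w) :: arcs) :: W, out) =>
    if vis w then (adj, vis, (v, arcs) :: W, out)
    else (adj, Function.update vis w true, (w, adj w) :: (v, arcs) :: W, (fl, e, w, v) :: out)

def searchStart (T : List (Edge κ)) (r : κ) : SearchState κ :=
  (adjacency T, Function.update (fun _ => false) r true, [(r, adjacency T r)], [])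

/-- The list `T` only serves as a counter of steps. -/
def searchRound (T : List (Edge κ)) (s : SearchState κ) : SearchState κ :=
  T.foldl (fun s _ => searchStep s) s

/-- The edges of the tree `T` rooted at `r`, directed to the root, children before parents. -/
def search (T : List (Edge κ)) (r : κ) : List (Edge κ) :=
  (searchStep (searchRound T (searchRound T (searchRound T (searchRound T
    (searchStart T r)))))).2.2.2

/-- Vertices are mapped to the topmost vertex of their component of flagged edges. As parents come
first, `φ p` is final when an edge below `p` is read. -/
def contractStep : (κ → κ) × List (Edge κ) → Edge κ → (κ → κ) × List (Edge κ)
  | (φ, o), (fl, e, v, p) =>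
    if fl then (Function.update φ v (φ p), o) else (φ, (false, e, v, φ p) :: o)

/-- Contracts the flagged edges of a rooted tree, parents before children. -/
def contract (l : List (Edge κ)) : (κ → κ) × List (Edge κ) := l.foldl contractStep (id, [])

def relabelEdge (φ : κ → κ) : Edge κ → Edge κ
  | (fl, e, x, y) => (fl, e, φ x, φ y)

def relabel (φ : κ → κ) (l : List (Edge κ)) : List (Edge κ) := l.map (relabelEdge φ)

def markEdge (S : κ → Bool) : Edge κ → κ → Bool
  | (_, _, x, y) => Function.update (Function.update S x true) y true

/-- The endpoints of the edges in a list. -/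
def markEnds (l : List (Edge κ)) : κ → Bool := l.foldl markEdge fun _ => false

/-- `M` collects the vertices with an element of `S` in their subtree; as children come first, `M v`
is final when the edge above `v` is read. An edge matters if `M v` holds and one of its ends is in
`S`. -/
def pruneStep : (κ → Bool) × (κ → Bool) × List (Edge κ) → Edge κ →
    (κ → Bool) × (κ → Bool) × List (Edge κ)
  | (S, M, acc), (_, e, v, p) =>
    (S, if M v then Function.update M p true else M, (!(M v && (S v || S p)), e, v, p) :: acc)

/-- Flags the edges of a rooted tree (children first) that are not needed for paths between
elements of `S`, or that are not incident to `S`. -/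
def prune (S : κ → Bool) (l : List (Edge κ)) : List (Edge κ) := (l.foldl pruneStep (S, S, [])).2.2

/-- Contracts all edges that are flagged or that do not matter for `ops`. -/
def shrink (r : κ) (tree ops : List (Edge κ)) : List (Edge κ) × List (Edge κ) :=
  let c := contract (search tree r).reverse
  let ops' := relabel c.1 ops
  -- `prune` reverses the order, so its output is already sorted with parents first.
  let c' := contract (prune (markEnds ops') c.2)
  (c'.2, relabel c'.1 ops')

def findStep : κ × κ → Edge κ → κ × κ
  | (v, f), (_, e, x, _) => if x = v then (v, e) else (v, f)

/-- The edge with child `v`. -/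
def findEdge (v f : κ) (l : List (Edge κ)) : κ := (l.foldl findStep (v, f)).2

/-- Splits the first list in the middle, if the second list has the same length. -/
def halve {α β : Type*} : List α → List β → List α × List α
  | x :: l, _ :: _ :: l' => (x :: (halve l l').1, (halve l l').2)
  | l, _ => ([], l)

/-- Lists play the role of an option type: `[]` for an edge that has not been a partner, `[b]` for
the partner in an exchange with outcome `b`. -/
def statusStep (st : κ → List Bool) : Bool × κ × κ → κ → List Bool
  | (b, _, f) => Function.update st f [b]

def keepStep (acc : List (Edge κ)) : Edge κ → List (Edge κ)
  | (b, e, x, y) => if b then (true, e, x, y) :: acc else acc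

/-- An edge that was a partner disappears if the coin was in favour of the other edge (`b = true`);
otherwise it is kept and becomes flagged. -/
def nextStep : (κ → List Bool) × List (Edge κ) → Edge κ → (κ → List Bool) × List (Edge κ)
  | (st, acc), (_, e, x, y) =>
    match st e with
    | [] => (st, (false, e, x, y) :: acc)
    | b :: _ => (st, if b then acc else (true, e, x, y) :: acc)

/-- The tree `B` after the exchanges `F` that belong to `ops`; the kept edges are flagged. -/
def nextTree (B : List (Edge κ)) (F : List (Bool × κ × κ)) (ops : List (Edge κ)) :
    List (Edge κ) :=
  (B.foldl nextStep (F.foldl statusStep (fun _ => []), ops.foldl keepStep [])).2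

/-- For a tree that is rooted at the parent end of the only edge to be treated: the edge above `v`
is the first one on the path from `v` to the root. The default value `e` of the search is never
returned for valid data. -/
def solveLast : List (Edge κ) × List (Edge κ) → List (Bool × κ × κ)
  | (B, (b, e, v, _) :: _) => [(b, e, findEdge v e B)]
  | (_, []) => []

/-- Computes the exchange partners of the edges `ops`, with given outcomes of the coin flips. -/
def solve : ℕ → List (Edge κ) → List (Edge κ) → List (Bool × κ × κ)
  | _, _, [] => []
  | _, tree, [(b, e, v, p)] => solveLast (shrink p tree [(b, e, v, p)])
  | 0, _, _ :: _ :: _ => []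
  | d + 1, tree, (b, e, v, p) :: o :: ops =>
    let s := shrink p tree ((b, e, v, p) :: o :: ops)
    let h := halve s.2 s.2
    let F := solve d s.1 h.1
    F ++ solve d (nextTree s.1 F h.1) h.2

omit [DecidableEq κ] in
/-- Replaces the flags by coin flips. -/
noncomputable def flipFlags (a b : ℝ≥0) : List (Edge κ) → PMF (List (Edge κ))
  | [] => PMF.pure []
  | (_, t) :: l => (coin a b).bind fun c => (flipFlags a b l).map fun l' => (c, t) :: l'

def keptEdge : Bool × κ × κ → κ
  | (b, e, f) => if b then e else f

/-- All coins are flipped before any partner is known; this is possible because their bias does not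
change during the merging. Any vertex of the first tree may serve as the root. -/
noncomputable def mergeTrees (d : ℕ) (a b : ℝ≥0) : List (Edge κ) → List (Edge κ) → PMF (List κ)
  | [], _ => PMF.pure []
  | (fl, e, x, y) :: X, Y =>
    (flipFlags a b (search ((fl, e, x, y) :: X) x)).map fun ops => (solve d Y ops).map keptEdge

abbrev Exch (κ : Type*) := List (Edge κ) × List (Edge κ)

/-- The total number of removed edges. -/
def removedCount (ex : List (Exch κ)) : ℕ := ex.foldl (fun n p => p.1.foldl (fun n _ => n + 1) n) 0

def setStep : Bool × (κ → Bool) → Edge κ → Bool × (κ → Bool)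
  | (b, U), (_, e, _) => (b, Function.update U e b)

def setEdges (b : Bool) (U : κ → Bool) (l : List (Edge κ)) : κ → Bool := (l.foldl setStep (b, U)).2

def markExch (U : κ → Bool) (p : Exch κ) : κ → Bool := setEdges true (setEdges true U p.1) p.2

def flagEdge (U : κ → Bool) : Edge κ → Edge κ
  | (_, e, x, y) => (!U e, e, x, y)

def restStep : (κ → Bool) × List κ → Edge κ → (κ → Bool) × List κ
  | (U, acc), (_, e, _) => if U e then (U, acc) else (U, e :: acc)

def relabelExch (φ : κ → κ) (p : Exch κ) : Exch κ := (relabel φ p.1, relabel φ p.2)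

/-- Here `c` is twice the number of edges removed so far and `r` the total number, so the middle
exchange is the first one with which more than half is exceeded, or else the last one. The result
consists of the left exchanges, the middle one, the right exchanges, and the weights of the two
sides. -/
def splitExch (r : ℕ) : ℕ → List (Exch κ) → List ℝ≥0 →
    List (Exch κ) × Exch κ × List (Exch κ) × List ℝ≥0 × List ℝ≥0
  | _, [], _ => ([], ([], []), [], [], [])
  | _, _ :: _, [] => ([], ([], []), [], [], [])
  | _, [p], a :: δ => ([], p, [], [a], δ)
  | c, p :: q :: ex, a :: δ =>
    if r < p.1.foldl (fun n _ => n + 2) c then ([], p, q :: ex, [a], δ)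
    else
      let s := splitExch r (p.1.foldl (fun n _ => n + 2) c) (q :: ex) δ
      (p :: s.1, s.2.1, s.2.2.1, a :: s.2.2.2.1, s.2.2.2.2)

def addedEdges (acc : List (Edge κ)) (p : Exch κ) : List (Edge κ) := p.2.reverse ++ acc

def applyExch (U : κ → Bool) (p : Exch κ) : κ → Bool := setEdges true (setEdges false U p.1) p.2

/-- Clearing the mark suppresses further copies of the same edge; an edge may be added by several
exchanges. -/
def gatherStep : (κ → Bool) × List (Edge κ) → Edge κ → (κ → Bool) × List (Edge κ)
  | (U, acc), (_, e, x, y) =>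
    if U e then (Function.update U e false, (false, e, x, y) :: acc) else (U, acc)

/-- The edges of a list whose identifiers are marked, each of them once. -/
def gather (U : κ → Bool) (l : List (Edge κ)) : List (Edge κ) := (l.foldl gatherStep (U, [])).2

def markIds (l : List κ) : κ → Bool := l.foldl (fun U e => Function.update U e true) fun _ => false

/-- The machine cannot create the weight `0`, so the summation starts with the first weight of a
non-empty list. -/
noncomputable def weightSum : List ℝ≥0 → ℝ≥0
  | [] => 0
  | a :: l => l.foldl (· + ·) a

def edgeIds (l : List (Edge κ)) : List κ := l.map fun t => t.2.1

/-- The data of a call of the divide-and-conquer algorithm: the contracted first tree, all edges of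
the contracted trees, the edges that are contracted, and the two halves. -/
structure Division (κ : Type*) where
  B : List (Edge κ)
  all : List (Edge κ)
  rest : List κ
  left : List (Exch κ)
  B' : List (Edge κ)
  right : List (Exch κ)
  leftWeights : List ℝ≥0
  rightWeights : List ℝ≥0

/-- The edges outside of `U` take part in no exchange; they are flagged and contracted. The first
tree on the right is obtained by replaying the exchanges on marks of identifiers and then collecting
the marked edges from `all`, which also handles exchanges that remove absent or add present edges.
-/
def divide (x : κ) (B : List (Edge κ)) (ex : List (Exch κ)) (δ : List ℝ≥0) : Division κ :=
  let U := ex.foldl markExch fun _ => false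
  let c := contract (search (B.map (flagEdge U)) x).reverse
  let ex' := ex.map (relabelExch c.1)
  let s := splitExch (removedCount ex) 0 ex' δ
  let B' := gather U c.2
  let all := ex'.foldl addedEdges B'
  { B := B'
    all := all
    rest := (B.foldl restStep (U, [])).2
    left := s.1
    B' := gather (applyExch (s.1.foldl applyExch (setEdges true (fun _ => false) B')) s.2.1) all
    right := s.2.2.1
    leftWeights := s.2.2.2.1
    rightWeights := s.2.2.2.2 }

/-- Divide-and-conquer swap rounding of spanning trees. -/
noncomputable def divideSwap (m : ℕ) :
    ℕ → List (Edge κ) → List (Exch κ) → List ℝ≥0 → PMF (List κ)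
  | _, [], _, _ => PMF.pure []
  | 0, B, _, _ => PMF.pure (edgeIds B)
  | d + 1, (fl, e, x, y) :: B, ex, δ =>
    -- If nothing is removed, each tree contains its predecessor, and spanning trees that contain
    -- each other are equal.
    if removedCount ex = 0 then PMF.pure (edgeIds ((fl, e, x, y) :: B))
    else
      let D := divide x ((fl, e, x, y) :: B) ex δ
      (divideSwap m d D.B D.left D.leftWeights).bind fun X =>
        (divideSwap m d D.B' D.right D.rightWeights).bind fun Y =>
          (mergeTrees m (weightSum D.leftWeights) (weightSum D.rightWeights)
            (gather (markIds X) D.all) (gather (markIds Y) D.all)).map fun Z => D.rest.reverse ++ Z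

/-! Crude bounds for the lengths of the lists that occur. -/

theorem length_searchStep_le (s : SearchState κ) :
    (searchStep s).2.2.2.length ≤ s.2.2.2.length + 1 := by
  obtain ⟨adj, vis, W, out⟩ := s
  rcases W with _ | ⟨⟨v, _ | ⟨⟨fl, e, w⟩, arcs⟩⟩, W⟩
  · simp [searchStep]
  · simp [searchStep]
  · rw [searchStep]
    split_ifs <;> simp

theorem length_searchRound_le (T : List (Edge κ)) (s : SearchState κ) :
    (searchRound T s).2.2.2.length ≤ s.2.2.2.length + T.length := by
  induction T generalizing s with
  | nil => simp [searchRound]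
  | cons t T ih =>
    have h1 := ih (searchStep s)
    have h2 := length_searchStep_le s
    rw [searchRound] at h1 ⊢
    rw [List.foldl_cons, List.length_cons]
    omega

theorem length_search_le (T : List (Edge κ)) (r : κ) :
    (search T r).length ≤ 4 * T.length + 1 := by
  rw [search]
  refine (length_searchStep_le _).trans ?_
  have h1 := length_searchRound_le T (searchStart T r)
  have h2 := length_searchRound_le T (searchRound T (searchStart T r))
  have h3 := length_searchRound_le T (searchRound T (searchRound T (searchStart T r)))
  have h4 := length_searchRound_le T
    (searchRound T (searchRound T (searchRound T (searchStart T r))))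
  have h5 : (searchStart T r).2.2.2.length = 0 := rfl
  omega

theorem length_contract_le (l : List (Edge κ)) : (contract l).2.length ≤ l.length := by
  suffices ∀ (l : List (Edge κ)) (s : (κ → κ) × List (Edge κ)),
      (l.foldl contractStep s).2.length ≤ s.2.length + l.length by
    simpa [contract] using this l (id, [])
  intro l
  induction l with
  | nil => simp
  | cons t l ih =>
    intro s
    refine (ih _).trans ?_
    obtain ⟨fl, e, v, p⟩ := t
    obtain ⟨φ, o⟩ := s
    cases fl <;> simp [contractStep] <;> omega

theorem length_prune (S : κ → Bool) (l : List (Edge κ)) : (prune S l).length = l.length := by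
  suffices ∀ (l : List (Edge κ)) (s : (κ → Bool) × (κ → Bool) × List (Edge κ)),
      (l.foldl pruneStep s).2.2.length = s.2.2.length + l.length by
    simpa [prune] using this l (S, S, [])
  intro l
  induction l with
  | nil => simp
  | cons t l ih =>
    intro s
    rw [List.foldl_cons, ih]
    obtain ⟨fl, e, v, p⟩ := t
    obtain ⟨S, M, acc⟩ := s
    simp [pruneStep]
    omega

end Algorithm

/-! ### Procedures for rooted trees -/

namespace Code
variable {k : ℕ}

abbrev on (i : Fin (k + 1)) (c : Code (k + 1)) : Code (k + 1) := .comp (.call i) c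

def addEdge : Code (k + 1) :=
  .letIn (.on 2 (.pair .π0 (.pair .π3 (.pair (.pair .π1 (.pair .π2 .τ4)) (.on 1 (.pair .π0 .π3))))))
    (.on 2 (.pair .π0 (.pair .τ5 (.pair (.pair .π2 (.pair .π3 .π4)) (.on 1 (.pair .π0 .τ5))))))

/-- A step of the search, on the pair of a vertex with its remaining arcs and the rest of the
state. -/
def searchStep : Code (k + 1) :=
  .ite .π2
    (.letIn (.comp .π0 .π2)
      (.ite (.comp .τ1 .π0)
        (.letIn (.comp .π0 (.comp .τ1 .π0))
          -- the argument is (arc, ((v, arcs), (adj, (vis, (W, out)))))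
          (.ite (.on 1 (.pair (.comp .π1 .τ2) (.comp .τ2 .π0)))
            (.pair .π2 (.pair .π3 (.pair
              (.pair (.pair (.comp .π0 .π1) (.comp .τ1 (.comp .τ1 .π1))) (.comp .τ1 .π4)) .τ5)))
            (.pair .π2 (.pair (.on 2 (.pair .π3 (.pair (.comp .τ2 .π0) .tt)))
              (.pair
                (.pair (.pair (.comp .τ2 .π0) (.on 1 (.pair .π2 (.comp .τ2 .π0))))
                  (.pair (.pair (.comp .π0 .π1) (.comp .τ1 (.comp .τ1 .π1))) (.comp .τ1 .π4)))
                (.pair (.pair (.comp .π0 .π0) (.pair (.comp .π1 .π0) (.pair (.comp .τ2 .π0)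
                  (.comp .π0 .π1)))) .τ5)))))
          )
        (.pair .π1 (.pair .π2 (.pair (.comp .τ1 .π3) .τ4)))))
    .self

/-- The search in a tree, on the empty dictionary, the tree and the root. -/
def search : Code (k + 1) :=
  .letIn (.on 5 (.pair .π0 .π1))
    -- the argument is (adj, (empty, (T, r)))
    (.letIn (.pair .π0 (.pair (.on 2 (.pair .π1 (.pair .τ3 .tt)))
        (.pair (.pair (.pair .τ3 (.on 1 (.pair .π0 .τ3))) .nil) .nil)))
      (.comp .τ3 (.comp .searchStep (.on 6 (.pair (.on 6 (.pair (.on 6 (.pair (.on 6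
        (.pair .π0 .π3)) .π3)) .π3)) .π3)))))

def contractStep : Code (k + 1) :=
  .ite .π1
    (.pair (.on 2 (.pair (.comp .π0 .π0) (.pair .π3 (.on 1 (.pair (.comp .π0 .π0) .τ4)))))
      (.comp .τ1 .π0))
    (.pair (.comp .π0 .π0) (.pair
      (.pair .nil (.pair .π2 (.pair .π3 (.on 1 (.pair (.comp .π0 .π0) .τ4))))) (.comp .τ1 .π0)))

def relabelEdge : Code (k + 1) :=
  .pair .π1 (.pair .π2 (.pair (.on 1 (.pair .π0 .π3)) (.on 1 (.pair .π0 .τ4))))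

def markEdge : Code (k + 1) :=
  .on 2 (.pair (.on 2 (.pair .π0 (.pair .π3 .tt))) (.pair .τ4 .tt))

/-- The argument is ((S, (M, acc)), (flag, (e, (v, p)))). -/
def pruneStep : Code (k + 1) :=
  .ite (.on 1 (.pair (.comp .π1 .π0) .π3))
    (.pair (.comp .π0 .π0) (.pair (.on 2 (.pair (.comp .π1 .π0) (.pair .τ4 .tt)))
      (.pair
        (.pair (.ite (.on 1 (.pair (.comp .π0 .π0) .π3)) .nil
          (.ite (.on 1 (.pair (.comp .π0 .π0) .τ4)) .nil .tt)) .τ2)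
        (.comp .τ2 .π0))))
    (.pair (.comp .π0 .π0) (.pair (.comp .π1 .π0) (.pair (.pair .tt .τ2) (.comp .τ2 .π0))))

/-- The argument is (((empty, id), r), (tree, ops)). -/
def shrink : Code (k + 1) :=
  .letIn (.on 8 (.pair (.pair (.comp .τ1 (.comp .π0 .π0)) .nil)
      (.on 4 (.pair .nil (.on 7 (.pair (.comp .π0 (.comp .π0 .π0)) (.pair .π1 (.comp .τ1 .π0))))))))
    -- the argument is ((φ, o), (((empty, id), r), (tree, ops)))
    (.letIn (.on 9 (.pair (.comp .π0 .π0) .τ3))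
      -- the argument is (ops', ((φ, o), (((empty, id), r), (tree, ops))))
      (.letIn (.on 10 (.pair (.comp .π0 (.comp .π0 .π2)) .π0))
        -- the argument is (S, (ops', ((φ, o), (((empty, id), r), (tree, ops)))))
        (.letIn (.on 8 (.pair (.pair (.comp .τ1 (.comp .π0 .π3)) .nil)
            (.comp .τ2 (.on 11 (.pair (.pair .π0 (.pair .π0 .nil)) (.comp .τ1 .π2))))))
          (.pair (.comp .τ1 .π0) (.on 9 (.pair (.comp .π0 .π0) .π2))))))

end Code

class HasTrees (P : Program) : Prop extends HasDict P where
  adjacency : P.body 5 = .fold 5 .addEdge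
  searchRound : P.body 6 = .fold 6 (.comp .searchStep .π0)
  search : P.body 7 = .search
  contract : P.body 8 = .fold 8 .contractStep
  relabel : P.body 9 = .mapList 9 .relabelEdge
  markEnds : P.body 10 = .fold 10 .markEdge
  prune : P.body 11 = .fold 11 .pruneStep
  shrink : P.body 12 = .shrink

section Trees

variable {κ : Type*} [Keys κ] [DecidableEq κ] {P : Program} [HasTrees P]

omit [DecidableEq κ] in
-- Thus one empty dictionary in the environment serves for marks, adjacency lists and statuses.
theorem enc_empty (α : Type*) [Enc α] :
    enc (fun _ : κ => ([] : List α)) = enc (fun _ : κ => false) := by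
  show SearchTree.toVal _ _ _ = SearchTree.toVal _ _ _
  induction (Keys.tree : SearchTree κ) with
  | leaf k => rfl
  | node s l r hl hr => rw [SearchTree.toVal, SearchTree.toVal, hl, hr]

theorem det_adjacency (T : List (Edge κ)) :
    Det P (.call 5) (.pair (enc fun _ : κ => false) (enc T)) (enc (adjacency T))
      (5 * unitCost κ * (T.length + 1)) := by
  rw [← enc_empty (κ := κ) (Arc κ)]
  have hu := le_unitCost κ
  refine Det.foldl HasTrees.adjacency (s := 4 * unitCost κ + 200) T (fun a x _ => ?_) _ (by omega)
  obtain ⟨fl, e, x, y⟩ := x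
  simp only [Code.addEdge, wp_rules, apply_rules, enc_pair, enc_cons, enc_nil, enc_true, enc_false]
  refine (Det.get a x).wp ?_
  refine (Det.set a x ((fl, e, y) :: a x)).wp ?_
  refine (Det.get _ y).wp ?_
  refine (Det.set _ y ((fl, e, x) :: _)).wp ?_
  refine ⟨rfl, ?_⟩
  omega

theorem steps_searchStep (s : SearchState κ) :
    Steps P .searchStep (enc s) (enc (searchStep s)) (3 * unitCost κ + 600) := by
  obtain ⟨adj, vis, W, out⟩ := s
  rcases W with _ | ⟨⟨v, _ | ⟨⟨fl, e, w⟩, arcs⟩⟩, W⟩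
  · simp only [Code.searchStep, wp_rules, apply_rules, enc_pair, enc_cons, enc_nil, enc_true, enc_false]
    exact ⟨rfl, by omega⟩
  · simp only [Code.searchStep, wp_rules, apply_rules, enc_pair, enc_cons, enc_nil, enc_true, enc_false]
    exact ⟨rfl, by omega⟩
  · simp only [Code.searchStep, wp_rules, apply_rules, enc_pair, enc_cons, enc_nil, enc_true, enc_false]
    refine (Det.get vis w).wp ?_
    cases h : vis w
    · simp only [enc_false, isNil_nil, cond_true]
      refine (Det.set vis w true).wp ?_
      refine (Det.get adj w).wp ?_
      refine ⟨?_, ?_⟩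
      · rw [searchStep, h]; rfl
      · omega
    · simp only [enc_true, isNil_pair, cond_false]
      refine ⟨?_, ?_⟩
      · rw [searchStep, h]; rfl
      · omega

theorem det_searchRound (T : List (Edge κ)) (s : SearchState κ) :
    Det P (.call 6) (.pair (enc s) (enc T)) (enc (searchRound T s))
      (5 * unitCost κ * (T.length + 1)) := by
  have hu := le_unitCost κ
  refine Det.foldl HasTrees.searchRound (s := 3 * unitCost κ + 700) T (fun a x _ => ?_) _
    (by omega)
  simp
  refine (steps_searchStep a).wp fun s hs => ?_
  refine ⟨rfl, ?_⟩
  omega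

theorem det_search (T : List (Edge κ)) (r : κ) :
    Det P (.call 7) (.pair (enc fun _ : κ => false) (.pair (enc T) (enc r))) (enc (search T r))
      (32 * unitCost κ * (T.length + 1)) := by
  have hu := le_unitCost κ
  refine det_call_of_wp HasTrees.search ?_
  simp only [Code.search, wp_rules, apply_rules, enc_pair, enc_cons, enc_nil, enc_true, enc_false]
  refine (det_adjacency T).wp ?_
  refine (Det.set (fun _ : κ => false) r true).wp ?_
  refine (Det.get _ r).wp ?_
  refine (det_searchRound T (searchStart T r)).wp ?_
  refine (det_searchRound T _).wp ?_
  refine (det_searchRound T _).wp ?_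
  refine (det_searchRound T _).wp ?_
  refine (steps_searchStep _).wp fun s hs => ?_
  refine ⟨rfl, ?_⟩
  have h : unitCost κ ≤ unitCost κ * (T.length + 1) := Nat.le_mul_of_pos_right _ (by omega)
  simp only [mul_assoc]
  omega

theorem det_contract (l : List (Edge κ)) :
    Det P (.call 8) (.pair (.pair (enc (id : κ → κ)) .nil) (enc l)) (enc (contract l))
      (4 * unitCost κ * (l.length + 1)) := by
  have hu := le_unitCost κ
  refine Det.foldl (f := contractStep) HasTrees.contract (s := 2 * unitCost κ + 200) l
    (fun a x _ => ?_) (id, []) (by omega)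
  obtain ⟨fl, e, v, p⟩ := x
  obtain ⟨φ, o⟩ := a
  cases fl <;> simp only [Code.contractStep, wp_rules, apply_rules, enc_pair, enc_cons, enc_nil, enc_true, enc_false]
  · refine (Det.get φ p).wp ?_
    exact ⟨rfl, by omega⟩
  · refine (Det.get φ p).wp ?_
    refine (Det.set φ v _).wp ?_
    exact ⟨rfl, by omega⟩

omit [DecidableEq κ] in
theorem det_relabel (φ : κ → κ) (l : List (Edge κ)) :
    Det P (.call 9) (.pair (enc φ) (enc l)) (enc (relabel φ l))
      (3 * unitCost κ * (l.length + 1)) := by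
  have hu := le_unitCost κ
  refine Det.map (f := relabelEdge) HasTrees.relabel (s := 2 * unitCost κ + 50) φ l
    (fun x _ => ?_) (by omega)
  obtain ⟨fl, e, x, y⟩ := x
  simp only [Code.relabelEdge, wp_rules, apply_rules, enc_pair, enc_cons, enc_nil, enc_true, enc_false]
  refine (Det.get φ x).wp ?_
  refine (Det.get φ y).wp ?_
  exact ⟨rfl, by omega⟩

theorem det_markEnds (l : List (Edge κ)) :
    Det P (.call 10) (.pair (enc fun _ : κ => false) (enc l)) (enc (markEnds l))
      (3 * unitCost κ * (l.length + 1)) := by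
  have hu := le_unitCost κ
  refine Det.foldl HasTrees.markEnds (s := 2 * unitCost κ + 50) l (fun a x _ => ?_) _ (by omega)
  obtain ⟨fl, e, x, y⟩ := x
  simp only [Code.markEdge, wp_rules, apply_rules, enc_pair, enc_cons, enc_nil, enc_true, enc_false]
  refine (Det.set a x true).wp ?_
  refine (Det.set _ y true).wp ?_
  exact ⟨rfl, by omega⟩

theorem det_prune (S : κ → Bool) (l : List (Edge κ)) :
    Det P (.call 11) (.pair (.pair (enc S) (.pair (enc S) .nil)) (enc l))
      (enc (l.foldl pruneStep (S, S, []))) (6 * unitCost κ * (l.length + 1)) := by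
  have hu := le_unitCost κ
  refine Det.foldl (f := pruneStep) HasTrees.prune (s := 4 * unitCost κ + 300) l
    (fun a x _ => ?_) (S, S, []) (by omega)
  obtain ⟨fl, e, v, p⟩ := x
  obtain ⟨S, M, acc⟩ := a
  simp only [Code.pruneStep, wp_rules, apply_rules, enc_pair, enc_cons, enc_nil, enc_true, enc_false]
  refine (Det.get M v).wp ?_
  cases h : M v
  · simp only [wp_rules, apply_rules, enc_pair, enc_cons, enc_nil, enc_true, enc_false]
    exact ⟨by simp [pruneStep, h], by omega⟩
  · simp only [wp_rules, apply_rules, enc_pair, enc_cons, enc_nil, enc_true, enc_false]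
    refine (Det.set M p true).wp ?_
    refine (Det.get S v).wp ?_
    cases h' : S v
    · simp only [wp_rules, apply_rules, enc_pair, enc_cons, enc_nil, enc_true, enc_false]
      refine (Det.get S p).wp ?_
      cases h'' : S p <;> simp only [wp_rules, apply_rules, enc_pair, enc_cons, enc_nil, enc_true, enc_false] <;>
        exact ⟨by simp [pruneStep, h, h', h''], by omega⟩
    · simp only [wp_rules, apply_rules, enc_pair, enc_cons, enc_nil, enc_true, enc_false]
      exact ⟨by simp [pruneStep, h, h'], by omega⟩

theorem det_shrink (r : κ) (tree ops : List (Edge κ)) {n : ℕ}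
    (ht : tree.length ≤ n) (ho : ops.length ≤ n) :
    Det P (.call 12) (.pair (.pair (.pair (enc fun _ : κ => false) (enc (id : κ → κ))) (enc r))
      (.pair (enc tree) (enc ops))) (enc (shrink r tree ops)) (300 * (unitCost κ * (n + 1))) := by
  have hu := le_unitCost κ
  refine det_call_of_wp HasTrees.shrink ?_
  simp only [Code.shrink, wp_rules, apply_rules, enc_pair, enc_cons, enc_nil, enc_true, enc_false]
  refine (det_search tree r).wp ?_
  refine (Det.revAppend _ []).wp ?_
  rw [List.append_nil]
  refine (det_contract _).wp ?_
  refine (det_relabel _ ops).wp ?_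
  refine (det_markEnds _).wp ?_
  refine (det_prune _ _).wp ?_
  refine (det_contract _).wp ?_
  refine (det_relabel _ _).wp ?_
  refine ⟨rfl, ?_⟩
  have h1 := length_search_le tree r
  have h2 := length_contract_le (search tree r).reverse
  rw [List.length_reverse] at h2
  have h3 := length_prune (markEnds (relabel (contract (search tree r).reverse).1 ops))
    (contract (search tree r).reverse).2
  rw [prune] at h3
  rw [h3, List.length_reverse, relabel, List.length_map]
  -- All the lists that occur have at most `4 * n + 1` elements, by the crude bound for the output
  -- of the search; so each procedure costs a multiple of `unitCost κ * (n + 1)`.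
  have key : ∀ {c l : ℕ}, l ≤ 4 * n + 1 →
      c * unitCost κ * (l + 1) ≤ c * 4 * (unitCost κ * (n + 1)) := fun {c l} h => by
    rw [mul_assoc, mul_assoc]
    refine Nat.mul_le_mul_left c ?_
    rw [mul_left_comm]
    exact Nat.mul_le_mul_left _ (by omega)
  have k1 := key (c := 32) (l := tree.length) (by omega)
  have k2 := key (c := 4) (l := (search tree r).length) (by omega)
  have k3 := key (c := 3) (l := ops.length) (by omega)
  have k4 := key (c := 6) (l := (contract (search tree r).reverse).2.length) (by omega)
  have k5 := key (c := 4) (l := (contract (search tree r).reverse).2.length) (by omega)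
  have k6 : 1000 * (n + 1) ≤ unitCost κ * (n + 1) := Nat.mul_le_mul_right _ hu
  omega

end Trees

/-! ### Rooted trees as lists of edges -/

section Rooted

variable {κ : Type*}

/-- The vertices of the tree with root `r` and edges `l`. -/
def verts (r : κ) (l : List (Edge κ)) : List κ := r :: l.map fun t => t.2.2.1

/-- `l` lists the edges of a tree with root `r`, directed to the root, children before parents. -/
def Rooted (r : κ) : List (Edge κ) → Prop
  | [] => True
  | t :: l => t.2.2.1 ∉ verts r l ∧ t.2.2.2 ∈ verts r l ∧ Rooted r l

theorem mem_verts_cons {r x : κ} {t : Edge κ} {l : List (Edge κ)} :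
    x ∈ verts r (t :: l) ↔ x = t.2.2.1 ∨ x ∈ verts r l := by
  simp only [verts, List.map_cons, List.mem_cons]
  tauto

theorem Rooted.nodup {r : κ} {l : List (Edge κ)} (h : Rooted r l) : (verts r l).Nodup := by
  induction l with
  | nil => simp [verts]
  | cons t l ih =>
    obtain ⟨h1, -, h3⟩ := h
    have := ih h3
    simp only [verts, List.map_cons, List.mem_cons, List.nodup_cons, not_or] at *
    exact ⟨⟨fun h => h1.1 h.symm, this.1⟩, h1.2, this.2⟩

variable [DecidableEq κ]

/-- The invariant of the search. -/
structure SearchState.Valid (r : κ) (s : SearchState κ) : Prop where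
  rooted : Rooted r s.2.2.2
  visited : ∀ v, s.2.1 v = true ↔ v ∈ verts r s.2.2.2
  pending : ∀ x ∈ s.2.2.1, x.1 ∈ verts r s.2.2.2

theorem SearchState.Valid.step {r : κ} {s : SearchState κ} (h : s.Valid r) :
    (searchStep s).Valid r := by
  obtain ⟨adj, vis, W, out⟩ := s
  obtain ⟨h1, h2, h3⟩ := h
  simp only at h1 h2 h3
  rcases W with _ | ⟨⟨v, _ | ⟨⟨fl, e, w⟩, arcs⟩⟩, W⟩
  · exact ⟨h1, h2, h3⟩
  · exact ⟨h1, h2, fun x hx => h3 x (List.mem_cons_of_mem _ hx)⟩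
  · have hv : v ∈ verts r out := h3 _ List.mem_cons_self
    rw [searchStep]
    split_ifs with hw
    · refine ⟨h1, h2, fun x hx => ?_⟩
      rcases List.mem_cons.1 hx with rfl | hx
      · exact hv
      · exact h3 x (by simp [hx])
    · refine ⟨⟨fun hw' => hw ((h2 w).2 hw'), hv, h1⟩, fun x => ?_, fun x hx => ?_⟩
      · simp only [mem_verts_cons, Function.update_apply]
        split_ifs with hx
        · simp [hx]
        · simp [hx, h2]
      · simp only [mem_verts_cons]
        simp only [List.mem_cons] at hx
        rcases hx with rfl | rfl | hx
        · exact Or.inl rfl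
        · exact Or.inr hv
        · exact Or.inr (h3 x (by simp [hx]))

theorem searchRound_induction {p : SearchState κ → Prop} (h : ∀ s, p s → p (searchStep s))
    (T : List (Edge κ)) {s : SearchState κ} (hs : p s) : p (searchRound T s) := by
  induction T generalizing s with
  | nil => exact hs
  | cons t T ih => exact ih (h s hs)

theorem valid_searchStart (T : List (Edge κ)) (r : κ) : (searchStart T r).Valid r := by
  refine ⟨trivial, fun v => ?_, fun x hx => ?_⟩
  · simp [searchStart, verts, Function.update_apply]
  · simp only [searchStart, List.mem_singleton] at hx
    subst hx
    simp [verts]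

theorem rooted_search (T : List (Edge κ)) (r : κ) : Rooted r (search T r) := by
  have h : ∀ s : SearchState κ, s.Valid r → (searchStep s).Valid r := fun s hs => hs.step
  exact (h _ (searchRound_induction h T (searchRound_induction h T (searchRound_induction h T
    (searchRound_induction h T (valid_searchStart T r)))))).rooted

theorem contract_cons (t : Edge κ) (l : List (Edge κ)) :
    contract (t :: l).reverse = contractStep (contract l.reverse) t := by
  simp [contract]

theorem contract_fixed {x : κ} {l : List (Edge κ)} (hx : x ∉ l.map fun t => t.2.2.1) :
    (contract l.reverse).1 x = x := by
  induction l with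
  | nil => rfl
  | cons t l ih =>
    obtain ⟨fl, e, v, p⟩ := t
    simp only [List.map_cons, List.mem_cons, not_or] at hx
    rw [contract_cons, contractStep]
    split_ifs
    · exact (Function.update_of_ne hx.1 _ _).trans (ih hx.2)
    · exact ih hx.2

theorem contract_root {r : κ} {l : List (Edge κ)} (hl : Rooted r l) :
    (contract l.reverse).1 r = r :=
  contract_fixed (List.nodup_cons.1 hl.nodup).1

theorem verts_contract_subset {r x : κ} {l : List (Edge κ)}
    (hx : x ∈ verts r (contract l.reverse).2) : x ∈ verts r l := by
  induction l with
  | nil => exact hx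
  | cons t l ih =>
    obtain ⟨fl, e, v, p⟩ := t
    rw [contract_cons, contractStep] at hx
    rw [mem_verts_cons]
    split_ifs at hx
    · exact Or.inr (ih hx)
    · exact (mem_verts_cons.1 hx).imp id ih

/-- The representatives are the root and the children of the unflagged edges, because a flagged edge
passes its child on to the representative of the parent. -/
theorem contract_mem_verts {r x : κ} {l : List (Edge κ)} (hl : Rooted r l) (hx : x ∈ verts r l) :
    (contract l.reverse).1 x ∈ verts r (contract l.reverse).2 := by
  induction l generalizing x with
  | nil => exact hx
  | cons t l ih =>
    obtain ⟨fl, e, v, p⟩ := t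
    obtain ⟨h1, h2, h3⟩ := hl
    rw [contract_cons, contractStep]
    split_ifs
    · simp only [Function.update_apply]
      split_ifs with hv
      · exact ih h3 h2
      · exact ih h3 ((mem_verts_cons.1 hx).resolve_left hv)
    · rw [mem_verts_cons]
      rcases mem_verts_cons.1 hx with rfl | hx
      · left
        refine contract_fixed fun h => h1 ?_
        exact List.mem_cons_of_mem _ h
      · exact Or.inr (ih h3 hx)

theorem Rooted.contract {r : κ} {l : List (Edge κ)} (hl : Rooted r l) :
    Rooted r (contract l.reverse).2 := by
  induction l with
  | nil => trivial
  | cons t l ih =>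
    obtain ⟨fl, e, v, p⟩ := t
    obtain ⟨h1, h2, h3⟩ := hl
    rw [contract_cons, contractStep]
    split_ifs
    · exact ih h3
    · exact ⟨fun h => h1 (verts_contract_subset h), contract_mem_verts h3 h2, ih h3⟩

theorem length_contract (l : List (Edge κ)) :
    (SwapRounding.contract l.reverse).2.length = l.countP fun t => !t.1 := by
  induction l with
  | nil => rfl
  | cons t l ih =>
    obtain ⟨fl, e, v, p⟩ := t
    rw [contract_cons, contractStep]
    cases fl <;> simp [ih]

/-- The flagging of `prune`, as a recursion from the leaves to the root. -/
def pruned (S : κ → Bool) : (κ → Bool) → List (Edge κ) → List (Edge κ)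
  | _, [] => []
  | M, (_, e, v, p) :: l =>
    (!(M v && (S v || S p)), e, v, p) ::
      pruned S (if M v then Function.update M p true else M) l

theorem prune_eq (S : κ → Bool) (l : List (Edge κ)) : prune S l = (pruned S S l).reverse := by
  suffices ∀ (l : List (Edge κ)) (M : κ → Bool) (acc : List (Edge κ)),
      (l.foldl pruneStep (S, M, acc)).2.2 = (pruned S M l).reverse ++ acc by
    rw [prune, this, List.append_nil]
  intro l
  induction l with
  | nil => intro M acc; rfl
  | cons t l ih =>
    intro M acc
    obtain ⟨fl, e, v, p⟩ := t
    rw [List.foldl_cons, pruneStep, ih, pruned]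
    simp

theorem verts_pruned (r : κ) (S M : κ → Bool) (l : List (Edge κ)) :
    verts r (pruned S M l) = verts r l := by
  simp only [verts, List.cons.injEq, true_and]
  induction l generalizing M with
  | nil => rfl
  | cons t l ih =>
    obtain ⟨fl, e, v, p⟩ := t
    rw [pruned, List.map_cons, List.map_cons, ih]

theorem Rooted.pruned {r : κ} {l : List (Edge κ)} (hl : Rooted r l) (S M : κ → Bool) :
    Rooted r (pruned S M l) := by
  induction l generalizing M with
  | nil => trivial
  | cons t l ih =>
    obtain ⟨fl, e, v, p⟩ := t
    obtain ⟨h1, h2, h3⟩ := hl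
    refine ⟨?_, ?_, ih h3 _⟩
    · rwa [verts_pruned]
    · rwa [verts_pruned]

omit [DecidableEq κ] in
theorem countP_verts_cons (q : κ → Bool) (r : κ) (t : Edge κ) (l : List (Edge κ)) :
    (verts r (t :: l)).countP q = (verts r l).countP q + if q t.2.2.1 then 1 else 0 := by
  simp only [verts, List.map_cons, List.countP_cons]
  omega

theorem countP_update_le (q : κ → Bool) (p : κ) {l : List κ} (hl : l.Nodup) :
    l.countP (Function.update q p true) ≤ l.countP q + if q p then 0 else 1 := by
  induction l with
  | nil => simp
  | cons x l ih =>
    obtain ⟨hx, hl⟩ := List.nodup_cons.1 hl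
    have := ih hl
    rw [List.countP_cons, List.countP_cons]
    by_cases h : x = p
    · subst h
      have : l.countP (Function.update q x true) = l.countP q :=
        List.countP_congr fun y hy => by rw [Function.update_of_ne (by rintro rfl; exact hx hy)]
      rw [this]
      cases q x <;> simp
    · rw [Function.update_of_ne h]
      omega

/-- A charging argument from the leaves upwards. An edge can remain unflagged only if `M v` holds,
and then the mark moves from `v` to `p`. If `p` had no mark, it is not in `S`, so the edge remains
only if `v` is in `S`, and it is charged to `v`. If `p` had a mark already, the number of marks on
the remaining vertices drops by one, which pays for the edge. -/
theorem countP_pruned_le {r : κ} {l : List (Edge κ)} (hl : Rooted r l) {S M : κ → Bool}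
    (hS : ∀ x, S x → M x) :
    (SwapRounding.pruned S M l).countP (fun t => !t.1) ≤
      (l.map fun t => t.2.2.1).countP S + (verts r l).countP M := by
  induction l generalizing M with
  | nil => simp [SwapRounding.pruned]
  | cons t l ih =>
    obtain ⟨fl, e, v, p⟩ := t
    have hnd := hl.2.2.nodup
    obtain ⟨h1, h2, h3⟩ := hl
    rw [SwapRounding.pruned, List.countP_cons, List.map_cons, List.countP_cons, countP_verts_cons]
    have ih' := ih h3 (M := if M v then Function.update M p true else M) (fun x hx => by
      split_ifs
      · rw [Function.update_apply]
        split_ifs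
        · rfl
        · exact hS x hx
      · exact hS x hx)
    have hup := countP_update_le M p hnd
    have hSv := hS v
    have hSp := hS p
    cases hMv : M v
    · simp only [hMv, Bool.false_eq_true, if_false, Bool.false_and, Bool.not_false,
        Bool.not_true] at ih' ⊢
      omega
    · simp only [hMv, if_true, Bool.true_and, Bool.not_not] at ih' ⊢
      cases hv : S v <;> cases hp : S p <;> simp_all <;> (try split_ifs at hup) <;> omega

theorem markEnds_iff (l : List (Edge κ)) (x : κ) :
    markEnds l x = true ↔ ∃ t ∈ l, x = t.2.2.1 ∨ x = t.2.2.2 := by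
  suffices ∀ S : κ → Bool, l.foldl markEdge S x = true ↔
      S x = true ∨ ∃ t ∈ l, x = t.2.2.1 ∨ x = t.2.2.2 by
    simpa [markEnds] using this fun _ => false
  induction l with
  | nil => simp
  | cons t l ih =>
    intro S
    obtain ⟨fl, e, v, p⟩ := t
    rw [List.foldl_cons, ih]
    simp only [markEdge, Function.update_apply, List.mem_cons, exists_eq_or_imp]
    split_ifs with h1 h2 <;> simp_all

theorem countP_markEnds_le (ops : List (Edge κ)) {l : List κ} (hl : l.Nodup) :
    l.countP (markEnds ops) ≤ 2 * ops.length := by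
  rw [List.countP_eq_length_filter]
  have h : l.filter (markEnds ops) ⊆ (ops.map fun t => t.2.2.1) ++ ops.map fun t => t.2.2.2 := by
    intro x hx
    rw [List.mem_filter, markEnds_iff] at hx
    obtain ⟨-, t, ht, h⟩ := hx
    rw [List.mem_append, List.mem_map, List.mem_map]
    rcases h with h | h
    · exact Or.inl ⟨t, ht, h.symm⟩
    · exact Or.inr ⟨t, ht, h.symm⟩
  have := ((hl.filter _).subperm h).length_le
  simp only [List.length_append, List.length_map] at this
  omega

/-- Both terms of `countP_pruned_le` count marked vertices, and every edge in `ops` marks at most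
two. -/
theorem length_shrink_le (r : κ) (tree ops : List (Edge κ)) :
    (shrink r tree ops).1.length ≤ 4 * ops.length := by
  rw [shrink]
  simp only [prune_eq, length_contract]
  set c := SwapRounding.contract (search tree r).reverse
  have hc : Rooted r c.2 := (rooted_search tree r).contract
  refine (countP_pruned_le hc fun x hx => hx).trans ?_
  have h1 := countP_markEnds_le (relabel c.1 ops) hc.nodup
  have h2 := countP_markEnds_le (relabel c.1 ops) (List.nodup_cons.1 hc.nodup).2
  rw [relabel, List.length_map] at h1 h2
  rw [relabel]
  omega

theorem length_shrink_ops (r : κ) (tree ops : List (Edge κ)) :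
    (shrink r tree ops).2.length = ops.length := by
  simp [shrink, relabel]

omit [DecidableEq κ] in
theorem halve_append {α β : Type*} (l : List α) (l' : List β) :
    (halve l l').1 ++ (halve l l').2 = l := by
  fun_induction halve l l' <;> simp_all

theorem length_halve {α β : Type*} {l : List α} {l' : List β} (h : l'.length ≤ l.length) :
    (halve l l').1.length = l'.length / 2 := by
  fun_induction halve l l' with
  | case1 x l y z l' ih =>
    simp only [List.length_cons] at *
    rw [ih (by omega)]
    omega
  | case2 l l' hne =>
    rcases l with _ | ⟨x, l⟩
    · simp at h; simp [h]
    · rcases l' with _ | ⟨y, _ | ⟨z, l'⟩⟩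
      · simp
      · simp
      · exact (hne x l y z l' rfl rfl).elim

theorem length_halve_self {α : Type*} (l : List α) :
    (halve l l).1.length = l.length / 2 ∧ (halve l l).2.length = l.length - l.length / 2 := by
  have h1 := length_halve (le_refl l.length)
  have h2 := congrArg List.length (halve_append l l)
  rw [List.length_append] at h2
  omega

theorem length_nextTree_le (B : List (Edge κ)) (F : List (Bool × κ × κ)) (ops : List (Edge κ)) :
    (nextTree B F ops).length ≤ B.length + ops.length := by
  have h1 : ∀ (l acc : List (Edge κ)), (l.foldl keepStep acc).length ≤ acc.length + l.length := by
    intro l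
    induction l with
    | nil => simp
    | cons t l ih =>
      intro acc
      refine (ih _).trans ?_
      obtain ⟨b, e, x, y⟩ := t
      cases b <;> simp [keepStep] <;> omega
  have h2 : ∀ (l : List (Edge κ)) (s : (κ → List Bool) × List (Edge κ)),
      (l.foldl nextStep s).2.length ≤ s.2.length + l.length := by
    intro l
    induction l with
    | nil => simp
    | cons t l ih =>
      intro s
      refine (ih _).trans ?_
      obtain ⟨b, e, x, y⟩ := t
      obtain ⟨st, acc⟩ := s
      rw [nextStep]
      split
      · simp; omega
      · split_ifs <;> simp <;> omega
  have := h1 ops []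
  refine (h2 _ _).trans ?_
  simp at this ⊢
  omega

theorem length_solve_le (d : ℕ) (tree ops : List (Edge κ)) :
    (solve d tree ops).length ≤ ops.length := by
  induction d generalizing tree ops with
  | zero =>
    rcases ops with _ | ⟨⟨b, e, v, p⟩, _ | ⟨o, ops⟩⟩
    · simp [solve]
    · simp [solve, shrink, relabel, relabelEdge, solveLast]
    · simp [solve]
  | succ d ih =>
    rcases ops with _ | ⟨⟨b, e, v, p⟩, _ | ⟨o, ops⟩⟩
    · simp [solve]
    · simp [solve, shrink, relabel, relabelEdge, solveLast]
    · rw [solve, List.length_append]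
      set s := shrink p tree ((b, e, v, p) :: o :: ops) with hs
      have h1 := ih s.1 (halve s.2 s.2).1
      have h2 := ih (nextTree s.1 (solve d s.1 (halve s.2 s.2).1) (halve s.2 s.2).1)
        (halve s.2 s.2).2
      have h3 := congrArg List.length (halve_append s.2 s.2)
      have h4 := length_shrink_ops p tree ((b, e, v, p) :: o :: ops)
      rw [List.length_append] at h3
      rw [← hs] at h4
      omega

end Rooted

/-! ### The procedure that computes the exchange partners -/

namespace Code
variable {k : ℕ}

def findStep : Code (k + 1) :=
  .ite (.on 3 (.pair .π3 (.comp .π0 .π0))) (.pair (.comp .π0 .π0) .π2) .π0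

def halve : Code (k + 1) :=
  .ite (.ite .π0 (.ite .τ1 .τ2 .nil) .nil)
    (.letIn (.on 14 (.pair (.comp .τ1 .π0) (.comp .τ1 .τ2)))
      (.pair (.pair (.comp .π0 .π1) (.comp .π0 .π0)) (.comp .τ1 .π0)))
    (.pair .nil .π0)

def statusStep : Code (k + 1) := .on 2 (.pair .π0 (.pair .τ3 (.pair .π1 .nil)))

def keepStep : Code (k + 1) := .ite .π1 (.pair (.pair .tt .τ2) .π0) .π0

def nextStep : Code (k + 1) :=
  .letIn (.on 1 (.pair (.comp .π0 .π0) .π2))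
    (.ite .π0
      (.ite (.comp .π0 .π0) .π1
        (.pair (.comp .π0 .π1) (.pair (.pair .tt .τ3) (.comp .τ1 .π1))))
      (.pair (.comp .π0 .π1) (.pair (.pair .nil .τ3) (.comp .τ1 .π1))))

/-- Concatenation of lists. -/
abbrev append (c d : Code (k + 1)) : Code (k + 1) := .on 4 (.pair d (.on 4 (.pair .nil c)))

/-- The argument is `((empty, id), (tree, ops))`. -/
def solve : Code (k + 1) :=
  .ite .τ2
    (.letIn (.on 12 (.pair (.pair .π0 (.comp .τ3 .π2)) .τ1))
      -- the argument is `((B, ops'), ((empty, id), (tree, ops)))`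
      (.ite .τ4
        (.letIn (.on 14 (.pair (.comp .τ1 .π0) (.comp .τ1 .π0)))
          (.letIn (.on 18 (.pair .π2 (.pair (.comp .π0 .π1) (.comp .π0 .π0))))
            -- the argument is `(F, (halves, ((B, ops'), ((empty, id), (tree, ops)))))`
            (.append .π0
              (.on 18 (.pair .π3 (.pair
                (.comp .τ1 (.on 17 (.pair (.pair (.on 15 (.pair (.comp .π0 .π3) .π0))
                  (.on 16 (.pair .nil (.comp .π0 .π1)))) (.comp .π0 .π2))))
                (.comp .τ1 .π1)))))))
        (.letIn (.comp .π1 .π0)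
          -- the argument is `((b, (e, (v, p))), ((B, ops'), …))`
          (.pair (.pair (.comp .π0 .π0) (.pair (.comp .π1 .π0) (.comp .τ1
            (.on 13 (.pair (.pair (.comp .π2 .π0) (.comp .π1 .π0)) (.comp .π0 .π1)))))) .nil))))
    .nil

end Code

class HasSolve (P : Program) : Prop extends HasTrees P where
  findEdge : P.body 13 = .fold 13 .findStep
  halve : P.body 14 = .halve
  status : P.body 15 = .fold 15 .statusStep
  keep : P.body 16 = .fold 16 .keepStep
  next : P.body 17 = .fold 17 .nextStep
  solve : P.body 18 = .solve

section Solve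

variable {κ : Type*} [Keys κ] [DecidableEq κ] {P : Program} [HasSolve P]

theorem det_findEdge (v f : κ) (l : List (Edge κ)) :
    Det P (.call 13) (.pair (.pair (enc v) (enc f)) (enc l)) (enc (l.foldl findStep (v, f)))
      (100 * (l.length + 1)) := by
  refine Det.foldl (f := findStep) HasSolve.findEdge (s := 60) l (fun a x _ => ?_) (v, f)
    (by omega)
  obtain ⟨fl, e, x, y⟩ := x
  obtain ⟨v, f⟩ := a
  simp only [Code.findStep, wp_rules, apply_rules, enc_pair, enc_cons, enc_nil, enc_true, enc_false]
  refine (Det.eqNum x v).wp ?_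
  by_cases h : x = v
  · simp only [h, decide_true, wp_rules, apply_rules, enc_pair, enc_cons, enc_nil, enc_true, enc_false]
    exact ⟨by simp [findStep], by omega⟩
  · simp only [h, decide_false, wp_rules, apply_rules, enc_pair, enc_cons, enc_nil, enc_true, enc_false]
    exact ⟨by simp [findStep, h], by omega⟩

omit [Keys κ] [DecidableEq κ] in
theorem det_halve {α β : Type*} [Enc α] [Enc β] (l : List α) (l' : List β) :
    Det P (.call 14) (.pair (enc l) (enc l')) (enc (halve l l')) (60 * (l'.length + 1)) := by
  fun_induction halve l l' with
  | case1 x l y z l' ih =>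
    refine det_call_of_wp HasSolve.halve ?_
    simp only [Code.halve, wp_rules, apply_rules, enc_pair, enc_cons, enc_nil, enc_true, enc_false]
    refine ih.wp ?_
    simp only [List.length_cons]
    exact ⟨rfl, by omega⟩
  | case2 l l' hne =>
    refine det_call_of_wp HasSolve.halve ?_
    rcases l with _ | ⟨x, l⟩
    · simp only [Code.halve, wp_rules, apply_rules, enc_pair, enc_cons, enc_nil, enc_true, enc_false]
      exact ⟨trivial, by omega⟩
    · rcases l' with _ | ⟨y, _ | ⟨z, l'⟩⟩
      · simp only [Code.halve, wp_rules, apply_rules, enc_pair, enc_cons, enc_nil, enc_true, enc_false]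
        exact ⟨trivial, by omega⟩
      · simp only [Code.halve, wp_rules, apply_rules, enc_pair, enc_cons, enc_nil, enc_true, enc_false]
        exact ⟨trivial, by omega⟩
      · exact (hne x l y z l' rfl rfl).elim

theorem det_status (F : List (Bool × κ × κ)) :
    Det P (.call 15) (.pair (enc fun _ : κ => false) (enc F))
      (enc (F.foldl statusStep fun _ => [])) (2 * unitCost κ * (F.length + 1)) := by
  rw [← enc_empty (κ := κ) Bool]
  have hu := le_unitCost κ
  refine Det.foldl HasSolve.status (s := unitCost κ + 60) F (fun a x _ => ?_) _ (by omega)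
  obtain ⟨b, e, f⟩ := x
  simp only [Code.statusStep, wp_rules, apply_rules, enc_pair, enc_cons, enc_nil, enc_true, enc_false]
  refine (Det.set a f [b]).wp ?_
  exact ⟨rfl, by omega⟩

omit [DecidableEq κ] in
theorem det_keep (l : List (Edge κ)) :
    Det P (.call 16) (.pair .nil (enc l)) (enc (l.foldl keepStep [])) (60 * (l.length + 1)) := by
  refine Det.foldl (f := keepStep) HasSolve.keep (s := 40) l (fun a x _ => ?_) [] (by omega)
  obtain ⟨b, e, x, y⟩ := x
  cases b <;> simp only [Code.keepStep, wp_rules, apply_rules, enc_pair, enc_cons, enc_nil, enc_true, enc_false]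
  · exact ⟨rfl, by omega⟩
  · exact ⟨rfl, by omega⟩

omit [DecidableEq κ] in
theorem det_next (st : κ → List Bool) (acc l : List (Edge κ)) :
    Det P (.call 17) (.pair (.pair (enc st) (enc acc)) (enc l)) (enc (l.foldl nextStep (st, acc)))
      (2 * unitCost κ * (l.length + 1)) := by
  have hu := le_unitCost κ
  refine Det.foldl (f := nextStep) HasSolve.next (s := unitCost κ + 150) l (fun a x _ => ?_)
    (st, acc) (by omega)
  obtain ⟨fl, e, x, y⟩ := x
  obtain ⟨st, acc⟩ := a
  simp only [Code.nextStep, wp_rules, apply_rules, enc_pair, enc_cons, enc_nil, enc_true, enc_false]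
  refine (Det.get st e).wp ?_
  rcases h : st e with _ | ⟨b, bs⟩
  · simp only [wp_rules, apply_rules, enc_pair, enc_cons, enc_nil, enc_true, enc_false]
    exact ⟨by simp [nextStep, h], by omega⟩
  · cases b <;> simp only [wp_rules, apply_rules, enc_pair, enc_cons, enc_nil, enc_true, enc_false]
    · exact ⟨by simp [nextStep, h], by omega⟩
    · exact ⟨by simp [nextStep, h], by omega⟩

omit [DecidableEq κ] in
theorem det_solve_nil (tree : List (Edge κ)) :
    Det P (.call 18) (.pair (.pair (enc fun _ : κ => false) (enc (id : κ → κ)))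
      (.pair (enc tree) .nil)) .nil 20 := by
  refine det_call_of_wp HasSolve.solve ?_
  simp only [Code.solve, wp_rules, apply_rules, enc_pair, enc_cons, enc_nil, enc_true, enc_false]
  exact ⟨trivial, by omega⟩

theorem det_solve_single (tree : List (Edge κ)) (t : Edge κ) :
    Det P (.call 18) (.pair (.pair (enc fun _ : κ => false) (enc (id : κ → κ)))
      (.pair (enc tree) (enc [t]))) (enc (solveLast (shrink t.2.2.2 tree [t])))
      (1000 * (unitCost κ * (tree.length + 2))) := by
  have hu := le_unitCost κ
  have hZ : 1000 * (tree.length + 2) ≤ unitCost κ * (tree.length + 2) := Nat.mul_le_mul_right _ hu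
  obtain ⟨b, e, v, p⟩ := t
  refine det_call_of_wp HasSolve.solve ?_
  simp only [Code.solve, wp_rules, apply_rules, enc_pair, enc_cons, enc_nil, enc_true, enc_false]
  refine (det_shrink p tree [(b, e, v, p)] (n := tree.length + 1) (by simp) (by simp)).wp ?_
  have hs := length_shrink_le p tree [(b, e, v, p)]
  have hs' := length_shrink_ops p tree [(b, e, v, p)]
  obtain ⟨B, os, hS⟩ : ∃ B os, shrink p tree [(b, e, v, p)] = (B, os) := ⟨_, _, rfl⟩
  rw [hS] at hs hs' ⊢
  rcases os with _ | ⟨⟨b', e', v', p'⟩, _ | ⟨o, os⟩⟩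
  · simp at hs'
  · simp only [wp_rules, apply_rules, enc_pair, enc_cons, enc_nil, enc_true, enc_false]
    refine (det_findEdge v' e' B).wp ?_
    simp only [wp_rules, apply_rules, enc_pair, enc_cons, enc_nil, enc_true, enc_false, List.length_cons, List.length_nil] at hs ⊢
    have e : unitCost κ * (tree.length + 1 + 1) = unitCost κ * (tree.length + 2) := rfl
    exact ⟨rfl, by omega⟩
  · simp at hs'

/-- Before the list of length `k` is divided, the tree is shrunk to at most `4 * k` edges; the tree
for the second half has at most `5 * k`. So the trees that go to the next level have at most `9 * k`
edges together, and the constant `12` leaves `3 * k` units for the work of this level. The original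
tree is read only at the top. -/
theorem det_solve (d : ℕ) (tree ops : List (Edge κ)) (hd : ops.length ≤ 2 ^ d) :
    Det P (.call 18) (.pair (.pair (enc fun _ : κ => false) (enc (id : κ → κ)))
      (.pair (enc tree) (enc ops))) (enc (solve d tree ops))
      (1000 * (unitCost κ * (tree.length + 12 * (ops.length * (d + 1)) + 1))) := by
  have hu := le_unitCost κ
  have hZ : ∀ n, 1000 * n ≤ unitCost κ * n := fun n => Nat.mul_le_mul_right _ hu
  have key : ∀ {c l a n : ℕ}, l + 1 ≤ a * n →
      c * unitCost κ * (l + 1) ≤ c * a * (unitCost κ * n) := fun {c l a n} h => by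
    rw [mul_assoc, mul_assoc]
    refine Nat.mul_le_mul_left c ?_
    rw [mul_left_comm]
    exact Nat.mul_le_mul_left _ h
  induction d generalizing tree ops with
  | zero =>
    rcases ops with _ | ⟨⟨b, e, v, p⟩, _ | ⟨o, ops⟩⟩
    · exact (det_solve_nil tree).mono (by
        have := hZ (tree.length + 12 * (([] : List (Edge κ)).length * (0 + 1)) + 1); omega)
    · refine (det_solve_single tree _).mono ?_
      refine Nat.mul_le_mul_left _ (Nat.mul_le_mul_left _ ?_)
      simp
    · simp at hd
  | succ d ih =>
    rcases ops with _ | ⟨⟨b, e, v, p⟩, _ | ⟨o, ops⟩⟩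
    · rw [solve]
      refine (det_solve_nil tree).mono ?_
      have := hZ (tree.length + 12 * (([] : List (Edge κ)).length * (d + 1 + 1)) + 1)
      omega
    · refine (det_solve_single tree _).mono ?_
      refine Nat.mul_le_mul_left _ (Nat.mul_le_mul_left _ ?_)
      simp only [List.length_cons, List.length_nil]
      omega
    refine det_call_of_wp HasSolve.solve ?_
    simp only [Code.solve, wp_rules, apply_rules, enc_pair, enc_cons, enc_nil, enc_true, enc_false]
    refine (det_shrink p tree ((b, e, v, p) :: o :: ops)
      (n := tree.length + (ops.length + 2)) (by simp) (by simp)).wp ?_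
    have hs := length_shrink_le p tree ((b, e, v, p) :: o :: ops)
    have hs' := length_shrink_ops p tree ((b, e, v, p) :: o :: ops)
    obtain ⟨B, os, hS⟩ : ∃ B os, shrink p tree ((b, e, v, p) :: o :: ops) = (B, os) := ⟨_, _, rfl⟩
    rw [solve, hS]
    rw [hS] at hs hs'
    simp only [wp_rules, apply_rules, enc_pair, enc_cons, enc_nil, enc_true, enc_false, List.length_cons] at hs hs' ⊢
    refine (det_halve os os).wp ?_
    obtain ⟨hh1, hh2⟩ := length_halve_self os
    obtain ⟨o1, o2, hH⟩ : ∃ o1 o2, halve os os = (o1, o2) := ⟨_, _, rfl⟩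
    rw [hH] at hh1 hh2 ⊢
    simp only [List.length_cons] at hd hh1 hh2
    rw [pow_succ] at hd
    simp only [wp_rules, apply_rules, enc_pair, enc_cons, enc_nil, enc_true, enc_false]
    refine (ih B o1 (by omega)).wp ?_
    have hF := length_solve_le d B o1
    set F := solve d B o1
    have hN := length_nextTree_le B F o1
    refine (det_status F).wp ?_
    refine (det_keep o1).wp ?_
    refine (det_next _ _ B).wp ?_
    refine (ih (nextTree B F o1) o2 (by omega)).wp ?_
    refine (Det.revAppend F []).wp ?_
    rw [List.append_nil]
    refine (Det.revAppend (P := P) F.reverse _).wp ?_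
    rw [List.reverse_reverse]
    refine ⟨rfl, ?_⟩
    rw [List.length_reverse]
    set u := unitCost κ
    have e1 : o1.length + o2.length = ops.length + 2 := by omega
    generalize hm : ops.length = m at *
    have g1 : u * B.length ≤ u * (4 * (m + 2)) := Nat.mul_le_mul_left _ hs
    have g2 : u * (nextTree B F o1).length ≤ u * (5 * (m + 2)) :=
      Nat.mul_le_mul_left _ (by omega)
    have g3 : u * F.length ≤ u * (m + 2) := Nat.mul_le_mul_left _ (by omega)
    have g4 : u * (o1.length * (d + 1)) + u * (o2.length * (d + 1)) = u * ((m + 2) * (d + 1)) := by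
      rw [← mul_add, ← add_mul, e1]
    have g5 := hZ (m + 2)
    have g6 := hZ 1
    have g7 : 0 ≤ u * tree.length := Nat.zero_le _
    have g8 : 0 ≤ u * m := Nat.zero_le _
    have g9 : F.length ≤ m + 2 := by omega
    have g10 : o1.length ≤ m + 2 := by omega
    have g11 : os.length = m + 2 := by omega
    nlinarith

end Solve

/-! ### Random procedures with typed values -/

section RandomTyped

variable {P : Program} {β γ : Type*}

/-- A continuation of an execution is indexed by machine values. Injectivity of the encoding `h`
allows indexing it by the abstract data instead, via `Function.invFun h`. -/
theorem Rnd.map_det {f g : Code (P.last + 1)} {v : Val} {m : PMF β} {h h' : β → Val} {s t : ℕ}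
    (hh : Function.Injective h) (hg : Rnd P g v (m.map h) t)
    (hf : ∀ b ∈ m.support, Det P f (h b) (h' b) s) :
    Rnd P (.comp f g) v (m.map h') (t + s + 1) := by
  classical
  rcases isEmpty_or_nonempty β with hβ | hβ
  · obtain ⟨b, -⟩ := m.support_nonempty
    exact hβ.elim b
  have := Rnd.comp (k := fun x => PMF.pure (h' (Function.invFun h x))) hg (t := s) (by
    intro x hx
    rw [PMF.support_map] at hx
    obtain ⟨b, hb, rfl⟩ := hx
    rw [Function.leftInverse_invFun hh b]
    exact (hf b hb).rnd)
  rw [PMF.bind_map] at this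
  convert this using 1
  rw [← PMF.bind_pure_comp]
  congr 1
  funext b
  simp [Function.leftInverse_invFun hh b]

theorem Rnd.bind {f g : Code (P.last + 1)} {v : Val} {m : PMF β} {h : β → Val} {h' : γ → Val}
    {k : β → PMF γ} {s t : ℕ} (hh : Function.Injective h) (hg : Rnd P g v (m.map h) t)
    (hf : ∀ b ∈ m.support, Rnd P f (h b) ((k b).map h') s) :
    Rnd P (.comp f g) v ((m.bind k).map h') (t + s + 1) := by
  classical
  rcases isEmpty_or_nonempty β with hβ | hβ
  · obtain ⟨b, -⟩ := m.support_nonempty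
    exact hβ.elim b
  have := Rnd.comp (k := fun x => (k (Function.invFun h x)).map h') hg (t := s) (by
    intro x hx
    rw [PMF.support_map] at hx
    obtain ⟨b, hb, rfl⟩ := hx
    rw [Function.leftInverse_invFun hh b]
    exact hf b hb)
  rw [PMF.bind_map] at this
  convert this using 1
  rw [PMF.map_bind]
  congr 1
  funext b
  simp [Function.leftInverse_invFun hh b]

theorem Rnd.pair_det {f g : Code (P.last + 1)} {v x : Val} {m : PMF β} {h : β → Val} {s t : ℕ}
    (hf : Det P f v x s) (hg : Rnd P g v (m.map h) t) :
    Rnd P (.pair f g) v (m.map fun b => .pair x (h b)) (s + t + 1) := by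
  have := hf.rnd.pair hg
  rwa [PMF.pure_bind, PMF.map_comp] at this

theorem Rnd.det_pair {f g : Code (P.last + 1)} {v x : Val} {m : PMF β} {h : β → Val} {s t : ℕ}
    (hf : Rnd P f v (m.map h) s) (hg : Det P g v x t) :
    Rnd P (.pair f g) v (m.map fun b => .pair (h b) x) (s + t + 1) := by
  have := hf.pair hg.rnd
  simp only [PMF.pure_map, PMF.bind_map] at this
  exact this

theorem Rnd.after_det {f g : Code (P.last + 1)} {v x : Val} {m : PMF Val} {s t : ℕ}
    (hg : Det P g v x s) (hf : Rnd P f x m t) : Rnd P (.comp f g) v m (s + t + 1) := by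
  have := hg.rnd.comp (k := fun _ => m) (t := t) (by
    intro y hy
    rw [PMF.support_pure, Set.mem_singleton_iff] at hy
    subst hy
    exact hf)
  rwa [PMF.pure_bind] at this

end RandomTyped

/-! ### Injectivity of the encodings -/

section Injectivity

theorem enc_bool_injective : Function.Injective (enc : Bool → Val) := by
  intro a b h
  cases a <;> cases b <;> simp_all

theorem enc_key_injective {κ : Type*} [Keys κ] : Function.Injective (enc : κ → Val) := by
  intro a b h
  rw [enc_key, enc_key, Val.num.injEq] at h
  exact Keys.num_injective h

theorem enc_pair_injective {α β : Type*} [Enc α] [Enc β]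
    (hα : Function.Injective (enc : α → Val)) (hβ : Function.Injective (enc : β → Val)) :
    Function.Injective (enc : α × β → Val) := by
  rintro ⟨a, b⟩ ⟨a', b'⟩ h
  rw [enc_pair, enc_pair, Val.pair.injEq] at h
  rw [hα h.1, hβ h.2]

theorem enc_list_injective {α : Type*} [Enc α] (hα : Function.Injective (enc : α → Val)) :
    Function.Injective (enc : List α → Val) := by
  intro l
  induction l with
  | nil =>
    intro l' h
    cases l' with
    | nil => rfl
    | cons a l' => simp at h
  | cons a l ih =>
    intro l' h
    cases l' with
    | nil => simp at h
    | cons a' l' =>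
      rw [enc_cons, enc_cons, Val.pair.injEq] at h
      rw [hα h.1, ih h.2]

end Injectivity

/-! ### Merging two trees -/

namespace Code
variable {k : ℕ}

def flipFlags : Code (k + 1) :=
  .ite .τ1 (.pair (.pair (.comp .flip .π0) (.comp .τ1 .π1)) (.on 19 (.pair .π0 .τ2))) .nil

def keptEdge : Code (k + 1) := .ite .π1 .π2 .τ3

/-- The argument is `((empty, id), ((a, b), (X, Y)))`. -/
def mergeTrees : Code (k + 1) :=
  .ite .π2
    (.on 20 (.pair .nil (.on 18 (.pair .π0 (.pair .τ3 (.on 19 (.pair .π1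
      (.on 7 (.pair (.comp .π0 .π0) (.pair .π2 (.comp .π2 (.comp .π0 .π2))))))))))))
    .nil

end Code

class HasMerge (P : Program) : Prop extends HasSolve P where
  flipFlags : P.body 19 = .flipFlags
  kept : P.body 20 = .mapList 20 .keptEdge
  merge : P.body 21 = .mergeTrees

section Merge

variable {κ : Type*} [Keys κ] [DecidableEq κ] {P : Program} [HasMerge P]

omit [HasMerge P] in
theorem det_op (o : Op) (v : Val) : Det P (.op o) v (o.apply v) 1 := ⟨1, le_rfl, .op o v⟩

omit [DecidableEq κ] in
theorem rnd_flipFlags (a b : ℝ≥0) (l : List (Edge κ)) :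
    Rnd P (.call 19) (.pair (.pair (.wt a) (.wt b)) (enc l)) ((flipFlags a b l).map enc)
      (60 * (l.length + 1)) := by
  induction l with
  | nil =>
    rw [flipFlags, PMF.pure_map]
    refine Det.rnd (det_call_of_wp HasMerge.flipFlags ?_)
    simp only [Code.flipFlags, wp_ite, wp_op, apply_snd, enc_nil, isNil_nil, cond_true]
    exact ⟨by trivial, by simp⟩
  | cons t l ih =>
    obtain ⟨fl, t⟩ := t
    have e1 : ∀ v, Det P Code.π0 v (Op.fst.apply v) 1 := det_op _
    have h1 : Rnd P (Code.comp .flip .π0)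
        (.pair (.pair (.wt a) (.wt b)) (enc ((fl, t) :: l))) ((coin a b).map enc) 3 :=
      Rnd.after_det (det_op _ _) (Rnd.flip rfl)
    have h2 : Det P (Code.comp .τ1 .π1) (.pair (.pair (.wt a) (.wt b)) (enc ((fl, t) :: l)))
        (enc t) 6 := WP.det (by
      simp only [wp_rules, apply_rules, enc_pair, enc_cons, enc_nil, enc_true, enc_false]
      exact ⟨by trivial, by omega⟩)
    have h3 : Rnd P (Code.on 19 (.pair .π0 .τ2))
        (.pair (.pair (.wt a) (.wt b)) (enc ((fl, t) :: l))) ((flipFlags a b l).map enc)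
        (60 * (l.length + 1) + 10) :=
      Rnd.mono (Rnd.after_det (Det.pair (det_op _ _) (Det.comp (det_op _ _) (det_op _ _))) ih)
        (by omega)
    have h4 := (h1.det_pair h2).pair h3
    have h5 := Rnd.call (HasMerge.flipFlags (P := P)) (Rnd.ite (g := .nil)
      (det_op .snd (.pair (.pair (.wt a) (.wt b)) (enc ((fl, t) :: l)))) h4)
    refine Rnd.mono (s := 1 + (3 + 6 + 1 + (60 * (l.length + 1) + 10) + 1) + 1 + 1) ?_ (by
      simp only [List.length_cons]
      omega)
    convert h5 using 1
    rw [flipFlags, PMF.map_bind, PMF.bind_map]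
    congr 1
    funext c
    simp only [Function.comp_apply, PMF.map_comp]
    rfl

omit [DecidableEq κ] [Keys κ] in
theorem length_of_mem_flipFlags {a b : ℝ≥0} {l l' : List (Edge κ)}
    (h : l' ∈ (flipFlags a b l).support) : l'.length = l.length := by
  induction l generalizing l' with
  | nil =>
    rw [flipFlags, PMF.support_pure, Set.mem_singleton_iff] at h
    rw [h]
  | cons t l ih =>
    rw [flipFlags, PMF.mem_support_bind_iff] at h
    obtain ⟨c, -, h⟩ := h
    rw [PMF.support_map] at h
    obtain ⟨l', h, rfl⟩ := h
    rw [List.length_cons, List.length_cons, ih h]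

omit [DecidableEq κ] in
theorem det_kept (F : List (Bool × κ × κ)) :
    Det P (.call 20) (.pair .nil (enc F)) (enc (F.map keptEdge)) (50 * (F.length + 1)) := by
  refine Det.map (f := fun _ : Bool => keptEdge) HasMerge.kept (s := 30) false F
    (fun x _ => ?_) (by omega)
  obtain ⟨b, e, f⟩ := x
  cases b <;> simp only [Code.keptEdge, wp_rules, apply_rules, enc_pair, enc_cons, enc_nil, enc_true, enc_false] <;> exact ⟨by trivial, by omega⟩

/-- The list of edges to be treated is the output of a search in `X`; for the cost only the crude
bound `4 * n + 1` of its length is used, whence the condition on `d`. -/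
theorem rnd_mergeTrees (d : ℕ) (a b : ℝ≥0) (X Y : List (Edge κ)) {n : ℕ} (hX : X.length ≤ n)
    (hY : Y.length ≤ n) (hd : 4 * n + 1 ≤ 2 ^ d) :
    Rnd P (.call 21) (.pair (.pair (enc fun _ : κ => false) (enc (id : κ → κ)))
      (.pair (.pair (.wt a) (.wt b)) (.pair (enc X) (enc Y))))
      ((mergeTrees d a b X Y).map enc) (100000 * (unitCost κ * ((n + 1) * (d + 1)))) := by
  have hu := le_unitCost κ
  have hZ : 1000 * ((n + 1) * (d + 1)) ≤ unitCost κ * ((n + 1) * (d + 1)) :=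
    Nat.mul_le_mul_right _ hu
  have hZ' : n + 1 ≤ (n + 1) * (d + 1) := Nat.le_mul_of_pos_right _ (by omega)
  rcases X with _ | ⟨⟨fl, e, x, y⟩, X⟩
  · rw [mergeTrees, PMF.pure_map]
    refine Det.rnd (det_call_of_wp HasMerge.merge ?_)
    simp only [Code.mergeTrees, wp_rules, apply_rules, enc_pair, enc_cons, enc_nil, enc_true, enc_false]
    exact ⟨by trivial, by omega⟩
  rw [mergeTrees]
  set S := search ((fl, e, x, y) :: X) x with hS
  have hSl := length_search_le ((fl, e, x, y) :: X) x
  rw [← hS] at hSl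
  set v : Val := .pair (.pair (enc fun _ : κ => false) (enc (id : κ → κ)))
      (.pair (.pair (.wt a) (.wt b)) (.pair (enc ((fl, e, x, y) :: X)) (enc Y)))
  have h1 : Det P (Code.pair .π1 (.on 7 (.pair (.comp .π0 .π0) (.pair .π2 (.comp .π2 (.comp .π0 .π2)))))) v
      (.pair (.pair (.wt a) (.wt b)) (enc S))
      (32 * unitCost κ * (((fl, e, x, y) :: X).length + 1) + 100) := WP.det (by
    simp only [wp_rules, apply_rules, enc_pair, enc_cons, enc_nil, enc_true, enc_false, v]
    refine (det_search (P := P) ((fl, e, x, y) :: X) x).wp ?_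
    exact ⟨by trivial, by omega⟩)
  have h2 := Rnd.after_det h1 (rnd_flipFlags a b S)
  have h3 : Det P Code.τ3 v (enc Y) 10 := WP.det (by
    simp only [wp_rules, apply_rules, enc_pair, enc_cons, enc_nil, enc_true, enc_false, v]
    exact ⟨by trivial, by omega⟩)
  have h4 : Det P Code.π0 v (.pair (enc fun _ : κ => false) (enc (id : κ → κ))) 10 := WP.det (by
    simp only [wp_rules, apply_rules, enc_pair, enc_cons, enc_nil, enc_true, enc_false, v]
    exact ⟨by trivial, by omega⟩)
  have h5 := h4.rnd
  have inj : Function.Injective (enc : List (Edge κ) → Val) :=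
    enc_list_injective (enc_pair_injective enc_bool_injective (enc_pair_injective
      enc_key_injective (enc_pair_injective enc_key_injective enc_key_injective)))
  have h6 := Rnd.map_det (h' := fun ops => enc (solve d Y ops)) (f := .call 18)
    (s := 1000 * (unitCost κ * (Y.length + 12 * (S.length * (d + 1)) + 1)))
    (fun l l' h => by
      simp only [Val.pair.injEq, true_and] at h
      exact inj h) (Rnd.pair_det h4 (Rnd.pair_det h3 h2)) (by
    intro ops hops
    have hl := length_of_mem_flipFlags hops
    have := det_solve (P := P) d Y ops (by rw [hl]; omega)
    rwa [hl] at this)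
  have inj' : Function.Injective (enc : List (Bool × κ × κ) → Val) :=
    enc_list_injective (enc_pair_injective enc_bool_injective
      (enc_pair_injective enc_key_injective enc_key_injective))
  have e7 : (flipFlags a b S).map (fun ops => enc (solve d Y ops)) =
      ((flipFlags a b S).map (solve d Y)).map enc := by
    rw [PMF.map_comp]; rfl
  rw [e7] at h6
  have h8 : Det P Code.nil v .nil 1 := det_op _ _
  have h9 := Rnd.map_det (h' := fun F => enc (F.map keptEdge)) (f := .call 20)
    (s := 50 * (S.length + 1))
    (fun l l' h => by
      simp only [Val.pair.injEq, true_and] at h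
      exact inj' h) (Rnd.pair_det h8 h6) (by
    intro F hF
    rw [PMF.support_map] at hF
    obtain ⟨ops, hops, rfl⟩ := hF
    refine (det_kept _).mono ?_
    have h1 := length_solve_le d Y ops
    have h2 := length_of_mem_flipFlags hops
    omega)
  have h10 : Det P Code.π2 v (enc ((fl, e, x, y) :: X)) 10 := WP.det (by
    simp only [wp_rules, apply_rules, enc_pair, enc_cons, enc_nil, enc_true, enc_false, v]
    exact ⟨by trivial, by omega⟩)
  have h11 := Rnd.call (HasMerge.merge (P := P)) (Rnd.ite (g := .nil) h10 h9)
  have e12 : ((flipFlags a b S).map fun ops => (solve d Y ops).map keptEdge).map enc =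
      ((flipFlags a b S).map (solve d Y)).map fun F => enc (F.map keptEdge) := by
    rw [PMF.map_comp, PMF.map_comp]; rfl
  rw [e12]
  refine h11.mono ?_
  generalize unitCost κ = u at *
  generalize ((fl, e, x, y) :: X).length = p at *
  generalize S.length = q at *
  generalize Y.length = r at *
  have g1 : u * p ≤ u * n := Nat.mul_le_mul_left _ hX
  have g2 : u * r ≤ u * n := Nat.mul_le_mul_left _ hY
  have g3 : u * (q * (d + 1)) ≤ u * ((4 * n + 1) * (d + 1)) :=
    Nat.mul_le_mul_left _ (Nat.mul_le_mul_right _ (by omega))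
  have g4 : u * (n + 1) ≤ u * ((n + 1) * (d + 1)) := Nat.mul_le_mul_left _ hZ'
  have g5 : q ≤ 4 * n + 1 := by omega
  nlinarith

end Merge

/-! ### Lists of exchanges -/

section Exchanges

variable {κ : Type*} [DecidableEq κ]

omit [DecidableEq κ] in
/-- The number of exchanges plus their total size. -/
def exSize (ex : List (Exch κ)) : ℕ := (ex.map fun p => p.1.length + p.2.length + 1).sum

omit [DecidableEq κ] in
@[simp] theorem exSize_nil : exSize ([] : List (Exch κ)) = 0 := rfl

omit [DecidableEq κ] in
@[simp] theorem exSize_cons (p : Exch κ) (ex : List (Exch κ)) :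
    exSize (p :: ex) = p.1.length + p.2.length + 1 + exSize ex := rfl

omit [DecidableEq κ] in
@[simp] theorem exSize_append (ex ex' : List (Exch κ)) :
    exSize (ex ++ ex') = exSize ex + exSize ex' := by
  simp [exSize]

omit [DecidableEq κ] in
theorem length_le_exSize (ex : List (Exch κ)) : ex.length ≤ exSize ex := by
  induction ex with
  | nil => simp
  | cons p ex ih => simp; omega

omit [DecidableEq κ] in
theorem exSize_relabel (φ : κ → κ) (ex : List (Exch κ)) :
    exSize (ex.map (relabelExch φ)) = exSize ex := by
  simp [exSize, Function.comp_def, relabelExch, relabel]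

theorem foldl_count {α : Type*} (k : ℕ) (l : List α) (n : ℕ) :
    l.foldl (fun n _ => n + k) n = n + k * l.length := by
  induction l generalizing n with
  | nil => rfl
  | cons x l ih =>
    rw [List.foldl_cons, ih, List.length_cons]
    ring

omit [DecidableEq κ] in
theorem removedCount_eq (ex : List (Exch κ)) :
    removedCount ex = (ex.map fun p => p.1.length).sum := by
  suffices ∀ n, ex.foldl (fun n p => p.1.foldl (fun n _ => n + 1) n) n =
      n + (ex.map fun p => p.1.length).sum by
    rw [removedCount, this, zero_add]
  induction ex with
  | nil => simp
  | cons p ex ih =>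
    intro n
    rw [List.foldl_cons, ih, foldl_count, List.map_cons, List.sum_cons]
    omega

omit [DecidableEq κ] in
theorem removedCount_le_exSize (ex : List (Exch κ)) : removedCount ex ≤ exSize ex := by
  rw [removedCount_eq]
  induction ex with
  | nil => simp
  | cons p ex ih => simp; omega

omit [DecidableEq κ] in
theorem removedCount_relabel (φ : κ → κ) (ex : List (Exch κ)) :
    removedCount (ex.map (relabelExch φ)) = removedCount ex := by
  simp [removedCount_eq, Function.comp_def, relabelExch, relabel]

theorem setEdges_iff (b : Bool) (U : κ → Bool) (l : List (Edge κ)) (e : κ) :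
    setEdges b U l e = true ↔ if e ∈ edgeIds l then b = true else U e = true := by
  suffices ∀ U, (l.foldl setStep (b, U)).2 e = true ↔
      if e ∈ edgeIds l then b = true else U e = true from this U
  induction l with
  | nil => simp [edgeIds]
  | cons t l ih =>
    intro U
    obtain ⟨fl, e', x, y⟩ := t
    rw [List.foldl_cons, setStep, ih]
    by_cases h : e ∈ edgeIds l
    · have : e ∈ edgeIds ((fl, e', x, y) :: l) := List.mem_cons_of_mem _ h
      rw [if_pos h, if_pos this]
    · rw [if_neg h, Function.update_apply]
      by_cases h' : e = e'
      · subst h'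
        rw [if_pos rfl, if_pos (by simp [edgeIds])]
      · rw [if_neg h', if_neg]
        simp only [edgeIds, List.map_cons, List.mem_cons, not_or]
        exact ⟨h', h⟩

theorem foldl_markExch_iff (U : κ → Bool) (ex : List (Exch κ)) (e : κ) :
    ex.foldl markExch U e = true ↔
      U e = true ∨ ∃ p ∈ ex, e ∈ edgeIds p.1 ∨ e ∈ edgeIds p.2 := by
  induction ex generalizing U with
  | nil => simp
  | cons p ex ih =>
    rw [List.foldl_cons, ih, markExch, setEdges_iff, setEdges_iff]
    simp only [List.mem_cons, exists_eq_or_imp]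
    split_ifs <;> simp_all

theorem markIds_iff (l : List κ) (e : κ) : markIds l e = true ↔ e ∈ l := by
  suffices ∀ U : κ → Bool, l.foldl (fun U e => Function.update U e true) U e = true ↔
      U e = true ∨ e ∈ l by
    simpa [markIds] using this fun _ => false
  induction l with
  | nil => simp
  | cons e' l ih =>
    intro U
    rw [List.foldl_cons, ih, Function.update_apply, List.mem_cons]
    split_ifs with h <;> simp [h]

theorem foldl_gatherStep (l : List (Edge κ)) (U : κ → Bool) (acc : List (Edge κ)) :
    ∃ g, (l.foldl gatherStep (U, acc)).2 = g ++ acc ∧ (edgeIds g).Nodup ∧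
      (∀ e, e ∈ edgeIds g ↔ U e = true ∧ e ∈ edgeIds l) ∧
      ∀ t ∈ g, t.1 = false ∧ ∃ t' ∈ l, t'.2 = t.2 := by
  induction l generalizing U acc with
  | nil => exact ⟨[], rfl, by simp [edgeIds], by simp [edgeIds], by simp⟩
  | cons t l ih =>
    obtain ⟨fl, e, x, y⟩ := t
    rw [List.foldl_cons, gatherStep]
    split_ifs with h
    · obtain ⟨g, h1, h2, h3, h4⟩ := ih (Function.update U e false) ((false, e, x, y) :: acc)
      refine ⟨g ++ [(false, e, x, y)], by rw [h1]; simp, ?_, fun f => ?_, fun t ht => ?_⟩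
      · rw [edgeIds, List.map_append, List.nodup_append]
        refine ⟨h2, by simp, ?_⟩
        intro a ha b hb
        rintro rfl
        simp only [List.map_cons, List.map_nil, List.mem_singleton] at hb
        subst hb
        simpa using (h3 a).1 ha
      · have := h3 f
        simp only [edgeIds, List.map_append, List.mem_append, List.map_cons, List.map_nil,
          List.mem_singleton, List.mem_cons] at this ⊢
        rw [this, Function.update_apply]
        split_ifs with hf
        · simp [hf, h]
        · simp [hf]
      · rcases List.mem_append.1 ht with ht | ht
        · obtain ⟨ha, t', ht', hb⟩ := h4 t ht
          exact ⟨ha, t', List.mem_cons_of_mem _ ht', hb⟩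
        · rw [List.mem_singleton] at ht
          subst ht
          exact ⟨rfl, _, List.mem_cons_self, rfl⟩
    · obtain ⟨g, h1, h2, h3, h4⟩ := ih U acc
      refine ⟨g, h1, h2, fun f => ?_, fun t ht => ?_⟩
      · rw [h3, edgeIds, edgeIds, List.map_cons, List.mem_cons]
        constructor
        · exact fun hf => ⟨hf.1, Or.inr hf.2⟩
        · rintro ⟨hf, rfl | hf'⟩
          · exact (h hf).elim
          · exact ⟨hf, hf'⟩
      · obtain ⟨ha, t', ht', hb⟩ := h4 t ht
        exact ⟨ha, t', List.mem_cons_of_mem _ ht', hb⟩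

theorem nodup_gather (U : κ → Bool) (l : List (Edge κ)) : (edgeIds (gather U l)).Nodup := by
  obtain ⟨g, h1, h2, -, -⟩ := foldl_gatherStep l U []
  rw [gather, h1, List.append_nil]
  exact h2

theorem mem_gather_ids {U : κ → Bool} {l : List (Edge κ)} {e : κ} :
    e ∈ edgeIds (gather U l) ↔ U e = true ∧ e ∈ edgeIds l := by
  obtain ⟨g, h1, -, h3, -⟩ := foldl_gatherStep l U []
  rw [gather, h1, List.append_nil]
  exact h3 e

theorem of_mem_gather {U : κ → Bool} {l : List (Edge κ)} {t : Edge κ} (ht : t ∈ gather U l) :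
    t.1 = false ∧ ∃ t' ∈ l, t'.2 = t.2 := by
  obtain ⟨g, h1, -, -, h4⟩ := foldl_gatherStep l U []
  rw [gather, h1, List.append_nil] at ht
  exact h4 t ht

theorem length_gather_le (U : κ → Bool) (l : List (Edge κ)) : (gather U l).length ≤ l.length := by
  have h := (nodup_gather U l).subperm (l₂ := edgeIds l) fun e he => (mem_gather_ids.1 he).2
  simpa [edgeIds] using h.length_le

/-- The collected edges have distinct identifiers, all of which occur in an exchange. This makes the
size of the recursive calls independent of the size of the original tree. -/
theorem length_gather_mark_le (ex : List (Exch κ)) (l : List (Edge κ)) :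
    (gather (ex.foldl markExch fun _ => false) l).length ≤ exSize ex := by
  have h := (nodup_gather (ex.foldl markExch fun _ => false) l).subperm
    (l₂ := ex.flatMap fun p => edgeIds p.1 ++ edgeIds p.2) (fun e he => by
      obtain ⟨h, -⟩ := mem_gather_ids.1 he
      rw [foldl_markExch_iff] at h
      simpa using h)
  have h1 := h.length_le
  have h2 : (ex.flatMap fun p => edgeIds p.1 ++ edgeIds p.2).length ≤ exSize ex := by
    clear h h1
    induction ex with
    | nil => simp
    | cons p ex ih =>
      simp only [List.flatMap_cons, List.length_append, edgeIds, List.length_map,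
        exSize_cons] at ih ⊢
      omega
  rw [edgeIds, List.length_map] at h1
  omega

omit [DecidableEq κ] in
theorem mem_foldl_addedEdges {ex : List (Exch κ)} {acc : List (Edge κ)} {t : Edge κ} :
    t ∈ ex.foldl addedEdges acc ↔ t ∈ acc ∨ ∃ p ∈ ex, t ∈ p.2 := by
  induction ex generalizing acc with
  | nil => simp
  | cons p ex ih =>
    rw [List.foldl_cons, ih, addedEdges]
    simp
    tauto

omit [DecidableEq κ] in
theorem length_foldl_addedEdges (ex : List (Exch κ)) (acc : List (Edge κ)) :
    (ex.foldl addedEdges acc).length ≤ acc.length + exSize ex := by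
  induction ex generalizing acc with
  | nil => simp
  | cons p ex ih =>
    refine (ih _).trans ?_
    simp [addedEdges]
    omega

omit [DecidableEq κ] in
/-- The result of `splitExch`. -/
theorem splitExch_spec (r c : ℕ) (ex : List (Exch κ)) (δ : List ℝ≥0) (hex : ex ≠ [])
    (hδ : ex.length ≤ δ.length) (hc : c ≤ r) :
    let s := splitExch r c ex δ
    ex = s.1 ++ s.2.1 :: s.2.2.1 ∧ δ = s.2.2.2.1 ++ s.2.2.2.2 ∧
      s.2.2.2.1.length = s.1.length + 1 ∧ c + 2 * removedCount s.1 ≤ r ∧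
      (s.2.2.1 = [] ∨ r < c + 2 * (removedCount s.1 + s.2.1.1.length)) := by
  induction ex generalizing c δ with
  | nil => exact (hex rfl).elim
  | cons p ex ih =>
    rcases δ with _ | ⟨a, δ⟩
    · simp at hδ
    rcases ex with _ | ⟨q, ex⟩
    · simp [splitExch, removedCount, hc]
    · rw [splitExch]
      split_ifs with h
      · rw [foldl_count] at h
        simp [removedCount, hc]
        exact h
      · have := ih (p.1.foldl (fun n _ => n + 2) c) δ (by simp) (by simpa using hδ) (by omega)
        simp only [foldl_count] at this ⊢
        generalize splitExch r (c + 2 * p.1.length) (q :: ex) δ = s at *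
        obtain ⟨h1, h2, h3, h4, h5⟩ := this
        simp only [removedCount_eq, List.map_cons, List.sum_cons] at h4 h5 ⊢
        refine ⟨by rw [h1]; rfl, by rw [h2]; rfl, by simp [h3], by omega, h5.imp id ?_⟩
        intro h
        omega

omit [DecidableEq κ] in
theorem removedCount_append (ex ex' : List (Exch κ)) :
    removedCount (ex ++ ex') = removedCount ex + removedCount ex' := by
  simp [removedCount_eq]

omit [DecidableEq κ] in
/-- Both parts of a split contain at most half of the removed edges. -/
theorem splitExch_removed (ex : List (Exch κ)) (δ : List ℝ≥0) (hex : ex ≠ [])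
    (hδ : ex.length ≤ δ.length) :
    2 * removedCount (splitExch (removedCount ex) 0 ex δ).1 ≤ removedCount ex ∧
      2 * removedCount (splitExch (removedCount ex) 0 ex δ).2.2.1 ≤ removedCount ex := by
  obtain ⟨h1, -, -, h4, h5⟩ := splitExch_spec (removedCount ex) 0 ex δ hex hδ (Nat.zero_le _)
  generalize splitExch (removedCount ex) 0 ex δ = s at *
  have h6 := congrArg removedCount h1
  rw [removedCount_append] at h6
  simp only [removedCount_eq, List.map_cons, List.sum_cons] at h6 h4 h5 ⊢
  refine ⟨by omega, ?_⟩
  rcases h5 with h5 | h5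
  · rw [h5]; simp
  · omega

end Exchanges

/-! ### The procedures for divide-and-conquer -/

instance : Enc ℕ := ⟨Val.num⟩

theorem enc_nat (n : ℕ) : enc n = Val.num n := rfl

namespace Code
variable {k : ℕ}

abbrev setEdges (b U l : Code (k + 1)) : Code (k + 1) := .comp .τ1 (.on 25 (.pair (.pair b U) l))

def setStep : Code (k + 1) :=
  .pair (.comp .π0 .π0) (.on 2 (.pair (.comp .τ1 .π0) (.pair .π2 (.comp .π0 .π0))))

def markExch : Code (k + 1) := .setEdges .tt (.setEdges .tt .π0 .π1) .τ2

def applyExch : Code (k + 1) := .setEdges .tt (.setEdges .nil .π0 .π1) .τ2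

def flagEdge : Code (k + 1) := .pair (.ite (.on 1 (.pair .π0 .π2)) .nil .tt) .τ2

def restStep : Code (k + 1) :=
  .ite (.on 1 (.pair (.comp .π0 .π0) .π2)) .π0
    (.pair (.comp .π0 .π0) (.pair .π2 (.comp .τ1 .π0)))

def relabelExch : Code (k + 1) := .pair (.on 9 (.pair .π0 .π1)) (.on 9 (.pair .π0 .τ2))

/-- The argument is `((r, c), (ex, δ))`. -/
def splitExch : Code (k + 1) :=
  .letIn (.on 24 (.pair (.comp .τ1 .π0) (.comp .π0 (.comp .π0 .π1))))
    (.ite (.ite (.comp .τ1 .π2) (.comp (.op .lt) (.pair (.comp .π0 .π1) .π0)) .tt)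
      (.pair .nil (.pair (.comp .π0 .π2) (.pair (.comp .τ1 .π2)
        (.pair (.pair (.comp .π0 .τ3) .nil) (.comp .τ1 .τ3)))))
      (.letIn (.on 31 (.pair (.pair (.comp .π0 .π1) .π0) (.pair (.comp .τ1 .π2) (.comp .τ1 .τ3))))
        (.pair (.pair (.comp .π0 .π3) (.comp .π0 .π0)) (.pair (.comp .π1 .π0)
          (.pair (.comp .π2 .π0) (.pair (.pair (.comp .π0 .τ4) (.comp .π3 .π0))
            (.comp .τ4 .π0)))))))

def addedEdges : Code (k + 1) := .on 4 (.pair .π0 .τ2)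

abbrev gather (U l : Code (k + 1)) : Code (k + 1) := .comp .τ1 (.on 33 (.pair (.pair U .nil) l))

def gatherStep : Code (k + 1) :=
  .ite (.on 1 (.pair (.comp .π0 .π0) .π2))
    (.pair (.on 2 (.pair (.comp .π0 .π0) (.pair .π2 .nil)))
      (.pair (.pair .nil .τ2) (.comp .τ1 .π0)))
    .π0

/-- The argument is `((empty, id), (B, (ex, δ)))`. -/
def divide : Code (k + 1) :=
  .letIn (.on 26 (.pair (.comp .π0 .π0) .π2))
    (.letIn (.on 8 (.pair (.pair (.comp .τ1 .π1) .nil) (.on 4 (.pair .nil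
        (.on 7 (.pair (.comp .π0 .π1) (.pair (.on 28 (.pair .π0 .π2))
          (.comp .π2 (.comp .π0 .π2)))))))))
      -- the argument is `((φ, o), (U, ((empty, id), (B, (ex, δ)))))`
      (.letIn (.pair (.gather .π1 (.comp .τ1 .π0)) (.on 30 (.pair (.comp .π0 .π0) .π4)))
        -- the argument is `((B', ex'), ((φ, o), (U, ((empty, id), (B, (ex, δ))))))`
        (.letIn (.pair
            (.on 31 (.pair (.pair (.on 22 (.pair (.op .zero) (.comp .π0 .τ5))) (.op .zero))
              (.pair (.comp .τ1 .π0) (.comp .τ1 .τ5))))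
            (.on 32 .π0))
          -- the argument is `((s, all), ((B', ex'), ((φ, o), (U, …))))`
          (.pair (.comp .τ1 .π0) (.pair (.comp .τ1 (.on 29 (.pair (.pair .π3 .nil) (.comp .π0 .τ5))))
            (.pair
              (.pair (.comp .π0 .π1) (.pair (.comp .π0 (.comp .π0 .π0))
                (.comp .π3 (.comp .π0 .π0))))
              (.pair
                (.gather (.comp .applyExch (.pair
                    (.on 27 (.pair (.setEdges .tt (.comp .π0 .π4) (.comp .π0 .π1))
                      (.comp .π0 (.comp .π0 .π0))))
                    (.comp .π1 (.comp .π0 .π0))))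
                  (.comp .τ1 .π0))
                (.pair (.comp .π2 (.comp .π0 .π0)) (.comp .τ4 (.comp .π0 .π0))))))))))

/-- The argument is `((empty, id), (B, (ex, δ)))`. -/
def divideSwap : Code (k + 1) :=
  .ite .π1
    (.ite (.comp (.op .lt) (.pair (.op .zero) (.on 22 (.pair (.op .zero) .π2))))
      (.comp
        (.comp
          -- the argument is `(Y, (X, ((empty, id), (all, (rest, (left, right))))))`
          (.comp (.call 4) (.pair
            (.on 21 (.pair .π2 (.pair
              (.pair (.on 35 (.comp .τ2 (.comp .π0 .τ5))) (.on 35 (.comp .τ2 (.comp .τ1 .τ5))))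
              (.pair (.gather (.on 34 (.pair (.comp .π0 .π2) .π1)) .π3)
                (.gather (.on 34 (.pair (.comp .π0 .π2) .π0)) .π3)))))
            .π4))
          (.pair (.on 38 (.pair .π1 (.comp .τ4 .τ1))) .self))
        (.comp (.pair (.on 38 (.pair .π0 .π3)) .self) (.pair .π0 (.on 37 .self))))
      (.on 36 (.pair .nil .π1)))
    .nil

end Code

class HasDivide (P : Program) : Prop extends HasMerge P where
  removedCount : P.body 22 = .fold 22 (.on 23 (.pair .π0 .π1))
  addLength : P.body 23 = .fold 23 (.comp (.op .succ) .π0)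
  addTwice : P.body 24 = .fold 24 (.comp (.op .succ) (.comp (.op .succ) .π0))
  setEdges : P.body 25 = .fold 25 .setStep
  markExch : P.body 26 = .fold 26 .markExch
  applyExch : P.body 27 = .fold 27 .applyExch
  flagEdge : P.body 28 = .mapList 28 .flagEdge
  rest : P.body 29 = .fold 29 .restStep
  relabelExch : P.body 30 = .mapList 30 .relabelExch
  splitExch : P.body 31 = .splitExch
  addedEdges : P.body 32 = .fold 32 .addedEdges
  gather : P.body 33 = .fold 33 .gatherStep
  markIds : P.body 34 = .fold 34 (.on 2 (.pair .π0 (.pair .τ1 .tt)))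
  weightSum : P.body 35 = .fold 35 (.op .addWt)
  edgeIds : P.body 36 = .mapList 36 .π2
  divide : P.body 37 = .divide
  divideSwap : P.body 38 = .divideSwap

section Divide

variable {κ : Type*} [Keys κ] [DecidableEq κ] {P : Program} [HasDivide P]

omit [DecidableEq κ] [HasDivide P] in
-- The summand `1` for each exchange in `exSize` pays for the treatment of exchanges with empty
-- sets; this is how the trivial exchanges enter the running time.
theorem Det.fold_exch {σ : Type*} [Enc σ] {i : Fin (P.last + 1)} {step : Code (P.last + 1)}
    {f : σ → Exch κ → σ} (hi : P.body i = .fold i step) (c : ℕ) (ex : List (Exch κ))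
    (hc : 30 ≤ c)
    (hstep : ∀ a, ∀ p ∈ ex, Steps P step (.pair (enc a) (enc p)) (enc (f a p))
      (c * (p.1.length + p.2.length + 1) - 20)) (a : σ) :
    Det P (.call i) (.pair (enc a) (enc ex)) (enc (ex.foldl f a)) (c * (exSize ex + 1)) := by
  refine (Det.fold_sum hi _ ex hstep a).mono ?_
  have : (ex.map fun p => c * (p.1.length + p.2.length + 1) - 20 + 20).sum = c * exSize ex := by
    rw [exSize, ← List.sum_map_mul_left]
    congr 1
    refine List.map_congr_left fun p _ => ?_
    have : c * 1 ≤ c * (p.1.length + p.2.length + 1) := Nat.mul_le_mul_left _ (by omega)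
    omega
  rw [this]
  linarith

omit [Keys κ] [DecidableEq κ] in
theorem det_addLength {α : Type*} [Enc α] (n : ℕ) (l : List α) :
    Det P (.call 23) (.pair (enc n) (enc l)) (enc (l.foldl (fun n _ => n + 1) n))
      (30 * (l.length + 1)) := by
  refine Det.foldl (f := fun n (_ : α) => n + 1) HasDivide.addLength (s := 10) l
    (fun a x _ => ?_) n (by omega)
  simp [enc_nat]

omit [Keys κ] [DecidableEq κ] in
theorem det_addTwice {α : Type*} [Enc α] (n : ℕ) (l : List α) :
    Det P (.call 24) (.pair (enc n) (enc l)) (enc (l.foldl (fun n _ => n + 2) n))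
      (30 * (l.length + 1)) := by
  refine Det.foldl (f := fun n (_ : α) => n + 2) HasDivide.addTwice (s := 10) l
    (fun a x _ => ?_) n (by omega)
  simp [enc_nat]

omit [DecidableEq κ] in
theorem det_removedCount (ex : List (Exch κ)) :
    Det P (.call 22) (.pair (.num 0) (enc ex)) (.num (removedCount ex))
      (100 * (exSize ex + 1)) := by
  refine Det.fold_exch (f := fun n (p : Exch κ) => p.1.foldl (fun n _ => n + 1) n)
    (HasDivide.removedCount (P := P)) 100 ex (by omega) (fun a x _ => ?_) 0
  obtain ⟨p, q⟩ := x
  simp only [wp_rules, apply_rules, enc_pair, enc_cons, enc_nil, enc_true, enc_false]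
  refine (det_addLength (P := P) a p).wp ?_
  exact ⟨rfl, by omega⟩

theorem det_setEdges (b : Bool) (U : κ → Bool) (l : List (Edge κ)) :
    Det P (.call 25) (.pair (.pair (enc b) (enc U)) (enc l))
      (.pair (enc (l.foldl setStep (b, U)).1) (enc (setEdges b U l)))
      (2 * unitCost κ * (l.length + 1)) := by
  have hu := le_unitCost κ
  refine Det.foldl (f := setStep) HasDivide.setEdges (s := unitCost κ + 50)
    (c := 2 * unitCost κ) l (fun a x _ => ?_) (b, U) (by omega)
  obtain ⟨fl, e, x, y⟩ := x
  obtain ⟨b, U⟩ := a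
  simp only [Code.setStep, wp_rules, apply_rules, enc_pair, enc_cons, enc_nil, enc_true, enc_false]
  refine (Det.set U e b).wp ?_
  exact ⟨rfl, by omega⟩

/-- Common to `markExch` and `applyExch`, which differ only in the mark given to the removed edges:
`c = true` and `c = false`, respectively. -/
theorem wp_exch {c : Bool} {U : κ → Bool} {p : Exch κ} {u : Code (P.last + 1)}
    (hu : u = bif c then .tt else .nil) :
    Steps P (.setEdges .tt (.setEdges u .π0 .π1) .τ2) (.pair (enc U) (enc p))
      (enc (setEdges true (setEdges c U p.1) p.2))
      (5 * unitCost κ * (p.1.length + p.2.length + 1) - 20) := by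
  have hu := le_unitCost κ
  obtain ⟨p, q⟩ := p
  have h1 := det_setEdges (P := P) c U p
  have h2 := det_setEdges (P := P) true (setEdges c U p) q
  have h3 : 2 * unitCost κ * (p.length + 1) + 2 * unitCost κ * (q.length + 1) + 100 ≤
      5 * unitCost κ * (p.length + q.length + 1) - 20 := by
    rw [Nat.le_sub_iff_add_le (by nlinarith)]
    nlinarith
  subst u
  cases c
  · simp only [wp_rules, apply_rules, enc_pair, enc_cons, enc_nil, enc_true, enc_false] at h1 h2 ⊢
    refine h1.wp (h2.wp ⟨rfl, ?_⟩)
    omega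
  · simp only [wp_rules, apply_rules, enc_pair, enc_cons, enc_nil, enc_true, enc_false] at h1 h2 ⊢
    refine h1.wp (h2.wp ⟨rfl, ?_⟩)
    omega

theorem det_markExch (U : κ → Bool) (ex : List (Exch κ)) :
    Det P (.call 26) (.pair (enc U) (enc ex)) (enc (ex.foldl markExch U))
      (5 * unitCost κ * (exSize ex + 1)) := by
  have hu := le_unitCost κ
  exact Det.fold_exch HasDivide.markExch _ ex (by omega) (fun U p _ => wp_exch rfl) U

theorem steps_applyExch (U : κ → Bool) (p : Exch κ) :
    Steps P .applyExch (.pair (enc U) (enc p)) (enc (applyExch U p))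
      (5 * unitCost κ * (p.1.length + p.2.length + 1) - 20) := wp_exch rfl

theorem det_applyExch (U : κ → Bool) (ex : List (Exch κ)) :
    Det P (.call 27) (.pair (enc U) (enc ex)) (enc (ex.foldl applyExch U))
      (5 * unitCost κ * (exSize ex + 1)) := by
  have hu := le_unitCost κ
  exact Det.fold_exch HasDivide.applyExch _ ex (by omega) (fun U p _ => steps_applyExch U p) U

omit [DecidableEq κ] in
theorem det_flagEdge (U : κ → Bool) (l : List (Edge κ)) :
    Det P (.call 28) (.pair (enc U) (enc l)) (enc (l.map (flagEdge U)))
      (2 * unitCost κ * (l.length + 1)) := by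
  have hu := le_unitCost κ
  refine Det.map (f := flagEdge) HasDivide.flagEdge (s := unitCost κ + 50) U l
    (fun x _ => ?_) (by omega)
  obtain ⟨fl, e, x, y⟩ := x
  simp only [Code.flagEdge, wp_rules, apply_rules, enc_pair, enc_cons, enc_nil, enc_true, enc_false]
  refine (Det.get U e).wp ?_
  cases h : U e <;> simp only [wp_rules, apply_rules, enc_pair, enc_cons, enc_nil, enc_true, enc_false]
  · exact ⟨by simp [flagEdge, h], by omega⟩
  · exact ⟨by simp [flagEdge, h], by omega⟩

omit [DecidableEq κ] in
theorem det_rest (U : κ → Bool) (acc : List κ) (l : List (Edge κ)) :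
    Det P (.call 29) (.pair (.pair (enc U) (enc acc)) (enc l))
      (enc (l.foldl restStep (U, acc))) (2 * unitCost κ * (l.length + 1)) := by
  have hu := le_unitCost κ
  refine Det.foldl (f := restStep) HasDivide.rest (s := unitCost κ + 50) l
    (fun a x _ => ?_) (U, acc) (by omega)
  obtain ⟨fl, e, x, y⟩ := x
  obtain ⟨U, acc⟩ := a
  simp only [Code.restStep, wp_rules, apply_rules, enc_pair, enc_cons, enc_nil, enc_true, enc_false]
  refine (Det.get U e).wp ?_
  cases h : U e <;> simp only [wp_rules, apply_rules, enc_pair, enc_cons, enc_nil, enc_true, enc_false]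
  · exact ⟨by simp [restStep, h], by omega⟩
  · exact ⟨by simp [restStep, h], by omega⟩

omit [DecidableEq κ] in
theorem det_relabelExch (φ : κ → κ) (ex : List (Exch κ)) :
    Det P (.call 30) (.pair (enc φ) (enc ex)) (enc (ex.map (relabelExch φ)))
      (7 * unitCost κ * (exSize ex + 1)) := by
  have hu := le_unitCost κ
  refine (Det.map_sum (f := relabelExch) HasDivide.relabelExch
    (fun p => 7 * unitCost κ * (p.1.length + p.2.length + 1) - 20) φ ex
    (fun p _ => ?_)).mono ?_
  · obtain ⟨p, q⟩ := p
    simp only [Code.relabelExch, wp_rules, apply_rules, enc_pair, enc_cons, enc_nil, enc_true, enc_false]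
    refine (det_relabel φ p).wp ?_
    refine (det_relabel φ q).wp ?_
    refine ⟨rfl, ?_⟩
    rw [Nat.le_sub_iff_add_le (by nlinarith)]
    nlinarith
  · have : (ex.map fun p => 7 * unitCost κ * (p.1.length + p.2.length + 1) - 20 + 20).sum =
        7 * unitCost κ * exSize ex := by
      rw [exSize, ← List.sum_map_mul_left]
      congr 1
      refine List.map_congr_left fun p _ => Nat.sub_add_cancel ?_
      nlinarith
    rw [this]
    linarith

omit [DecidableEq κ] in
theorem det_splitExch (r c : ℕ) (ex : List (Exch κ)) (δ : List ℝ≥0) (hex : ex ≠ [])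
    (hδ : ex.length ≤ δ.length) :
    Det P (.call 31) (.pair (.pair (.num r) (.num c)) (.pair (enc ex) (enc δ)))
      (enc (splitExch r c ex δ)) (500 * (exSize ex + 1)) := by
  induction ex generalizing c δ with
  | nil => exact (hex rfl).elim
  | cons p ex ih =>
    rcases δ with _ | ⟨a, δ⟩
    · simp at hδ
    have h1 := det_addTwice (P := P) c p.1
    rw [enc_nat, enc_nat] at h1
    refine det_call_of_wp HasDivide.splitExch ?_
    obtain ⟨p, p'⟩ := p
    simp only [Code.splitExch, wp_rules, apply_rules, enc_pair, enc_cons, enc_nil, enc_true, enc_false]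
    refine h1.wp ?_
    rcases ex with _ | ⟨q, ex⟩
    · simp only [wp_rules, apply_rules, enc_pair, enc_cons, enc_nil, enc_true, enc_false, exSize_cons, exSize_nil, splitExch]
      exact ⟨trivial, by omega⟩
    · have h2 := ih (p.foldl (fun n _ => n + 2) c) δ (by simp) (by simpa using hδ)
      rw [enc_cons] at h2
      simp only [wp_rules, apply_rules, enc_pair, enc_cons, enc_nil, enc_true, enc_false, apply_lt, isNil_ofBool]
      rw [splitExch]
      by_cases h : r < p.foldl (fun n _ => n + 2) c
      · simp only [h, decide_true, Bool.not_true, wp_rules, apply_rules, enc_pair, enc_cons, enc_nil, enc_true, enc_false, if_true]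
        refine ⟨trivial, ?_⟩
        simp only [exSize_cons]
        omega
      · simp only [h, decide_false, Bool.not_false, wp_rules, apply_rules, enc_pair, enc_cons, enc_nil, enc_true, enc_false, if_false]
        refine h2.wp ?_
        generalize splitExch r (p.foldl (fun n _ => n + 2) c) (q :: ex) δ = s
        obtain ⟨s1, s2, s3, s4, s5⟩ := s
        simp only [wp_rules, apply_rules, enc_pair, enc_cons, enc_nil, enc_true, enc_false]
        refine ⟨trivial, ?_⟩
        simp only [exSize_cons]
        omega

omit [DecidableEq κ] in
theorem det_addedEdges (acc : List (Edge κ)) (ex : List (Exch κ)) :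
    Det P (.call 32) (.pair (enc acc) (enc ex)) (enc (ex.foldl addedEdges acc))
      (100 * (exSize ex + 1)) := by
  refine Det.fold_exch (f := addedEdges) HasDivide.addedEdges _ ex (by omega) (fun a p _ => ?_) acc
  obtain ⟨p, q⟩ := p
  simp only [Code.addedEdges, wp_rules, apply_rules, enc_pair, enc_cons, enc_nil, enc_true, enc_false]
  refine (Det.revAppend q a).wp ?_
  exact ⟨rfl, by omega⟩

theorem det_gather (U : κ → Bool) (l : List (Edge κ)) :
    Det P (.call 33) (.pair (.pair (enc U) .nil) (enc l))
      (.pair (enc (l.foldl gatherStep (U, [])).1) (enc (gather U l)))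
      (3 * unitCost κ * (l.length + 1)) := by
  have hu := le_unitCost κ
  refine Det.foldl (f := gatherStep) HasDivide.gather (s := 2 * unitCost κ + 50)
    (c := 3 * unitCost κ) l (fun a x _ => ?_) (U, []) (by omega)
  obtain ⟨fl, e, x, y⟩ := x
  obtain ⟨U, acc⟩ := a
  simp only [Code.gatherStep, wp_rules, apply_rules, enc_pair, enc_cons, enc_nil, enc_true, enc_false]
  refine (Det.get U e).wp ?_
  cases h : U e <;> simp only [wp_rules, apply_rules, enc_pair, enc_cons, enc_nil, enc_true, enc_false]
  · exact ⟨by simp [gatherStep, h], by omega⟩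
  · refine (Det.set U e false).wp ?_
    exact ⟨by simp [gatherStep, h], by omega⟩

theorem det_markIds (l : List κ) :
    Det P (.call 34) (.pair (enc fun _ : κ => false) (enc l)) (enc (markIds l))
      (2 * unitCost κ * (l.length + 1)) := by
  have hu := le_unitCost κ
  refine Det.foldl (f := fun U e => Function.update U e true) HasDivide.markIds
    (s := unitCost κ + 50) l (fun a x _ => ?_) (fun _ => false) (by omega)
  simp only [wp_rules, apply_rules, enc_pair, enc_cons, enc_nil, enc_true, enc_false]
  refine (Det.set a x true).wp ?_
  exact ⟨rfl, by omega⟩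

theorem det_weightSum (l : List ℝ≥0) (hl : l ≠ []) :
    Det P (.call 35) (enc l) (.wt (weightSum l)) (30 * (l.length + 1)) := by
  rcases l with _ | ⟨a, l⟩
  · exact (hl rfl).elim
  refine (Det.foldl (f := fun a b : ℝ≥0 => a + b) HasDivide.weightSum (s := 10) (c := 30) l
    (fun a x _ => ?_) a (by omega)).mono (by simp)
  simp only [wp_rules, apply_rules, enc_pair, enc_cons, enc_nil, enc_true, enc_false, enc_weight, apply_addWt]
  exact ⟨trivial, by omega⟩

omit [DecidableEq κ] in
theorem det_edgeIds (l : List (Edge κ)) :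
    Det P (.call 36) (.pair .nil (enc l)) (enc (edgeIds l)) (30 * (l.length + 1)) := by
  refine Det.map (f := fun (_ : Bool) (t : Edge κ) => t.2.1) HasDivide.edgeIds (s := 10) false l
    (fun x _ => ?_) (by omega)
  obtain ⟨fl, e, x, y⟩ := x
  simp only [wp_rules, apply_rules, enc_pair, enc_cons, enc_nil, enc_true, enc_false]
  exact ⟨trivial, by omega⟩

omit [DecidableEq κ] in
/-- The representation of the result of `divide`. -/
def Division.toVal (D : Division κ) : Val :=
  .pair (enc D.all) (.pair (enc D.rest) (.pair (.pair (enc D.B) (.pair (enc D.left)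
    (enc D.leftWeights))) (.pair (enc D.B') (.pair (enc D.right) (enc D.rightWeights)))))

theorem det_divide (fl : Bool) (e x y : κ) (B₀ : List (Edge κ)) (ex : List (Exch κ))
    (δ : List ℝ≥0) (hex : ex ≠ []) (hδ : ex.length ≤ δ.length) :
    Det P (.call 37) (.pair (.pair (enc fun _ : κ => false) (enc (id : κ → κ)))
      (.pair (enc ((fl, e, x, y) :: B₀)) (.pair (enc ex) (enc δ))))
      (divide x ((fl, e, x, y) :: B₀) ex δ).toVal
      (1000 * (unitCost κ * (((fl, e, x, y) :: B₀).length + exSize ex + 1))) := by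
  have hu := le_unitCost κ
  refine det_call_of_wp HasDivide.divide ?_
  generalize hB : (fl, e, x, y) :: B₀ = B
  have hd : enc B = .pair (.pair (enc fl) (.pair (enc e) (.pair (enc x) (enc y)))) (enc B₀) := by
    rw [← hB]; rfl
  simp only [Code.divide, wp_rules, apply_rules, enc_pair, enc_cons, enc_nil, enc_true, enc_false]
  refine (det_markExch (fun _ => false) ex).wp ?_
  generalize hU : ex.foldl markExch (fun _ => false) = U
  refine (det_flagEdge U B).wp ?_
  rw [hd]
  simp only [wp_rules, apply_rules, enc_pair, enc_cons, enc_nil, enc_true, enc_false]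
  refine (det_search (B.map (flagEdge U)) x).wp ?_
  refine (Det.revAppend (search (B.map (flagEdge U)) x) []).wp ?_
  rw [List.append_nil]
  refine (det_contract _).wp ?_
  have hl1 := length_search_le (B.map (flagEdge U)) x
  have hl2 := length_contract_le (search (B.map (flagEdge U)) x).reverse
  rw [List.length_reverse]
  rw [List.length_reverse] at hl2
  generalize hc : contract (search (B.map (flagEdge U)) x).reverse = c at *
  have hl4 := length_gather_mark_le ex c.2
  rw [hU] at hl4
  obtain ⟨φ, o⟩ := c
  simp only [wp_rules, apply_rules, enc_pair, enc_cons, enc_nil, enc_true, enc_false] at hl4 ⊢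
  refine (det_gather U o).wp ?_
  simp only [wp_rules, apply_rules, enc_pair, enc_cons, enc_nil, enc_true, enc_false]
  refine (det_relabelExch φ ex).wp ?_
  refine (det_removedCount ex).wp ?_
  have hes := exSize_relabel φ ex
  have hs := det_splitExch (P := P) (removedCount ex) 0 (ex.map (relabelExch φ)) δ (by simpa)
    (by simpa)
  have hspec := splitExch_spec (removedCount ex) 0 (ex.map (relabelExch φ)) δ (by simpa)
    (by simpa) (Nat.zero_le _)
  simp only at hspec
  simp only [apply_zero]
  refine hs.wp ?_
  have hll := length_foldl_addedEdges (ex.map (relabelExch φ)) (gather U o)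
  refine (det_addedEdges (gather U o) (ex.map (relabelExch φ))).wp ?_
  have hD : divide x B ex δ =
      { B := gather U o
        all := (ex.map (relabelExch φ)).foldl addedEdges (gather U o)
        rest := (B.foldl restStep (U, [])).2
        left := (splitExch (removedCount ex) 0 (ex.map (relabelExch φ)) δ).1
        B' := gather (applyExch ((splitExch (removedCount ex) 0 (ex.map (relabelExch φ)) δ).1.foldl
          applyExch (setEdges true (fun _ => false) (gather U o)))
          (splitExch (removedCount ex) 0 (ex.map (relabelExch φ)) δ).2.1)
          ((ex.map (relabelExch φ)).foldl addedEdges (gather U o))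
        right := (splitExch (removedCount ex) 0 (ex.map (relabelExch φ)) δ).2.2.1
        leftWeights := (splitExch (removedCount ex) 0 (ex.map (relabelExch φ)) δ).2.2.2.1
        rightWeights := (splitExch (removedCount ex) 0 (ex.map (relabelExch φ)) δ).2.2.2.2 } := by
    rw [divide, hU, hc]
  rw [hD, Division.toVal]
  simp only
  generalize (ex.map (relabelExch φ)).foldl addedEdges (gather U o) = all at *
  generalize splitExch (removedCount ex) 0 (ex.map (relabelExch φ)) δ = s at *
  obtain ⟨L, p, R, dL, dR⟩ := s
  simp only [wp_rules, apply_rules, enc_pair, enc_cons, enc_nil, enc_true, enc_false] at hspec ⊢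
  have hr := det_rest (P := P) U [] B
  rw [enc_nil, hd] at hr
  refine hr.wp ?_
  generalize B.foldl restStep (U, []) = rs
  obtain ⟨rs1, rs2⟩ := rs
  simp only [wp_rules, apply_rules, enc_pair, enc_cons, enc_nil, enc_true, enc_false]
  have hst := det_setEdges (P := P) true (fun _ => false) (gather U o)
  rw [enc_true] at hst
  refine hst.wp ?_
  simp only [wp_rules, apply_rules, enc_pair, enc_cons, enc_nil, enc_true, enc_false]
  have hlen : exSize ex = exSize L + (p.1.length + p.2.length + 1) + exSize R := by
    rw [← hes, hspec.1]
    simp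
    ring
  refine (det_applyExch (setEdges true (fun _ => false) (gather U o)) L).wp ?_
  refine (steps_applyExch (L.foldl applyExch (setEdges true (fun _ => false) (gather U o))) p).wp
    fun t3 ht3 => ?_
  refine (det_gather _ all).wp ?_
  refine ⟨rfl, ?_⟩
  rw [List.length_map] at hl1 ⊢
  rw [hes] at hll ⊢
  generalize exSize ex = K at *
  generalize unitCost κ = u at *
  generalize B.length = b at *
  generalize (search (B.map (flagEdge U)) x).length = q at *
  generalize o.length = q' at *
  generalize (gather U o).length = g at *
  generalize all.length = a at *
  have g1 : u * q ≤ u * (4 * b + 1) := Nat.mul_le_mul_left _ hl1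
  have g2 : u * q' ≤ u * q := Nat.mul_le_mul_left _ hl2
  have g3 : u * g ≤ u * K := Nat.mul_le_mul_left _ hl4
  have g4 : u * a ≤ u * (2 * K) := Nat.mul_le_mul_left _ (by omega)
  have g5 : u * exSize L ≤ u * K := Nat.mul_le_mul_left _ (by omega)
  have g6 : u * (p.1.length + p.2.length + 1) ≤ u * K := Nat.mul_le_mul_left _ (by omega)
  have g7 : 1000 * (b + K + 1) ≤ u * (b + K + 1) := Nat.mul_le_mul_right _ hu
  have g8 : t3 ≤ 5 * (u * K) := by
    refine ht3.trans ((Nat.sub_le _ _).trans ?_)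
    linarith
  nlinarith

end Divide

/-! ### Sizes of the two halves -/

section DivideSizes

variable {κ : Type*} [DecidableEq κ]

omit [DecidableEq κ] in
theorem length_foldl_restStep (l : List (Edge κ)) (s : (κ → Bool) × List κ) :
    (l.foldl restStep s).2.length ≤ s.2.length + l.length := by
  induction l generalizing s with
  | nil => simp
  | cons t l ih =>
    refine (ih _).trans ?_
    obtain ⟨fl, e, x, y⟩ := t
    obtain ⟨U, acc⟩ := s
    rw [restStep]
    split_ifs
    · simp
    · simp; omega

/-- In a call, `b` is the number of edges of the tree, `K` the size of the exchanges and `r` the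
number of removed edges. The middle exchange belongs to neither half, which gives the `+ 1` in
`sizes`. -/
structure Division.Bounded (D : Division κ) (b K r : ℕ) : Prop where
  B : D.B.length ≤ K
  all : D.all.length ≤ 2 * K
  B' : D.B'.length ≤ 2 * K
  rest : D.rest.length ≤ b
  sizes : exSize D.left + exSize D.right + 1 ≤ K
  leftWeights : D.leftWeights.length = D.left.length + 1
  rightWeights : D.rightWeights.length = D.right.length + 1
  removed_left : 2 * removedCount D.left ≤ r
  removed_right : 2 * removedCount D.right ≤ r

theorem divide_bounded (x : κ) (B : List (Edge κ)) (ex : List (Exch κ)) (δ : List ℝ≥0)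
    (hex : ex ≠ []) (hδ : δ.length = ex.length + 1) :
    (divide x B ex δ).Bounded B.length (exSize ex) (removedCount ex) := by
  rw [divide]
  generalize hU : ex.foldl markExch (fun _ => false) = U
  generalize contract (search (B.map (flagEdge U)) x).reverse = c
  have h1 : (gather U c.2).length ≤ exSize ex := hU ▸ length_gather_mark_le ex c.2
  have h2 := length_foldl_addedEdges (ex.map (relabelExch c.1)) (gather U c.2)
  rw [exSize_relabel] at h2
  have hlen : (ex.map (relabelExch c.1)).length = ex.length := by simp
  have hs := splitExch_spec (removedCount ex) 0 (ex.map (relabelExch c.1)) δ (by simpa)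
    (by omega) (Nat.zero_le _)
  have hr := splitExch_removed (ex.map (relabelExch c.1)) δ (by simpa) (by omega)
  rw [removedCount_relabel] at hr
  obtain ⟨s1, s2, s3, -, -⟩ := hs
  have s4 := congrArg exSize s1
  rw [exSize_relabel, exSize_append, exSize_cons] at s4
  have s5 := congrArg List.length s1
  have s6 := congrArg List.length s2
  rw [List.length_append] at s6
  simp only [List.length_append, List.length_cons, List.length_map] at s5
  exact
    { B := h1
      all := by simp only; omega
      B' := (length_gather_le _ _).trans (by omega)
      rest := (length_foldl_restStep _ _).trans (by simp)
      sizes := by simp only; omega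
      leftWeights := s3
      rightWeights := by simp only; omega
      removed_left := hr.1
      removed_right := hr.2 }

theorem length_of_mem_mergeTrees {d : ℕ} {a b : ℝ≥0} {X Y : List (Edge κ)} {Z : List κ}
    (hZ : Z ∈ (mergeTrees d a b X Y).support) : Z.length ≤ 4 * X.length + 1 := by
  rcases X with _ | ⟨⟨fl, e, x, y⟩, X⟩
  · rw [mergeTrees, PMF.support_pure, Set.mem_singleton_iff] at hZ
    rw [hZ]; simp
  · rw [mergeTrees, PMF.support_map] at hZ
    obtain ⟨ops, h, rfl⟩ := hZ
    have h1 := length_of_mem_flipFlags h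
    have h2 := length_search_le ((fl, e, x, y) :: X) x
    have h3 := length_solve_le d Y ops
    rw [List.length_map]
    omega

/-- A crude bound that disregards correctness: the output contains at most `B.length` contracted
edges and a merged list of at most `4 * (2 * K) + 1` edges. It is needed for the cost of reading the
results of the halves. -/
theorem length_of_mem_divideSwap {m d : ℕ} {B : List (Edge κ)} {ex : List (Exch κ)}
    {δ : List ℝ≥0} (hδ : δ.length = ex.length + 1) {Z : List κ}
    (hZ : Z ∈ (divideSwap m d B ex δ).support) : Z.length ≤ B.length + 8 * exSize ex + 1 := by
  rcases B with _ | ⟨⟨fl, e, x, y⟩, B⟩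
  · rw [divideSwap, PMF.support_pure, Set.mem_singleton_iff] at hZ
    rw [hZ]; simp
  rcases d with _ | d
  · rw [divideSwap, PMF.support_pure, Set.mem_singleton_iff] at hZ
    · rw [hZ]; simp [edgeIds]; omega
    · simp
  rw [divideSwap] at hZ
  split_ifs at hZ with h
  · rw [PMF.support_pure, Set.mem_singleton_iff] at hZ
    rw [hZ]; simp [edgeIds]; omega
  have hD := divide_bounded x ((fl, e, x, y) :: B) ex δ (by rintro rfl; exact h rfl) hδ
  simp only [PMF.mem_support_bind_iff, PMF.support_map] at hZ
  obtain ⟨X, -, Y, -, Z, hZ, rfl⟩ := hZ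
  have h1 := length_of_mem_mergeTrees hZ
  have h2 := length_gather_le (markIds X) (divide x ((fl, e, x, y) :: B) ex δ).all
  have h3 := hD.all
  have h4 := hD.rest
  rw [List.length_append, List.length_reverse]
  omega

end DivideSizes

/-! ### Cost of the divide-and-conquer recursion -/

section DivideSwap

variable {κ : Type*} [Keys κ] [DecidableEq κ] {P : Program} [HasDivide P]

/-- The final part of the divide-and-conquer procedure. -/
theorem rnd_mergeHalves (m : ℕ) (D : Division κ) (X Y : List κ) {b K r n : ℕ}
    (hD : D.Bounded b K r) (hX : X.length ≤ n) (hY : Y.length ≤ n) (hm : 8 * K + 1 ≤ 2 ^ m) :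
    Rnd P (.comp (.call 4) (.pair
            (.on 21 (.pair .π2 (.pair
              (.pair (.on 35 (.comp .τ2 (.comp .π0 .τ5))) (.on 35 (.comp .τ2 (.comp .τ1 .τ5))))
              (.pair (.gather (.on 34 (.pair (.comp .π0 .π2) .π1)) .π3)
                (.gather (.on 34 (.pair (.comp .π0 .π2) .π0)) .π3)))))
            .π4))
      (.pair (enc Y) (.pair (enc X) (.pair (.pair (enc fun _ : κ => false) (enc (id : κ → κ)))
        D.toVal)))
      (((mergeTrees m (weightSum D.leftWeights) (weightSum D.rightWeights)
            (gather (markIds X) D.all) (gather (markIds Y) D.all)).map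
            fun Z => D.rest.reverse ++ Z).map enc)
      (300000 * (unitCost κ * ((b + K + n + 1) * (m + 1)))) := by
  have hu := le_unitCost κ
  set v : Val := (.pair (enc Y) (.pair (enc X) (.pair (.pair (enc fun _ : κ => false)
    (enc (id : κ → κ))) D.toVal))) with hv
  have h1 : Det P (.pair .π2 (.pair
              (.pair (.on 35 (.comp .τ2 (.comp .π0 .τ5))) (.on 35 (.comp .τ2 (.comp .τ1 .τ5))))
              (.pair (.gather (.on 34 (.pair (.comp .π0 .π2) .π1)) .π3)
                (.gather (.on 34 (.pair (.comp .π0 .π2) .π0)) .π3)))) v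
      (.pair (.pair (enc fun _ : κ => false) (enc (id : κ → κ)))
        (.pair (.pair (.wt (weightSum D.leftWeights)) (.wt (weightSum D.rightWeights)))
        (.pair (enc (gather (markIds X) D.all)) (enc (gather (markIds Y) D.all)))))
      (30 * (D.leftWeights.length + 1) + 30 * (D.rightWeights.length + 1) +
        2 * unitCost κ * (X.length + 1) + 2 * unitCost κ * (Y.length + 1) +
        3 * unitCost κ * (D.all.length + 1) + 3 * unitCost κ * (D.all.length + 1) + 200) := by
    refine WP.det ?_
    rw [hv, Division.toVal]
    simp only [wp_rules, apply_rules, enc_pair, enc_cons, enc_nil, enc_true, enc_false]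
    have w1 := hD.leftWeights
    have w2 := hD.rightWeights
    refine (det_weightSum D.leftWeights (by rw [← List.length_pos_iff]; omega)).wp ?_
    refine (det_weightSum D.rightWeights (by rw [← List.length_pos_iff]; omega)).wp ?_
    refine (det_markIds X).wp ?_
    refine (det_gather (markIds X) D.all).wp ?_
    refine (det_markIds Y).wp ?_
    refine (det_gather (markIds Y) D.all).wp ?_
    exact ⟨rfl, by omega⟩
  have l1 := length_gather_le (markIds X) D.all
  have l2 := length_gather_le (markIds Y) D.all
  have l3 := hD.all
  have h2 := Rnd.after_det h1 (rnd_mergeTrees (P := P) m (weightSum D.leftWeights)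
    (weightSum D.rightWeights) (gather (markIds X) D.all) (gather (markIds Y) D.all) (n := 2 * K)
    (by omega) (by omega) (by omega))
  have h3 : Det P .π4 v (enc D.rest) 20 := by
    refine WP.det ?_
    rw [hv, Division.toVal]
    simp only [wp_rules, apply_rules, enc_pair, enc_cons, enc_nil, enc_true, enc_false]
    exact ⟨trivial, by omega⟩
  have h4 := Rnd.map_det (f := .call 4) (h' := fun Z : List κ => enc (D.rest.reverse ++ Z))
    (s := 25 * (D.rest.length + 1)) (fun l l' h => by
      simp only [Val.pair.injEq, and_true] at h
      exact enc_list_injective enc_key_injective h) (h2.det_pair h3)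
    fun Z _ => Det.revAppend D.rest Z
  have e5 : ((mergeTrees m (weightSum D.leftWeights) (weightSum D.rightWeights)
      (gather (markIds X) D.all) (gather (markIds Y) D.all)).map
      fun Z => D.rest.reverse ++ Z).map (enc : List κ → Val) =
      (mergeTrees m (weightSum D.leftWeights) (weightSum D.rightWeights)
      (gather (markIds X) D.all) (gather (markIds Y) D.all)).map
      fun Z => enc (D.rest.reverse ++ Z) := by
    rw [PMF.map_comp]; rfl
  rw [e5]
  refine h4.mono ?_
  have g0 := hD.rest
  have g1 := hD.leftWeights
  have g2 := hD.rightWeights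
  have g3 := length_le_exSize D.left
  have g4 := length_le_exSize D.right
  have g5 := hD.sizes
  have t1 : D.leftWeights.length + D.rightWeights.length ≤ 2 * K + 2 := by omega
  generalize D.leftWeights.length = p1 at *
  generalize D.rightWeights.length = p2 at *
  generalize D.all.length = a at *
  generalize D.rest.length = r at *
  generalize X.length = x at *
  generalize Y.length = y at *
  clear_value v
  clear g3 g4 g5 h1 h2 h3 h4 e5 l1 l2 hm
  set W := b + K + n + 1 with hW
  have k1 : W ≤ W * (m + 1) := Nat.le_mul_of_pos_right _ (by omega)
  have k2 : unitCost κ * W ≤ unitCost κ * (W * (m + 1)) := Nat.mul_le_mul_left _ k1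
  have k3 : 1000 * W ≤ unitCost κ * W := Nat.mul_le_mul_right _ hu
  have k4 : unitCost κ * (x + 1) ≤ unitCost κ * W := Nat.mul_le_mul_left _ (by omega)
  have k5 : unitCost κ * (y + 1) ≤ unitCost κ * W := Nat.mul_le_mul_left _ (by omega)
  have k6 : unitCost κ * (a + 1) ≤ unitCost κ * (2 * W) := Nat.mul_le_mul_left _ (by omega)
  have k7 : unitCost κ * ((2 * K + 1) * (m + 1)) ≤ unitCost κ * (2 * W * (m + 1)) :=
    Nat.mul_le_mul_left _ (Nat.mul_le_mul_right _ (by omega))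
  have k8 : unitCost κ * (2 * W * (m + 1)) = 2 * (unitCost κ * (W * (m + 1))) := by ring
  have k9 : unitCost κ * (2 * W) = 2 * (unitCost κ * W) := by ring
  rw [k8] at k7
  rw [k9] at k6
  simp only [mul_assoc]
  omega

omit [Keys κ] in
theorem divideSwap_nil (m d : ℕ) (ex : List (Exch κ)) (δ : List ℝ≥0) :
    divideSwap m d ([] : List (Edge κ)) ex δ = PMF.pure [] := by
  rw [divideSwap]

omit [Keys κ] in
theorem divideSwap_of_removedCount (m d : ℕ) (B : List (Edge κ)) {ex : List (Exch κ)}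
    (δ : List ℝ≥0) (h : removedCount ex = 0) : divideSwap m d B ex δ = PMF.pure (edgeIds B) := by
  rcases B with _ | ⟨⟨fl, e, x, y⟩, B⟩
  · rw [divideSwap]; rfl
  · rcases d with _ | d
    · rw [divideSwap]; simp
    · rw [divideSwap, if_pos h]

omit [DecidableEq κ] in
theorem det_divideSwap_nil (ex : List (Exch κ)) (δ : List ℝ≥0) :
    Det P (.call 38) (.pair (.pair (enc fun _ : κ => false) (enc (id : κ → κ)))
      (.pair (enc ([] : List (Edge κ))) (.pair (enc ex) (enc δ)))) (enc ([] : List κ)) 20 := by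
  refine det_call_of_wp HasDivide.divideSwap ?_
  simp only [Code.divideSwap, wp_rules, apply_rules, enc_pair, enc_cons, enc_nil, enc_true, enc_false]
  exact ⟨trivial, by omega⟩

omit [DecidableEq κ] in
theorem det_divideSwap_of_removedCount (B : List (Edge κ)) {ex : List (Exch κ)} (δ : List ℝ≥0)
    (h : removedCount ex = 0) :
    Det P (.call 38) (.pair (.pair (enc fun _ : κ => false) (enc (id : κ → κ)))
      (.pair (enc B) (.pair (enc ex) (enc δ)))) (enc (edgeIds B))
      (100 * (B.length + exSize ex + 1)) := by
  rcases B with _ | ⟨t, B⟩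
  · exact (det_divideSwap_nil ex δ).mono (by omega)
  refine WP.det ?_
  have hi := det_edgeIds (P := P) (t :: B)
  rw [enc_cons] at hi
  have h1 : Det P (.call 38) (.pair (.pair (enc fun _ : κ => false) (enc (id : κ → κ)))
      (.pair (enc (t :: B)) (.pair (enc ex) (enc δ)))) (enc (edgeIds (t :: B)))
      (100 * (exSize ex + 1) + 30 * ((t :: B).length + 1) + 40) := by
    refine det_call_of_wp HasDivide.divideSwap ?_
    simp only [Code.divideSwap, wp_ite, wp_comp, wp_op, wp_pair, apply_fst, apply_snd, enc_cons,
      isNil_pair, cond_false, apply_zero]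
    refine (det_removedCount ex).wp ?_
    rw [h]
    simp only [apply_lt, lt_irrefl, decide_false, isNil_ofBool, Bool.not_false, cond_true,
      apply_nil]
    refine hi.wp ?_
    exact ⟨rfl, by omega⟩
  refine h1.wp ⟨rfl, ?_⟩
  simp only [List.length_cons]
  omega

/-- The number of removed edges halves from level to level, so `d` levels suffice. The trees of the
two halves have at most `K` and `2 * K` edges, and the sizes of their exchanges add up to less than
`K`. Hence every level below the top one costs a multiple of `K`, and `B.length` is paid only once.
Merged trees have at most `2 * K` edges, whose searches have length at most `8 * K + 1`; this is the
condition on `m`. -/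
theorem rnd_divideSwap (m d : ℕ) (B : List (Edge κ)) (ex : List (Exch κ)) (δ : List ℝ≥0)
    (hδ : δ.length = ex.length + 1) (hd : removedCount ex < 2 ^ d)
    (hm : 8 * exSize ex + 1 ≤ 2 ^ m) :
    Rnd P (.call 38) (.pair (.pair (enc fun _ : κ => false) (enc (id : κ → κ)))
      (.pair (enc B) (.pair (enc ex) (enc δ)))) ((divideSwap m d B ex δ).map enc)
      (10000000 * (unitCost κ * (m + 1) * (B.length + 12 * exSize ex * (d + 1) + 1))) := by
  have hu := le_unitCost κ
  have hun : ∀ n, 1000 * n ≤ unitCost κ * (m + 1) * n := fun n => Nat.mul_le_mul_right _ (by nlinarith)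
  induction d generalizing B ex δ with
  | zero =>
    have h0 : removedCount ex = 0 := by simpa using hd
    rw [divideSwap_of_removedCount m 0 B δ h0, PMF.pure_map]
    refine ((det_divideSwap_of_removedCount B δ h0).mono ?_).rnd
    have := hun (B.length + 12 * exSize ex * (0 + 1) + 1)
    omega
  | succ d ih =>
    rcases B with _ | ⟨⟨fl, e, x, y⟩, B⟩
    · rw [divideSwap_nil, PMF.pure_map]
      refine ((det_divideSwap_nil ex δ).mono ?_).rnd
      have := hun (([] : List (Edge κ)).length + 12 * exSize ex * (d + 1 + 1) + 1)
      omega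
    by_cases h0 : removedCount ex = 0
    · rw [divideSwap_of_removedCount m _ _ δ h0, PMF.pure_map]
      refine ((det_divideSwap_of_removedCount _ δ h0).mono ?_).rnd
      have h1 := hun (((fl, e, x, y) :: B).length + 12 * exSize ex * (d + 1 + 1) + 1)
      have h2 : exSize ex ≤ 12 * exSize ex * (d + 1 + 1) := by nlinarith
      omega
    have hex : ex ≠ [] := by rintro rfl; exact h0 rfl
    have hD := divide_bounded x ((fl, e, x, y) :: B) ex δ hex hδ
    have h1 := det_divide (P := P) fl e x y B ex δ hex (by omega)
    rw [divideSwap, if_neg h0]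
    generalize divide x ((fl, e, x, y) :: B) ex δ = D at *
    set v : Val := .pair (.pair (enc fun _ : κ => false) (enc (id : κ → κ)))
      (.pair (enc ((fl, e, x, y) :: B)) (.pair (enc ex) (enc δ))) with hv
    have c1 : Det P (.pair .π0 (.on 37 .self)) v
        (.pair (.pair (enc fun _ : κ => false) (enc (id : κ → κ))) D.toVal) _ :=
      Det.pair (det_op _ _) (Det.comp (det_op _ _) h1)
    have hsz := hD.sizes
    have hrl := hD.removed_left
    have hrr := hD.removed_right
    rw [pow_succ] at hd
    have il := ih D.B D.left D.leftWeights hD.leftWeights (by omega) (by omega)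
    have ir := ih D.B' D.right D.rightWeights hD.rightWeights (by omega) (by omega)
    have hinj : ∀ w : Val, Function.Injective fun X : List κ => Val.pair (enc X) w :=
      fun w l l' h => by
        simp only [Val.pair.injEq, and_true] at h
        exact enc_list_injective enc_key_injective h
    have c2 : Det P (.pair .π0 .π3)
        (.pair (.pair (enc fun _ : κ => false) (enc (id : κ → κ))) D.toVal)
        (.pair (.pair (enc fun _ : κ => false) (enc (id : κ → κ)))
          (.pair (enc D.B) (.pair (enc D.left) (enc D.leftWeights)))) 20 := by
      refine WP.det ?_
      rw [Division.toVal]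
      simp only [wp_rules, apply_rules, enc_pair, enc_cons, enc_nil, enc_true, enc_false]
      exact ⟨trivial, by omega⟩
    have c3 := Rnd.after_det c1 (Rnd.det_pair (Rnd.after_det c2 il)
      (det_op .id (.pair (.pair (enc fun _ : κ => false) (enc (id : κ → κ))) D.toVal)))
    have hX : ∀ X ∈ (divideSwap m d D.B D.left D.leftWeights).support,
        X.length ≤ 18 * exSize ex + 1 := fun X hX => by
      have := length_of_mem_divideSwap hD.leftWeights hX
      have := hD.B
      omega
    have hY : ∀ Y ∈ (divideSwap m d D.B' D.right D.rightWeights).support,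
        Y.length ≤ 18 * exSize ex + 1 := fun Y hY => by
      have := length_of_mem_divideSwap hD.rightWeights hY
      have := hD.B'
      omega
    have c4 := fun (X : List κ) (hX : X.length ≤ 18 * exSize ex + 1) =>
      Rnd.bind (hinj (.pair (enc X) (.pair (.pair (enc fun _ : κ => false) (enc (id : κ → κ)))
        D.toVal))) (f := .comp (.call 4) (.pair
            (.on 21 (.pair .π2 (.pair
              (.pair (.on 35 (.comp .τ2 (.comp .π0 .τ5))) (.on 35 (.comp .τ2 (.comp .τ1 .τ5))))
              (.pair (.gather (.on 34 (.pair (.comp .π0 .π2) .π1)) .π3)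
                (.gather (.on 34 (.pair (.comp .π0 .π2) .π0)) .π3)))))
            .π4))
        (g := .pair (.on 38 (.pair .π1 (.comp .τ4 .τ1))) .self) (P := P)
        (v := .pair (enc X) (.pair (.pair (enc fun _ : κ => false) (enc (id : κ → κ)))
          D.toVal))
        (Rnd.det_pair (Rnd.after_det (s := 30) (WP.det (by
          rw [Division.toVal]
          simp only [wp_rules, apply_rules, enc_pair, enc_cons, enc_nil, enc_true, enc_false]
          exact ⟨trivial, by omega⟩)) ir) (det_op .id _))
        fun Y h => rnd_mergeHalves m D X Y hD hX (hY Y h) hm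
    have c5 := Rnd.bind (hinj (.pair (.pair (enc fun _ : κ => false) (enc (id : κ → κ)))
        D.toVal)) c3 fun X h => c4 X (hX X h)
    have c6 : Det P (.comp (.op .lt) (.pair (.op .zero) (.on 22 (.pair (.op .zero) .π2)))) v
        (.pair .nil .nil) (100 * (exSize ex + 1) + 30) := by
      refine WP.det ?_
      rw [hv]
      simp only [wp_rules, apply_rules, enc_pair, enc_cons, enc_nil, enc_true, enc_false, apply_zero]
      refine (det_removedCount ex).wp ?_
      simp only [apply_lt, Nat.pos_of_ne_zero h0, decide_true]
      exact ⟨rfl, by omega⟩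
    have c7 := Rnd.ite (g := .on 36 (.pair .nil .π1)) c6 c5
    have c8 : Det P .π1 v (enc ((fl, e, x, y) :: B)) 10 := by
      refine WP.det ?_
      rw [hv]
      simp only [wp_rules, apply_rules, enc_pair, enc_cons, enc_nil, enc_true, enc_false]
      exact ⟨trivial, by omega⟩
    have c9 := Rnd.call (HasDivide.divideSwap (P := P)) (Rnd.ite (g := .nil) c8 c7)
    refine c9.mono ?_
    have g1 := hD.B
    have g2 := hD.B'
    clear c9 c8 c7 c6 c5 c4 c3 c2 c1 il ir ih hX hY hinj h1 hv hD
    generalize ((fl, e, x, y) :: B).length = b at *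
    generalize D.B.length = b1 at *
    generalize D.B'.length = b2 at *
    generalize exSize D.left = KL at *
    generalize exSize D.right = KR at *
    generalize exSize ex = K at *
    have e1 : unitCost κ * ((b + K + (18 * K + 1) + 1) * (m + 1)) =
        unitCost κ * (m + 1) * (b + K + (18 * K + 1) + 1) := by ring
    rw [e1]
    have g3 : unitCost κ * (b + K + 1) ≤ unitCost κ * (m + 1) * (b + K + 1) :=
      Nat.mul_le_mul_right _ (Nat.le_mul_of_pos_right _ (by omega))
    generalize unitCost κ * (m + 1) = W at *
    -- Of the `12 * K` units that an additional level provides, `3 * K` pay for the trees handed to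
    -- the two halves; the remaining `9 * K` cover the local work.
    have g4 : W * (b1 + 12 * KL * (d + 1) + 1) + W * (b2 + 12 * KR * (d + 1) + 1) ≤
        W * (3 * K + 12 * K * (d + 1) + 2) := by
      rw [← mul_add]
      refine Nat.mul_le_mul_left _ ?_
      have : 12 * KL * (d + 1) + 12 * KR * (d + 1) ≤ 12 * K * (d + 1) := by
        rw [← add_mul, ← mul_add]
        exact Nat.mul_le_mul_right _ (by omega)
      omega
    have g5 := hun (b + K + 1)
    have e2 : W * (b + 12 * K * (d + 1 + 1) + 1) =
        W * (3 * K + 12 * K * (d + 1) + 2) + W * b + 9 * (W * K) - W := by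
      refine (Nat.sub_eq_of_eq_add ?_).symm
      ring
    have e3 : W ≤ W * K := Nat.le_mul_of_pos_right _ (by omega)
    rw [e2]
    have e4 : W * (b + K + 1) = W * b + W * K + W := by ring
    have e5 : W * (b + K + (18 * K + 1) + 1) = W * b + 19 * (W * K) + 2 * W := by ring
    rw [e4] at g3 g5
    rw [e5]
    omega

end DivideSwap

/-! ### Sorting the labels -/

/-- Combines neighbouring elements of a list. -/
def pairUp {α : Type*} (f : α → α → α) : List α → List α
  | a :: b :: l => f a b :: pairUp f l
  | l => l

theorem length_pairUp {α : Type*} (f : α → α → α) (l : List α) {n : ℕ} (h : l.length ≤ 2 ^ (n + 1)) :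
    (pairUp f l).length ≤ 2 ^ n := by
  suffices 2 * (pairUp f l).length ≤ l.length + 1 by
    rw [pow_succ] at h
    omega
  clear h
  fun_induction pairUp f l with
  | case1 a b l ih => simp only [List.length_cons]; omega
  | case2 l hl =>
    rcases l with _ | ⟨a, _ | ⟨b, l⟩⟩
    · simp
    · simp
    · exact (hl a b l rfl).elim

theorem pairUp_iterate_of_length_le {α : Type*} (f : α → α → α) {l : List α} (h : l.length ≤ 1)
    (n : ℕ) : (pairUp f)^[n] l = l := by
  refine Function.iterate_fixed ?_ n
  rcases l with _ | ⟨a, _ | ⟨b, l⟩⟩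
  · rfl
  · rfl
  · simp at h

theorem length_pairUp_iterate {α : Type*} (f : α → α → α) (n : ℕ) (l : List α)
    (h : l.length ≤ 2 ^ n) : ((pairUp f)^[n] l).length ≤ 1 := by
  induction n generalizing l with
  | zero => simpa using h
  | succ n ih => exact ih _ (length_pairUp f l h)

theorem pairUp_ne_nil {α : Type*} (f : α → α → α) {l : List α} (h : l ≠ []) : pairUp f l ≠ [] := by
  rcases l with _ | ⟨a, _ | ⟨b, l⟩⟩
  · exact h
  · exact h
  · simp [pairUp]

theorem pairUp_iterate_eq_singleton {α : Type*} (f : α → α → α) (n : ℕ) (l : List α) (hl : l ≠ [])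
    (h : l.length ≤ 2 ^ n) : ∃ a, (pairUp f)^[n] l = [a] := by
  have h1 := length_pairUp_iterate f n l h
  have h2 : (pairUp f)^[n] l ≠ [] := by
    clear h h1
    induction n generalizing l with
    | zero => exact hl
    | succ n ih => exact ih _ (pairUp_ne_nil f hl)
  generalize (pairUp f)^[n] l = l' at *
  rcases l' with _ | ⟨a, _ | ⟨b, l'⟩⟩
  · exact (h2 rfl).elim
  · exact ⟨a, rfl⟩
  · simp at h1

/-- The union of two strictly increasing lists. -/
def mergeUnion : List ℕ → List ℕ → List ℕ
  | [], l' => l'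
  | a :: l, [] => a :: l
  | a :: l, b :: l' =>
    if a < b then a :: mergeUnion l (b :: l')
    else if b < a then b :: mergeUnion (a :: l) l'
    else a :: mergeUnion l l'
termination_by l l' => l.length + l'.length

theorem mem_mergeUnion (l l' : List ℕ) (x : ℕ) : x ∈ mergeUnion l l' ↔ x ∈ l ∨ x ∈ l' := by
  fun_induction mergeUnion l l' with
  | case1 l' => simp
  | case2 a l => simp
  | case3 a l b l' h ih => rw [List.mem_cons, ih]; simp; tauto
  | case4 a l b l' h h' ih => rw [List.mem_cons, ih]; simp; tauto
  | case5 a l b l' h h' ih =>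
    have : a = b := by omega
    subst this
    rw [List.mem_cons, ih]; simp; tauto

theorem pairwise_mergeUnion (l l' : List ℕ) (h : l.Pairwise (· < ·)) (h' : l'.Pairwise (· < ·)) :
    (mergeUnion l l').Pairwise (· < ·) := by
  fun_induction mergeUnion l l' with
  | case1 l' => exact h'
  | case2 a l => exact h
  | case3 a l b l' hab ih =>
    rw [List.pairwise_cons] at h h' ⊢
    refine ⟨fun x hx => ?_, ih h.2 (List.pairwise_cons.2 h')⟩
    rw [mem_mergeUnion, List.mem_cons] at hx
    rcases hx with hx | rfl | hx
    · exact h.1 x hx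
    · exact hab
    · exact hab.trans (h'.1 x hx)
  | case4 a l b l' hab hba ih =>
    rw [List.pairwise_cons] at h h' ⊢
    refine ⟨fun x hx => ?_, ih (List.pairwise_cons.2 h) h'.2⟩
    rw [mem_mergeUnion, List.mem_cons] at hx
    rcases hx with (rfl | hx) | hx
    · exact hba
    · exact hba.trans (h.1 x hx)
    · exact h'.1 x hx
  | case5 a l b l' hab hba ih =>
    rw [List.pairwise_cons] at h h' ⊢
    refine ⟨fun x hx => ?_, ih h.2 h'.2⟩
    rw [mem_mergeUnion] at hx
    have : a = b := by omega
    subst this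
    exact hx.elim (h.1 x) (h'.1 x)

theorem length_mergeUnion_le (l l' : List ℕ) :
    (mergeUnion l l').length ≤ l.length + l'.length := by
  fun_induction mergeUnion l l' with
  | case1 l' => simp
  | case2 a l => simp
  | case3 a l b l' h ih => simp only [List.length_cons] at ih ⊢; omega
  | case4 a l b l' h h' ih => simp only [List.length_cons] at ih ⊢; omega
  | case5 a l b l' h h' ih => simp only [List.length_cons] at ih ⊢; omega

theorem pairUp_mergeUnion (L : List (List ℕ)) (hL : ∀ l ∈ L, l.Pairwise (· < ·)) :
    (∀ l ∈ pairUp mergeUnion L, l.Pairwise (· < ·)) ∧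
      ∀ x, (∃ l ∈ pairUp mergeUnion L, x ∈ l) ↔ ∃ l ∈ L, x ∈ l := by
  fun_induction pairUp mergeUnion L with
  | case1 a b l ih =>
    obtain ⟨h1, h2⟩ := ih fun l' hl' => hL l' (by simp [hl'])
    refine ⟨?_, fun x => ?_⟩
    · rintro l' hl'
      rw [List.mem_cons] at hl'
      rcases hl' with rfl | hl'
      · exact pairwise_mergeUnion a b (hL a (by simp)) (hL b (by simp))
      · exact h1 l' hl'
    · simp only [List.mem_cons, exists_eq_or_imp, h2, mem_mergeUnion]
      tauto
  | case2 L _ => exact ⟨hL, fun x => Iff.rfl⟩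

/-- The sorted list of the elements of some lists. -/
theorem sorted_labels (n : ℕ) (L : List (List ℕ)) (hL : ∀ l ∈ L, l.Pairwise (· < ·)) (hne : L ≠ [])
    (h : L.length ≤ 2 ^ n) :
    ∃ u, (pairUp mergeUnion)^[n] L = [u] ∧ u.Pairwise (· < ·) ∧ ∀ x, x ∈ u ↔ ∃ l ∈ L, x ∈ l := by
  obtain ⟨u, hu⟩ := pairUp_iterate_eq_singleton mergeUnion n L hne h
  have key : (∀ l ∈ (pairUp mergeUnion)^[n] L, l.Pairwise (· < ·)) ∧
      ∀ x, (∃ l ∈ (pairUp mergeUnion)^[n] L, x ∈ l) ↔ ∃ l ∈ L, x ∈ l := by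
    clear hu h hne
    induction n generalizing L with
    | zero => exact ⟨hL, fun x => Iff.rfl⟩
    | succ n ih =>
      obtain ⟨h1, h2⟩ := pairUp_mergeUnion L hL
      obtain ⟨h3, h4⟩ := ih _ h1
      exact ⟨h3, fun x => (h4 x).trans (h2 x)⟩
  rw [hu] at key
  exact ⟨u, hu, key.1 u (by simp), fun x => by rw [← key.2]; simp⟩

/-! ### Balanced search trees -/

section Balanced

variable {κ : Type*}

/-- Joins two search trees that are given together with their smallest keys. -/
def joinTrees (s t : κ × SearchTree κ) : κ × SearchTree κ := (s.1, .node t.1 s.2 t.2)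

/-- A list of search trees with keys in increasing order. -/
structure IsTreeList (num : κ → ℕ) (u : List κ) (d : ℕ) (L : List (κ × SearchTree κ)) : Prop where
  leaves : (L.flatMap fun s => s.2.leaves) = u
  min : ∀ s ∈ L, s.1 ∈ s.2.leaves ∧ ∀ k ∈ s.2.leaves, num s.1 ≤ num k
  valid : ∀ s ∈ L, s.2.Valid num
  depth : ∀ s ∈ L, s.2.depth ≤ d

/-- The separator of two joined trees is the smallest key on the right; therefore smallest keys are
carried along. The keys of consecutive trees are increasing since the concatenation of the leaves is
the sorted list `u`. -/
theorem IsTreeList.pairUp {num : κ → ℕ} {u : List κ} {d : ℕ} {L : List (κ × SearchTree κ)}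
    (hu : u.Pairwise fun j k => num j < num k) (h : IsTreeList num u d L) :
    IsTreeList num u (d + 1) (pairUp joinTrees L) := by
  fun_induction SwapRounding.pairUp joinTrees L generalizing u with
  | case1 a b l ih =>
    obtain ⟨h1, h2, h3, h4⟩ := h
    simp only [List.flatMap_cons] at h1
    rw [← List.append_assoc] at h1
    rw [← h1, List.pairwise_append] at hu
    obtain ⟨hab, hl, -⟩ := hu
    rw [List.pairwise_append] at hab
    obtain ⟨-, -, hab⟩ := hab
    have hr := ih hl ⟨rfl, fun s hs => h2 s (by simp [hs]), fun s hs => h3 s (by simp [hs]),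
      fun s hs => h4 s (by simp [hs])⟩
    obtain ⟨ha1, ha2⟩ := h2 a (by simp)
    obtain ⟨hb1, hb2⟩ := h2 b (by simp)
    refine ⟨?_, ?_, ?_, ?_⟩
    · rw [List.flatMap_cons, hr.leaves, ← h1]; rfl
    · rintro s hs
      rw [List.mem_cons] at hs
      rcases hs with rfl | hs
      · refine ⟨List.mem_append_left _ ha1, fun k hk => ?_⟩
        rcases List.mem_append.1 hk with hk | hk
        · exact ha2 k hk
        · exact (hab _ ha1 _ hk).le
      · exact hr.min s hs
    · rintro s hs
      rw [List.mem_cons] at hs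
      rcases hs with rfl | hs
      · exact ⟨fun k hk => hab k hk _ hb1, hb2, h3 a (by simp), h3 b (by simp)⟩
      · exact hr.valid s hs
    · rintro s hs
      rw [List.mem_cons] at hs
      rcases hs with rfl | hs
      · have := h4 a (by simp)
        have := h4 b (by simp)
        simp only [joinTrees, SearchTree.depth]
        omega
      · exact hr.depth s hs
  | case2 L _ => exact ⟨h.leaves, h.min, h.valid, fun s hs => (h.depth s hs).trans d.le_succ⟩

/-- Joining neighbours halves the number of trees and increases the depth by at most one, so `n`
rounds suffice for `2 ^ n` keys and give depth at most `n`. -/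
theorem exists_balanced {num : κ → ℕ} {u : List κ} (hu : u.Pairwise fun j k => num j < num k)
    (hne : u ≠ []) {n : ℕ} (h : u.length ≤ 2 ^ n) :
    ∃ s, (pairUp joinTrees)^[n] (u.map fun k => (k, SearchTree.leaf k)) = [s] ∧
      s.2.Valid num ∧ s.2.leaves = u ∧ s.2.depth ≤ n := by
  obtain ⟨s, hs⟩ := pairUp_iterate_eq_singleton joinTrees n
    (u.map fun k => (k, SearchTree.leaf k)) (by simpa) (by simpa)
  have key : ∀ n d (L : List (κ × SearchTree κ)), IsTreeList num u d L →
      IsTreeList num u (d + n) ((pairUp joinTrees)^[n] L) := by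
    intro n
    induction n with
    | zero => exact fun d L h => h
    | succ n ih =>
      intro d L h
      have := ih (d + 1) _ (h.pairUp hu)
      rwa [add_right_comm] at this
  have h0 := key n 0 (u.map fun k => (k, SearchTree.leaf k)) ⟨by
    rw [List.flatMap_map]
    exact List.flatMap_singleton' u, by simp [SearchTree.leaves], by simp [SearchTree.Valid],
    by simp [SearchTree.depth]⟩
  rw [hs] at h0
  have h1 := h0.leaves
  simp only [List.flatMap_cons, List.flatMap_nil, List.append_nil] at h1
  exact ⟨s, hs, h0.valid s (by simp), h1, by simpa using h0.depth s (by simp)⟩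

end Balanced

/-- The keys taken from a strictly increasing list of numbers. -/
@[reducible] noncomputable def keysOfSorted (u : List ℕ) (hu : u.Pairwise (· < ·)) (hne : u ≠ []) (n : ℕ)
    (h : u.length ≤ 2 ^ n) : Keys {k // k ∈ u} :=
  have ex := exists_balanced (num := fun k : {k // k ∈ u} => k.1) (u := u.attach)
    (List.pairwise_iff_getElem.2 fun i j hi hj hij => by
      simpa using List.pairwise_iff_getElem.1 hu i j (by simpa using hi) (by simpa using hj) hij)
    (by simpa) (n := n) (by simpa)
  { num := fun k => k.1
    num_injective := Subtype.val_injective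
    tree := ex.choose.2
    valid := ex.choose_spec.2.1
    complete := fun k => by rw [ex.choose_spec.2.2.1]; exact List.mem_attach _ _
    cost := n + 1
    depth_lt := Nat.lt_succ_of_le ex.choose_spec.2.2.2 }

/-! ### The main program -/

/-- A tree under construction is represented by two dictionaries at once, the identity and the
constant `false`. These are the dictionaries from which all others arise by updates. -/
instance {κ : Type*} [Keys κ] : Enc (SearchTree κ) :=
  ⟨fun t => .pair (t.toVal Keys.num (id : κ → κ)) (t.toVal Keys.num fun _ : κ => false)⟩

namespace Code
variable {k : ℕ}

/-- One round of combining neighbouring elements. -/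
def pairUp (i : Fin k) (c : Code k) : Code k := .ite .τ1 (.pair c (.comp (.call i) .τ2)) .self

/-- Rounds until one element is left. -/
def pairUpLoop (i j : Fin k) : Code k :=
  .ite .τ1 (.comp (.call j) (.comp (.call i) .self)) .self

def labels : Code (k + 1) :=
  .pair (.pair .π1 .nil) (.pair (.pair .π2 .nil) (.pair (.pair .τ3 .nil) .π0))

def mergeUnion : Code (k + 1) :=
  .ite .π0
    (.ite .τ1
      (.ite (.comp (.op .lt) (.pair (.comp .π0 .π0) .π1))
        (.pair (.comp .π0 .π0) (.on 41 (.pair (.comp .τ1 .π0) .τ1)))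
        (.ite (.comp (.op .lt) (.pair .π1 (.comp .π0 .π0)))
          (.pair .π1 (.on 41 (.pair .π0 .τ2)))
          (.pair (.comp .π0 .π0) (.on 41 (.pair (.comp .τ1 .π0) .τ2)))))
      .π0)
    .τ1

def joinTrees : Code (k + 1) :=
  .pair (.comp .π0 .π0) (.pair
    (.pair (.comp .π0 .π1) (.pair (.comp .π1 .π0) (.comp .π1 .π1)))
    (.pair (.comp .π0 .π1) (.pair (.comp .τ2 .π0) (.comp .τ2 .π1))))

/-- The argument is the input `(T, (ex, δ))`. -/
def main : Code (k + 1) :=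
  .letIn (.comp .π0 (.on 46 (.on 44 (.pair .nil (.comp .π0 (.on 43
      (.on 40 (.pair (.on 39 (.pair (.pair (.pair (.op .zero) .nil) .nil) .π0)) .π1))))))))
    (.on 38 (.pair (.pair (.comp .τ2 .π0) (.comp .π1 .π0))
      (.pair (.on 47 (.pair .nil .π1)) (.pair (.on 48 (.pair .nil .π2)) .τ3))))

end Code

class HasMain (P : Program) : Prop extends HasDivide P where
  main : P.body 0 = .main
  labels : P.body 39 = .fold 39 .labels
  allLabels : P.body 40 = .fold 40 (.on 39 (.pair (.on 39 (.pair .π0 .π1)) .τ2))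
  mergeUnion : P.body 41 = .mergeUnion
  mergeRound : P.body 42 = .pairUp 42 (.on 41 (.pair .π0 .π1))
  mergeLoop : P.body 43 = .pairUpLoop 42 43
  leaves : P.body 44 = .mapList 44 (.pair .τ1 (.pair (.pair .nil .τ1) (.pair .nil .nil)))
  joinRound : P.body 45 = .pairUp 45 .joinTrees
  joinLoop : P.body 46 = .pairUpLoop 45 46
  edges : P.body 47 = .mapList 47 (.pair .nil .τ1)
  exchanges : P.body 48 = .mapList 48
    (.pair (.on 47 (.pair .nil .π1)) (.on 47 (.pair .nil .τ2)))

/-! ### Repeated combination of neighbours: results and costs -/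

section Reduction

variable {P : Program} {α : Type*} [Enc α] {f : α → α → α} {i j : Fin (P.last + 1)}
  {c : Code (P.last + 1)} {t : α → ℕ}

theorem apply_snd_nil : Op.snd.apply .nil = .nil := rfl

theorem Det.pairUp (hi : P.body i = .pairUp i c)
    (hc : ∀ a b v, Steps P c (.pair (enc a) (.pair (enc b) v)) (enc (f a b)) (t a + t b))
    (l : List α) :
    Det P (.call i) (enc l) (enc (pairUp f l)) ((l.map fun x => t x + 30).sum + 20) := by
  fun_induction SwapRounding.pairUp f l with
  | case1 a b l ih =>
    refine det_call_of_wp hi ?_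
    simp only [Code.pairUp, wp_rules, apply_rules, enc_pair, enc_cons, enc_nil, enc_true, enc_false]
    refine (hc a b _).wp fun s hs => ?_
    refine ih.wp ⟨rfl, ?_⟩
    simp only [List.map_cons, List.sum_cons]
    omega
  | case2 l hl =>
    refine det_call_of_wp hi ?_
    rcases l with _ | ⟨a, _ | ⟨b, l⟩⟩
    · simp only [Code.pairUp, wp_rules, apply_rules, enc_pair, enc_cons, enc_nil, enc_true, enc_false, apply_snd_nil]
      exact ⟨trivial, by omega⟩
    · simp only [Code.pairUp, wp_rules, apply_rules, enc_pair, enc_cons, enc_nil, enc_true, enc_false]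
      exact ⟨trivial, by omega⟩
    · exact (hl a b l rfl).elim

omit [Enc α] in
theorem sum_pairUp_le (ht : ∀ a b, t (f a b) ≤ t a + t b) (l : List α) :
    ((pairUp f l).map t).sum ≤ (l.map t).sum := by
  fun_induction SwapRounding.pairUp f l with
  | case1 a b l ih =>
    have := ht a b
    simp only [List.map_cons, List.sum_cons]
    omega
  | case2 l hl => exact le_rfl

/-- The measure `t` is subadditive under `f`, so the total size never grows and each round costs no
more than the bound for the first. This is bottom-up merge sort when `f` is `mergeUnion`. -/
theorem Det.pairUp_iterate (hi : P.body i = .pairUp i c) (hj : P.body j = .pairUpLoop i j)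
    (hc : ∀ a b v, Steps P c (.pair (enc a) (.pair (enc b) v)) (enc (f a b)) (t a + t b))
    (ht : ∀ a b, t (f a b) ≤ t a + t b) (n : ℕ) (l : List α) (hl : l.length ≤ 2 ^ n) :
    Det P (.call j) (enc l) (enc ((SwapRounding.pairUp f)^[n] l))
      ((n + 1) * ((l.map fun x => t x + 30).sum + 60)) := by
  have triv : ∀ n, ∀ l : List α, l.length ≤ 1 → Det P (.call j) (enc l)
      (enc ((SwapRounding.pairUp f)^[n] l)) 20 := fun n l hl => by
    rw [pairUp_iterate_of_length_le f hl]
    refine det_call_of_wp hj ?_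
    rcases l with _ | ⟨a, _ | ⟨b, l⟩⟩
    · simp only [Code.pairUpLoop, wp_rules, apply_rules, enc_pair, enc_cons, enc_nil, enc_true, enc_false, apply_snd_nil]
      exact ⟨trivial, by omega⟩
    · simp only [Code.pairUpLoop, wp_rules, apply_rules, enc_pair, enc_cons, enc_nil, enc_true, enc_false]
      exact ⟨trivial, by omega⟩
    · simp at hl
  induction n generalizing l with
  | zero => exact (triv 0 l (by simpa using hl)).mono (by omega)
  | succ n ih =>
    by_cases h : l.length ≤ 1
    · exact (triv (n + 1) l h).mono
        ((by omega : 20 ≤ _ + 60).trans (Nat.le_mul_of_pos_left _ (by omega)))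
    · obtain ⟨a, b, l', rfl⟩ : ∃ a b l', l = a :: b :: l' := by
        rcases l with _ | ⟨a, _ | ⟨b, l⟩⟩
        · simp at h
        · simp at h
        · exact ⟨a, b, l, rfl⟩
      have h1 := Det.pairUp hi hc (a :: b :: l')
      have h2 := ih _ (length_pairUp f _ hl)
      have h3 := sum_pairUp_le (f := f) (t := fun x => t x + 30)
        (fun a b => (Nat.add_le_add_right (ht a b) 30).trans (by omega)) (a :: b :: l')
      rw [Function.iterate_succ_apply]
      refine det_call_of_wp hj ?_
      simp only [Code.pairUpLoop, wp_ite, wp_comp, wp_op, apply_snd, apply_id, enc_cons,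
        isNil_pair, cond_false]
      rw [enc_cons, enc_cons] at h1
      refine h1.wp (h2.wp ⟨rfl, ?_⟩)
      have := Nat.mul_le_mul_left (n + 1) (Nat.add_le_add_right h3 60)
      generalize ((a :: b :: l').map fun x => t x + 30).sum = A at *
      generalize ((SwapRounding.pairUp f (a :: b :: l')).map fun x => t x + 30).sum = B at *
      linarith

end Reduction

/-! ### Labels of the input and the main procedure -/

section Labels

/-- An edge with numbers as labels. -/
abbrev RawEdge := ℕ × ℕ × ℕ

def edgeLabels (acc : List (List ℕ)) (t : RawEdge) : List (List ℕ) :=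
  [t.1] :: [t.2.1] :: [t.2.2] :: acc

def exchLabels (acc : List (List ℕ)) (p : List RawEdge × List RawEdge) : List (List ℕ) :=
  p.2.foldl edgeLabels (p.1.foldl edgeLabels acc)

/-- Singletons with all labels that occur in the input. -/
def allLabels (T : List RawEdge) (ex : List (List RawEdge × List RawEdge)) : List (List ℕ) :=
  ex.foldl exchLabels (T.foldl edgeLabels [[0]])

variable {P : Program} [HasMain P]

theorem det_labels (acc : List (List ℕ)) (l : List RawEdge) :
    Det P (.call 39) (.pair (enc acc) (enc l)) (enc (l.foldl edgeLabels acc))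
      (60 * (l.length + 1)) := by
  refine Det.foldl (f := edgeLabels) HasMain.labels (s := 40) l (fun a x _ => ?_) acc (by omega)
  obtain ⟨e, x, y⟩ := x
  simp only [Code.labels, wp_rules, apply_rules, enc_pair, enc_cons, enc_nil, enc_true, enc_false]
  exact ⟨rfl, by omega⟩

theorem det_mergeUnion (l l' : List ℕ) :
    Det P (.call 41) (.pair (enc l) (enc l')) (enc (mergeUnion l l'))
      (60 * (l.length + l'.length + 1)) := by
  fun_induction mergeUnion l l' with
  | case1 l' =>
    refine det_call_of_wp HasMain.mergeUnion ?_
    simp only [Code.mergeUnion, wp_rules, apply_rules, enc_pair, enc_cons, enc_nil, enc_true, enc_false]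
    exact ⟨trivial, by omega⟩
  | case2 a l =>
    refine det_call_of_wp HasMain.mergeUnion ?_
    simp only [Code.mergeUnion, wp_rules, apply_rules, enc_pair, enc_cons, enc_nil, enc_true, enc_false]
    exact ⟨trivial, by omega⟩
  | case3 a l b l' h ih =>
    rw [enc_cons] at ih
    refine det_call_of_wp HasMain.mergeUnion ?_
    simp only [Code.mergeUnion, wp_rules, apply_rules, enc_pair, enc_cons, enc_nil, enc_true, enc_false, enc_nat, apply_lt, isNil_ofBool, h, decide_true,
      Bool.not_true]
    refine ih.wp ⟨rfl, ?_⟩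
    simp only [List.length_cons]
    omega
  | case4 a l b l' h h' ih =>
    rw [enc_cons] at ih
    refine det_call_of_wp HasMain.mergeUnion ?_
    simp only [Code.mergeUnion, wp_rules, apply_rules, enc_pair, enc_cons, enc_nil, enc_true, enc_false, enc_nat, apply_lt, isNil_ofBool, h, h', decide_true,
      Bool.not_true, decide_false, Bool.not_false]
    refine ih.wp ⟨rfl, ?_⟩
    simp only [List.length_cons]
    omega
  | case5 a l b l' h h' ih =>
    refine det_call_of_wp HasMain.mergeUnion ?_
    simp only [Code.mergeUnion, wp_rules, apply_rules, enc_pair, enc_cons, enc_nil, enc_true, enc_false, enc_nat, apply_lt, isNil_ofBool, h, h',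
      decide_false, Bool.not_false]
    refine ih.wp ⟨rfl, ?_⟩
    simp only [List.length_cons]
    omega

theorem det_sort (n : ℕ) (L : List (List ℕ)) (hL : L.length ≤ 2 ^ n) :
    Det P (.call 43) (enc L) (enc ((pairUp mergeUnion)^[n] L))
      ((n + 1) * ((L.map fun l => 60 * (l.length + 1) + 30).sum + 60)) := by
  refine Det.pairUp_iterate (HasMain.mergeRound (P := P)) HasMain.mergeLoop
    (t := fun l : List ℕ => 60 * (l.length + 1)) (fun a b v => ?_) (fun a b => ?_) n L hL
  · simp only [wp_rules, apply_rules, enc_pair, enc_cons, enc_nil, enc_true, enc_false]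
    refine (det_mergeUnion a b).wp ⟨rfl, ?_⟩
    omega
  · have := length_mergeUnion_le a b
    omega

variable {κ : Type*} [Keys κ]

theorem det_leaves (u : List κ) :
    Det P (.call 44) (.pair .nil (enc u)) (enc (u.map fun k => (k, SearchTree.leaf k)))
      (50 * (u.length + 1)) := by
  refine Det.map (f := fun (_ : Bool) k => (k, SearchTree.leaf k)) HasMain.leaves (s := 30) false u
    (fun x _ => ?_) (by omega)
  simp only [wp_rules, apply_rules, enc_pair, enc_cons, enc_nil, enc_true, enc_false]
  exact ⟨rfl, by omega⟩

theorem det_join (n : ℕ) (L : List (κ × SearchTree κ)) (hL : L.length ≤ 2 ^ n) :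
    Det P (.call 46) (enc L) (enc ((pairUp joinTrees)^[n] L))
      ((n + 1) * ((L.map fun _ => 110).sum + 60)) := by
  refine Det.pairUp_iterate (HasMain.joinRound (P := P)) HasMain.joinLoop
    (t := fun _ : κ × SearchTree κ => 80) (fun a b v => ?_) (fun a b => by omega) n L hL
  obtain ⟨m, s⟩ := a
  obtain ⟨m', s'⟩ := b
  have e : ∀ t : SearchTree κ, enc t = .pair (t.toVal Keys.num (id : κ → κ))
    (t.toVal Keys.num fun _ : κ => false) := fun _ => rfl
  simp only [Code.joinTrees, e, wp_rules, apply_rules, enc_pair, enc_cons, enc_nil, enc_true, enc_false]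
  exact ⟨rfl, by omega⟩

omit [Keys κ] in
theorem length_foldl_edgeLabels (acc : List (List ℕ)) (l : List RawEdge) :
    (l.foldl edgeLabels acc).length = acc.length + 3 * l.length := by
  induction l generalizing acc with
  | nil => simp
  | cons t l ih => rw [List.foldl_cons, ih, edgeLabels]; simp; omega

omit [Keys κ] in
theorem mem_foldl_edgeLabels (acc : List (List ℕ)) (l : List RawEdge) (a : List ℕ) :
    a ∈ l.foldl edgeLabels acc ↔
      a ∈ acc ∨ ∃ t ∈ l, a = [t.1] ∨ a = [t.2.1] ∨ a = [t.2.2] := by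
  induction l generalizing acc with
  | nil => simp
  | cons t l ih =>
    rw [List.foldl_cons, ih, edgeLabels]
    simp only [List.mem_cons, exists_eq_or_imp]
    generalize (∃ t ∈ l, a = [t.1] ∨ a = [t.2.1] ∨ a = [t.2.2]) = q
    tauto

def rawSize (ex : List (List RawEdge × List RawEdge)) : ℕ :=
  (ex.map fun p => p.1.length + p.2.length + 1).sum

theorem length_allLabels_le (T : List RawEdge) (ex : List (List RawEdge × List RawEdge)) :
    (allLabels T ex).length ≤ 3 * (T.length + rawSize ex) + 1 := by
  suffices ∀ acc, (ex.foldl exchLabels acc).length ≤ acc.length + 3 * rawSize ex by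
    refine (this _).trans ?_
    rw [length_foldl_edgeLabels]
    simp only [List.length_cons, List.length_nil]
    omega
  induction ex with
  | nil => simp
  | cons p ex ih =>
    intro acc
    refine (ih _).trans ?_
    rw [exchLabels, length_foldl_edgeLabels, length_foldl_edgeLabels]
    simp only [rawSize, List.map_cons, List.sum_cons]
    omega

theorem mem_allLabels (T : List RawEdge) (ex : List (List RawEdge × List RawEdge)) (a : List ℕ) :
    a ∈ allLabels T ex ↔ a = [0] ∨
      ∃ t, (t ∈ T ∨ ∃ p ∈ ex, t ∈ p.1 ∨ t ∈ p.2) ∧ (a = [t.1] ∨ a = [t.2.1] ∨ a = [t.2.2]) := by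
  suffices ∀ acc, a ∈ ex.foldl exchLabels acc ↔ a ∈ acc ∨
      ∃ t, (∃ p ∈ ex, t ∈ p.1 ∨ t ∈ p.2) ∧ (a = [t.1] ∨ a = [t.2.1] ∨ a = [t.2.2]) by
    rw [allLabels, this, mem_foldl_edgeLabels, List.mem_singleton, or_assoc]
    refine or_congr_right ?_
    constructor
    · rintro (⟨t, h1, h2⟩ | ⟨t, h1, h2⟩)
      · exact ⟨t, Or.inl h1, h2⟩
      · exact ⟨t, Or.inr h1, h2⟩
    · rintro ⟨t, h1 | h1, h2⟩
      · exact Or.inl ⟨t, h1, h2⟩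
      · exact Or.inr ⟨t, h1, h2⟩
  induction ex with
  | nil => simp
  | cons p ex ih =>
    intro acc
    rw [List.foldl_cons, ih, exchLabels, mem_foldl_edgeLabels, mem_foldl_edgeLabels, or_assoc,
      or_assoc]
    refine or_congr_right ?_
    constructor
    · rintro (⟨t, h1, h2⟩ | ⟨t, h1, h2⟩ | ⟨t, ⟨q, hq, h1⟩, h2⟩)
      · exact ⟨t, ⟨p, by simp, Or.inl h1⟩, h2⟩
      · exact ⟨t, ⟨p, by simp, Or.inr h1⟩, h2⟩
      · exact ⟨t, ⟨q, by simp [hq], h1⟩, h2⟩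
    · rintro ⟨t, ⟨q, hq, h1⟩, h2⟩
      rw [List.mem_cons] at hq
      rcases hq with rfl | hq
      · rcases h1 with h1 | h1
        · exact Or.inl ⟨t, h1, h2⟩
        · exact Or.inr (Or.inl ⟨t, h1, h2⟩)
      · exact Or.inr (Or.inr ⟨t, ⟨q, hq, h1⟩, h2⟩)

/-- Sorting removes duplicates and never increases the total length, so the length of `u` is bounded
by the number of singletons. The label `0` is always included; it makes the list non-empty and
serves as a default. -/
theorem exists_labels (n : ℕ) (T : List RawEdge) (ex : List (List RawEdge × List RawEdge))
    (hn : 8 * (T.length + rawSize ex) + 1 ≤ 2 ^ n) :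
    ∃ u, (pairUp mergeUnion)^[n] (allLabels T ex) = [u] ∧ u.Pairwise (· < ·) ∧ 0 ∈ u ∧
      (∀ t, (t ∈ T ∨ ∃ p ∈ ex, t ∈ p.1 ∨ t ∈ p.2) → t.1 ∈ u ∧ t.2.1 ∈ u ∧ t.2.2 ∈ u) ∧
      u.length ≤ 3 * (T.length + rawSize ex) + 1 := by
  have hl := length_allLabels_le T ex
  have h0 : [0] ∈ allLabels T ex := (mem_allLabels T ex [0]).2 (Or.inl rfl)
  have h1 : ∀ l ∈ allLabels T ex, l.length = 1 := by
    intro l hl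
    rw [mem_allLabels] at hl
    rcases hl with rfl | ⟨t, -, rfl | rfl | rfl⟩ <;> rfl
  obtain ⟨u, hu, hs, hm⟩ := sorted_labels n (allLabels T ex) (fun l hl => by
    obtain ⟨x, rfl⟩ := List.length_eq_one_iff.1 (h1 l hl)
    simp) (List.ne_nil_of_mem h0) (by omega)
  refine ⟨u, hu, hs, (hm 0).2 ⟨_, h0, by simp⟩, fun t ht => ?_, ?_⟩
  · refine ⟨(hm _).2 ⟨[t.1], ?_, by simp⟩, (hm _).2 ⟨[t.2.1], ?_, by simp⟩,
      (hm _).2 ⟨[t.2.2], ?_, by simp⟩⟩ <;> rw [mem_allLabels] <;> right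
    · exact ⟨t, ht, Or.inl rfl⟩
    · exact ⟨t, ht, Or.inr (Or.inl rfl)⟩
    · exact ⟨t, ht, Or.inr (Or.inr rfl)⟩
  · have h2 : ∀ n (L : List (List ℕ)), (((pairUp mergeUnion)^[n] L).map List.length).sum ≤
        (L.map List.length).sum := by
      intro n
      induction n with
      | zero => exact fun L => le_rfl
      | succ n ih => exact fun L => (ih _).trans (sum_pairUp_le length_mergeUnion_le L)
    have h3 := h2 n (allLabels T ex)
    rw [hu, List.map_congr_left h1] at h3
    simp only [List.map_cons, List.map_nil, List.sum_cons, List.sum_nil, List.map_const',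
      List.sum_replicate, smul_eq_mul] at h3
    omega

def rawEdge (t : κ × κ × κ) : RawEdge := (Keys.num t.1, Keys.num t.2.1, Keys.num t.2.2)

/-- A key is encoded by its number. So the input is the same machine value whether it is read as raw
numbers, before the dictionary exists, or as keys. -/
theorem enc_rawEdges (l : List (κ × κ × κ)) : enc (l.map rawEdge) = enc l := by
  rw [enc_list, enc_list, List.map_map]
  rfl

theorem enc_rawExch (ex : List (List (κ × κ × κ) × List (κ × κ × κ))) :
    enc (ex.map fun p => (p.1.map rawEdge, p.2.map rawEdge)) = enc ex := by
  rw [enc_list, enc_list, List.map_map]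
  congr 1
  refine List.map_congr_left fun p _ => ?_
  obtain ⟨p, q⟩ := p
  simp only [Function.comp_apply, enc_pair, enc_rawEdges]

omit [Keys κ] in
def unflagged (l : List (κ × κ × κ)) : List (Edge κ) := l.map fun t => (false, t)

theorem det_edges (l : List (κ × κ × κ)) :
    Det P (.call 47) (.pair .nil (enc l)) (enc (unflagged l)) (30 * (l.length + 1)) := by
  refine Det.map (f := fun (_ : Bool) (t : κ × κ × κ) => (false, t)) HasMain.edges (s := 10) false l
    (fun x _ => ?_) (by omega)
  simp only [wp_rules, apply_rules, enc_pair, enc_cons, enc_nil, enc_true, enc_false]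
  exact ⟨trivial, by omega⟩

theorem det_exchanges (ex : List (List (κ × κ × κ) × List (κ × κ × κ))) :
    Det P (.call 48) (.pair .nil (enc ex)) (enc (ex.map fun p => (unflagged p.1, unflagged p.2)))
      (200 * (exSize (ex.map fun p => (unflagged p.1, unflagged p.2)) + 1)) := by
  refine (Det.map_sum (f := fun (_ : Bool) (p : List (κ × κ × κ) × List (κ × κ × κ)) =>
    (unflagged p.1, unflagged p.2)) HasMain.exchanges
    (fun p => 100 * (p.1.length + p.2.length + 1)) false ex (fun p _ => ?_)).mono ?_
  · obtain ⟨p, q⟩ := p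
    simp only [wp_rules, apply_rules, enc_pair, enc_cons, enc_nil, enc_true, enc_false]
    refine (det_edges p).wp ?_
    refine (det_edges q).wp ?_
    exact ⟨rfl, by omega⟩
  · induction ex with
    | nil => simp
    | cons p ex ih =>
      simp only [List.map_cons, List.sum_cons, exSize_cons, unflagged, List.length_map] at ih ⊢
      omega

theorem det_allLabels (acc : List (List ℕ)) (ex : List (List RawEdge × List RawEdge)) :
    Det P (.call 40) (.pair (enc acc) (enc ex)) (enc (ex.foldl exchLabels acc))
      (200 * (rawSize ex + 1)) := by
  refine (Det.fold_sum (f := exchLabels) HasMain.allLabels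
    (fun p => 60 * (p.1.length + p.2.length + 2) + 30) ex (fun a p _ => ?_) acc).mono ?_
  · obtain ⟨p, q⟩ := p
    simp only [wp_rules, apply_rules, enc_pair, enc_cons, enc_nil, enc_true, enc_false]
    refine (det_labels a p).wp ?_
    refine (det_labels (p.foldl edgeLabels a) q).wp ?_
    exact ⟨rfl, by omega⟩
  · induction ex with
    | nil => simp; omega
    | cons p ex ih =>
      simp only [List.map_cons, List.sum_cons, rawSize] at ih ⊢
      omega

/-- The keys are not known to the program in advance: `hu` and `ht` express that its sorting phase
and its joining phase produce precisely the list of keys and the search tree of the given instance.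
-/
theorem rnd_main [DecidableEq κ] (n : ℕ) (T : List (κ × κ × κ))
    (ex : List (List (κ × κ × κ) × List (κ × κ × κ))) (δ : List ℝ≥0)
    (hδ : δ.length = ex.length + 1) {s : ℕ}
    (hs : T.length + exSize (ex.map fun p => (unflagged p.1, unflagged p.2)) = s)
    (hn : 8 * s + 1 ≤ 2 ^ n) (hk : Keys.cost κ = n + 1) (u : List κ) {m : κ}
    (hul : u.length ≤ 3 * s + 1)
    (hu : (pairUp mergeUnion)^[n] (allLabels (T.map rawEdge)
      (ex.map fun p => (p.1.map rawEdge, p.2.map rawEdge))) = [u.map Keys.num])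
    (ht : (pairUp joinTrees)^[n] (u.map fun k => (k, SearchTree.leaf k)) = [(m, Keys.tree)]) :
    Rnd P (.call 0) (.pair (enc T) (.pair (enc ex) (enc δ)))
      ((divideSwap n n (unflagged T) (ex.map fun p => (unflagged p.1, unflagged p.2)) δ).map enc)
      (1000000000000 * ((n + 1) ^ 3 * (s + 1))) := by
  set rT := T.map rawEdge with hrT
  set rex := ex.map fun p => (p.1.map rawEdge, p.2.map rawEdge) with hrex
  have hsize : rT.length + rawSize rex = s := by
    rw [← hs, hrT, hrex, rawSize, exSize, List.length_map, List.map_map, List.map_map]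
    simp [Function.comp_def, unflagged]
  have hL := length_allLabels_le rT rex
  have hL1 : ∀ l ∈ allLabels rT rex, 60 * (l.length + 1) + 30 = 150 := by
    intro l hl
    rw [mem_allLabels] at hl
    rcases hl with rfl | ⟨t, -, rfl | rfl | rfl⟩ <;> rfl
  have e0 : enc (u.map (Keys.num : κ → ℕ)) = enc u := by
    rw [enc_list, enc_list, List.map_map]
    rfl
  have hsort := det_sort (P := P) n (allLabels rT rex) (by omega)
  rw [hu, List.map_congr_left hL1, enc_cons, e0] at hsort
  have hjoin := det_join (P := P) n (u.map fun k => (k, SearchTree.leaf k)) (by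
    rw [List.length_map]; omega)
  rw [ht, enc_cons] at hjoin
  set v : Val := .pair (enc T) (.pair (enc ex) (enc δ)) with hv
  have h1 : Det P (.comp .π0 (.on 46 (.on 44 (.pair .nil (.comp .π0 (.on 43
      (.on 40 (.pair (.on 39 (.pair (.pair (.pair (.op .zero) .nil) .nil) .π0)) .π1)))))))) v
      (.pair (enc m) (.pair (enc (id : κ → κ)) (enc fun _ : κ => false)))
      (60 * (rT.length + 1) + 200 * (rawSize rex + 1) + (n + 1) * (150 * (3 * s + 1) + 60) +
        50 * (u.length + 1) + (n + 1) * (110 * (3 * s + 1) + 60) + 100) := by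
    refine WP.det ?_
    rw [hv, ← enc_rawEdges, ← enc_rawExch, ← hrT, ← hrex]
    simp only [wp_rules, apply_rules, enc_pair, enc_cons, enc_nil, enc_true, enc_false, apply_zero]
    have i1 := det_labels (P := P) [[0]] rT
    refine i1.wp ?_
    refine (det_allLabels (rT.foldl edgeLabels [[0]]) rex).wp ?_
    refine hsort.wp ?_
    simp only [wp_rules, apply_rules, enc_pair, enc_cons, enc_nil, enc_true, enc_false]
    refine (det_leaves u).wp ?_
    refine hjoin.wp ?_
    simp only [wp_rules, apply_rules, enc_pair, enc_cons, enc_nil, enc_true, enc_false]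
    refine ⟨rfl, ?_⟩
    simp only [List.map_const', List.length_map, List.sum_replicate, smul_eq_mul]
    have j1 : (n + 1) * ((allLabels rT rex).length * 150 + 60) ≤
        (n + 1) * (150 * (3 * s + 1) + 60) := Nat.mul_le_mul_left _ (by omega)
    have j2 : (n + 1) * (u.length * 110 + 60) ≤
        (n + 1) * (110 * (3 * s + 1) + 60) := Nat.mul_le_mul_left _ (by omega)
    omega
  set ex' := ex.map fun p => (unflagged p.1, unflagged p.2) with hex'
  have hlT : (unflagged T).length = T.length := by simp [unflagged]
  have h2 : Det P (.pair (.pair (.comp .τ2 .π0) (.comp .π1 .π0))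
      (.pair (.on 47 (.pair .nil .π1)) (.pair (.on 48 (.pair .nil .π2)) .τ3)))
      (.pair (.pair (enc m) (.pair (enc (id : κ → κ)) (enc fun _ : κ => false))) v)
      (.pair (.pair (enc fun _ : κ => false) (enc (id : κ → κ)))
        (.pair (enc (unflagged T)) (.pair (enc ex') (enc δ))))
      (30 * (T.length + 1) + 200 * (exSize ex' + 1) + 100) := by
    refine WP.det ?_
    rw [hv]
    simp only [wp_rules, apply_rules, enc_pair, enc_cons, enc_nil, enc_true, enc_false]
    refine (det_edges T).wp ?_
    have i1 := det_exchanges (P := P) ex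
    rw [← hex'] at i1
    refine i1.wp ?_
    exact ⟨rfl, by omega⟩
  have hr := removedCount_le_exSize ex'
  have hK : exSize ex' ≤ s := by rw [← hs]; exact Nat.le_add_left _ _
  have h3 := rnd_divideSwap (P := P) n n (unflagged T) ex' δ (by rw [hδ, hex', List.length_map])
    (by omega) (by omega)
  have h4 := Rnd.call (HasMain.main (P := P)) (Rnd.after_det (Det.pair h1 (det_op .id v))
    (Rnd.after_det h2 h3))
  refine h4.mono ?_
  rw [hlT, unitCost, hk]
  have hul' : rT.length + rawSize rex = T.length + exSize ex' := by omega
  rw [show rT.length = T.length by simp [hrT]] at hul' ⊢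
  generalize T.length = t at *
  generalize exSize ex' = K at *
  generalize rawSize rex = K' at *
  generalize u.length = q at *
  clear h1 h2 h3 h4 hsort hjoin
  have k1 : 1 ≤ (n + 1) ^ 3 := Nat.one_le_pow _ _ (by omega)
  have k2 : (n + 1) ≤ (n + 1) ^ 3 := Nat.le_self_pow (by omega) _
  -- The three factors `n + 1` come from an access to a dictionary, from the recursion of `solve`
  -- and from the recursion of `divideSwap`.
  have k3 : 1000 * (n + 1) * (n + 1) * (t + 12 * K * (n + 1) + 1) ≤
      12000 * ((n + 1) ^ 3 * (s + 1)) := by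
    have : t + 12 * K * (n + 1) + 1 ≤ 12 * (n + 1) * (s + 1) := by subst hs; nlinarith
    calc _ ≤ 1000 * (n + 1) * (n + 1) * (12 * (n + 1) * (s + 1)) := Nat.mul_le_mul_left _ this
      _ = _ := by ring
  have k4 : s + 1 ≤ (n + 1) ^ 3 * (s + 1) := Nat.le_mul_of_pos_left _ (by omega)
  have k5 : (n + 1) * (150 * (3 * s + 1) + 60) ≤ 1000 * ((n + 1) ^ 3 * (s + 1)) := by
    calc _ ≤ (n + 1) ^ 3 * (1000 * (s + 1)) := Nat.mul_le_mul k2 (by omega)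
      _ = _ := by ring
  have k6 : (n + 1) * (110 * (3 * s + 1) + 60) ≤ 1000 * ((n + 1) ^ 3 * (s + 1)) := by
    calc _ ≤ (n + 1) ^ 3 * (1000 * (s + 1)) := Nat.mul_le_mul k2 (by omega)
      _ = _ := by ring
  clear hn
  linarith

end Labels

/-! ### The table of the procedures -/

def table : ℕ → Code 49
  | 0 => .main
  | 1 => .get
  | 2 => .set
  | 3 => .eqNum
  | 4 => .revAppend
  | 5 => .fold 5 .addEdge
  | 6 => .fold 6 (.comp .searchStep .π0)
  | 7 => .search
  | 8 => .fold 8 .contractStep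
  | 9 => .mapList 9 .relabelEdge
  | 10 => .fold 10 .markEdge
  | 11 => .fold 11 .pruneStep
  | 12 => .shrink
  | 13 => .fold 13 .findStep
  | 14 => .halve
  | 15 => .fold 15 .statusStep
  | 16 => .fold 16 .keepStep
  | 17 => .fold 17 .nextStep
  | 18 => .solve
  | 19 => .flipFlags
  | 20 => .mapList 20 .keptEdge
  | 21 => .mergeTrees
  | 22 => .fold 22 (.on 23 (.pair .π0 .π1))
  | 23 => .fold 23 (.comp (.op .succ) .π0)
  | 24 => .fold 24 (.comp (.op .succ) (.comp (.op .succ) .π0))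
  | 25 => .fold 25 .setStep
  | 26 => .fold 26 .markExch
  | 27 => .fold 27 .applyExch
  | 28 => .mapList 28 .flagEdge
  | 29 => .fold 29 .restStep
  | 30 => .mapList 30 .relabelExch
  | 31 => .splitExch
  | 32 => .fold 32 .addedEdges
  | 33 => .fold 33 .gatherStep
  | 34 => .fold 34 (.on 2 (.pair .π0 (.pair .τ1 .tt)))
  | 35 => .fold 35 (.op .addWt)
  | 36 => .mapList 36 .π2
  | 37 => .divide
  | 38 => .divideSwap
  | 39 => .fold 39 .labels
  | 40 => .fold 40 (.on 39 (.pair (.on 39 (.pair .π0 .π1)) .τ2))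
  | 41 => .mergeUnion
  | 42 => .pairUp 42 (.on 41 (.pair .π0 .π1))
  | 43 => .pairUpLoop 42 43
  | 44 => .mapList 44 (.pair .τ1 (.pair (.pair .nil .τ1) (.pair .nil .nil)))
  | 45 => .pairUp 45 .joinTrees
  | 46 => .pairUpLoop 45 46
  | 47 => .mapList 47 (.pair .nil .τ1)
  | _ => .mapList 48 (.pair (.on 47 (.pair .nil .π1)) (.on 47 (.pair .nil .τ2)))

/-- Swap rounding of spanning trees. -/
def swapRounding : Program := ⟨48, fun i => table i⟩

instance : HasMain swapRounding where
  get := rfl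
  set := rfl
  eqNum := rfl
  revAppend := rfl
  adjacency := rfl
  searchRound := rfl
  search := rfl
  contract := rfl
  relabel := rfl
  markEnds := rfl
  prune := rfl
  shrink := rfl
  findEdge := rfl
  halve := rfl
  status := rfl
  keep := rfl
  next := rfl
  solve := rfl
  flipFlags := rfl
  kept := rfl
  merge := rfl
  removedCount := rfl
  addLength := rfl
  addTwice := rfl
  setEdges := rfl
  markExch := rfl
  applyExch := rfl
  flagEdge := rfl
  rest := rfl
  relabelExch := rfl
  splitExch := rfl
  addedEdges := rfl
  gather := rfl
  markIds := rfl
  weightSum := rfl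
  edgeIds := rfl
  divide := rfl
  divideSwap := rfl
  main := rfl
  labels := rfl
  allLabels := rfl
  mergeUnion := rfl
  mergeRound := rfl
  mergeLoop := rfl
  leaves := rfl
  joinRound := rfl
  joinLoop := rfl
  edges := rfl
  exchanges := rfl

/-! ### Swap rounding in a contraction -/

section Lifting

variable {α : Type*} [DecidableEq α] {I : Finset α → Prop} {A : Finset α}

theorem exchange_union {X : Finset α} {p : Finset α × Finset α} (h : Disjoint p.1 A) :
    exchange (X ∪ A) p = exchange X p ∪ A := by
  rw [exchange, exchange, Finset.union_sdiff_distrib, Finset.sdiff_eq_self_of_disjoint h.symm,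
    Finset.union_right_comm]

theorem disjoint_exchange {X : Finset α} {p : Finset α × Finset α} (hX : Disjoint X A)
    (h : Disjoint p.2 A) : Disjoint (exchange X p) A :=
  Finset.disjoint_union_left.2 ⟨hX.mono_left Finset.sdiff_subset, h⟩

theorem union_sdiff_cancel_of_disjoint {X : Finset α} (h : Disjoint X A) : (X ∪ A) \ A = X := by
  rw [Finset.union_sdiff_right, Finset.sdiff_eq_self_of_disjoint h]

theorem MergeLaw.disjoint {a b : ℝ≥0} {X Y : Finset α} {μ : PMF (Finset α)}
    (h : MergeLaw (contractIndep I A) a b X Y μ) (hX : Disjoint X A) :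
    ∀ Z ∈ μ.support, Disjoint Z A := by
  induction h with
  | done B B' _ =>
    intro Z hZ
    rw [PMF.support_pure, Set.mem_singleton_iff] at hZ
    rwa [hZ]
  | swap B B' e e' μ μ' _ _ h1 _ _ _ ih1 ih2 =>
    intro Z hZ
    rw [PMF.mem_support_bind_iff] at hZ
    obtain ⟨c, -, hZ⟩ := hZ
    cases c
    · exact ih2 h1.1 Z hZ
    · exact ih1 hX Z hZ

theorem insert_erase_union {B : Finset α} {e e' : α} (he : e ∈ B) (h : Disjoint B A) :
    insert e' ((B ∪ A).erase e) = insert e' (B.erase e) ∪ A := by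
  rw [Finset.erase_union_distrib, Finset.erase_eq_of_notMem (Finset.disjoint_left.1 h he),
    Finset.insert_union]

theorem union_sdiff_union_of_disjoint {X Y : Finset α} (h : Disjoint X A) :
    (X ∪ A) \ (Y ∪ A) = X \ Y := by
  ext x
  have := fun hx : x ∈ X => Finset.disjoint_left.1 h hx
  simp only [Finset.mem_sdiff, Finset.mem_union]
  tauto

/-- Merging in a contraction. -/
theorem MergeLaw.lift {a b : ℝ≥0} {X Y : Finset α} {μ : PMF (Finset α)}
    (h : MergeLaw (contractIndep I A) a b X Y μ) (hX : Disjoint X A) (hY : Disjoint Y A) :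
    MergeLaw I a b (X ∪ A) (Y ∪ A) (μ.map (· ∪ A)) := by
  induction h with
  | done B B' h =>
    rw [PMF.pure_map]
    exact .done _ _ (by rw [union_sdiff_union_of_disjoint hX, h])
  | swap B B' e e' μ μ' he he' h1 h2 _ _ ih1 ih2 =>
    have e1 := insert_erase_union (e' := e') (Finset.mem_sdiff.1 he).1 hX
    have e2 := insert_erase_union (e' := e) (Finset.mem_sdiff.1 he').1 hY
    have ih1 := ih1 hX h2.1
    have ih2 := ih2 h1.1 hY
    rw [← e2] at ih1
    rw [← e1] at ih2
    have := MergeLaw.swap (Indep := I) (a := a) (a' := b) (B ∪ A) (B' ∪ A) e e' _ _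
      (by rwa [union_sdiff_union_of_disjoint hX]) (by rwa [union_sdiff_union_of_disjoint hY])
      (by rw [e1]; exact h1.2) (by rw [e2]; exact h2.2) ih1 ih2
    rw [PMF.map_bind]
    convert this using 3 with c
    cases c <;> rfl

theorem SwapRoundLaw.disjoint {L : List (ℝ≥0 × Finset α)} {μ : PMF (Finset α)}
    (h : SwapRoundLaw (contractIndep I A) L μ) (hL : ∀ p ∈ L, Disjoint p.2 A) :
    ∀ Z ∈ μ.support, Disjoint Z A := by
  induction h with
  | single a B =>
    intro Z hZ
    rw [PMF.support_pure, Set.mem_singleton_iff] at hZ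
    rw [hZ]
    exact hL (a, B) (by simp)
  | merge L R μL μR κ _ _ hκ ihL ihR =>
    intro Z hZ
    simp only [PMF.mem_support_bind_iff] at hZ
    obtain ⟨X, hX, Y, hY, hZ⟩ := hZ
    exact (hκ X hX Y hY).disjoint (ihL (fun p hp => hL p (by simp [hp])) X hX) Z hZ
  | reorder L L' μ hp _ ih => exact ih fun p h => hL p (hp.subset h)

omit [DecidableEq α] in
theorem totalWeight_map (L : List (ℝ≥0 × Finset α)) (f : Finset α → Finset α) :
    totalWeight (L.map fun p => (p.1, f p.2)) = totalWeight L := by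
  simp [totalWeight, Function.comp_def]

/-- Swap rounding in a contraction. -/
theorem SwapRoundLaw.lift {L : List (ℝ≥0 × Finset α)} {μ : PMF (Finset α)}
    (h : SwapRoundLaw (contractIndep I A) L μ) (hL : ∀ p ∈ L, Disjoint p.2 A) :
    SwapRoundLaw I (L.map fun p => (p.1, p.2 ∪ A)) (μ.map (· ∪ A)) := by
  induction h with
  | single a B =>
    rw [PMF.pure_map]
    exact .single a (B ∪ A)
  | merge L R μL μR κ hl hr hκ ihL ihR =>
    have hL' : ∀ p ∈ L, Disjoint p.2 A := fun p hp => hL p (by simp [hp])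
    have hR' : ∀ p ∈ R, Disjoint p.2 A := fun p hp => hL p (by simp [hp])
    -- The kernel of the lifted merging first removes `A` again. On the supports, whose elements
    -- have the form `X ∪ A` with `X` disjoint from `A`, this recovers `X`.
    have h1 := SwapRoundLaw.merge _ _ _ _ (fun X Y => (κ (X \ A) (Y \ A)).map (· ∪ A))
      (ihL hL') (ihR hR') (by
        intro X hX Y hY
        rw [PMF.support_map] at hX hY
        obtain ⟨X, hX, rfl⟩ := hX
        obtain ⟨Y, hY, rfl⟩ := hY
        have dX := hl.disjoint hL' X hX
        have dY := hr.disjoint hR' Y hY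
        simp only
        rw [union_sdiff_cancel_of_disjoint dX, union_sdiff_cancel_of_disjoint dY,
          totalWeight_map L (· ∪ A), totalWeight_map R (· ∪ A)]
        exact (hκ X hX Y hY).lift dX dY)
    rw [List.map_append]
    convert h1 using 1
    rw [PMF.map_bind, PMF.bind_map]
    refine bind_congr_support fun X hX => ?_
    rw [Function.comp_apply, PMF.map_bind, PMF.bind_map]
    refine bind_congr_support fun Y hY => ?_
    rw [Function.comp_apply, union_sdiff_cancel_of_disjoint (hl.disjoint hL' X hX),
      union_sdiff_cancel_of_disjoint (hr.disjoint hR' Y hY)]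
  | reorder L L' μ hp _ ih =>
    exact .reorder _ _ _ (hp.map _) (ih fun p h => hL p (hp.subset h))

end Lifting

/-! ### Splitting a sequence of bases -/

section Sequences

variable {α : Type*} [DecidableEq α]

@[simp] theorem length_bases (B : Finset α) (ex : List (Finset α × Finset α)) :
    (bases B ex).length = ex.length + 1 := by
  induction ex generalizing B with
  | nil => rfl
  | cons p ex ih => rw [bases, List.length_cons, ih, List.length_cons]

/-- The exchange with index `k` is used only to pass from the left sequence to the first base of the
right one: it occurs in `take (k + 1)` but in neither `take k` nor `drop (k + 1)`. -/
theorem bases_split (B : Finset α) (ex : List (Finset α × Finset α)) {k : ℕ} (hk : k < ex.length) :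
    bases B ex = bases B (ex.take k) ++
      bases ((ex.take (k + 1)).foldl exchange B) (ex.drop (k + 1)) := by
  induction ex generalizing B k with
  | nil => simp at hk
  | cons p ex ih =>
    rcases k with _ | k
    · simp [bases]
    · rw [bases, ih (exchange B p) (k := k) (by simpa using hk)]
      simp [bases]

omit [DecidableEq α] in
theorem splitIndex_lt {ex : List (Finset α × Finset α)} (h : ex ≠ []) :
    splitIndex ex < ex.length := by
  have h1 := Nat.findGreatest_le
    (P := fun k => 2 * removedSize (ex.take k) ≤ removedSize ex) (ex.length - 1)
  have h2 := List.length_pos_iff.2 h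
  rw [splitIndex]
  omega

theorem subset_touched {ex : List (Finset α × Finset α)} {p : Finset α × Finset α} (hp : p ∈ ex) :
    p.1 ⊆ touched ex ∧ p.2 ⊆ touched ex := by
  induction ex with
  | nil => simp at hp
  | cons q ex ih =>
    rw [touched]
    rcases List.mem_cons.1 hp with rfl | hp
    · exact ⟨Finset.subset_union_left.trans Finset.subset_union_left,
        Finset.subset_union_right.trans Finset.subset_union_left⟩
    · exact ⟨(ih hp).1.trans Finset.subset_union_right, (ih hp).2.trans Finset.subset_union_right⟩

theorem bases_union {A : Finset α} (B : Finset α) (ex : List (Finset α × Finset α))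
    (h : ∀ p ∈ ex, Disjoint p.1 A) : bases (B ∪ A) ex = (bases B ex).map (· ∪ A) := by
  induction ex generalizing B with
  | nil => rfl
  | cons p ex ih =>
    rw [bases, bases, exchange_union (h p (by simp)), ih _ fun q hq => h q (by simp [hq])]
    rfl

theorem foldl_exchange_union {A : Finset α} (B : Finset α) (ex : List (Finset α × Finset α))
    (h : ∀ p ∈ ex, Disjoint p.1 A) : ex.foldl exchange (B ∪ A) = ex.foldl exchange B ∪ A := by
  induction ex generalizing B with
  | nil => rfl
  | cons p ex ih =>
    rw [List.foldl_cons, exchange_union (h p (by simp)), ih _ fun q hq => h q (by simp [hq])]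
    rfl

theorem disjoint_foldl_exchange {A B : Finset α} {ex : List (Finset α × Finset α)}
    (hB : Disjoint B A) (h : ∀ p ∈ ex, Disjoint p.2 A) : Disjoint (ex.foldl exchange B) A := by
  induction ex generalizing B with
  | nil => exact hB
  | cons p ex ih =>
    exact ih (disjoint_exchange hB (h p (by simp))) fun q hq => h q (by simp [hq])

theorem disjoint_bases {A B : Finset α} {ex : List (Finset α × Finset α)}
    (hB : Disjoint B A) (h : ∀ p ∈ ex, Disjoint p.2 A) : ∀ X ∈ bases B ex, Disjoint X A := by
  induction ex generalizing B with
  | nil => simpa [bases]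
  | cons p ex ih =>
    intro X hX
    rcases List.mem_cons.1 hX with rfl | hX
    · exact hB
    · exact ih (disjoint_exchange hB (h p (by simp))) (fun q hq => h q (by simp [hq])) X hX

omit [DecidableEq α] in
theorem totalWeight_zip (δ : List ℝ≥0) (L : List (Finset α)) (h : δ.length = L.length) :
    totalWeight (δ.zip L) = δ.sum := by
  rw [totalWeight, List.map_fst_zip h.le]

/-- Divide-and-conquer is swap rounding. -/
theorem DivideSwapLaw.swapRoundLaw {I : Finset α → Prop} {B : Finset α}
    {ex : List (Finset α × Finset α)} {δ : List ℝ≥0} {μ : PMF (Finset α)}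
    (h : DivideSwapLaw I B ex δ μ) (hδ : δ.length = ex.length + 1) :
    SwapRoundLaw I (δ.zip (bases B ex)) μ := by
  induction h with
  | single I B a => exact .single a B
  | split I B ex δ k U μL μR κ hne hk hU _ _ hκ ihL ihR =>
    have hkl : k < ex.length := hk ▸ splitIndex_lt hne
    have d1 : ∀ p ∈ ex, Disjoint p.1 (B \ U) := fun p hp =>
      Finset.disjoint_sdiff.mono_left (hU ▸ (subset_touched hp).1)
    have d2 : ∀ p ∈ ex, Disjoint p.2 (B \ U) := fun p hp =>
      Finset.disjoint_sdiff.mono_left (hU ▸ (subset_touched hp).2)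
    have d3 : Disjoint (B ∩ U) (B \ U) :=
      Finset.disjoint_sdiff.mono_left Finset.inter_subset_right
    have hB : B ∩ U ∪ B \ U = B := by rw [Finset.union_comm, Finset.sdiff_union_inter]
    have l1 : (δ.take (k + 1)).length = (ex.take k).length + 1 := by
      rw [List.length_take, List.length_take]; omega
    have l2 : (δ.drop (k + 1)).length = (ex.drop (k + 1)).length + 1 := by
      rw [List.length_drop, List.length_drop]; omega
    have hL := ihL l1
    have hR := ihR l2
    have dL : ∀ p ∈ (δ.take (k + 1)).zip (bases (B ∩ U) (ex.take k)), Disjoint p.2 (B \ U) :=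
      fun p hp => disjoint_bases d3 (fun q hq => d2 q (List.mem_of_mem_take hq)) _
        (List.of_mem_zip hp).2
    have d4 : Disjoint ((ex.take (k + 1)).foldl exchange (B ∩ U)) (B \ U) :=
      disjoint_foldl_exchange d3 fun q hq => d2 q (List.mem_of_mem_take hq)
    have dR : ∀ p ∈ (δ.drop (k + 1)).zip (bases ((ex.take (k + 1)).foldl exchange (B ∩ U))
        (ex.drop (k + 1))), Disjoint p.2 (B \ U) :=
      fun p hp => disjoint_bases d4 (fun q hq => d2 q (List.mem_of_mem_drop hq)) _
        (List.of_mem_zip hp).2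
    -- Elements of `B \ U` are never exchanged, so adding them to the contracted bases of both
    -- halves gives back the original weighted sequence.
    have hzip : δ.zip (bases B ex) =
        (((δ.take (k + 1)).zip (bases (B ∩ U) (ex.take k))).map fun p => (p.1, p.2 ∪ B \ U)) ++
        (((δ.drop (k + 1)).zip (bases ((ex.take (k + 1)).foldl exchange (B ∩ U))
          (ex.drop (k + 1)))).map fun p => (p.1, p.2 ∪ B \ U)) := by
      have e1 : ∀ (l : List ℝ≥0) (L : List (Finset α)),
          ((l.zip L).map fun p => (p.1, p.2 ∪ B \ U)) = l.zip (L.map (· ∪ B \ U)) := by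
        intro l L
        rw [List.zip_map_right]
        rfl
      rw [e1, e1, ← bases_union _ _ fun q hq => d1 q (List.mem_of_mem_take hq),
        ← bases_union _ _ fun q hq => d1 q (List.mem_of_mem_drop hq),
        ← foldl_exchange_union _ _ fun q hq => d1 q (List.mem_of_mem_take hq), hB,
        ← List.zip_append (by rw [l1, length_bases]), ← bases_split B ex hkl, List.take_append_drop]
    rw [hzip]
    have h1 := SwapRoundLaw.merge _ _ _ _
      (fun X Y => (κ (X \ (B \ U)) (Y \ (B \ U))).map (· ∪ B \ U))
      (hL.lift dL) (hR.lift dR) (by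
        intro X hX Y hY
        rw [PMF.support_map] at hX hY
        obtain ⟨X, hX, rfl⟩ := hX
        obtain ⟨Y, hY, rfl⟩ := hY
        have dX := hL.disjoint dL X hX
        have dY := hR.disjoint dR Y hY
        simp only
        rw [union_sdiff_cancel_of_disjoint dX, union_sdiff_cancel_of_disjoint dY,
          totalWeight_map _ (· ∪ B \ U), totalWeight_map _ (· ∪ B \ U),
          totalWeight_zip _ _ (by rw [l1, length_bases]),
          totalWeight_zip _ _ (by rw [l2, length_bases])]
        exact (hκ X hX Y hY).lift dX dY)
    convert h1 using 1
    rw [PMF.bind_map]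
    refine bind_congr_support fun X hX => ?_
    rw [Function.comp_apply, PMF.bind_map]
    refine bind_congr_support fun Y hY => ?_
    rw [Function.comp_apply, union_sdiff_cancel_of_disjoint (hL.disjoint dL X hX),
      union_sdiff_cancel_of_disjoint (hR.disjoint dR Y hY)]

end Sequences

/-! ### Existence of runs in every matroid -/

section Existence

open Set in
/-- The symmetric exchange property of bases. -/
theorem exists_symmetric_exchange {α : Type*} {M : Matroid α} {B B' : Set α} {e : α}
    (hB : M.IsBase B) (hB' : M.IsBase B') (he : e ∈ B \ B') :
    ∃ f ∈ B' \ B, M.IsBase (insert f (B \ {e})) ∧ M.IsBase (insert e (B' \ {f})) := by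
  have heE : e ∈ M.E := hB.subset_ground he.1
  have hC := hB'.fundCircuit_isCircuit heE he.2
  have hI := hB.indep.sdiff {e}
  -- Otherwise the closure of `B - e` would contain the whole circuit except `e`, hence also `e`,
  -- contrary to the independence of `B`.
  have h1 : ∃ f ∈ M.fundCircuit e B' \ {e}, f ∉ M.closure (B \ {e}) := by
    by_contra! h
    have h2 := hC.mem_closure_sdiff_singleton_of_mem (M.mem_fundCircuit e B')
    have h3 := M.closure_subset_closure_of_subset_closure (Y := B \ {e}) h h2
    rw [hI.mem_closure_iff' ] at h3
    have h4 := h3.2 (by rw [insert_sdiff_singleton, insert_eq_of_mem he.1]; exact hB.indep)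
    exact h4.2 rfl
  obtain ⟨f, ⟨hf, hfe⟩, hcl⟩ := h1
  have hfe' : f ≠ e := hfe
  have hfE : f ∈ M.E := hC.subset_ground hf
  have hfB' : f ∈ B' := ((M.fundCircuit_subset_insert e B') hf).resolve_left hfe'
  rw [hI.notMem_closure_iff hfE] at hcl
  have hfB : f ∉ B := fun h => hcl.2 ⟨h, hfe⟩
  refine ⟨f, ⟨hfB', hfB⟩, hB.exchange_isBase_of_indep hfB hcl.1, ?_⟩
  -- Membership of `f` in the fundamental circuit of `e` means that `B' - f + e` is independent.
  rw [hB'.indep.mem_fundCircuit_iff (by rwa [hB'.closure_eq]) he.2,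
    ← insert_sdiff_singleton_comm hfe'.symm] at hf
  exact hB'.exchange_isBase_of_indep he.2 hf

variable {α : Type*} [DecidableEq α]

/-- Induction on the size of `B \ B'`, which drops by one in an exchange, whichever way the coin
falls. Both sets stay bases, so symmetric exchange applies again. -/
theorem exists_mergeLaw (M : Matroid α) (a b : ℝ≥0) (B B' : Finset α)
    (hB : M.IsBase (B : Set α)) (hB' : M.IsBase (B' : Set α)) :
    ∃ μ, MergeLaw (fun X => M.Indep (X : Set α)) a b B B' μ ∧
      ∀ X ∈ μ.support, M.IsBase (X : Set α) := by
  induction hn : (B \ B').card generalizing B B' with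
  | zero =>
    refine ⟨_, .done B B' (Finset.card_eq_zero.1 hn), fun X hX => ?_⟩
    rw [PMF.support_pure, Set.mem_singleton_iff] at hX
    rwa [hX]
  | succ n ih =>
    obtain ⟨e, he⟩ : (B \ B').Nonempty := Finset.card_pos.1 (by omega)
    obtain ⟨f, hf, h1, h2⟩ := exists_symmetric_exchange hB hB' (e := e) (by simpa using he)
    have hf' : f ∈ B' \ B := by simpa using hf
    rw [Finset.mem_sdiff] at he hf'
    have e1 : ((insert f (B.erase e) : Finset α) : Set α) = insert f ((B : Set α) \ {e}) := by simp
    have e2 : ((insert e (B'.erase f) : Finset α) : Set α) = insert e ((B' : Set α) \ {f}) := by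
      simp
    rw [← e1] at h1
    rw [← e2] at h2
    have c0 : (B \ B').erase e ⊆ B \ B' := Finset.erase_subset _ _
    have hc : ((B \ B').erase e).card = n := by
      rw [Finset.card_erase_of_mem (by simp [he]), hn]; rfl
    obtain ⟨μ, hμ, hs⟩ := ih B _ hB h2 (by
      rw [← hc]
      congr 1
      ext x
      simp only [Finset.mem_sdiff, Finset.mem_insert, Finset.mem_erase]
      by_cases hx : x = f
      · subst hx; simp [hf'.2]
      · tauto)
    obtain ⟨μ', hμ', hs'⟩ := ih _ B' h1 hB' (by
      rw [← hc]
      congr 1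
      ext x
      simp only [Finset.mem_sdiff, Finset.mem_insert, Finset.mem_erase]
      by_cases hx : x = f
      · subst hx; simp [hf'.1]
      · tauto)
    refine ⟨_, .swap B B' e f μ μ' (by simp [he]) (by simp [hf']) h1.indep h2.indep hμ hμ', ?_⟩
    intro X hX
    rw [PMF.mem_support_bind_iff] at hX
    obtain ⟨c, -, hX⟩ := hX
    cases c
    · exact hs' X hX
    · exact hs X hX

/-- Divide-and-conquer can be carried out in every matroid. -/
theorem exists_divideSwapLaw (M : Matroid α) (B : Finset α) (ex : List (Finset α × Finset α))
    (δ : List ℝ≥0) (hδ : δ.length = ex.length + 1)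
    (hB : ∀ X ∈ bases B ex, M.IsBase (X : Set α)) :
    ∃ μ, DivideSwapLaw (fun X => M.Indep (X : Set α)) B ex δ μ ∧
      ∀ X ∈ μ.support, M.IsBase (X : Set α) := by
  induction hn : ex.length using Nat.strong_induction_on generalizing M B ex δ with
  | _ n ih =>
  subst hn
  by_cases hne : ex = []
  · subst hne
    obtain ⟨a, rfl⟩ := List.length_eq_one_iff.1 hδ
    refine ⟨_, .single _ B a, fun X hX => ?_⟩
    rw [PMF.support_pure, Set.mem_singleton_iff] at hX
    rw [hX]
    exact hB B (by simp [bases])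
  have hkl := splitIndex_lt hne
  set k := splitIndex ex with hk
  set U := touched ex with hU
  have hBB : M.IsBase (B : Set α) := hB B (by cases ex <;> simp [bases])
  have hA : M.Indep ((B \ U : Finset α) : Set α) :=
    hBB.indep.subset (by exact_mod_cast Finset.sdiff_subset)
  -- For the independent set `B \ U` the combinatorial definition of the contraction agrees with the
  -- contraction of the matroid, so the induction hypothesis can be applied to a matroid.
  have hI : (fun X : Finset α => (M.contract ((B \ U : Finset α) : Set α)).Indep (X : Set α)) =
      contractIndep (fun X => M.Indep (X : Set α)) (B \ U) := by
    funext X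
    rw [hA.contract_indep_iff, contractIndep, Finset.disjoint_coe, ← Finset.coe_union]
  have hIb : ∀ X : Finset α, (M.contract ((B \ U : Finset α) : Set α)).IsBase (X : Set α) ↔
      M.IsBase ((X ∪ B \ U : Finset α) : Set α) ∧ Disjoint X (B \ U) := by
    intro X
    rw [hA.contract_isBase_iff, Finset.disjoint_coe, ← Finset.coe_union]
  have d1 : ∀ p ∈ ex, Disjoint p.1 (B \ U) := fun p hp =>
    Finset.disjoint_sdiff.mono_left (subset_touched hp).1
  have d2 : ∀ p ∈ ex, Disjoint p.2 (B \ U) := fun p hp =>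
    Finset.disjoint_sdiff.mono_left (subset_touched hp).2
  have d3 : Disjoint (B ∩ U) (B \ U) :=
    Finset.disjoint_sdiff.mono_left Finset.inter_subset_right
  have hBU : B ∩ U ∪ B \ U = B := by rw [Finset.union_comm, Finset.sdiff_union_inter]
  have hsplit := bases_split (B ∩ U ∪ B \ U) ex hkl
  rw [bases_union _ _ fun q hq => d1 q (List.mem_of_mem_take hq),
    foldl_exchange_union _ _ fun q hq => d1 q (List.mem_of_mem_take hq),
    bases_union _ _ fun q hq => d1 q (List.mem_of_mem_drop hq), hBU] at hsplit
  have d4 : Disjoint ((ex.take (k + 1)).foldl exchange (B ∩ U)) (B \ U) :=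
    disjoint_foldl_exchange d3 fun q hq => d2 q (List.mem_of_mem_take hq)
  obtain ⟨μL, hL, bL⟩ := ih _ (by rw [List.length_take]; omega) (M.contract ((B \ U : Finset α) : Set α))
    (B ∩ U) (ex.take k) (δ.take (k + 1)) (by rw [List.length_take, List.length_take]; omega)
    (fun X hX => (hIb X).2 ⟨hB _ (by
        rw [hsplit]
        exact List.mem_append_left _ (List.mem_map_of_mem (f := (· ∪ B \ U)) hX)),
      disjoint_bases d3 (fun q hq => d2 q (List.mem_of_mem_take hq)) X hX⟩) rfl
  obtain ⟨μR, hR, bR⟩ := ih _ (by rw [List.length_drop]; omega) (M.contract ((B \ U : Finset α) : Set α))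
    ((ex.take (k + 1)).foldl exchange (B ∩ U)) (ex.drop (k + 1)) (δ.drop (k + 1))
    (by rw [List.length_drop, List.length_drop]; omega)
    (fun X hX => (hIb X).2 ⟨hB _ (by
        rw [hsplit]
        exact List.mem_append_right _ (List.mem_map_of_mem (f := (· ∪ B \ U)) hX)),
      disjoint_bases d4 (fun q hq => d2 q (List.mem_of_mem_drop hq)) X hX⟩) rfl
  have hm := fun X Y (h : X ∈ μL.support ∧ Y ∈ μR.support) =>
    exists_mergeLaw (M.contract ((B \ U : Finset α) : Set α)) (δ.take (k + 1)).sum (δ.drop (k + 1)).sum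
      X Y (bL X h.1) (bR Y h.2)
  choose! κ hκ bκ using hm
  rw [hI] at hL hR hκ
  refine ⟨_, .split _ B ex δ k U μL μR κ hne hk hU hL hR fun X hX Y hY => hκ X Y ⟨hX, hY⟩, ?_⟩
  intro Z hZ
  simp only [PMF.mem_support_bind_iff, PMF.support_map] at hZ
  obtain ⟨X, hX, Y, hY, Z, hZ, rfl⟩ := hZ
  exact ((hIb Z).1 (bκ X Y ⟨hX, hY⟩ Z hZ)).1

end Existence

/-! ### Connectivity -/

section Connectivity

variable {ι V W : Type*} {ep : ι → Sym2 V} {F G K : Set ι} {e f : ι} {x y z u v : V}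

/-- Some edge in `F` joins the two vertices. -/
def Link (ep : ι → Sym2 V) (F : Set ι) (x y : V) : Prop := ∃ e ∈ F, ep e = s(x, y)

/-- The vertices are connected by edges in `F`. -/
def Conn (ep : ι → Sym2 V) (F : Set ι) : V → V → Prop := Relation.ReflTransGen (Link ep F)

/-- The edges in `F` do not contain a cycle. -/
def Acyc (ep : ι → Sym2 V) (F : Set ι) : Prop :=
  ∀ e ∈ F, ∀ x y, ep e = s(x, y) → ¬ Conn ep (F \ {e}) x y

theorem Link.symm (h : Link ep F x y) : Link ep F y x := by
  obtain ⟨e, he, h⟩ := h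
  exact ⟨e, he, h.trans Sym2.eq_swap⟩

@[refl] theorem Conn.refl (x : V) : Conn ep F x x := Relation.ReflTransGen.refl

theorem Conn.symm (h : Conn ep F x y) : Conn ep F y x := by
  induction h with
  | refl => exact .refl _
  | tail _ h ih => exact .head h.symm ih

theorem Conn.trans (h : Conn ep F x y) (h' : Conn ep F y z) : Conn ep F x z :=
  Relation.ReflTransGen.trans h h'

theorem Conn.mono (h : Conn ep F x y) (hF : F ⊆ G) : Conn ep G x y :=
  Relation.ReflTransGen.mono (fun _ _ ⟨e, he, h⟩ => ⟨e, hF he, h⟩) _ _ h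

theorem Conn.of_mem (he : e ∈ F) (h : ep e = s(x, y)) : Conn ep F x y :=
  Relation.ReflTransGen.single ⟨e, he, h⟩

theorem conn_empty : Conn ep ∅ x y ↔ x = y := by
  constructor
  · intro h
    induction h with
    | refl => rfl
    | tail _ h _ => obtain ⟨e, he, -⟩ := h; exact he.elim
  · rintro rfl; rfl

/-- A path either stays in a set of edges or has a first edge outside of it. -/
theorem Conn.exists_exit (h : Conn ep (K ∪ F) x y) (hK : ¬ Conn ep K x y) :
    ∃ e ∈ F, ∃ z w, ep e = s(z, w) ∧ Conn ep K x z := by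
  induction h with
  | refl => exact (hK (.refl _)).elim
  | @tail b c hb hc ih =>
    by_cases hKb : Conn ep K x b
    · obtain ⟨e, he, hc⟩ := hc
      rcases he with he | he
      · exact (hK (hKb.trans (.of_mem he hc))).elim
      · exact ⟨e, he, b, c, hc, hKb⟩
    · exact ih hKb

theorem conn_of_conn (h : Conn ep F x y)
    (hF : ∀ e ∈ F, ∀ x y, ep e = s(x, y) → Conn ep G x y) : Conn ep G x y := by
  induction h with
  | refl => rfl
  | tail _ h ih =>
    obtain ⟨e, he, h⟩ := h
    exact ih.trans (hF e he _ _ h)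

/-- If the removal of `f` disconnects two vertices, they are connected to different ends of `f`. -/
theorem Conn.exists_ends (h : Conn ep F x y) (h' : ¬ Conn ep (F \ {f}) x y) :
    ∃ z w, ep f = s(z, w) ∧ Conn ep (F \ {f}) x z ∧ Conn ep (F \ {f}) w y := by
  have key : ∀ y, Conn ep F x y → Conn ep (F \ {f}) x y ∨
      ∃ z w, ep f = s(z, w) ∧ Conn ep (F \ {f}) x z ∧ Conn ep (F \ {f}) w y := by
    intro y h
    induction h with
    | refl => exact Or.inl (.refl _)
    | @tail b c _ hc ih =>
      obtain ⟨e, he, hc⟩ := hc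
      by_cases hef : e = f
      · subst hef
        rcases ih with ih | ⟨z, w, h1, h2, h3⟩
        · exact Or.inr ⟨b, c, hc, ih, .refl _⟩
        · rw [h1, Sym2.eq_iff] at hc
          rcases hc with ⟨rfl, rfl⟩ | ⟨rfl, rfl⟩
          · exact Or.inr ⟨z, w, h1, h2, .refl _⟩
          · exact Or.inl h2
      · have hbc : Conn ep (F \ {f}) b c := .of_mem ⟨he, hef⟩ hc
        rcases ih with ih | ⟨z, w, h1, h2, h3⟩
        · exact Or.inl (ih.trans hbc)
        · exact Or.inr ⟨z, w, h1, h2, h3.trans hbc⟩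
  exact (key y h).resolve_left h'

theorem conn_insert_iff (he : ep e = s(u, v)) : Conn ep (insert e F) x y ↔
    Conn ep F x y ∨ (Conn ep F x u ∧ Conn ep F v y) ∨ (Conn ep F x v ∧ Conn ep F u y) := by
  constructor
  · intro h
    by_cases hF : Conn ep (insert e F \ {e}) x y
    · exact Or.inl (hF.mono (by simp))
    · obtain ⟨z, w, h1, h2, h3⟩ := h.exists_ends hF
      have h2 : Conn ep F x z := h2.mono (by simp)
      have h3 : Conn ep F w y := h3.mono (by simp)
      rw [he, Sym2.eq_iff] at h1
      rcases h1 with ⟨rfl, rfl⟩ | ⟨rfl, rfl⟩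
      · exact Or.inr (Or.inl ⟨h2, h3⟩)
      · exact Or.inr (Or.inr ⟨h2, h3⟩)
  · have h0 : Conn ep (insert e F) u v := .of_mem (Set.mem_insert _ _) he
    have hs : F ⊆ insert e F := Set.subset_insert _ _
    rintro (h | ⟨h1, h2⟩ | ⟨h1, h2⟩)
    · exact h.mono hs
    · exact ((h1.mono hs).trans h0).trans (h2.mono hs)
    · exact ((h1.mono hs).trans h0.symm).trans (h2.mono hs)

/-- An exchange along a cycle does not change connectivity. -/
theorem Conn.exchange (hxy : Conn ep F x y) (he : ep e = s(u, v)) (huv : Conn ep F u v)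
    (h : ¬ Conn ep (F \ {f}) u v) : Conn ep (insert e (F \ {f})) x y := by
  obtain ⟨z, w, h1, h2, h3⟩ := huv.exists_ends h
  have h4 : Conn ep (insert e (F \ {f})) z w := by
    rw [conn_insert_iff he]
    exact Or.inr (Or.inl ⟨h2.symm, h3.symm⟩)
  refine conn_of_conn hxy fun g hg a b hab => ?_
  by_cases hgf : g = f
  · subst hgf
    rw [h1, Sym2.eq_iff] at hab
    rcases hab with ⟨rfl, rfl⟩ | ⟨rfl, rfl⟩
    · exact h4
    · exact h4.symm
  · exact .of_mem (Or.inr ⟨hg, hgf⟩) hab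

theorem Acyc.mono (h : Acyc ep G) (hF : F ⊆ G) : Acyc ep F := fun e he x y hxy hc =>
  h e (hF he) x y hxy (hc.mono (Set.sdiff_subset_sdiff_left hF))

theorem Acyc.insert (h : Acyc ep F) (he : ep e = s(u, v)) (huv : ¬ Conn ep F u v) :
    Acyc ep (insert e F) := by
  intro g hg x y hxy hc
  by_cases hge : g = e
  · subst hge
    rw [he, Sym2.eq_iff] at hxy
    have hc' : Conn ep F x y := hc.mono (by simp)
    rcases hxy with ⟨rfl, rfl⟩ | ⟨rfl, rfl⟩
    · exact huv hc'
    · exact huv hc'.symm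
  · have hgF : g ∈ F := hg.resolve_left hge
    rw [Set.insert_sdiff_of_notMem _ (by simpa using Ne.symm hge), conn_insert_iff he] at hc
    have h0 : Conn ep F x y := .of_mem hgF hxy
    have hs : F \ {g} ⊆ F := Set.sdiff_subset
    rcases hc with hc | ⟨h1, h2⟩ | ⟨h1, h2⟩
    · exact h g hgF x y hxy hc
    · exact huv (((h1.mono hs).symm.trans h0).trans (h2.mono hs).symm)
    · exact huv (((h2.mono hs).trans h0.symm).trans (h1.mono hs))

theorem Acyc.not_conn (h : Acyc ep F) (he : e ∈ F) (hxy : ep e = s(x, y)) (hG : G ⊆ F)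
    (heG : e ∉ G) : ¬ Conn ep G x y := fun hc =>
  h e he x y hxy (hc.mono fun _ hg => ⟨hG hg, fun hge => heG (hge ▸ hg)⟩)

/-- Separating edges on a path within an acyclic set. -/
theorem exists_separating {D : Set ι} (hF : Acyc ep F) (hKF : K ⊆ F) (hDF : D ⊆ F)
    (hD : D.Finite) (hc : Conn ep (K ∪ D) u v) (hK : ¬ Conn ep K u v) :
    ∃ f ∈ D, f ∉ K ∧ (∃ z w, ep f = s(z, w) ∧ Conn ep K u z) ∧ ¬ Conn ep (F \ {f}) u v := by
  induction hn : D.ncard using Nat.strong_induction_on generalizing D with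
  | _ n ih =>
  -- Drop edges of `D` until all of them are needed. Then the first edge that leaves the
  -- `K`-component of `u` separates `u` from `v` in `K ∪ D`, and by acyclicity also in `F`.
  by_cases h : ∃ a ∈ D, Conn ep (K ∪ D \ {a}) u v
  · obtain ⟨a, ha, h⟩ := h
    obtain ⟨f, hf, h'⟩ := ih _ (hn ▸ Set.ncard_sdiff_singleton_lt_of_mem ha hD)
      (Set.sdiff_subset.trans hDF) (hD.subset Set.sdiff_subset) h rfl
    exact ⟨f, hf.1, h'⟩
  · push Not at h
    obtain ⟨f, hf, z, w, hzw, hz⟩ := hc.exists_exit hK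
    have hfK : f ∉ K := fun hfK => h f hf (hc.mono fun g hg => by
      by_cases hgf : g = f
      · exact Or.inl (hgf ▸ hfK)
      · exact hg.imp id fun hg => ⟨hg, hgf⟩)
    have hsub : (K ∪ D) \ {f} ⊆ K ∪ D \ {f} := fun g hg => hg.1.imp id fun hgD => ⟨hgD, hg.2⟩
    obtain ⟨z', w', h1, h2, h3⟩ := hc.exists_ends (f := f) fun hc' => h f hf (hc'.mono hsub)
    have hsub' : (K ∪ D) \ {f} ⊆ F \ {f} :=
      Set.sdiff_subset_sdiff_left (Set.union_subset hKF hDF)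
    refine ⟨f, hf, hfK, ⟨z, w, hzw, hz⟩, fun hc' => ?_⟩
    exact hF f (hDF hf) z' w' h1 (((h2.mono hsub').symm.trans hc').trans (h3.mono hsub').symm)

/-- There is at most one separating edge that is incident to the first component. -/
theorem separating_unique {g : ι} {z w z' w' : V} (hF : Acyc ep F) (hf : f ∈ F \ K) (hg : g ∈ F \ K)
    (hKF : K ⊆ F) (hc : Conn ep F u v) (hz : ep f = s(z, w)) (hfz : Conn ep K u z)
    (hz' : ep g = s(z', w')) (hgz : Conn ep K u z') (h1 : ¬ Conn ep (F \ {f}) u v)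
    (h2 : ¬ Conn ep (F \ {g}) u v) : f = g := by
  by_contra hne
  have k1 : K ⊆ (F \ {f}) \ {g} := fun a ha =>
    ⟨⟨hKF ha, fun h => hf.2 (h ▸ ha)⟩, fun h => hg.2 (h ▸ ha)⟩
  have k2 : (F \ {f}) \ {g} ⊆ F \ {f} := Set.sdiff_subset
  have k3 : (F \ {f}) \ {g} ⊆ F \ {g} := Set.sdiff_subset_sdiff_left Set.sdiff_subset
  have hw : Conn ep (F \ {f}) w v := by
    obtain ⟨a, b, h3, h4, h5⟩ := hc.exists_ends h1
    rw [hz, Sym2.eq_iff] at h3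
    rcases h3 with ⟨rfl, rfl⟩ | ⟨rfl, rfl⟩
    · exact h5
    · exact (h1 (((hfz.mono k1).mono k2).trans h5)).elim
  have hfg : Conn ep (F \ {g}) z w := .of_mem ⟨hf.1, fun h => hne h⟩ hz
  -- The vertex `w` is the far end of `f`. If it reaches `v` without `g`, then so does `u`, through
  -- `f`. If not, a connection from `w` to `v` without `f` passes through `g`, which touches the
  -- `K`-component of `u`: either it closes a cycle through `f` or it leads from `u` to `v` without
  -- `f`.
  by_cases h3 : Conn ep ((F \ {f}) \ {g}) w v
  · exact h2 ((((hfz.mono k1).mono k3).trans hfg).trans (h3.mono k3))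
  · obtain ⟨a, b, h4, h5, h6⟩ := hw.exists_ends h3
    rw [hz', Sym2.eq_iff] at h4
    rcases h4 with ⟨rfl, rfl⟩ | ⟨rfl, rfl⟩
    · have h7 : Conn ep (F \ {f}) w z := (h5.mono k2).trans
        (((hgz.mono k1).mono k2).symm.trans ((hfz.mono k1).mono k2))
      exact hF f hf.1 z w hz h7.symm
    · exact h1 (((hgz.mono k1).mono k2).trans (h6.mono k2))

/-- Connectivity after the contraction of `K`. -/
theorem conn_contract {φ : V → W} (hφ : ∀ x y, φ x = φ y ↔ Conn ep K x y) :
    Conn (fun e => (ep e).map φ) F (φ x) (φ y) ↔ Conn ep (F ∪ K) x y := by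
  constructor
  · intro h
    generalize hy : φ y = y' at h
    induction h generalizing y with
    | refl => exact ((hφ x y).1 hy.symm).mono Set.subset_union_right
    | @tail b c _ hc ih =>
      obtain ⟨e, he, hc⟩ := hc
      obtain ⟨p, q, hpq⟩ : ∃ p q, ep e = s(p, q) := by
        induction h : ep e with | _ p q => exact ⟨p, q, rfl⟩
      simp only [hpq, Sym2.map_mk, Sym2.eq_iff] at hc
      have h0 : Conn ep (F ∪ K) p q := .of_mem (Or.inl he) hpq
      have hs : ∀ {a b}, φ a = φ b → Conn ep (F ∪ K) a b := fun h =>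
        ((hφ _ _).1 h).mono Set.subset_union_right
      rcases hc with ⟨h1, h2⟩ | ⟨h1, h2⟩
      · exact ((ih h1).trans h0).trans (hs (h2.trans hy.symm))
      · exact ((ih h2).trans h0.symm).trans (hs (h1.trans hy.symm))
  · intro h
    induction h with
    | refl => rfl
    | tail _ h ih =>
      obtain ⟨e, he, h⟩ := h
      rcases he with he | he
      · exact ih.trans (.of_mem he (by simp [h]))
      · rw [← (hφ _ _).2 (Conn.of_mem he h)]
        exact ih

theorem Acyc.contract {φ : V → W} (hφ : ∀ x y, φ x = φ y ↔ Conn ep K x y) (h : Acyc ep (F ∪ K))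
    (hd : Disjoint F K) : Acyc (fun e => (ep e).map φ) F := by
  intro e he x' y' hxy hc
  obtain ⟨x, y, hxy'⟩ : ∃ x y, ep e = s(x, y) := by
    induction h : ep e with | _ p q => exact ⟨p, q, rfl⟩
  simp only [hxy', Sym2.map_mk] at hxy
  have hc' : Conn (fun e => (ep e).map φ) (F \ {e}) (φ x) (φ y) := by
    rw [Sym2.eq_iff] at hxy
    rcases hxy with ⟨rfl, rfl⟩ | ⟨rfl, rfl⟩
    · exact hc
    · exact hc.symm
  rw [conn_contract hφ] at hc'
  refine h.not_conn (Or.inl he) hxy' ?_ ?_ hc'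
  · exact Set.union_subset_union_left _ Set.sdiff_subset
  · rintro (⟨-, h⟩ | h)
    · exact h rfl
    · exact Set.disjoint_left.1 hd he h

end Connectivity

/-! ### Lists of edges as trees -/

section Trees

variable {κ : Type*} {ep : κ → Sym2 κ} {r : κ} {l : List (Edge κ)}

/-- The identifiers of the edges with a given flag. -/
def flagIds (b : Bool) (l : List (Edge κ)) : Set κ := {e | ∃ t ∈ l, t.1 = b ∧ t.2.1 = e}

/-- The identifiers of the edges. -/
def idSet (l : List (Edge κ)) : Set κ := {e | e ∈ edgeIds l}

theorem mem_idSet {e : κ} : e ∈ idSet l ↔ ∃ t ∈ l, t.2.1 = e := by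
  simp [idSet, edgeIds]

theorem idSet_eq (l : List (Edge κ)) : idSet l = flagIds false l ∪ flagIds true l := by
  ext e
  simp only [mem_idSet, flagIds, Set.mem_union, Set.mem_ofPred_eq]
  constructor
  · rintro ⟨t, ht, rfl⟩
    cases h : t.1
    · exact Or.inl ⟨t, ht, h, rfl⟩
    · exact Or.inr ⟨t, ht, h, rfl⟩
  · rintro (⟨t, ht, -, rfl⟩ | ⟨t, ht, -, rfl⟩) <;> exact ⟨t, ht, rfl⟩

theorem flagIds_subset (b : Bool) (l : List (Edge κ)) : flagIds b l ⊆ idSet l :=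
  fun _ ⟨t, ht, _, h⟩ => mem_idSet.2 ⟨t, ht, h⟩

theorem idSet_cons (t : Edge κ) (l : List (Edge κ)) : idSet (t :: l) = insert t.2.1 (idSet l) := by
  ext e; simp [idSet, edgeIds]

theorem eq_of_nodup_ids (h : (edgeIds l).Nodup) {t t' : Edge κ} (ht : t ∈ l) (ht' : t' ∈ l)
    (hid : t.2.1 = t'.2.1) : t = t' := List.inj_on_of_nodup_map h ht ht' hid

theorem flagIds_disjoint (h : (edgeIds l).Nodup) : Disjoint (flagIds false l) (flagIds true l) := by
  rw [Set.disjoint_left]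
  rintro e ⟨t, ht, hf, rfl⟩ ⟨t', ht', hf', hid⟩
  rw [eq_of_nodup_ids h ht' ht hid, hf] at hf'
  cases hf'

/-- The endpoints that are stored in a list of edges. -/
def HasEnds (ep : κ → Sym2 κ) (l : List (Edge κ)) : Prop :=
  ∀ t ∈ l, ep t.2.1 = s(t.2.2.1, t.2.2.2)

/-- The list `l` contains the edges of a tree on the vertices `V`. -/
structure IsTree (ep : κ → Sym2 κ) (V : Set κ) (l : List (Edge κ)) : Prop where
  ends : HasEnds ep l
  nodup : (edgeIds l).Nodup
  acyc : Acyc ep (idSet l)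
  mem : ∀ t ∈ l, t.2.2.1 ∈ V ∧ t.2.2.2 ∈ V
  conn : ∀ x ∈ V, ∀ y ∈ V, Conn ep (idSet l) x y

theorem HasEnds.tail {t : Edge κ} (h : HasEnds ep (t :: l)) : HasEnds ep l :=
  fun t' ht' => h t' (List.mem_cons_of_mem _ ht')

theorem Rooted.mem (hl : Rooted r l) {t : Edge κ} (ht : t ∈ l) :
    t.2.2.1 ∈ verts r l ∧ t.2.2.2 ∈ verts r l := by
  induction l with
  | nil => simp at ht
  | cons t' l ih =>
    rw [mem_verts_cons, mem_verts_cons]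
    rcases List.mem_cons.1 ht with rfl | ht
    · exact ⟨Or.inl rfl, Or.inr hl.2.1⟩
    · exact ⟨Or.inr (ih hl.2.2 ht).1, Or.inr (ih hl.2.2 ht).2⟩

theorem Rooted.nodup_ids (hl : Rooted r l) (he : HasEnds ep l) : (edgeIds l).Nodup := by
  induction l with
  | nil => simp [edgeIds]
  | cons t l ih =>
    rw [edgeIds, List.map_cons, List.nodup_cons]
    refine ⟨fun h => ?_, ih hl.2.2 he.tail⟩
    obtain ⟨t', ht', hid⟩ := List.mem_map.1 h
    have h1 := he t' (List.mem_cons_of_mem _ ht')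
    rw [hid, he t List.mem_cons_self, Sym2.eq_iff] at h1
    have h2 := hl.2.2.mem ht'
    rcases h1 with ⟨h1, -⟩ | ⟨h1, -⟩
    · exact hl.1 (h1 ▸ h2.1)
    · exact hl.1 (h1 ▸ h2.2)

theorem Rooted.conn (hl : Rooted r l) (he : HasEnds ep l) {x : κ} (hx : x ∈ verts r l) :
    Conn ep (idSet l) x r := by
  induction l generalizing x with
  | nil =>
    simp only [verts, List.map_nil, List.mem_singleton] at hx
    rw [hx]
  | cons t l ih =>
    rw [idSet_cons]
    have hs : idSet l ⊆ insert t.2.1 (idSet l) := Set.subset_insert _ _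
    rcases mem_verts_cons.1 hx with rfl | hx
    · exact (Conn.of_mem (Set.mem_insert _ _) (he t List.mem_cons_self)).trans
        ((ih hl.2.2 he.tail hl.2.1).mono hs)
    · exact (ih hl.2.2 he.tail hx).mono hs

/-- Edges that avoid a vertex do not connect it to anything. -/
theorem eq_of_conn_of_isolated {F : Set κ} {x y : κ} (hF : ∀ e ∈ F, ∀ z w, ep e = s(z, w) → z ≠ x)
    (h : Conn ep F x y) : x = y := by
  induction h with
  | refl => rfl
  | tail _ h ih =>
    obtain ⟨e, he, h⟩ := h
    subst ih
    exact (hF e he _ _ h rfl).elim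

/-- The child of the first edge is a leaf: no later edge touches it. Inductions along a rooted list
rest on this. -/
theorem Rooted.isolated {t : Edge κ} (hl : Rooted r (t :: l)) (he : HasEnds ep (t :: l))
    {F : Set κ} (hF : F ⊆ idSet l) : ∀ e ∈ F, ∀ z w, ep e = s(z, w) → z ≠ t.2.2.1 := by
  intro e heF z w hzw hz
  obtain ⟨t', ht', rfl⟩ := mem_idSet.1 (hF heF)
  rw [he.tail t' ht', Sym2.eq_iff] at hzw
  have h2 := hl.2.2.mem ht'
  rcases hzw with ⟨h1, -⟩ | ⟨-, h1⟩
  · exact hl.1 (hz ▸ h1 ▸ h2.1)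
  · exact hl.1 (hz ▸ h1 ▸ h2.2)

theorem Rooted.acyc (hl : Rooted r l) (he : HasEnds ep l) : Acyc ep (idSet l) := by
  induction l with
  | nil => intro e he; simp [idSet, edgeIds] at he
  | cons t l ih =>
    rw [idSet_cons]
    refine (ih hl.2.2 he.tail).insert (he t List.mem_cons_self) fun h => ?_
    have := eq_of_conn_of_isolated (hl.isolated he subset_rfl) h
    exact hl.1 (this ▸ hl.2.1)

/-- The edge below a vertex separates it from the root. -/
theorem Rooted.not_conn (hl : Rooted r l) (he : HasEnds ep l) {t : Edge κ} (ht : t ∈ l) :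
    ¬ Conn ep (idSet l \ {t.2.1}) t.2.2.1 r := by
  intro h
  -- The parent is connected to the root without the edge. If the child were too, the edge would lie
  -- on a cycle.
  have h1 : Conn ep (idSet l \ {t.2.1}) t.2.2.2 r := by
    induction l with
    | nil => simp at ht
    | cons t' l ih =>
      have hnd := hl.nodup_ids he
      rw [edgeIds, List.map_cons, List.nodup_cons] at hnd
      rcases List.mem_cons.1 ht with rfl | ht
      · refine (hl.2.2.conn he.tail hl.2.1).mono fun e he' => ?_
        rw [idSet_cons]
        exact ⟨Or.inr he', fun h => hnd.1 (by rw [Set.mem_singleton_iff] at h; exact h ▸ he')⟩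
      · have hne : t'.2.1 ≠ t.2.1 := fun h => hnd.1 (h ▸ List.mem_map_of_mem ht)
        have hsub : idSet l \ {t.2.1} ⊆ idSet (t' :: l) \ {t.2.1} := by
          rw [idSet_cons]
          exact Set.sdiff_subset_sdiff_left (Set.subset_insert _ _)
        refine (ih hl.2.2 he.tail ht ?_).mono hsub
        rw [idSet_cons, Set.insert_sdiff_of_notMem _ (by simpa using hne),
          conn_insert_iff (he t' List.mem_cons_self)] at h
        have hi : ∀ y, Conn ep (idSet l \ {t.2.1}) t'.2.2.1 y → t'.2.2.1 = y := fun y hy =>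
          eq_of_conn_of_isolated (hl.isolated he Set.sdiff_subset) hy
        rcases h with h | ⟨h1, -⟩ | ⟨-, h2⟩
        · exact h
        · have := hi _ h1.symm
          exact (hl.1 (this ▸ (hl.2.2.mem ht).1)).elim
        · have := hi _ h2
          exact (hl.1 (this ▸ by simp [verts])).elim
  exact (hl.acyc he).not_conn (mem_idSet.2 ⟨t, ht, rfl⟩) (he t ht) Set.sdiff_subset (by simp)
    (h.trans h1.symm)

variable [DecidableEq κ]

/-! ### Contraction -/

theorem contract_edges (hl : Rooted r l) {t : Edge κ} (ht : t ∈ (contract l.reverse).2) :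
    ∃ t' ∈ l, t'.1 = false ∧
      t = (false, t'.2.1, (contract l.reverse).1 t'.2.2.1, (contract l.reverse).1 t'.2.2.2) := by
  induction l with
  | nil => simp [contract] at ht
  | cons t' l ih =>
    obtain ⟨fl, e, v, p⟩ := t'
    have hv : (contract l.reverse).1 v = v :=
      contract_fixed fun h => hl.1 (List.mem_cons_of_mem _ h)
    rw [contract_cons, contractStep] at ht ⊢
    split_ifs at ht ⊢ with hfl
    · obtain ⟨t', ht', h1, h2⟩ := ih hl.2.2 ht
      refine ⟨t', List.mem_cons_of_mem _ ht', h1, ?_⟩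
      have h3 := hl.2.2.mem ht'
      have h4 : ∀ x ∈ verts r l, x ≠ v := fun x hx h => hl.1 (h ▸ hx)
      simp only
      rw [Function.update_of_ne (h4 _ h3.1), Function.update_of_ne (h4 _ h3.2)]
      exact h2
    · rcases List.mem_cons.1 ht with rfl | ht
      · exact ⟨_, List.mem_cons_self, by simpa using hfl, by simp [hv]⟩
      · obtain ⟨t', ht', h1, h2⟩ := ih hl.2.2 ht
        exact ⟨t', List.mem_cons_of_mem _ ht', h1, h2⟩

omit [DecidableEq κ] in
theorem flagIds_cons (b : Bool) (t : Edge κ) (l : List (Edge κ)) :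
    flagIds b (t :: l) = if t.1 = b then insert t.2.1 (flagIds b l) else flagIds b l := by
  ext e
  split_ifs with h
  · simp [flagIds, h, eq_comm]
  · simp [flagIds, h]

theorem idSet_contract (l : List (Edge κ)) :
    idSet (contract l.reverse).2 = flagIds false l := by
  induction l with
  | nil => ext; simp [contract, idSet, edgeIds, flagIds]
  | cons t l ih =>
    obtain ⟨fl, e, v, p⟩ := t
    rw [contract_cons, contractStep, flagIds_cons]
    cases fl
    · simp only [Bool.false_eq_true, if_false, if_true]
      rw [idSet_cons, ih]
    · simp only [if_true, Bool.true_eq_false, if_false]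
      exact ih

/-- The labels after a contraction are the components of the contracted edges. -/
theorem contract_eq_iff (hl : Rooted r l) (he : HasEnds ep l) (x y : κ) :
    (contract l.reverse).1 x = (contract l.reverse).1 y ↔ Conn ep (flagIds true l) x y := by
  induction l generalizing x y with
  | nil =>
    have : flagIds true ([] : List (Edge κ)) = ∅ := by ext; simp [flagIds]
    rw [this, conn_empty]
    rfl
  | cons t l ih =>
    have ih := ih hl.2.2 he.tail
    have hi : ∀ y, Conn ep (flagIds true l) t.2.2.1 y ↔ t.2.2.1 = y := fun y =>
      ⟨eq_of_conn_of_isolated (hl.isolated he (flagIds_subset _ _)), by rintro rfl; rfl⟩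
    have hi' : ∀ y, Conn ep (flagIds true l) y t.2.2.1 ↔ t.2.2.1 = y := fun y =>
      ⟨fun h => (hi y).1 h.symm, fun h => ((hi y).2 h).symm⟩
    have hee := he t List.mem_cons_self
    have hvp : t.2.2.1 ≠ t.2.2.2 := fun h => hl.1 (h ▸ hl.2.1)
    obtain ⟨fl, e, v, p⟩ := t
    rw [contract_cons, contractStep, flagIds_cons]
    cases fl
    · simpa using ih x y
    · simp only [if_true]
      rw [conn_insert_iff hee, hi', hi]
      simp only at hi hi' hvp ⊢
      by_cases hx : x = v
      · by_cases hy : y = v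
        · subst hx; subst hy; simp [Conn.refl]
        · subst hx
          rw [Function.update_self, Function.update_of_ne hy, ih, hi]
          simp [Ne.symm hy]
      · by_cases hy : y = v
        · subst hy
          rw [Function.update_self, Function.update_of_ne hx, ih, hi']
          simp [Ne.symm hx]
        · rw [Function.update_of_ne hx, Function.update_of_ne hy, ih]
          simp [Ne.symm hx, Ne.symm hy]

/-! ### Pruning -/

theorem edgeIds_pruned (S M : κ → Bool) (l : List (Edge κ)) :
    edgeIds (pruned S M l) = edgeIds l := by
  induction l generalizing M with
  | nil => rfl
  | cons t l ih =>
    obtain ⟨fl, e, v, p⟩ := t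
    simp only [pruned, edgeIds, List.map_cons] at ih ⊢
    rw [ih]

theorem mem_pruned {S M : κ → Bool} {t : Edge κ} (ht : t ∈ pruned S M l) :
    ∃ t' ∈ l, t'.2 = t.2 := by
  induction l generalizing M with
  | nil => simp [pruned] at ht
  | cons t' l ih =>
    obtain ⟨fl, e, v, p⟩ := t'
    rw [pruned] at ht
    rcases List.mem_cons.1 ht with rfl | ht
    · exact ⟨_, List.mem_cons_self, rfl⟩
    · obtain ⟨t', ht', h⟩ := ih ht
      exact ⟨t', List.mem_cons_of_mem _ ht', h⟩

/-- The flagged edges are not on the paths between marked vertices, or not incident to marked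
vertices. -/
theorem pruned_spec {S M : κ → Bool} (hl : Rooted r l) (he : HasEnds ep l) {t : Edge κ}
    (ht : t ∈ pruned S M l) (hf : t.1 = true) :
    (∀ x ∈ verts r l, M x = true → Conn ep (idSet l \ {t.2.1}) x r) ∨
      (S t.2.2.1 = false ∧ S t.2.2.2 = false) := by
  induction l generalizing M with
  | nil => simp [pruned] at ht
  | cons t' l ih =>
    have hnd := hl.nodup_ids he
    rw [edgeIds, List.map_cons, List.nodup_cons] at hnd
    have hee := he t' List.mem_cons_self
    obtain ⟨fl, e, v, p⟩ := t'
    rw [pruned] at ht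
    rcases List.mem_cons.1 ht with rfl | ht2
    · simp only [Bool.not_eq_true', Bool.and_eq_false_iff, Bool.or_eq_false_iff] at hf ⊢
      rcases hf with hf | hf
      · left
        intro x hx hM
        rcases mem_verts_cons.1 hx with rfl | hx
        · simp_all
        · refine (hl.2.2.conn he.tail hx).mono fun e' he' => ?_
          rw [idSet_cons]
          exact ⟨Or.inr he', fun h => hnd.1 (by rw [Set.mem_singleton_iff] at h; exact h ▸ he')⟩
      · exact Or.inr hf
    · refine (ih hl.2.2 he.tail ht2).imp_left fun h x hx hM => ?_
      have hne : e ≠ t.2.1 := by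
        intro he'
        obtain ⟨t', ht', h⟩ := mem_pruned ht2
        exact hnd.1 (List.mem_map.2 ⟨t', ht', by rw [h, he']⟩)
      have hsub : idSet l \ {t.2.1} ⊆ idSet ((fl, e, v, p) :: l) \ {t.2.1} := by
        rw [idSet_cons]
        exact Set.sdiff_subset_sdiff_left (Set.subset_insert _ _)
      -- A marked leaf passes its mark to its parent and is joined to it by an edge other than the
      -- one in question; so the statement for the parent suffices.
      rcases mem_verts_cons.1 hx with rfl | hx
      · refine (Conn.of_mem ?_ hee).trans ((h p hl.2.1 ?_).mono hsub)
        · rw [idSet_cons]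
          exact ⟨Or.inl rfl, hne⟩
        · simp [hM]
      · refine (h x hx ?_).mono hsub
        split_ifs
        · rw [Function.update_apply]
          split_ifs
          · rfl
          · exact hM
        · exact hM

end Trees

/-! ### Correctness of the search -/

section Search

variable {κ : Type*} [DecidableEq κ] {ep : κ → Sym2 κ} {r : κ} {T : List (Edge κ)}

theorem mem_addEdge {adj : κ → List (Arc κ)} {t : Edge κ} {x : κ} {a : Arc κ} :
    a ∈ addEdge adj t x ↔ a ∈ adj x ∨ (t.2.2.1 = x ∧ a = (t.1, t.2.1, t.2.2.2)) ∨
      (t.2.2.2 = x ∧ a = (t.1, t.2.1, t.2.2.1)) := by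
  obtain ⟨fl, e, v, p⟩ := t
  simp only [addEdge, Function.update_apply, @eq_comm _ v x, @eq_comm _ p x]
  by_cases hp : x = p <;> by_cases hv : x = v
  · subst hp; subst hv; simp; tauto
  · subst hp; simp [hv]; tauto
  · subst hv; simp [hp]; tauto
  · simp [hp, hv]

theorem mem_adjacency {x : κ} {a : Arc κ} : a ∈ adjacency T x ↔ ∃ t ∈ T,
    (t.2.2.1 = x ∧ a = (t.1, t.2.1, t.2.2.2)) ∨ (t.2.2.2 = x ∧ a = (t.1, t.2.1, t.2.2.1)) := by
  suffices ∀ adj : κ → List (Arc κ), a ∈ T.foldl addEdge adj x ↔ a ∈ adj x ∨ ∃ t ∈ T,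
      (t.2.2.1 = x ∧ a = (t.1, t.2.1, t.2.2.2)) ∨
        (t.2.2.2 = x ∧ a = (t.1, t.2.1, t.2.2.1)) by
    simpa [adjacency] using this fun _ => []
  induction T with
  | nil => simp
  | cons t T ih =>
    intro adj
    rw [List.foldl_cons, ih, mem_addEdge, List.exists_mem_cons_iff, or_assoc]

theorem mem_adjacency_symm {fl : Bool} {e x y : κ} (h : (fl, e, y) ∈ adjacency T x) :
    (fl, e, x) ∈ adjacency T y := by
  rw [mem_adjacency] at h ⊢
  obtain ⟨t, ht, h⟩ := h
  refine ⟨t, ht, ?_⟩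
  simp only [Prod.mk.injEq] at h ⊢
  rcases h with ⟨h1, h2, h3, h4⟩ | ⟨h1, h2, h3, h4⟩
  · exact Or.inr ⟨h4.symm, h2, h3, h1.symm⟩
  · exact Or.inl ⟨h4.symm, h2, h3, h1.symm⟩

theorem length_addEdge (adj : κ → List (Arc κ)) (t : Edge κ) (x : κ) :
    (addEdge adj t x).length = (adj x).length + (if x = t.2.2.1 then 1 else 0) +
      if x = t.2.2.2 then 1 else 0 := by
  obtain ⟨fl, e, v, p⟩ := t
  simp only [addEdge, Function.update_apply]
  by_cases hp : x = p <;> by_cases hv : x = v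
  · subst hp; subst hv; simp
  · subst hp; simp [hv]
  · subst hv; simp [hp]
  · simp [hp, hv]

theorem sum_length_adjacency [Fintype κ] (T : List (Edge κ)) :
    ∑ v, (adjacency T v).length = 2 * T.length := by
  suffices ∀ adj : κ → List (Arc κ),
      ∑ v, (T.foldl addEdge adj v).length = ∑ v, (adj v).length + 2 * T.length by
    simpa [adjacency] using this fun _ => []
  induction T with
  | nil => simp
  | cons t T ih =>
    intro adj
    rw [List.foldl_cons, ih]
    simp only [length_addEdge, Finset.sum_add_distrib, Finset.sum_ite_eq', Finset.mem_univ,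
      if_true, List.length_cons]
    ring

/-- Bounds the number of the remaining steps of a search. -/
def SearchState.potential [Fintype κ] (s : SearchState κ) : ℕ :=
  (s.2.2.1.map fun x => x.2.length + 1).sum +
    ∑ v, if s.2.1 v then 0 else 2 * (s.1 v).length

/-- The invariants of the search of `T`. -/
structure SearchState.Searches (T : List (Edge κ)) (s : SearchState κ) : Prop where
  adj_eq : s.1 = adjacency T
  pending : ∀ x ∈ s.2.2.1, ∀ a ∈ x.2, a ∈ adjacency T x.1
  closed : ∀ v, s.2.1 v = true → ∀ a ∈ adjacency T v,
    s.2.1 a.2.2 = true ∨ ∃ x ∈ s.2.2.1, x.1 = v ∧ a ∈ x.2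
  out : ∀ t ∈ s.2.2.2, (t.1, t.2.1, t.2.2.1) ∈ adjacency T t.2.2.2

theorem SearchState.Searches.step {s : SearchState κ} (h : s.Searches T) :
    (searchStep s).Searches T := by
  obtain ⟨adj, vis, W, out⟩ := s
  obtain ⟨h1, h2, h3, h4⟩ := h
  simp only at h1 h2 h3 h4
  subst h1
  rcases W with _ | ⟨⟨v, _ | ⟨⟨fl, e, w⟩, arcs⟩⟩, W⟩
  · exact ⟨rfl, h2, h3, h4⟩
  · refine ⟨rfl, fun x hx => h2 x (List.mem_cons_of_mem _ hx), fun x hx a ha => ?_, h4⟩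
    refine (h3 x hx a ha).imp_right ?_
    rintro ⟨y, hy, hyx, hay⟩
    rcases List.mem_cons.1 hy with rfl | hy
    · simp at hay
    · exact ⟨y, hy, hyx, hay⟩
  · have hv := h2 _ List.mem_cons_self
    rw [searchStep]
    split_ifs with hw
    · refine ⟨rfl, fun x hx a ha => ?_, fun x hx a ha => ?_, h4⟩
      · rcases List.mem_cons.1 hx with rfl | hx
        · exact hv a (List.mem_cons_of_mem _ ha)
        · exact h2 x (List.mem_cons_of_mem _ hx) a ha
      · rcases h3 x hx a ha with h | ⟨y, hy, hyx, hay⟩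
        · exact Or.inl h
        · rcases List.mem_cons.1 hy with rfl | hy
          · rcases List.mem_cons.1 hay with rfl | hay
            · exact Or.inl hw
            · exact Or.inr ⟨_, List.mem_cons_self, hyx, hay⟩
          · exact Or.inr ⟨y, List.mem_cons_of_mem _ hy, hyx, hay⟩
    · refine ⟨rfl, fun x hx a ha => ?_, fun x hx a ha => ?_, fun t ht => ?_⟩
      · simp only [List.mem_cons] at hx
        rcases hx with rfl | rfl | hx
        · exact ha
        · exact hv a (List.mem_cons_of_mem _ ha)
        · exact h2 x (List.mem_cons_of_mem _ hx) a ha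
      · by_cases hxw : x = w
        · exact Or.inr ⟨_, List.mem_cons_self, hxw.symm, hxw ▸ ha⟩
        · simp only [Function.update_of_ne hxw] at hx
          have hmono : ∀ z, vis z = true → Function.update vis w true z = true := fun z hz => by
            rw [Function.update_apply]; split_ifs <;> simp [hz]
          rcases h3 x hx a ha with h | ⟨y, hy, hyx, hay⟩
          · exact Or.inl (hmono _ h)
          · rcases List.mem_cons.1 hy with rfl | hy
            · rcases List.mem_cons.1 hay with rfl | hay
              · exact Or.inl (by simp)
              · exact Or.inr ⟨_, List.mem_cons_of_mem _ List.mem_cons_self, hyx, hay⟩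
            · exact Or.inr ⟨y, by simp [hy], hyx, hay⟩
      · rcases List.mem_cons.1 ht with rfl | ht
        · exact hv _ List.mem_cons_self
        · exact h4 t ht

/-- Discovering `w` removes the scanned arc, adds a worklist entry of size `deg w + 1` and gives up
the reserve `2 * deg w`. The balance is `-deg w`, and `deg w` is positive because the adjacency
lists are symmetric. The other steps clearly decrease the worklist. -/
theorem SearchState.Searches.potential_lt [Fintype κ] {s : SearchState κ} (h : s.Searches T)
    (hW : s.2.2.1 ≠ []) : (searchStep s).potential < s.potential := by
  obtain ⟨adj, vis, W, out⟩ := s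
  obtain ⟨h1, h2, -, -⟩ := h
  simp only at h1 h2
  subst h1
  rcases W with _ | ⟨⟨v, _ | ⟨⟨fl, e, w⟩, arcs⟩⟩, W⟩
  · exact (hW rfl).elim
  · exact Nat.add_lt_add_right (Nat.lt_add_of_pos_left Nat.one_pos) _
  · rw [searchStep]
    split_ifs with hw
    · simp [potential]
    · have h3 := List.length_pos_of_mem
        (mem_adjacency_symm (h2 _ List.mem_cons_self _ List.mem_cons_self))
      simp only [potential, List.map_cons, List.sum_cons, List.length_cons]
      rw [← Finset.add_sum_erase _ _ (Finset.mem_univ w),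
        ← Finset.add_sum_erase _ _ (Finset.mem_univ w)]
      have h4 : ∀ x ∈ Finset.univ.erase w,
          (if Function.update vis w true x then 0 else 2 * (adjacency T x).length) =
            if vis x then 0 else 2 * (adjacency T x).length := fun x hx => by
        rw [Function.update_of_ne (Finset.ne_of_mem_erase hx)]
      rw [Finset.sum_congr rfl h4, Function.update_self, if_neg hw]
      simp only [if_true]
      omega

theorem searchRound_eq (T : List (Edge κ)) (s : SearchState κ) :
    searchRound T s = searchStep^[T.length] s := by
  induction T generalizing s with
  | nil => rfl
  | cons t T ih => exact ih _

theorem search_eq (T : List (Edge κ)) (r : κ) :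
    search T r = (searchStep^[4 * T.length + 1] (searchStart T r)).2.2.2 := by
  have h : 4 * T.length + 1 = (T.length + (T.length + (T.length + T.length))).succ := by omega
  simp only [search, searchRound_eq, ← Function.iterate_add_apply]
  rw [h, Function.iterate_succ_apply' searchStep]

theorem SearchState.Searches.iterate [Fintype κ] {s : SearchState κ} (h : s.Searches T) {n : ℕ}
    (hn : s.2.2.1 = [] ∨ s.potential ≤ n) :
    (searchStep^[n] s).Searches T ∧ (searchStep^[n] s).2.2.1 = [] := by
  induction n generalizing s with
  | zero =>
    refine ⟨h, hn.elim id fun hn => ?_⟩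
    rcases hW : s.2.2.1 with _ | ⟨x, W⟩
    · exact hW
    · simp [potential, hW] at hn
  | succ n ih =>
    refine ih h.step ?_
    by_cases hW : s.2.2.1 = []
    · left
      obtain ⟨adj, vis, W, out⟩ := s
      simp only at hW
      subst hW
      rfl
    · have := h.potential_lt hW
      right
      have := hn.resolve_left hW
      omega

theorem searches_searchStart (T : List (Edge κ)) (r : κ) : (searchStart T r).Searches T := by
  refine ⟨rfl, fun x hx a ha => ?_, fun v hv a ha => ?_, fun t ht => ?_⟩
  · simp only [searchStart, List.mem_singleton] at hx
    subst hx
    exact ha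
  · simp only [searchStart, Function.update_apply] at hv
    split_ifs at hv with h
    subst h
    exact Or.inr ⟨_, List.mem_singleton.2 rfl, rfl, ha⟩
  · simp [searchStart] at ht

/-- The degrees add up to `2 * T.length` and are counted at most twice; the entry of the root
contributes one more. This explains the four rounds and the additional step in `search`. -/
theorem potential_searchStart [Fintype κ] (T : List (Edge κ)) (r : κ) :
    (searchStart T r).potential ≤ 4 * T.length + 1 := by
  have h := sum_length_adjacency T
  have h0 : (searchStart T r).potential = (adjacency T r).length + 1 +
      ∑ v, if Function.update (fun _ => false) r true v then 0
        else 2 * (adjacency T v).length := rfl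
  rw [h0]
  rw [← Finset.add_sum_erase _ _ (Finset.mem_univ r)] at h ⊢
  have h4 : ∑ x ∈ Finset.univ.erase r,
      (if Function.update (fun _ => false) r true x then 0 else 2 * (adjacency T x).length) =
        2 * ∑ x ∈ Finset.univ.erase r, (adjacency T x).length := by
    rw [Finset.mul_sum]
    refine Finset.sum_congr rfl fun x hx => ?_
    rw [Function.update_of_ne (Finset.ne_of_mem_erase hx)]
    simp
  rw [h4, Function.update_self]
  simp only [if_true]
  omega

/-- The search computes a rooted form of a tree. -/
theorem IsTree.search [Fintype κ] {V : Set κ} (h : IsTree ep V T) (hr : r ∈ V) :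
    IsTree ep V (search T r) ∧ (∀ b, flagIds b (SwapRounding.search T r) = flagIds b T) ∧
      ∀ x, x ∈ verts r (SwapRounding.search T r) ↔ x ∈ V := by
  have hS := rooted_search T r
  obtain ⟨hs, hW⟩ := (searches_searchStart T r).iterate (Or.inr (potential_searchStart T r))
  have hval : (searchStep^[4 * T.length + 1] (searchStart T r)).Valid r :=
    Function.Iterate.rec (fun s : SearchState κ => s.Valid r) (valid_searchStart T r)
      (fun _ h => h.step) _
  rw [search_eq] at hS ⊢
  generalize searchStep^[4 * T.length + 1] (searchStart T r) = s at *
  obtain ⟨-, -, hclosed, hout⟩ := hs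
  have hmem : ∀ t ∈ s.2.2.2, ∃ t' ∈ T, t'.1 = t.1 ∧ t'.2.1 = t.2.1 ∧
      ((t'.2.2.1 = t.2.2.1 ∧ t'.2.2.2 = t.2.2.2) ∨
        (t'.2.2.1 = t.2.2.2 ∧ t'.2.2.2 = t.2.2.1)) := by
    intro t ht
    obtain ⟨t', ht', h'⟩ := mem_adjacency.1 (hout t ht)
    simp only [Prod.mk.injEq] at h'
    refine ⟨t', ht', ?_⟩
    rcases h' with ⟨h1, h2, h3, h4⟩ | ⟨h1, h2, h3, h4⟩
    · exact ⟨h2.symm, h3.symm, Or.inr ⟨h1, h4.symm⟩⟩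
    · exact ⟨h2.symm, h3.symm, Or.inl ⟨h4.symm, h1⟩⟩
  have hends : HasEnds ep s.2.2.2 := by
    intro t ht
    obtain ⟨t', ht', -, h1, h2⟩ := hmem t ht
    rw [← h1, h.ends t' ht']
    rcases h2 with ⟨h2, h3⟩ | ⟨h2, h3⟩
    · rw [h2, h3]
    · rw [h2, h3, Sym2.eq_swap]
  have hmemV : ∀ t ∈ s.2.2.2, t.2.2.1 ∈ V ∧ t.2.2.2 ∈ V := by
    intro t ht
    obtain ⟨t', ht', -, -, h2⟩ := hmem t ht
    have h3 := h.mem t' ht'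
    rcases h2 with ⟨h4, h5⟩ | ⟨h4, h5⟩
    · rw [← h4, ← h5]; exact h3
    · rw [← h4, ← h5]; exact h3.symm
  -- The worklist is empty, so the set of visited vertices is closed under adjacency.
  have hvis : ∀ x, Conn ep (idSet T) r x → x ∈ verts r s.2.2.2 := by
    intro x hx
    induction hx with
    | refl => simp [verts]
    | @tail b c _ hc ih =>
      rw [← hval.visited] at ih ⊢
      obtain ⟨e, he, hbc⟩ := hc
      obtain ⟨t, ht, rfl⟩ := mem_idSet.1 he
      have hadj : (t.1, t.2.1, c) ∈ adjacency T b := by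
        rw [mem_adjacency]
        refine ⟨t, ht, ?_⟩
        rw [h.ends t ht, Sym2.eq_iff] at hbc
        rcases hbc with ⟨h1, h2⟩ | ⟨h1, h2⟩
        · exact Or.inl ⟨h1, by rw [h2]⟩
        · exact Or.inr ⟨h2, by rw [h1]⟩
      rcases hclosed b ih _ hadj with h | ⟨x, hx, -⟩
      · exact h
      · rw [hW] at hx
        simp at hx
  have hverts : ∀ x, x ∈ verts r s.2.2.2 ↔ x ∈ V := by
    refine fun x => ⟨fun hx => ?_, fun hx => hvis x (h.conn r hr x hx)⟩
    simp only [verts, List.mem_cons, List.mem_map] at hx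
    rcases hx with rfl | ⟨t, ht, rfl⟩
    · exact hr
    · exact (hmemV t ht).1
  have hsub : ∀ b, flagIds b s.2.2.2 ⊆ flagIds b T := by
    rintro b _ ⟨t, ht, rfl, rfl⟩
    obtain ⟨t', ht', h1, h2, -⟩ := hmem t ht
    exact ⟨t', ht', h1, h2⟩
  -- The search tree already connects the ends of every edge of `T`, so an omitted edge would close
  -- a cycle in `T`.
  have hid : ∀ e ∈ idSet T, e ∈ idSet s.2.2.2 := by
    intro e he
    by_contra hne
    obtain ⟨t, ht, rfl⟩ := mem_idSet.1 he
    have h1 := hS.conn hends ((hverts _).2 (h.mem t ht).1)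
    have h2 := hS.conn hends ((hverts _).2 (h.mem t ht).2)
    refine h.acyc.not_conn he (h.ends t ht) ?_ hne (h1.trans h2.symm)
    rw [idSet_eq, idSet_eq]
    exact Set.union_subset_union (hsub _) (hsub _)
  have hflag : ∀ b, flagIds b s.2.2.2 = flagIds b T := by
    refine fun b => (hsub b).antisymm ?_
    rintro _ ⟨t, ht, rfl, rfl⟩
    obtain ⟨t1, ht1, h1⟩ := mem_idSet.1 (hid _ (mem_idSet.2 ⟨t, ht, rfl⟩))
    obtain ⟨t2, ht2, h2, h3, -⟩ := hmem t1 ht1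
    have := eq_of_nodup_ids h.nodup ht2 ht (h3.trans h1)
    exact ⟨t1, ht1, by rw [← h2, this], h1⟩
  have hids : idSet s.2.2.2 = idSet T := by rw [idSet_eq, hflag, hflag, ← idSet_eq]
  refine ⟨⟨hends, hS.nodup_ids hends, hids ▸ h.acyc, hmemV, ?_⟩, hflag, hverts⟩
  rw [hids]
  exact h.conn

end Search

/-! ### Sequences of exchange partners -/

section Refines

variable {κ : Type*} {ep : κ → Sym2 κ} {K B D : Set κ} {ops : List (Edge κ)}
  {fs : List (Bool × κ × κ)} {x y : κ}

/-- `fs` lists valid exchange partners of the edges `ops`: the two trees consist of the common edges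
`K` and of the edges `ops` and `B`, respectively, the edges `ops` are processed in their order, and
their flags are the outcomes of the coin flips. -/
inductive Refines (ep : κ → Sym2 κ) :
    Set κ → Set κ → List (Edge κ) → List (Bool × κ × κ) → Prop
  | nil (K B : Set κ) : Refines ep K B [] []
  | cons (K B : Set κ) (b : Bool) (e v p f : κ) (ops : List (Edge κ))
      (fs : List (Bool × κ × κ)) :
      f ∈ B → (∃ z w, ep f = s(z, w) ∧ Conn ep K v z) → ¬ Conn ep ((K ∪ B) \ {f}) v p →
      Refines ep (insert (if b then e else f) K) (B \ {f}) ops fs →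
      Refines ep K B ((b, e, v, p) :: ops) ((b, e, f) :: fs)

/-- The endpoints of the edges in a list. -/
def Terminal (ops : List (Edge κ)) (x : κ) : Prop := ∃ t ∈ ops, x = t.2.2.1 ∨ x = t.2.2.2

/-- The children of later edges are not among the endpoints of earlier edges. -/
def Peels : List (Edge κ) → Prop
  | [] => True
  | t :: ops => t.2.2.1 ≠ t.2.2.2 ∧ ¬ Terminal ops t.2.2.1 ∧ Peels ops

theorem terminal_cons {t : Edge κ} :
    Terminal (t :: ops) x ↔ (x = t.2.2.1 ∨ x = t.2.2.2) ∨ Terminal ops x := by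
  simp [Terminal]

theorem terminal_append {ops' : List (Edge κ)} :
    Terminal (ops ++ ops') x ↔ Terminal ops x ∨ Terminal ops' x := by
  simp [Terminal, or_and_right, exists_or]

/-- The conditions under which exchange partners exist. -/
structure Ready (ep : κ → Sym2 κ) (K B : Set κ) (ops : List (Edge κ)) : Prop where
  ends : HasEnds ep ops
  peels : Peels ops
  sep : ∀ x y, Terminal ops x → Terminal ops y → Conn ep K x y → x = y
  conn : ∀ x y, Terminal ops x → Terminal ops y → Conn ep (K ∪ B) x y
  acyc : Acyc ep (K ∪ B)
  disj : Disjoint K B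

/-! ### A single exchange -/

section Step

variable {b : Bool} {e v p f : κ}

theorem Ready.not_conn (h : Ready ep K B ((b, e, v, p) :: ops)) : ¬ Conn ep K v p := fun hc =>
  h.peels.1 (h.sep v p (terminal_cons.2 (Or.inl (Or.inl rfl)))
    (terminal_cons.2 (Or.inl (Or.inr rfl))) hc)

theorem Ready.conn_head (h : Ready ep K B ((b, e, v, p) :: ops)) : Conn ep (K ∪ B) v p :=
  h.conn v p (terminal_cons.2 (Or.inl (Or.inl rfl))) (terminal_cons.2 (Or.inl (Or.inr rfl)))

theorem Ready.notMem (h : Ready ep K B ((b, e, v, p) :: ops)) : e ∉ K := fun he =>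
  h.not_conn (.of_mem he (h.ends _ List.mem_cons_self))

/-- The union is the second tree. If `f` is kept, this tree does not change, and `f` only moves from
`B` to `K`. -/
theorem exchange_eq (h : Disjoint K B) (hf : f ∈ B) :
    insert (if b then e else f) K ∪ B \ {f} =
      if b then insert e ((K ∪ B) \ {f}) else K ∪ B := by
  have hfK : f ∉ K := fun h' => Set.disjoint_left.1 h h' hf
  have h1 : (K ∪ B) \ {f} = K ∪ B \ {f} := by
    rw [Set.union_sdiff_distrib, Set.sdiff_singleton_eq_self hfK]
  cases b
  · rw [if_neg (by simp), if_neg (by simp), Set.insert_union, ← Set.union_insert,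
      Set.insert_sdiff_singleton, Set.insert_eq_of_mem hf]
  · rw [if_pos rfl, if_pos rfl, Set.insert_union, h1]

/-- Connectivity is preserved by exchanges. -/
theorem Ready.conn_step (h : Ready ep K B ((b, e, v, p) :: ops)) (hf : f ∈ B)
    (hn : ¬ Conn ep ((K ∪ B) \ {f}) v p) (hc : Conn ep (K ∪ B) x y) :
    Conn ep (insert (if b then e else f) K ∪ B \ {f}) x y := by
  rw [exchange_eq h.disj hf]
  split_ifs
  · exact hc.exchange (h.ends _ List.mem_cons_self) h.conn_head hn
  · exact hc

theorem Ready.ends_step (h : Ready ep K B ((b, e, v, p) :: ops))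
    (hi : ∃ z w, ep f = s(z, w) ∧ Conn ep K v z) :
    ∃ z w, ep (if b then e else f) = s(z, w) ∧ Conn ep K v z := by
  cases b
  · exact hi
  · exact ⟨v, p, h.ends _ List.mem_cons_self, .refl _⟩

/-- The terminals other than the child of the processed edge are not merged with it. -/
theorem Ready.conn_insert (h : Ready ep K B ((b, e, v, p) :: ops)) {g : κ}
    (hi : ∃ z w, ep g = s(z, w) ∧ Conn ep K v z) (hx : Terminal ops x)
    (hc : Conn ep (insert g K) x y) : Conn ep K x y ∨ Conn ep K v y := by
  obtain ⟨z, w, hg, hz⟩ := hi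
  rw [conn_insert_iff hg] at hc
  rcases hc with hc | ⟨h1, -⟩ | ⟨-, h2⟩
  · exact Or.inl hc
  · have := h.sep x v (terminal_cons.2 (Or.inr hx)) (terminal_cons.2 (Or.inl (Or.inl rfl)))
      (h1.trans hz.symm)
    exact (h.peels.2.1 (this ▸ hx)).elim
  · exact Or.inr (hz.trans h2)

/-- The inserted edge touches the `K`-component of `v`, and `v` is not an endpoint of any later
edge. So that component can be merged with the component of at most one later endpoint, and
different endpoints stay separated. The tree stays a tree, since `f` is on the cycle closed by `e`.
-/
theorem Ready.step (h : Ready ep K B ((b, e, v, p) :: ops)) (hf : f ∈ B)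
    (hi : ∃ z w, ep f = s(z, w) ∧ Conn ep K v z) (hn : ¬ Conn ep ((K ∪ B) \ {f}) v p) :
    Ready ep (insert (if b then e else f) K) (B \ {f}) ops := by
  have hee := h.ends _ List.mem_cons_self
  refine ⟨h.ends.tail, h.peels.2.2, fun x y hx hy hc => ?_, fun x y hx hy => ?_, ?_, ?_⟩
  · rcases h.conn_insert (h.ends_step hi) hx hc with hc | hc
    · exact h.sep x y (terminal_cons.2 (Or.inr hx)) (terminal_cons.2 (Or.inr hy)) hc
    · have := h.sep v y (terminal_cons.2 (Or.inl (Or.inl rfl))) (terminal_cons.2 (Or.inr hy)) hc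
      exact (h.peels.2.1 (this ▸ hy)).elim
  · exact h.conn_step hf hn
      (h.conn x y (terminal_cons.2 (Or.inr hx)) (terminal_cons.2 (Or.inr hy)))
  · rw [exchange_eq h.disj hf]
    split_ifs
    · exact (h.acyc.mono Set.sdiff_subset).insert hee hn
    · exact h.acyc
  · rw [Set.disjoint_insert_left]
    refine ⟨?_, h.disj.mono_right Set.sdiff_subset⟩
    cases b
    · simp
    · exact fun he => hn (.of_mem ⟨Or.inr he.1, he.2⟩ hee)

theorem Ready.exists_partner (h : Ready ep K B ((b, e, v, p) :: ops)) (hB : B.Finite) :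
    ∃ f ∈ B, (∃ z w, ep f = s(z, w) ∧ Conn ep K v z) ∧ ¬ Conn ep ((K ∪ B) \ {f}) v p := by
  obtain ⟨f, h1, -, h2⟩ := exists_separating h.acyc Set.subset_union_left Set.subset_union_right hB
    h.conn_head h.not_conn
  exact ⟨f, h1, h2⟩

/-- The exchange partner is unique, even after the contraction of some edges. -/
theorem Ready.partner_unique (h : Ready ep K B ((b, e, v, p) :: ops)) {f' : κ} (hD : D ⊆ B)
    (hf : f ∈ B \ D) (hf' : f' ∈ B \ D) (hi : ∃ z w, ep f = s(z, w) ∧ Conn ep (K ∪ D) v z)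
    (hi' : ∃ z w, ep f' = s(z, w) ∧ Conn ep (K ∪ D) v z)
    (hn : ¬ Conn ep ((K ∪ B) \ {f}) v p) (hn' : ¬ Conn ep ((K ∪ B) \ {f'}) v p) : f = f' := by
  obtain ⟨z, w, h1, h2⟩ := hi
  obtain ⟨z', w', h3, h4⟩ := hi'
  have hd : ∀ f ∈ B \ D, f ∈ (K ∪ B) \ (K ∪ D) := fun f hf =>
    ⟨Or.inr hf.1, fun h' => h'.elim (fun h' => Set.disjoint_left.1 h.disj h' hf.1) hf.2⟩
  exact separating_unique h.acyc (hd f hf) (hd f' hf') (Set.union_subset_union_right _ hD)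
    h.conn_head h1 h2 h3 h4 hn hn'

end Step

theorem insert_kept (K : Set κ) (b : Bool) (e f : κ) (fs : List (Bool × κ × κ)) :
    insert (if b then e else f) K ∪ {x | x ∈ fs.map keptEdge} =
      K ∪ {x | x ∈ ((b, e, f) :: fs).map keptEdge} := by
  ext x
  rw [Set.mem_union, Set.mem_union, Set.mem_insert_iff, Set.mem_ofPred_eq, Set.mem_ofPred_eq,
    List.map_cons, List.mem_cons, keptEdge, or_left_comm, or_assoc]

theorem sdiff_used (B : Set κ) (b : Bool) (e f : κ) (fs : List (Bool × κ × κ)) :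
    (B \ {f}) \ {x | x ∈ fs.map fun t => t.2.2} =
      B \ {x | x ∈ ((b, e, f) :: fs).map fun t => t.2.2} := by
  ext x
  rw [Set.mem_sdiff, Set.mem_sdiff, Set.mem_sdiff, Set.mem_singleton_iff, Set.mem_ofPred_eq,
    Set.mem_ofPred_eq, List.map_cons, List.mem_cons, not_or, and_assoc]

theorem Refines.append {ops' : List (Edge κ)} {fs' : List (Bool × κ × κ)}
    (h : Refines ep K B ops fs)
    (h' : Refines ep (K ∪ {x | x ∈ fs.map keptEdge}) (B \ {x | x ∈ fs.map fun t => t.2.2})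
      ops' fs') : Refines ep K B (ops ++ ops') (fs ++ fs') := by
  induction h with
  | nil K B => simpa using h'
  | cons K B b e v p f ops fs hf hi hn _ ih =>
    refine .cons K B b e v p f _ _ hf hi hn (ih ?_)
    rwa [insert_kept, sdiff_used]

theorem Refines.map_eq (h : Refines ep K B ops fs) :
    (fs.map fun t => (t.1, t.2.1)) = ops.map fun t => (t.1, t.2.1) := by
  induction h with
  | nil => rfl
  | cons K B b e v p f ops fs hf hi hn _ ih => simp [ih]

theorem Refines.used (h : Refines ep K B ops fs) :
    (fs.map fun t => t.2.2).Nodup ∧ ∀ t ∈ fs, t.2.2 ∈ B := by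
  induction h with
  | nil => simp
  | cons K B b e v p f ops fs hf hi hn _ ih =>
    refine ⟨?_, ?_⟩
    · rw [List.map_cons, List.nodup_cons]
      refine ⟨fun h => ?_, ih.1⟩
      obtain ⟨t, ht, h⟩ := List.mem_map.1 h
      exact (ih.2 t ht).2 h
    · intro t ht
      rcases List.mem_cons.1 ht with rfl | ht
      · exact hf
      · exact (ih.2 t ht).1

theorem Refines.kept (h : Refines ep K B ops fs) (hr : Ready ep K B ops) :
    (fs.map keptEdge).Nodup ∧ ∀ x ∈ fs.map keptEdge, x ∉ K := by
  induction h with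
  | nil => simp
  | cons K B b e v p f ops fs hf hi hn _ ih =>
    have ih := ih (hr.step hf hi hn)
    have h0 : (if b then e else f) ∉ K := by
      cases b
      · exact fun h' => Set.disjoint_left.1 hr.disj h' hf
      · exact hr.notMem
    rw [List.map_cons]
    refine ⟨?_, ?_⟩
    · rw [List.nodup_cons]
      exact ⟨fun h => ih.2 _ h (Set.mem_insert _ _), ih.1⟩
    · intro x hx
      rcases List.mem_cons.1 hx with rfl | hx
      · exact h0
      · exact fun h => ih.2 x hx (Set.mem_insert_of_mem _ h)

/-- The state after some exchanges. -/
theorem Refines.ready {ops' : List (Edge κ)} (h : Refines ep K B ops fs)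
    (hr : Ready ep K B (ops ++ ops')) :
    Ready ep (K ∪ {x | x ∈ fs.map keptEdge}) (B \ {x | x ∈ fs.map fun t => t.2.2}) ops' ∧
      ∀ x y, Conn ep (K ∪ B) x y → Conn ep (K ∪ {x | x ∈ fs.map keptEdge} ∪
        B \ {x | x ∈ fs.map fun t => t.2.2}) x y := by
  induction h with
  | nil => simpa using hr
  | cons K B b e v p f ops fs hf hi hn _ ih =>
    have ih := ih (hr.step hf hi hn)
    rw [insert_kept, sdiff_used] at ih
    exact ⟨ih.1, fun x y hc => ih.2 x y (Ready.conn_step hr hf hn hc)⟩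

/-! ### Contraction of edges that do not matter -/

/-- The edges in `D` are never chosen as exchange partners. -/
def Irrelevant (ep : κ → Sym2 κ) (K B D : Set κ) (ops : List (Edge κ)) : Prop :=
  ∀ g ∈ D, (∀ x y, Terminal ops x → Terminal ops y → Conn ep ((K ∪ B) \ {g}) x y) ∨
    ∀ z w, ep g = s(z, w) → ∀ x, Terminal ops x → ¬ Conn ep K x z

/-- If two endpoints were connected by `K ∪ D` but not by `K`, some edge of `D` would separate them
in the tree and touch the `K`-component of one of them. Both alternatives in `Irrelevant` exclude
this. -/
theorem Ready.union (h : Ready ep K B ops) (hB : B.Finite) (hDB : D ⊆ B)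
    (hD : Irrelevant ep K B D ops) : Ready ep (K ∪ D) (B \ D) ops := by
  have hu : K ∪ D ∪ B \ D = K ∪ B := by
    rw [Set.union_assoc, Set.union_sdiff_cancel hDB]
  refine ⟨h.ends, h.peels, fun x y hx hy hc => ?_, hu ▸ h.conn, hu ▸ h.acyc, ?_⟩
  · by_contra hne
    obtain ⟨f, hf, -, ⟨z, w, h1, h2⟩, h3⟩ := exists_separating h.acyc Set.subset_union_left
      (hDB.trans Set.subset_union_right) (hB.subset hDB) hc fun hK => hne (h.sep x y hx hy hK)
    rcases hD f hf with h4 | h4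
    · exact h3 (h4 x y hx hy)
    · exact h4 z w h1 x hx h2
  · rw [Set.disjoint_union_left]
    exact ⟨h.disj.mono_right Set.sdiff_subset, Set.disjoint_sdiff_right⟩

/-- The true partner is not in `D` by irrelevance. It remains a separating edge at the component of
`v` after the contraction of `D`, where such an edge is unique; so it is the partner found there. -/
theorem Refines.of_union (h : Ready ep K B ops) (hB : B.Finite) (hDB : D ⊆ B)
    (hD : Irrelevant ep K B D ops) (hr : Refines ep (K ∪ D) (B \ D) ops fs) :
    Refines ep K B ops fs := by
  induction ops generalizing K B fs with
  | nil => cases hr; exact .nil _ _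
  | cons t ops ih =>
    rcases hr with _ | ⟨_, _, b, e, v, p, f, _, fs, hf, hi, hn, hr⟩
    have hu : K ∪ D ∪ B \ D = K ∪ B := by
      rw [Set.union_assoc, Set.union_sdiff_cancel hDB]
    rw [hu] at hn
    have hv : Terminal ((b, e, v, p) :: ops) v := terminal_cons.2 (Or.inl (Or.inl rfl))
    have hp : Terminal ((b, e, v, p) :: ops) p := terminal_cons.2 (Or.inl (Or.inr rfl))
    obtain ⟨f', hf', hi', hn'⟩ := h.exists_partner hB
    have hf'D : f' ∉ D := fun hf'D => by
      rcases hD f' hf'D with h4 | h4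
      · exact hn' (h4 v p hv hp)
      · obtain ⟨z, w, h1, h2⟩ := hi'
        exact h4 z w h1 v hv h2
    obtain rfl : f = f' := h.partner_unique hDB hf ⟨hf', hf'D⟩ hi
      (by obtain ⟨z, w, h1, h2⟩ := hi'; exact ⟨z, w, h1, h2.mono Set.subset_union_left⟩) hn hn'
    have hst := h.step hf' hi' hn'
    refine .cons K B b e v p f ops fs hf' hi' hn' (ih hst (hB.subset Set.sdiff_subset)
      (fun g hg => ⟨hDB hg, fun h => hf'D (h ▸ hg)⟩) ?_ ?_)
    -- Irrelevance survives the exchange. A connection without `g` is rerouted along the cycle of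
    -- `e`, and this is possible without `g` since `v` and `p` are connected without `g`. In the
    -- second alternative the component of a later endpoint grows at most by that of `v`, which `g`
    -- does not touch either.
    · intro g hg
      rcases hD g hg with h4 | h4
      · left
        intro x y hx hy
        have hxy := h4 x y (terminal_cons.2 (Or.inr hx)) (terminal_cons.2 (Or.inr hy))
        rw [exchange_eq h.disj hf']
        split_ifs
        · have hge : g ≠ e := by
            rintro rfl
            exact hn (.of_mem ⟨Or.inr (hDB hg), fun h => hf'D (h ▸ hg)⟩
              (h.ends _ List.mem_cons_self))
          have h5 := hxy.exchange (f := f) (h.ends _ List.mem_cons_self) (h4 v p hv hp)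
            fun hc => hn (hc.mono (Set.sdiff_subset_sdiff_left Set.sdiff_subset))
          refine h5.mono ?_
          rintro a (rfl | ha)
          · exact ⟨Or.inl rfl, fun h => hge h.symm⟩
          · exact ⟨Or.inr ⟨ha.1.1, ha.2⟩, ha.1.2⟩
        · exact hxy
      · right
        intro z w hzw x hx hc
        rcases h.conn_insert (h.ends_step hi') hx hc with hc | hc
        · exact h4 z w hzw x (terminal_cons.2 (Or.inr hx)) hc
        · exact h4 z w hzw v hv hc
    · rw [Set.insert_union, Set.sdiff_sdiff_comm]
      exact hr

/-! ### Exchange partners in a contraction -/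

section Contract

variable {φ : κ → κ} {K₀ : Set κ}

theorem terminal_relabel : Terminal (relabel φ ops) x ↔ ∃ y, Terminal ops y ∧ φ y = x := by
  simp only [Terminal, relabel, List.mem_map]
  constructor
  · rintro ⟨_, ⟨⟨fl, e, v, p⟩, ht, rfl⟩, rfl | rfl⟩
    · exact ⟨v, ⟨_, ht, Or.inl rfl⟩, rfl⟩
    · exact ⟨p, ⟨_, ht, Or.inr rfl⟩, rfl⟩
  · rintro ⟨y, ⟨⟨fl, e, v, p⟩, ht, rfl | rfl⟩, rfl⟩
    · exact ⟨_, ⟨_, ht, rfl⟩, Or.inl rfl⟩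
    · exact ⟨_, ⟨_, ht, rfl⟩, Or.inr rfl⟩

theorem hasEnds_relabel (h : HasEnds ep ops) :
    HasEnds (fun e => (ep e).map φ) (relabel φ ops) := by
  intro t ht
  obtain ⟨⟨fl, e, v, p⟩, ht', rfl⟩ := List.mem_map.1 ht
  simp [h _ ht', relabelEdge]

theorem Peels.relabel (h : Peels ops)
    (hφ : ∀ x y, Terminal ops x → Terminal ops y → φ x = φ y → x = y) :
    Peels (relabel φ ops) := by
  induction ops with
  | nil => trivial
  | cons t ops ih =>
    obtain ⟨fl, e, v, p⟩ := t
    have hv : Terminal ((fl, e, v, p) :: ops) v := terminal_cons.2 (Or.inl (Or.inl rfl))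
    refine ⟨fun h' => h.1 (hφ _ _ hv (terminal_cons.2 (Or.inl (Or.inr rfl))) h'), fun h' => ?_,
      ih h.2.2 fun x y hx hy => hφ x y (terminal_cons.2 (Or.inr hx)) (terminal_cons.2 (Or.inr hy))⟩
    obtain ⟨y, hy, h'⟩ := terminal_relabel.1 h'
    have := hφ y v (terminal_cons.2 (Or.inr hy)) hv h'
    exact h.2.1 (this ▸ hy)

theorem Ready.contract (hφ : ∀ x y, φ x = φ y ↔ Conn ep K₀ x y) (h : Ready ep K₀ B ops) :
    Ready (fun e => (ep e).map φ) ∅ B (relabel φ ops) := by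
  refine ⟨hasEnds_relabel h.ends,
    h.peels.relabel fun x y hx hy hxy => h.sep x y hx hy ((hφ x y).1 hxy), ?_, ?_, ?_,
    Set.empty_disjoint _⟩
  · intro x' y' hx hy hc
    obtain ⟨x, -, rfl⟩ := terminal_relabel.1 hx
    obtain ⟨y, -, rfl⟩ := terminal_relabel.1 hy
    exact conn_empty.1 hc
  · intro x' y' hx hy
    obtain ⟨x, hx', rfl⟩ := terminal_relabel.1 hx
    obtain ⟨y, hy', rfl⟩ := terminal_relabel.1 hy
    rw [Set.empty_union, conn_contract hφ, Set.union_comm]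
    exact h.conn x y hx' hy'
  · rw [Set.empty_union]
    exact Acyc.contract hφ (Set.union_comm _ _ ▸ h.acyc) h.disj.symm

/-- The converse passage to `Ready.contract`: partners are identifiers, which contraction does not
change, and incidence and separation in the contraction mean incidence and separation modulo `K₀`.
-/
theorem Refines.of_contract (hφ : ∀ x y, φ x = φ y ↔ Conn ep K₀ x y) (hd : Disjoint K₀ B)
    (h : Refines (fun e => (ep e).map φ) K B (relabel φ ops) fs) :
    Refines ep (K ∪ K₀) B ops fs := by
  induction ops generalizing K B fs with
  | nil => cases h; exact .nil _ _
  | cons t ops ih =>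
    obtain ⟨b, e, v, p⟩ := t
    rcases h with _ | ⟨_, _, _, _, _, _, f, _, fs, hf, hi, hn, hr⟩
    refine .cons _ B b e v p f ops fs hf ?_ ?_ ?_
    · obtain ⟨z', w', h1, h2⟩ := hi
      obtain ⟨z, w, hzw⟩ : ∃ z w, ep f = s(z, w) := by
        induction h : ep f with | _ p q => exact ⟨p, q, rfl⟩
      simp only [hzw, Sym2.map_mk, Sym2.eq_iff] at h1
      rcases h1 with ⟨rfl, rfl⟩ | ⟨rfl, rfl⟩
      · exact ⟨z, w, hzw, (conn_contract hφ).1 h2⟩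
      · exact ⟨w, z, hzw.trans Sym2.eq_swap, (conn_contract hφ).1 h2⟩
    · refine fun hc => hn ((conn_contract hφ).2 (hc.mono ?_))
      rintro x ⟨(hx | hx) | hx, hxf⟩
      · exact Or.inl ⟨Or.inl hx, hxf⟩
      · exact Or.inr hx
      · exact Or.inl ⟨Or.inr hx, hxf⟩
    · rw [← Set.insert_union]
      exact ih (hd.mono_right Set.sdiff_subset) hr

end Contract

end Refines

/-! ### Correctness of the computation of exchange partners -/

section Solve

variable {κ : Type*} {ep : κ → Sym2 κ} {r : κ} {l T ops : List (Edge κ)}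

theorem Rooted.isTree (hl : Rooted r l) (he : HasEnds ep l) : IsTree ep {x | x ∈ verts r l} l :=
  ⟨he, hl.nodup_ids he, hl.acyc he, fun _ ht => hl.mem ht,
    fun _ hx _ hy => (hl.conn he hx).trans (hl.conn he hy).symm⟩

theorem finite_idSet (l : List (Edge κ)) : (idSet l).Finite := List.finite_toSet _

theorem flagIds_eq_empty {b : Bool} (h : ∀ t ∈ l, t.1 ≠ b) : flagIds b l = ∅ := by
  ext e
  simp only [flagIds, Set.mem_ofPred_eq, Set.mem_empty_iff_false, iff_false]
  rintro ⟨t, ht, hb, -⟩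
  exact h t ht hb

theorem relabel_relabel (φ ψ : κ → κ) (l : List (Edge κ)) :
    relabel φ (relabel ψ l) = relabel (φ ∘ ψ) l := by
  simp [relabel, relabelEdge, Function.comp_def]

variable [DecidableEq κ]

theorem Rooted.hasEnds_contract (hl : Rooted r l) (he : HasEnds ep l) :
    HasEnds (fun e => (ep e).map (SwapRounding.contract l.reverse).1)
      (SwapRounding.contract l.reverse).2 := by
  intro t ht
  obtain ⟨t', ht', -, rfl⟩ := contract_edges hl ht
  simp [he t' ht']

/-- What remains after the contraction of the irrelevant edges. -/
theorem shrink_spec [Fintype κ] {V : Set κ} (hT : IsTree ep V T) (hr : r ∈ V)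
    (hops : ∀ x, Terminal ops x → x ∈ V)
    (h : Ready ep (flagIds true T) (flagIds false T) ops) :
    ∃ (ep' : κ → Sym2 κ) (φ : κ → κ), Rooted r (shrink r T ops).1 ∧
      HasEnds ep' (shrink r T ops).1 ∧ (∀ t ∈ (shrink r T ops).1, t.1 = false) ∧
      (shrink r T ops).2 = relabel φ ops ∧ φ r = r ∧
      (∀ x, Terminal (shrink r T ops).2 x → x ∈ verts r (shrink r T ops).1) ∧
      Ready ep' ∅ (idSet (shrink r T ops).1) (shrink r T ops).2 ∧
      ∀ fs, Refines ep' ∅ (idSet (shrink r T ops).1) (shrink r T ops).2 fs →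
        Refines ep (flagIds true T) (flagIds false T) ops fs := by
  obtain ⟨hS, hflag, hverts⟩ := hT.search hr
  have hSr := rooted_search T r
  rw [shrink]
  generalize search T r = S at *
  have h1r := hSr.contract
  have h1e := hSr.hasEnds_contract hS.ends
  have h1φ := contract_eq_iff hSr hS.ends
  have h1root := contract_root hSr
  have h1id := idSet_contract S
  have h1v := fun x hx => contract_mem_verts (x := x) hSr ((hverts x).2 hx)
  rw [hflag] at h1φ h1id
  generalize contract S.reverse = c at *
  have hR1 := h.contract h1φ
  have hback1 : ∀ fs, Refines (fun e => (ep e).map c.1) ∅ (flagIds false T) (relabel c.1 ops) fs →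
      Refines ep (flagIds true T) (flagIds false T) ops fs := fun fs hfs => by
    simpa using hfs.of_contract h1φ h.disj
  have hterm : ∀ x, Terminal (relabel c.1 ops) x → x ∈ verts r c.2 := fun x hx => by
    obtain ⟨y, hy, rfl⟩ := terminal_relabel.1 hx
    exact h1v y (hops y hy)
  set ops1 := relabel c.1 ops with hops1
  set ep1 : κ → Sym2 κ := fun e => (ep e).map c.1
  simp only [prune_eq]
  set L := pruned (markEnds ops1) (markEnds ops1) c.2 with hL
  have hLr : Rooted r L := h1r.pruned _ _
  have hLv : verts r L = verts r c.2 := verts_pruned _ _ _ _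
  have hLid : idSet L = flagIds false T := by rw [← h1id, idSet, idSet, hL, edgeIds_pruned]
  have hLe : HasEnds ep1 L := fun t ht => by
    obtain ⟨t', ht', h'⟩ := mem_pruned ht
    rw [← h']
    exact h1e t' ht'
  have hLt := hLr.isTree hLe
  have hmark : ∀ x, markEnds ops1 x = true ↔ Terminal ops1 x := markEnds_iff ops1
  -- An edge flagged by pruning is avoided by the paths from all endpoints to the root, hence
  -- between endpoints, or it touches no endpoint at all.
  have hirr : Irrelevant ep1 ∅ (flagIds false T) (flagIds true L) ops1 := by
    rintro _ ⟨t, ht, hf, rfl⟩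
    rcases pruned_spec h1r h1e ht hf with h' | ⟨h2, h3⟩
    · left
      intro x y hx hy
      rw [Set.empty_union, ← h1id]
      exact (h' x (hterm x hx) ((hmark x).2 hx)).trans (h' y (hterm y hy) ((hmark y).2 hy)).symm
    · right
      intro z w hzw x hx hc
      rw [conn_empty] at hc
      subst hc
      rw [hLe t ht, Sym2.eq_iff] at hzw
      rw [← hmark] at hx
      rcases hzw with ⟨h4, -⟩ | ⟨-, h4⟩
      · rw [h4, hx] at h2; cases h2
      · rw [h4, hx] at h3; cases h3
  have hfin : (flagIds false T).Finite := hLid ▸ finite_idSet L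
  have hsub : flagIds true L ⊆ flagIds false T := hLid ▸ flagIds_subset true L
  have hsd : flagIds false T \ flagIds true L = flagIds false L := by
    rw [← hLid, idSet_eq, Set.union_sdiff_cancel_right]
    rw [Set.subset_empty_iff, ← Set.disjoint_iff_inter_eq_empty]
    exact flagIds_disjoint hLt.nodup
  have hR2 := hR1.union hfin hsub hirr
  have h2φ := contract_eq_iff hLr hLe
  rw [Set.empty_union] at hR2
  have hR3 := hR2.contract h2φ
  have h2r := hLr.contract
  have h2e := hLr.hasEnds_contract hLe
  have h2f := fun t ht => contract_edges (t := t) hLr ht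
  have h2root := contract_root hLr
  have h2id := idSet_contract L
  have h2v := fun x hx => contract_mem_verts (x := x) hLr (hLv ▸ hterm x hx)
  generalize contract L.reverse = c' at *
  rw [hsd] at hR3
  rw [h2id]
  refine ⟨_, c'.1 ∘ c.1, h2r, h2e, fun t ht => ?_, relabel_relabel _ _ _, ?_, fun x hx => ?_, hR3,
    fun fs hfs => ?_⟩
  · obtain ⟨t', -, -, rfl⟩ := h2f t ht
    rfl
  · rw [Function.comp_apply, h1root, h2root]
  · obtain ⟨y, hy, rfl⟩ := terminal_relabel.1 hx
    exact h2v y hy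
  · refine hback1 fs (Refines.of_union hR1 hfin hsub hirr ?_)
    rw [hsd]
    exact hfs.of_contract h2φ (flagIds_disjoint hLt.nodup).symm

/-- Different edges of a rooted tree have different children, so there is only one hit. -/
theorem findEdge_eq (hl : Rooted r l) {t : Edge κ} (ht : t ∈ l) (f : κ) :
    findEdge t.2.2.1 f l = t.2.1 := by
  have h0 : ∀ (l : List (Edge κ)) (v f : κ), (l.foldl findStep (v, f)).1 = v := by
    intro l
    induction l with
    | nil => intros; rfl
    | cons t l ih =>
      intro v f
      obtain ⟨fl, e, x, y⟩ := t
      rw [List.foldl_cons, findStep]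
      split_ifs <;> exact ih _ _
  have h1 : ∀ (l : List (Edge κ)) (v f : κ), v ∉ (l.map fun t => t.2.2.1) → findEdge v f l = f := by
    intro l
    induction l with
    | nil => intros; rfl
    | cons t l ih =>
      intro v f hv
      obtain ⟨fl, e, x, y⟩ := t
      simp only [List.map_cons, List.mem_cons, not_or] at hv
      rw [findEdge, List.foldl_cons, findStep, if_neg (Ne.symm hv.1)]
      exact ih v f hv.2
  induction l generalizing f with
  | nil => simp at ht
  | cons t' l ih =>
    obtain ⟨fl, e, x, y⟩ := t'
    rw [findEdge, List.foldl_cons, findStep]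
    rcases List.mem_cons.1 ht with rfl | ht
    · rw [if_pos rfl]
      exact h1 _ _ _ fun h => hl.1 (List.mem_cons_of_mem _ h)
    · split_ifs
      · exact ih hl.2.2 ht e
      · exact ih hl.2.2 ht f

/-- The root `p` is its own representative under the contractions, so the edge above the image of
`v` both touches that image and separates it from `p`. -/
theorem refines_solveLast [Fintype κ] {V : Set κ} {b : Bool} {e v p : κ} (hT : IsTree ep V T)
    (hops : ∀ x, Terminal [(b, e, v, p)] x → x ∈ V)
    (h : Ready ep (flagIds true T) (flagIds false T) [(b, e, v, p)]) :
    Refines ep (flagIds true T) (flagIds false T) [(b, e, v, p)]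
      (solveLast (shrink p T [(b, e, v, p)])) := by
  obtain ⟨ep', φ, h1, h2, -, h4, h5, h6, h7, h8⟩ := shrink_spec hT
    (hops p (terminal_cons.2 (Or.inl (Or.inr rfl)))) hops h
  refine h8 _ ?_
  generalize shrink p T [(b, e, v, p)] = s at *
  obtain ⟨l, ops⟩ := s
  simp only at h1 h2 h4 h6 h7 ⊢
  subst h4
  simp only [relabel, relabelEdge, List.map_cons, List.map_nil, h5] at h6 h7 ⊢
  rw [solveLast]
  have hv := h6 (φ v) (terminal_cons.2 (Or.inl (Or.inl rfl)))
  have hne := h7.peels.1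
  simp only at hne
  rw [verts, List.mem_cons] at hv
  obtain ⟨t, ht, htv⟩ := List.mem_map.1 (hv.resolve_left hne)
  rw [← htv, findEdge_eq h1 ht]
  refine .cons _ _ _ _ _ _ _ _ _ (mem_idSet.2 ⟨t, ht, rfl⟩) ⟨_, _, h2 t ht, .refl _⟩ ?_
    (.nil _ _)
  rw [Set.empty_union]
  exact h1.not_conn h2 ht

/-! ### The tree after some exchanges -/

theorem foldl_statusStep (F : List (Bool × κ × κ)) (st : κ → List Bool) (e : κ) :
    (F.foldl statusStep st e = st e ∧ ∀ t ∈ F, t.2.2 ≠ e) ∨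
      ∃ t ∈ F, t.2.2 = e ∧ F.foldl statusStep st e = [t.1] := by
  induction F generalizing st with
  | nil => simp
  | cons t F ih =>
    obtain ⟨b, e', f⟩ := t
    rw [List.foldl_cons, statusStep]
    rcases ih (Function.update st f [b]) with ⟨h1, h2⟩ | ⟨t, ht, h⟩
    · by_cases hf : f = e
      · refine Or.inr ⟨_, List.mem_cons_self, hf, ?_⟩
        rw [h1, hf, Function.update_self]
      · refine Or.inl ⟨?_, fun t ht => ?_⟩
        · rw [h1, Function.update_of_ne (Ne.symm hf)]
        · rcases List.mem_cons.1 ht with rfl | ht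
          · exact hf
          · exact h2 t ht
    · exact Or.inr ⟨t, List.mem_cons_of_mem _ ht, h⟩

omit [DecidableEq κ] in
/-- The edges of a tree that remain, with the flag for those that are kept in an exchange. -/
def remaining (st : κ → List Bool) (B : List (Edge κ)) : List (Edge κ) := B.filterMap fun t =>
  match st t.2.1 with
  | [] => some (false, t.2)
  | b :: _ => if b then none else some (true, t.2)

omit [DecidableEq κ] in
theorem foldl_nextStep (st : κ → List Bool) (B acc : List (Edge κ)) :
    (B.foldl nextStep (st, acc)).2 = (remaining st B).reverse ++ acc := by
  induction B generalizing acc with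
  | nil => rfl
  | cons t B ih =>
    obtain ⟨fl, e, x, y⟩ := t
    rw [List.foldl_cons, nextStep, remaining, List.filterMap_cons]
    simp only
    rcases st e with _ | ⟨b, _⟩
    · rw [ih]; simp [remaining]
    · rw [ih]; cases b <;> simp [remaining]

omit [DecidableEq κ] in
theorem edgeIds_remaining (st : κ → List Bool) (B : List (Edge κ)) :
    (edgeIds (remaining st B)).Sublist (edgeIds B) := by
  induction B with
  | nil => exact .slnil
  | cons t B ih =>
    rw [remaining, List.filterMap_cons]
    rcases st t.2.1 with _ | ⟨b, _⟩
    · exact ih.cons_cons _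
    · cases b
      · exact ih.cons_cons _
      · exact ih.cons _

omit [DecidableEq κ] in
theorem foldl_keepStep (ops acc : List (Edge κ)) :
    ops.foldl keepStep acc = (ops.filter fun t => t.1).reverse ++ acc := by
  induction ops generalizing acc with
  | nil => rfl
  | cons t ops ih =>
    obtain ⟨b, e, x, y⟩ := t
    rw [List.foldl_cons, keepStep, ih]
    cases b <;> simp

omit [DecidableEq κ] in
theorem Peels.nodup_ids (h : Peels ops) (he : HasEnds ep ops) : (edgeIds ops).Nodup := by
  induction ops with
  | nil => simp [edgeIds]
  | cons t ops ih =>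
    rw [edgeIds, List.map_cons, List.nodup_cons]
    refine ⟨fun h' => ?_, ih h.2.2 he.tail⟩
    obtain ⟨t', ht', hid⟩ := List.mem_map.1 h'
    have h1 := he t' (List.mem_cons_of_mem _ ht')
    rw [hid, he t List.mem_cons_self, Sym2.eq_iff] at h1
    rcases h1 with ⟨h1, -⟩ | ⟨h1, -⟩
    · exact h.2.1 ⟨t', ht', Or.inl h1⟩
    · exact h.2.1 ⟨t', ht', Or.inr h1⟩

variable {B o₁ o₂ : List (Edge κ)} {F : List (Bool × κ × κ)}

omit [DecidableEq κ] in
theorem Peels.of_append (h : Peels (o₁ ++ o₂)) : Peels o₁ := by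
  induction o₁ with
  | nil => trivial
  | cons t o₁ ih =>
    exact ⟨h.1, fun h' => h.2.1 (terminal_append.2 (Or.inl h')), ih h.2.2⟩

omit [DecidableEq κ] in
theorem Ready.of_append {K B : Set κ} (h : Ready ep K B (o₁ ++ o₂)) : Ready ep K B o₁ :=
  ⟨fun t ht => h.ends t (List.mem_append_left _ ht), h.peels.of_append,
    fun x y hx hy => h.sep x y (terminal_append.2 (Or.inl hx)) (terminal_append.2 (Or.inl hy)),
    fun x y hx hy => h.conn x y (terminal_append.2 (Or.inl hx)) (terminal_append.2 (Or.inl hy)),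
    h.acyc, h.disj⟩

omit [DecidableEq κ] in
theorem Refines.mem_kept {K B : Set κ} (h : Refines ep K B ops F) {x : κ} :
    x ∈ F.map keptEdge ↔ (∃ t ∈ ops, t.1 = true ∧ t.2.1 = x) ∨ ∃ e, (false, e, x) ∈ F := by
  have h1 : (∃ t ∈ ops, t.1 = true ∧ t.2.1 = x) ↔ (true, x) ∈ F.map fun t => (t.1, t.2.1) := by
    rw [h.map_eq]
    simp
  rw [h1]
  simp only [List.mem_map, keptEdge]
  constructor
  · rintro ⟨⟨b, e, f⟩, ht, rfl⟩
    cases b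
    · exact Or.inr ⟨e, ht⟩
    · exact Or.inl ⟨_, ht, rfl⟩
  · rintro (⟨⟨b, e, f⟩, ht, h⟩ | ⟨e, he⟩)
    · obtain ⟨rfl, rfl⟩ := Prod.mk.inj h
      exact ⟨_, ht, rfl⟩
    · exact ⟨_, he, rfl⟩

theorem mem_remaining (hu : (F.map fun t => t.2.2).Nodup) {t : Edge κ} :
    t ∈ remaining (F.foldl statusStep fun _ => []) B ↔ ∃ t' ∈ B, t'.2 = t.2 ∧
      ((t.1 = false ∧ ∀ f ∈ F, f.2.2 ≠ t.2.1) ∨ (t.1 = true ∧ ∃ e, (false, e, t.2.1) ∈ F)) := by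
  rw [remaining, List.mem_filterMap]
  refine exists_congr fun t' => and_congr_right fun _ => ?_
  obtain ⟨fl', e', x', y'⟩ := t'
  obtain ⟨fl, e, x, y⟩ := t
  rcases foldl_statusStep F (fun _ => []) e' with ⟨h1, h2⟩ | ⟨⟨b, a, f⟩, hf, rfl, h1⟩
  · simp only [h1, Option.some.injEq, Prod.mk.injEq]
    constructor
    · rintro ⟨rfl, rfl, rfl, rfl⟩
      exact ⟨⟨rfl, rfl, rfl⟩, Or.inl ⟨rfl, h2⟩⟩
    · rintro ⟨⟨rfl, rfl, rfl⟩, ⟨rfl, -⟩ | ⟨-, a, ha⟩⟩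
      · exact ⟨rfl, rfl, rfl, rfl⟩
      · exact (h2 _ ha rfl).elim
  · simp only [h1, Prod.mk.injEq]
    cases b
    · simp only [Bool.false_eq_true, if_false, Option.some.injEq, Prod.mk.injEq]
      constructor
      · rintro ⟨rfl, rfl, rfl, rfl⟩
        exact ⟨⟨rfl, rfl, rfl⟩, Or.inr ⟨rfl, _, hf⟩⟩
      · rintro ⟨⟨rfl, rfl, rfl⟩, ⟨rfl, h3⟩ | ⟨rfl, -⟩⟩
        · exact (h3 _ hf rfl).elim
        · exact ⟨rfl, rfl, rfl, rfl⟩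
    · simp only [if_true, reduceCtorEq, false_iff]
      rintro ⟨⟨rfl, rfl, rfl⟩, ⟨rfl, h3⟩ | ⟨rfl, a', h3⟩⟩
      · exact h3 _ hf rfl
      · have := List.inj_on_of_nodup_map hu hf h3 rfl
        simp at this

/-- Membership in the tree after some exchanges. -/
theorem mem_nextTree (hu : (F.map fun t => t.2.2).Nodup) {t : Edge κ} :
    t ∈ nextTree B F ops ↔ (t ∈ ops ∧ t.1 = true) ∨ ∃ t' ∈ B, t'.2 = t.2 ∧
      ((t.1 = false ∧ ∀ f ∈ F, f.2.2 ≠ t.2.1) ∨ (t.1 = true ∧ ∃ e, (false, e, t.2.1) ∈ F)) := by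
  rw [nextTree, foldl_nextStep, foldl_keepStep, List.append_nil, List.mem_append, List.mem_reverse,
    List.mem_reverse, List.mem_filter, mem_remaining hu, or_comm]

/-- The pair `(K, B)` of the specification is stored in a single list: `K` consists of the flagged
edges and `B` of the unflagged ones. The updated tree therefore encodes the state after the
exchanges `F`. -/
theorem flagIds_true_nextTree (h : Refines ep ∅ (idSet B) ops F) :
    flagIds true (nextTree B F ops) = {x | x ∈ F.map keptEdge} := by
  ext x
  rw [Set.mem_ofPred_eq, h.mem_kept]
  simp only [flagIds, Set.mem_ofPred_eq, mem_nextTree h.used.1]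
  constructor
  · rintro ⟨t, ⟨ht, -⟩ | ⟨t', -, -, ⟨h1, -⟩ | ⟨-, h1⟩⟩, hb, rfl⟩
    · exact Or.inl ⟨t, ht, hb, rfl⟩
    · rw [h1] at hb; cases hb
    · exact Or.inr h1
  · rintro (⟨t, ht, hb, rfl⟩ | ⟨e, he⟩)
    · exact ⟨t, Or.inl ⟨ht, hb⟩, hb, rfl⟩
    · obtain ⟨t, ht, h1⟩ := mem_idSet.1 (h.used.2 _ he)
      simp only at h1
      exact ⟨(true, t.2), Or.inr ⟨t, ht, rfl, Or.inr ⟨rfl, e, by rw [h1]; exact he⟩⟩, rfl, h1⟩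

theorem flagIds_false_nextTree (h : Refines ep ∅ (idSet B) ops F) :
    flagIds false (nextTree B F ops) = idSet B \ {x | x ∈ F.map fun t => t.2.2} := by
  ext x
  simp only [flagIds, Set.mem_ofPred_eq, mem_nextTree h.used.1, Set.mem_sdiff, mem_idSet,
    List.mem_map, not_exists, not_and]
  constructor
  · rintro ⟨t, ⟨-, h1⟩ | ⟨t', ht', h0, ⟨-, h2⟩ | ⟨h1, -⟩⟩, hb, rfl⟩
    · rw [h1] at hb; cases hb
    · exact ⟨⟨t', ht', by rw [h0]⟩, h2⟩
    · rw [h1] at hb; cases hb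
  · rintro ⟨⟨t, ht, rfl⟩, h2⟩
    exact ⟨(false, t.2), Or.inr ⟨t, ht, rfl, Or.inl ⟨rfl, h2⟩⟩, rfl, rfl⟩

theorem isTree_nextTree {V : Set κ} (hB : IsTree ep V B) (hops : ∀ x, Terminal o₁ x → x ∈ V)
    (hr : Ready ep ∅ (idSet B) (o₁ ++ o₂)) (h : Refines ep ∅ (idSet B) o₁ F) :
    IsTree ep V (nextTree B F o₁) := by
  have hr1 := hr.of_append
  have hu := h.used.1
  obtain ⟨hn, hc⟩ := h.ready hr
  have hids : idSet (nextTree B F o₁) =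
      ∅ ∪ {x | x ∈ F.map keptEdge} ∪ idSet B \ {x | x ∈ F.map fun t => t.2.2} := by
    rw [idSet_eq, flagIds_true_nextTree h, flagIds_false_nextTree h, Set.empty_union,
      Set.union_comm]
  refine ⟨fun t ht => ?_, ?_, hids ▸ hn.acyc, fun t ht => ?_, fun x hx y hy => ?_⟩
  · rcases (mem_nextTree hu).1 ht with ⟨ht, -⟩ | ⟨t', ht', h0, -⟩
    · exact hr1.ends t ht
    · rw [← h0]
      exact hB.ends t' ht'
  · have hd : ∀ x ∈ {x | x ∈ F.map keptEdge}, x ∉ idSet B \ {x | x ∈ F.map fun t => t.2.2} :=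
      fun x hx hx' => Set.disjoint_left.1 hn.disj (Or.inr hx) hx'
    rw [nextTree, foldl_nextStep, foldl_keepStep, List.append_nil, edgeIds, List.map_append,
      List.nodup_append']
    refine ⟨?_, ?_, ?_⟩
    · rw [List.map_reverse, List.nodup_reverse]
      exact List.Nodup.sublist (edgeIds_remaining _ B) hB.nodup
    · rw [List.map_reverse, List.nodup_reverse]
      exact (hr1.peels.nodup_ids hr1.ends).sublist (List.Sublist.map _ List.filter_sublist)
    · rw [List.disjoint_left]
      intro x hx hx'
      rw [List.mem_map] at hx hx'
      obtain ⟨t, ht, rfl⟩ := hx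
      obtain ⟨t', ht', hid⟩ := hx'
      rw [List.mem_reverse, List.mem_filter] at ht'
      have hk : t.2.1 ∈ F.map keptEdge := h.mem_kept.2 (Or.inl ⟨t', ht'.1, ht'.2, hid⟩)
      obtain ⟨t'', ht'', h0, ⟨-, h2⟩ | ⟨-, e, h2⟩⟩ := (mem_remaining hu).1 (List.mem_reverse.1 ht)
      · refine hd _ hk ⟨mem_idSet.2 ⟨t'', ht'', by rw [h0]⟩, fun h3 => ?_⟩
        obtain ⟨f, hf, h3⟩ := List.mem_map.1 h3
        exact h2 f hf h3
      · have h3 : (true, t.2.1) ∈ F.map fun t => (t.1, t.2.1) := by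
          rw [h.map_eq]
          exact List.mem_map.2 ⟨t', ht'.1, by rw [ht'.2, hid]⟩
        obtain ⟨⟨b, a, f⟩, hf, h4⟩ := List.mem_map.1 h3
        obtain ⟨rfl, rfl⟩ := Prod.mk.inj h4
        have := List.inj_on_of_nodup_map (h.kept hr1).1 hf h2 rfl
        simp at this
  · rcases (mem_nextTree hu).1 ht with ⟨ht, -⟩ | ⟨t', ht', h0, -⟩
    · exact ⟨hops _ ⟨t, ht, Or.inl rfl⟩, hops _ ⟨t, ht, Or.inr rfl⟩⟩
    · rw [← h0]
      exact hB.mem t' ht'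
  · rw [hids]
    refine hc x y ?_
    rw [Set.empty_union]
    exact hB.conn x hx y hy

/-- The computation of exchange partners is correct. -/
theorem solve_spec [Fintype κ] {d : ℕ} {V : Set κ} (hT : IsTree ep V T)
    (hops : ∀ x, Terminal ops x → x ∈ V)
    (h : Ready ep (flagIds true T) (flagIds false T) ops) (hd : ops.length ≤ 2 ^ d) :
    Refines ep (flagIds true T) (flagIds false T) ops (solve d T ops) := by
  induction d generalizing ep V T ops with
  | zero =>
    rcases ops with _ | ⟨⟨b, e, v, p⟩, _ | ⟨o, ops⟩⟩
    · rw [solve]; exact .nil _ _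
    · rw [solve]
      exact refines_solveLast hT hops h
    · simp at hd
  | succ d ih =>
    rcases ops with _ | ⟨⟨b, e, v, p⟩, _ | ⟨o, ops⟩⟩
    · rw [solve]; exact .nil _ _
    · rw [solve]
      exact refines_solveLast hT hops h
    · rw [solve]
      have hlen := length_shrink_ops p T ((b, e, v, p) :: o :: ops)
      obtain ⟨ep', φ, h1, h2, h3, -, -, h4, h5, h6⟩ := shrink_spec hT
        (hops p (terminal_cons.2 (Or.inl (Or.inr rfl)))) hops h
      generalize shrink p T ((b, e, v, p) :: o :: ops) = s at *
      have h7 := length_halve_self s.2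
      have h8 := halve_append s.2 s.2
      generalize halve s.2 s.2 = hs at *
      -- After shrinking no edge is flagged, so the recursion for the first half starts with `K =
      -- ∅`.
      have h9 : flagIds true s.1 = ∅ := flagIds_eq_empty fun t ht => by simp [h3 t ht]
      have h10 : flagIds false s.1 = idSet s.1 := by rw [idSet_eq, h9, Set.union_empty]
      have h11 := h1.isTree h2
      rw [← h8] at h4 h5
      have hd' : hs.1.length ≤ 2 ^ d ∧ hs.2.length ≤ 2 ^ d := by
        rw [pow_succ] at hd
        omega
      have hF := ih h11 (fun x hx => h4 x (terminal_append.2 (Or.inl hx)))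
        (by rw [h9, h10]; exact h5.of_append) hd'.1
      rw [h9, h10] at hF
      have h12 := isTree_nextTree h11 (fun x hx => h4 x (terminal_append.2 (Or.inl hx))) h5 hF
      have h13 := flagIds_true_nextTree hF
      have h14 := flagIds_false_nextTree hF
      have h15 := (hF.ready h5).1
      rw [Set.empty_union] at h15
      have hF' := ih h12 (fun x hx => h4 x (terminal_append.2 (Or.inr hx)))
        (by rw [h13, h14]; exact h15) hd'.2
      refine h6 _ ?_
      rw [← h8]
      refine hF.append ?_
      rwa [Set.empty_union, ← h13, ← h14]

end Solve

/-! ### The law of the merged tree -/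

section Merge

variable {κ : Type*} {ep : κ → Sym2 κ} {ops ops' : List (Edge κ)}

/-- Each partner is determined by the state. This is needed for an edge common to both trees, where
the two outcomes of the coin must lead to the same continuation. -/
theorem Refines.unique {K B : Set κ} {fs fs' : List (Bool × κ × κ)} (hr : Ready ep K B ops)
    (h : Refines ep K B ops fs) (h' : Refines ep K B ops fs') : fs = fs' := by
  induction h generalizing fs' with
  | nil => cases h'; rfl
  | cons K B b e v p f ops fs hf hi hn _ ih =>
    rcases h' with _ | ⟨_, _, _, _, _, _, f', _, fs', hf', hi', hn', h'⟩
    obtain rfl : f = f' := hr.partner_unique (Set.empty_subset B) (by simpa using hf)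
      (by simpa using hf') (by simpa using hi) (by simpa using hi') hn hn'
    rw [ih (hr.step hf hi hn) h']

/-- Flags are coin outcomes and do not influence the geometry; this and the next lemmas allow
replacing them. -/
theorem terminal_congr (h : ops'.map Prod.snd = ops.map Prod.snd) {x : κ} :
    Terminal ops' x ↔ Terminal ops x := by
  have key : ∀ ops : List (Edge κ),
      Terminal ops x ↔ ∃ t ∈ ops.map Prod.snd, x = t.2.1 ∨ x = t.2.2 := by
    intro ops
    constructor
    · rintro ⟨t, ht, h⟩
      exact ⟨t.2, List.mem_map_of_mem ht, h⟩
    · rintro ⟨_, ht, h⟩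
      obtain ⟨t, ht', rfl⟩ := List.mem_map.1 ht
      exact ⟨t, ht', h⟩
  rw [key, key, h]

theorem Peels.congr (h : ops'.map Prod.snd = ops.map Prod.snd) (hp : Peels ops) : Peels ops' := by
  induction ops generalizing ops' with
  | nil => rw [List.map_eq_nil_iff.1 h]; trivial
  | cons t ops ih =>
    rcases ops' with _ | ⟨t', ops'⟩
    · trivial
    · simp only [List.map_cons, List.cons.injEq] at h
      refine ⟨?_, ?_, ih h.2 hp.2.2⟩
      · rw [h.1]
        exact hp.1
      · rw [h.1, terminal_congr h.2]
        exact hp.2.1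

theorem Ready.congr {K B : Set κ} (h : ops'.map Prod.snd = ops.map Prod.snd)
    (hr : Ready ep K B ops) : Ready ep K B ops' := by
  refine ⟨fun t ht => ?_, hr.peels.congr h, ?_, ?_, hr.acyc, hr.disj⟩
  · have h1 : t.2 ∈ ops.map Prod.snd := h ▸ List.mem_map_of_mem ht
    obtain ⟨t', ht', h2⟩ := List.mem_map.1 h1
    rw [← h2]
    exact hr.ends t' ht'
  · simp only [terminal_congr h]
    exact hr.sep
  · simp only [terminal_congr h]
    exact hr.conn

theorem map_congr_support {α β : Type*} {p : PMF α} {f g : α → β} (h : ∀ x ∈ p.support, f x = g x) :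
    p.map f = p.map g := by
  ext b
  rw [PMF.map_apply, PMF.map_apply]
  refine tsum_congr fun a => ?_
  by_cases ha : p a = 0
  · simp [ha]
  · rw [h a ((PMF.mem_support_iff _ _).2 ha)]

theorem map_snd_of_mem_flipFlags {a b : ℝ≥0} (h : ops' ∈ (flipFlags a b ops).support) :
    ops'.map Prod.snd = ops.map Prod.snd := by
  induction ops generalizing ops' with
  | nil =>
    rw [flipFlags, PMF.support_pure, Set.mem_singleton_iff] at h
    rw [h]
  | cons t ops ih =>
    obtain ⟨fl, t⟩ := t
    rw [flipFlags, PMF.mem_support_bind_iff] at h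
    obtain ⟨c, -, h⟩ := h
    rw [PMF.support_map] at h
    obtain ⟨l, hl, rfl⟩ := h
    simp [ih hl]

theorem Rooted.peels {r : κ} (h : Rooted r ops) : Peels ops := by
  induction ops with
  | nil => trivial
  | cons t ops ih =>
    refine ⟨fun h' => h.1 (h' ▸ h.2.1), ?_, ih h.2.2⟩
    rintro ⟨t', ht', h' | h'⟩
    · exact h.1 (h' ▸ (h.2.2.mem ht').1)
    · exact h.1 (h' ▸ (h.2.2.mem ht').2)

variable [DecidableEq κ]

theorem coe_edgeIds (l : List (Edge κ)) : ((edgeIds l).toFinset : Set κ) = idSet l := by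
  ext; simp [idSet]

/-- Coin flips followed by the computation of the exchange partners merge two trees. -/
theorem mergeLaw_flipFlags {I : Finset κ → Prop} {W : Set κ}
    (hI : ∀ X : Finset κ, (X : Set κ) ⊆ W → Acyc ep X → I X) {a b : ℝ≥0} {K B : Finset κ}
    (hr : Ready ep K B ops) {sol : List (Edge κ) → List (Bool × κ × κ)}
    (hsol : ∀ ops' : List (Edge κ), ops'.map Prod.snd = ops.map Prod.snd →
      Refines ep K B ops' (sol ops'))
    (hX : Acyc ep (K ∪ idSet ops)) (hW : (K : Set κ) ∪ B ∪ idSet ops ⊆ W) :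
    MergeLaw I a b (K ∪ (edgeIds ops).toFinset) (K ∪ B)
      ((flipFlags a b ops).map fun ops' => K ∪ ((sol ops').map keptEdge).toFinset) := by
  induction ops generalizing K B sol with
  | nil =>
    rw [flipFlags, PMF.pure_map]
    have h := hsol [] rfl
    generalize sol [] = fs at h ⊢
    cases h
    exact .done _ _ (by simp [edgeIds])
  | cons t ops ih =>
    obtain ⟨b₀, e, v, p⟩ := t
    obtain ⟨f, hf, hi, hn⟩ := hr.exists_partner B.finite_toSet
    have hee := hr.ends _ List.mem_cons_self
    have heK := hr.notMem
    have hfK : f ∉ (K : Set κ) := fun h => Set.disjoint_left.1 hr.disj h hf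
    have heo : e ∉ idSet ops := by
      have := hr.peels.nodup_ids hr.ends
      rw [edgeIds, List.map_cons, List.nodup_cons] at this
      exact this.1
    -- The partner of the first edge is `f` for all outcomes of the coins, so both branches of the
    -- first coin belong to the same exchange pair.
    have hkey : ∀ (c : Bool) (ops' : List (Edge κ)), ops'.map Prod.snd = ops.map Prod.snd →
        ∃ fs, sol ((c, e, v, p) :: ops') = (c, e, f) :: fs ∧
          Refines ep (insert (if c then e else f) K) (B \ {f}) ops' fs := by
      intro c ops' h
      have h1 := hsol ((c, e, v, p) :: ops') (by simp [h])
      generalize sol ((c, e, v, p) :: ops') = fs at h1 ⊢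
      rcases h1 with _ | ⟨_, _, _, _, _, _, f', _, fs, hf', hi', hn', h'⟩
      obtain rfl : f = f' := hr.partner_unique (Set.empty_subset _) (by simpa using hf)
        (by simpa using hf') (by simpa using hi) (by simpa using hi') hn hn'
      exact ⟨fs, rfl, h'⟩
    have hcons : idSet ((b₀, e, v, p) :: ops) = insert e (idSet ops) := idSet_cons _ _
    rw [hcons] at hX hW
    -- the component of the child after the removal of `e`
    have hcomp : ∀ y, Conn ep (K ∪ idSet ops) v y → Conn ep K v y := by
      intro y hy
      by_contra hc
      obtain ⟨e', he', z, w, h1, h2⟩ := hy.exists_exit hc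
      obtain ⟨t, ht, rfl⟩ := mem_idSet.1 he'
      have hz : Terminal ops z := by
        rw [hr.ends.tail t ht, Sym2.eq_iff] at h1
        rcases h1 with ⟨h1, -⟩ | ⟨-, h1⟩
        · exact ⟨t, ht, Or.inl h1.symm⟩
        · exact ⟨t, ht, Or.inr h1.symm⟩
      have := hr.sep v z (terminal_cons.2 (Or.inl (Or.inl rfl))) (terminal_cons.2 (Or.inr hz)) h2
      exact hr.peels.2.1 (this ▸ hz)
    obtain ⟨z, w, hzw, hvz⟩ := hi
    -- Without `e`, the component of `v` in the first tree is its `K`-component, and `f` leaves it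
    -- because the second tree is acyclic. So `f` may replace `e` in the first tree.
    have hnf : ¬ Conn ep (K ∪ idSet ops) z w := by
      intro hc
      have h1 := hcomp w ((hvz.mono Set.subset_union_left).trans hc)
      exact hr.acyc.not_conn (Or.inr hf) hzw Set.subset_union_left hfK (hvz.symm.trans h1)
    have hfo : f ∉ idSet ops := fun h => hnf (.of_mem (Or.inr h) hzw)
    have hsub : (K : Set κ) ∪ idSet ops ⊆ K ∪ insert e (idSet ops) :=
      Set.union_subset_union_right _ (Set.subset_insert _ _)
    have hXf : Acyc ep (insert f (K ∪ idSet ops)) := (hX.mono hsub).insert hzw hnf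
    have hst := fun c => (show Ready ep K B ((c, e, v, p) :: ops) from
      hr.congr (by simp)).step hf ⟨z, w, hzw, hvz⟩ hn
    have hc := fun c : Bool => ih (K := insert (if c then e else f) K) (B := B.erase f)
      (sol := fun ops' => (sol ((c, e, v, p) :: ops')).tail)
      (by
        rw [Finset.coe_insert, Finset.coe_erase]
        exact hst c)
      (fun ops' h => by
        obtain ⟨fs, h1, h2⟩ := hkey c ops' h
        rw [h1, Finset.coe_insert, Finset.coe_erase]
        exact h2)
      (by
        rw [Finset.coe_insert, Set.insert_union]
        cases c
        · exact hXf
        · rw [if_pos rfl, ← Set.union_insert]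
          exact hX)
      (by
        refine subset_trans ?_ hW
        rw [Finset.coe_insert, Finset.coe_erase]
        have h1 : (if c then e else f) ∈ (K : Set κ) ∪ B ∪ insert e (idSet ops) := by
          cases c
          · exact Or.inl (Or.inr hf)
          · exact Or.inr (Or.inl rfl)
        refine Set.union_subset (Set.union_subset (Set.insert_subset h1 ?_) ?_) ?_
        · exact fun x hx => Or.inl (Or.inl hx)
        · exact fun x hx => Or.inl (Or.inr hx.1)
        · exact fun x hx => Or.inr (Or.inr hx))
    have hlaw : (flipFlags a b ((b₀, e, v, p) :: ops)).map
        (fun ops' => K ∪ ((sol ops').map keptEdge).toFinset) =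
        (coin a b).bind fun c => (flipFlags a b ops).map fun ops' =>
          insert (if c then e else f) K ∪
            (((sol ((c, e, v, p) :: ops')).tail).map keptEdge).toFinset := by
      rw [flipFlags, PMF.map_bind]
      congr 1
      ext1 c
      rw [PMF.map_comp]
      refine map_congr_support fun ops' h => ?_
      obtain ⟨fs, h1, -⟩ := hkey c ops' (map_snd_of_mem_flipFlags h)
      simp only [Function.comp_apply, h1, List.tail_cons, List.map_cons, List.toFinset_cons,
        keptEdge]
      rw [Finset.union_insert, Finset.insert_union]
    rw [hlaw]
    by_cases heB : e ∈ B
    -- An edge common to both trees is its own partner. No exchange takes place, and the outcome of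
    -- its coin has no influence.
    · obtain rfl : f = e := by
        refine hr.partner_unique (Set.empty_subset _) (by simpa using hf) (by simpa using heB)
          (by rw [Set.union_empty]; exact ⟨z, w, hzw, hvz⟩) ⟨v, p, hee, .refl _⟩ hn ?_
        exact hr.acyc.not_conn (Or.inr heB) hee Set.sdiff_subset (by simp)
      have hsame : ∀ c, ((flipFlags a b ops).map fun ops' => insert (if c then f else f) K ∪
            (((sol ((c, f, v, p) :: ops')).tail).map keptEdge).toFinset) =
          (flipFlags a b ops).map fun ops' => insert (if true then f else f) K ∪
            (((sol ((true, f, v, p) :: ops')).tail).map keptEdge).toFinset := by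
        intro c
        refine map_congr_support fun ops' h => ?_
        have h0 := map_snd_of_mem_flipFlags h
        obtain ⟨fs, h1, h2⟩ := hkey c ops' h0
        obtain ⟨fs', h3, h4⟩ := hkey true ops' h0
        have h5 : fs = fs' := by
          simp only [ite_self] at h2 h4
          have := (hst true).congr h0
          simp only [ite_self] at this
          exact h2.unique this h4
        rw [h1, h3, h5]
        simp
      rw [funext hsame, PMF.bind_const]
      convert hc true using 1
      · ext x; simp [edgeIds]
      · ext x
        simp only [Finset.mem_union, Finset.mem_insert, Finset.mem_erase, if_true]
        by_cases hx : x = f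
        · simp [hx, heB]
        · simp [hx]
    · have hfe : f ≠ e := fun h => heB (h ▸ hf)
      have h1 : (K ∪ (edgeIds ((b₀, e, v, p) :: ops)).toFinset).erase e =
          K ∪ (edgeIds ops).toFinset := by
        ext x
        have h2 : x ∈ edgeIds ops → x ≠ e := fun hx h => heo (h ▸ hx)
        have h3 : x ∈ K → x ≠ e := fun hx h => heK (h ▸ hx)
        simp only [edgeIds, List.map_cons, List.toFinset_cons, Finset.mem_erase, Finset.mem_union,
          Finset.mem_insert, List.mem_toFinset] at h2 ⊢
        tauto
      have h2 : (K ∪ B).erase f = K ∪ B.erase f := by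
        ext x
        have h3 : x ∈ K → x ≠ f := fun hx h => hfK (h ▸ hx)
        simp only [Finset.mem_erase, Finset.mem_union]
        tauto
      have hmem : ∀ x ∈ (K : Set κ) ∪ B ∪ insert e (idSet ops), x ∈ W := fun x hx => hW hx
      have h3 := hc true
      have h4 := hc false
      rw [if_pos rfl, Finset.insert_union, Finset.insert_union] at h3
      rw [if_neg (by simp), Finset.insert_union, Finset.insert_union] at h4
      have h5 : insert e (K ∪ (edgeIds ops).toFinset) =
          K ∪ (edgeIds ((b₀, e, v, p) :: ops)).toFinset := by
        rw [← Finset.union_insert]; simp [edgeIds]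
      have h6 : insert f (K ∪ B.erase f) = K ∪ B := by
        rw [← Finset.union_insert, Finset.insert_erase hf]
      rw [h5, ← h2] at h3
      rw [h6, ← h1] at h4
      have h7 := MergeLaw.swap (Indep := I) (K ∪ (edgeIds ((b₀, e, v, p) :: ops)).toFinset) (K ∪ B)
        e f _ _ ?_ ?_ ?_ ?_ h3 h4
      · convert h7 using 2
        ext1 c
        cases c <;> rfl
      · rw [Finset.mem_sdiff, Finset.mem_union, Finset.mem_union]
        exact ⟨Or.inr (by simp [edgeIds]), fun h => h.elim heK heB⟩
      · rw [Finset.mem_sdiff, Finset.mem_union, Finset.mem_union, List.mem_toFinset, edgeIds,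
          List.map_cons, List.mem_cons]
        exact ⟨Or.inr hf, fun h => h.elim hfK fun h => h.elim hfe hfo⟩
      · rw [h1]
        refine hI _ ?_ ?_
        · rw [Finset.coe_insert, Finset.coe_union, coe_edgeIds]
          exact Set.insert_subset (hW (Or.inl (Or.inr hf)))
            (subset_trans (hsub.trans (Set.union_subset_union_left _ Set.subset_union_left)) hW)
        · rw [Finset.coe_insert, Finset.coe_union, coe_edgeIds]
          exact hXf
      · rw [h2]
        refine hI _ ?_ ?_
        · intro x hx
          rw [Finset.coe_insert, Finset.coe_union, Finset.coe_erase] at hx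
          refine hW ?_
          rcases hx with rfl | hx | hx
          · exact Or.inr (Or.inl rfl)
          · exact Or.inl (Or.inl hx)
          · exact Or.inl (Or.inr hx.1)
        · rw [Finset.coe_insert, Finset.coe_union, Finset.coe_erase, ← Set.insert_union]
          exact (hst true).acyc

theorem IsTree.length_search [Fintype κ] {V : Set κ} {T : List (Edge κ)} (h : IsTree ep V T)
    {r : κ} (hr : r ∈ V) : (SwapRounding.search T r).length = T.length := by
  obtain ⟨h1, h2, -⟩ := h.search hr
  have h3 : idSet (SwapRounding.search T r) = idSet T := by rw [idSet_eq, h2, h2, ← idSet_eq]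
  have h4 : (edgeIds (SwapRounding.search T r)).Perm (edgeIds T) :=
    (List.perm_ext_iff_of_nodup h1.nodup h.nodup).2 fun x => Set.ext_iff.1 h3 x
  simpa [edgeIds] using h4.length_eq

/-- Rooted at the same vertex, both trees list the vertices `V` without repetition: the root and one
child for every edge. -/
theorem IsTree.length_eq [Fintype κ] {V : Set κ} {X Y : List (Edge κ)} (hX : IsTree ep V X)
    (hY : IsTree ep V Y) {r : κ} (hr : r ∈ V) : X.length = Y.length := by
  have h1 : (verts r (SwapRounding.search X r)).Perm (verts r (SwapRounding.search Y r)) :=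
    (List.perm_ext_iff_of_nodup (rooted_search X r).nodup (rooted_search Y r).nodup).2 fun x => by
      rw [(hX.search hr).2.2, (hY.search hr).2.2]
  have h2 := h1.length_eq
  simp only [verts, List.length_cons, List.length_map, hX.length_search hr,
    hY.length_search hr] at h2
  omega

omit [DecidableEq κ] in
theorem IsTree.eq_nil {V : Set κ} {Y : List (Edge κ)} (hX : IsTree ep V ([] : List (Edge κ)))
    (hY : IsTree ep V Y) : Y = [] := by
  rcases Y with _ | ⟨t, Y⟩
  · rfl
  · have h := hX.conn _ (hY.mem t List.mem_cons_self).1 _ (hY.mem t List.mem_cons_self).2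
    exact (hY.acyc.not_conn (G := ∅) (mem_idSet.2 ⟨t, List.mem_cons_self, rfl⟩)
      (hY.ends t List.mem_cons_self) (Set.empty_subset _) (by simp)
      (h.mono (by simp [idSet, edgeIds]))).elim

/-- The merged tree. -/
theorem mergeTrees_spec [Fintype κ] {I : Finset κ → Prop} {V W : Set κ}
    (hI : ∀ X : Finset κ, (X : Set κ) ⊆ W → Acyc ep X → I X) {m : ℕ} {X Y : List (Edge κ)}
    (hX : IsTree ep V X) (hY : IsTree ep V Y) (hYf : ∀ t ∈ Y, t.1 = false)
    (hW : idSet X ∪ idSet Y ⊆ W) (hm : X.length ≤ 2 ^ m) (a b : ℝ≥0) :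
    MergeLaw I a b (edgeIds X).toFinset (edgeIds Y).toFinset
        ((mergeTrees m a b X Y).map List.toFinset) ∧
      ∀ Z ∈ (mergeTrees m a b X Y).support, Z.Nodup ∧ (∀ x ∈ Z, x ∈ idSet X ∪ idSet Y) ∧
        Acyc ep {x | x ∈ Z} ∧ ∀ x ∈ V, ∀ y ∈ V, Conn ep {x | x ∈ Z} x y := by
  rcases X with _ | ⟨⟨fl, e, x, y⟩, X⟩
  · obtain rfl := hX.eq_nil hY
    rw [mergeTrees, PMF.pure_map]
    refine ⟨.done _ _ (by simp [edgeIds]), fun Z hZ => ?_⟩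
    rw [PMF.support_pure, Set.mem_singleton_iff] at hZ
    subst hZ
    exact ⟨List.nodup_nil, by simp, hX.acyc, hX.conn⟩
  · have hx : x ∈ V := (hX.mem _ List.mem_cons_self).1
    obtain ⟨hS, hflag, hverts⟩ := hX.search hx
    have hSr := rooted_search ((fl, e, x, y) :: X) x
    have hSX : idSet (search ((fl, e, x, y) :: X) x) = idSet ((fl, e, x, y) :: X) := by
      rw [idSet_eq, hflag, hflag, ← idSet_eq]
    have hlen := hX.length_search hx
    have hlen' := hX.length_eq hY hx
    rw [mergeTrees]
    generalize (fl, e, x, y) :: X = X at *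
    generalize search X x = S at *
    have h0 : flagIds true Y = ∅ := flagIds_eq_empty fun t ht => by simp [hYf t ht]
    have h0' : flagIds false Y = idSet Y := by rw [idSet_eq, h0, Set.union_empty]
    have hterm : ∀ x, Terminal S x → x ∈ V := by
      rintro x ⟨t, ht, rfl | rfl⟩
      · exact (hS.mem t ht).1
      · exact (hS.mem t ht).2
    have hr : Ready ep ∅ (idSet Y) S := by
      refine ⟨hS.ends, hSr.peels, fun x y _ _ hc => conn_empty.1 hc, fun x y hx hy => ?_, ?_,
        Set.empty_disjoint _⟩
      · rw [Set.empty_union]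
        exact hY.conn x (hterm x hx) y (hterm y hy)
      · rw [Set.empty_union]
        exact hY.acyc
    have hsol : ∀ ops' : List (Edge κ), ops'.map Prod.snd = S.map Prod.snd →
        Refines ep ∅ (idSet Y) ops' (solve m Y ops') := by
      intro ops' h
      have h1 := solve_spec (d := m) (T := Y) (ops := ops') hY
        (fun x hx => hterm x ((terminal_congr h).1 hx)) (by rw [h0, h0']; exact hr.congr h)
        (by
          have := congrArg List.length h
          simp only [List.length_map] at this
          omega)
      rwa [h0, h0'] at h1
    refine ⟨?_, fun Z hZ => ?_⟩
    · have h1 := mergeLaw_flipFlags hI (a := a) (b := b) (K := ∅) (B := (edgeIds Y).toFinset)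
        (ops := S) (sol := solve m Y)
        (by rw [coe_edgeIds, Finset.coe_empty]; exact hr)
        (by rw [coe_edgeIds, Finset.coe_empty]; exact hsol)
        (by rw [Finset.coe_empty, Set.empty_union]; exact hS.acyc)
        (by rw [coe_edgeIds, Finset.coe_empty, Set.empty_union, hSX, Set.union_comm]; exact hW)
      have h2 : (edgeIds S).toFinset = (edgeIds X).toFinset := by
        rw [← Finset.coe_inj, coe_edgeIds, coe_edgeIds, hSX]
      rw [Finset.empty_union, Finset.empty_union, h2] at h1
      rw [PMF.map_comp]
      convert h1 using 2
      ext1 ops'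
      simp
    · rw [PMF.support_map] at hZ
      obtain ⟨ops', hops', rfl⟩ := hZ
      have h1 := map_snd_of_mem_flipFlags hops'
      have h2 := hsol ops' h1
      have h3 := hr.congr h1
      obtain ⟨h4, h5⟩ := h2.ready (ops' := []) (by rwa [List.append_nil])
      -- The partners are distinct edges of `Y`, and there are as many of them as `Y` has edges. So
      -- `Y` is used up, and the kept edges alone form the merged tree.
      have hempty : idSet Y \ {x | x ∈ (solve m Y ops').map fun t => t.2.2} = ∅ := by
        rw [Set.sdiff_eq_empty]
        have hsp := (h2.used.1.subperm (l₂ := edgeIds Y) (fun x hx => by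
          obtain ⟨t, ht, rfl⟩ := List.mem_map.1 hx
          exact h2.used.2 t ht)).perm_of_length_le (by
            have h6 := congrArg List.length h2.map_eq
            have h7 := congrArg List.length h1
            simp only [List.length_map, edgeIds] at h6 h7 ⊢
            omega)
        exact fun x hx => hsp.mem_iff.2 hx
      simp only [hempty, Set.union_empty, Set.empty_union] at h5
      have h6 := h4.acyc
      rw [hempty, Set.union_empty, Set.empty_union] at h6
      refine ⟨(h2.kept h3).1, fun x hx => ?_, h6, fun x hx y hy => h5 x y (hY.conn x hx y hy)⟩
      · rcases h2.mem_kept.1 hx with ⟨t, ht, -, rfl⟩ | ⟨e, he⟩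
        · left
          rw [← hSX]
          have h7 : t.2 ∈ S.map Prod.snd := h1 ▸ List.mem_map_of_mem ht
          obtain ⟨t', ht', h8⟩ := List.mem_map.1 h7
          exact mem_idSet.2 ⟨t', ht', by rw [h8]⟩
        · exact Or.inr (h2.used.2 _ he)

end Merge

/-! ### Correctness of the divide-and-conquer algorithm -/

section Divide

theorem mem_bases_self {α : Type*} [DecidableEq α] (B : Finset α)
    (ex : List (Finset α × Finset α)) : B ∈ bases B ex := by
  cases ex <;> simp [bases]

/-- A run of the algorithm on equal bases. -/
theorem divideSwapLaw_of_forall_eq {α : Type*} [DecidableEq α] (I : Finset α → Prop)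
    (B : Finset α) (ex : List (Finset α × Finset α)) (δ : List ℝ≥0)
    (hδ : δ.length = ex.length + 1) (h : ∀ X ∈ bases B ex, X = B) :
    DivideSwapLaw I B ex δ (PMF.pure B) := by
  induction hn : ex.length using Nat.strong_induction_on generalizing I B ex δ with
  | _ n ih =>
  subst hn
  by_cases hne : ex = []
  · subst hne
    obtain ⟨a, rfl⟩ := List.length_eq_one_iff.1 hδ
    exact .single I B a
  have hk := splitIndex_lt hne
  have hd : ∀ p ∈ ex, Disjoint p.1 (B \ touched ex) ∧ Disjoint p.2 (B \ touched ex) :=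
    fun p hp => ⟨Finset.disjoint_sdiff.mono_left (subset_touched hp).1,
      Finset.disjoint_sdiff.mono_left (subset_touched hp).2⟩
  have hBU : B ∩ touched ex ∪ B \ touched ex = B := by
    rw [Finset.union_comm]; exact Finset.sdiff_union_inter _ _
  have hdis : Disjoint (B ∩ touched ex) (B \ touched ex) := (Finset.disjoint_sdiff_inter _ _).symm
  have h' : ∀ X ∈ bases (B ∩ touched ex) ex, X = B ∩ touched ex := by
    intro X hX
    have h1 : X ∪ B \ touched ex ∈ bases B ex := by
      have h2 := bases_union (B ∩ touched ex) ex fun p hp => (hd p hp).1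
      rw [hBU] at h2
      rw [h2]
      exact List.mem_map_of_mem hX
    have h2 := disjoint_bases hdis (fun p hp => (hd p hp).2) X hX
    rw [← union_sdiff_cancel_of_disjoint h2, h _ h1]
    simp
  have hsplit := bases_split (B ∩ touched ex) ex hk
  have h3 : (ex.take (splitIndex ex + 1)).foldl exchange (B ∩ touched ex) = B ∩ touched ex :=
    h' _ (hsplit ▸ List.mem_append_right _ (mem_bases_self _ _))
  have hL := ih (ex.take (splitIndex ex)).length (by rw [List.length_take]; omega)
    (contractIndep I (B \ touched ex)) (B ∩ touched ex) (ex.take (splitIndex ex))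
    (δ.take (splitIndex ex + 1)) (by simp only [List.length_take]; omega)
    (fun X hX => h' X (hsplit ▸ List.mem_append_left _ hX)) rfl
  have hR := ih (ex.drop (splitIndex ex + 1)).length (by rw [List.length_drop]; omega)
    (contractIndep I (B \ touched ex)) (B ∩ touched ex) (ex.drop (splitIndex ex + 1))
    (δ.drop (splitIndex ex + 1)) (by simp only [List.length_drop]; omega)
    (fun X hX => h' X (hsplit ▸ List.mem_append_right _ (by rwa [h3]))) rfl
  have := DivideSwapLaw.split I B ex δ _ _ _ _ (fun X _ => PMF.pure X) hne rfl rfl hL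
    (by rw [h3]; exact hR) fun X hX Y hY => by
      rw [PMF.support_pure, Set.mem_singleton_iff] at hX hY
      subst hX; subst hY
      exact .done _ _ (by simp)
  simpa [PMF.pure_bind, PMF.pure_map, hBU] using this

variable {κ : Type*} {ep : κ → Sym2 κ} {V W F G : Set κ}

/-- The edges in `F` are a spanning tree of the vertices `V`. -/
structure Spans (ep : κ → Sym2 κ) (V F : Set κ) : Prop where
  acyc : Acyc ep F
  conn : ∀ x ∈ V, ∀ y ∈ V, Conn ep F x y

theorem exists_ends (ep : κ → Sym2 κ) (e : κ) : ∃ x y, ep e = s(x, y) := by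
  induction h : ep e with | _ p q => exact ⟨p, q, rfl⟩

/-- An edge of `G` outside of `F` would close a cycle, since `F` already connects its ends. -/
theorem Spans.eq_of_subset (hF : Spans ep V F) (hG : Spans ep V G) (h : F ⊆ G)
    (hV : ∀ e ∈ G, ∀ x ∈ ep e, x ∈ V) : G = F := by
  refine Set.Subset.antisymm (fun e he => ?_) h
  by_contra hne
  obtain ⟨x, y, hxy⟩ := exists_ends ep e
  refine hG.acyc.not_conn he hxy h hne (hF.conn x ?_ y ?_)
  · exact hV e he x (by simp [hxy])
  · exact hV e he y (by simp [hxy])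

theorem Spans.isTree {l : List (Edge κ)} (h : Spans ep V (idSet l)) (he : HasEnds ep l)
    (hnd : (edgeIds l).Nodup) (hV : ∀ e ∈ idSet l, ∀ x ∈ ep e, x ∈ V) : IsTree ep V l := by
  refine ⟨he, hnd, h.acyc, fun t ht => ?_, h.conn⟩
  have h1 := hV _ (mem_idSet.2 ⟨t, ht, rfl⟩)
  rw [he t ht] at h1
  exact ⟨h1 _ (by simp), h1 _ (by simp)⟩

/-- The edges of `F` are added to `A` one by one; an edge that closes a cycle with its predecessors
and `A` closes one in the contraction. -/
theorem Acyc.of_contract {φ : κ → κ} {A : Set κ} (hφ : ∀ x y, φ x = φ y ↔ Conn ep A x y)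
    (hA : Acyc ep A) (hFf : F.Finite) (hF : Acyc (fun e => (ep e).map φ) F) :
    Acyc ep (F ∪ A) := by
  suffices ∀ G ⊆ F, Acyc ep (G ∪ A) from this F subset_rfl
  intro G hG
  induction G, hFf.subset hG using Set.Finite.induction_on with
  | empty => rwa [Set.empty_union]
  | @insert e G heG _ ih =>
    obtain ⟨x, y, hxy⟩ := exists_ends ep e
    rw [Set.insert_union]
    refine (ih fun a ha => hG (Or.inr ha)).insert hxy fun hc => ?_
    rw [← conn_contract hφ] at hc
    exact hF.not_conn (hG (Or.inl rfl)) (by simp [hxy]) (fun a ha => hG (Or.inr ha)) heG hc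

theorem Spans.contract {φ : κ → κ} {A : Set κ} (hφ : ∀ x y, φ x = φ y ↔ Conn ep A x y)
    (h : Spans ep V (F ∪ A)) (hd : Disjoint F A) :
    Spans (fun e => (ep e).map φ) (φ '' V) F := by
  refine ⟨h.acyc.contract hφ hd, ?_⟩
  rintro _ ⟨x, hx, rfl⟩ _ ⟨y, hy, rfl⟩
  rw [conn_contract hφ]
  exact h.conn x hx y hy

theorem Spans.of_contract {φ : κ → κ} {A : Set κ} (hφ : ∀ x y, φ x = φ y ↔ Conn ep A x y)
    (hA : Acyc ep A) (hFf : F.Finite) (h : Spans (fun e => (ep e).map φ) (φ '' V) F) :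
    Spans ep V (F ∪ A) := by
  refine ⟨Acyc.of_contract hφ hA hFf h.acyc, fun x hx y hy => ?_⟩
  rw [← conn_contract hφ]
  exact h.conn _ ⟨x, hx, rfl⟩ _ ⟨y, hy, rfl⟩

variable [DecidableEq κ]

/-- The identifiers of the exchanged edges. -/
def exIds (ex : List (Exch κ)) : List (Finset κ × Finset κ) :=
  ex.map fun p => ((edgeIds p.1).toFinset, (edgeIds p.2).toFinset)

omit [DecidableEq κ] in
theorem edgeIds_relabel (φ : κ → κ) (l : List (Edge κ)) : edgeIds (relabel φ l) = edgeIds l := by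
  simp [edgeIds, relabel, relabelEdge, Function.comp_def]

theorem exIds_relabel (φ : κ → κ) (ex : List (Exch κ)) :
    exIds (ex.map (relabelExch φ)) = exIds ex := by
  simp [exIds, relabelExch, edgeIds_relabel, Function.comp_def]

theorem mem_touched_exIds {ex : List (Exch κ)} {e : κ} :
    e ∈ touched (exIds ex) ↔ ∃ p ∈ ex, e ∈ edgeIds p.1 ∨ e ∈ edgeIds p.2 := by
  induction ex with
  | nil => simp [exIds, touched]
  | cons p ex ih =>
    rw [exIds, List.map_cons, touched, Finset.mem_union, ← exIds, ih]
    simp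

theorem removedSize_exIds {ex : List (Exch κ)} (h : ∀ p ∈ ex, (edgeIds p.1).Nodup) :
    removedSize (exIds ex) = removedCount ex := by
  rw [removedSize, exIds, removedCount_eq, List.map_map]
  congr 1
  refine List.map_congr_left fun p hp => ?_
  exact (List.toFinset_card_of_nodup (h p hp)).trans (List.length_map _)

/-- The scan stops at the first exchange with which more than half of the removed edges is exceeded,
or at the last exchange. Since the partial sums are monotone, the index of that exchange is the
greatest one allowed. Absence of repetitions makes lengths of lists equal to cardinalities. -/
theorem splitIndex_exIds {ex : List (Exch κ)} {δ : List ℝ≥0} (hex : ex ≠ [])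
    (h : ∀ p ∈ ex, (edgeIds p.1).Nodup) (hδ : ex.length ≤ δ.length) :
    splitIndex (exIds ex) = (splitExch (removedCount ex) 0 ex δ).1.length := by
  obtain ⟨h1, -, -, h4, h5⟩ := splitExch_spec (removedCount ex) 0 ex δ hex hδ (Nat.zero_le _)
  generalize splitExch (removedCount ex) 0 ex δ = s at *
  have hlen := congrArg List.length h1
  have h0 : (exIds ex).length = ex.length := List.length_map _
  have hr : ∀ k, removedSize ((exIds ex).take k) = removedCount (ex.take k) := fun k => by
    rw [exIds, ← List.map_take, ← exIds,
      removedSize_exIds fun p hp => h p (List.mem_of_mem_take hp)]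
  rw [List.length_append, List.length_cons] at hlen
  rw [splitIndex, Nat.findGreatest_eq_iff, h0, removedSize_exIds h]
  refine ⟨by omega, fun _ => ?_, fun n hn hn' => ?_⟩
  · rw [hr]
    conv_lhs => rw [h1]
    rw [List.take_left]
    omega
  · rw [hr]
    have h6 : s.2.2.1 ≠ [] := by
      rw [← List.length_pos_iff]
      omega
    have h7 := h5.resolve_left h6
    have h8 : ex.take n = s.1 ++ s.2.1 :: s.2.2.1.take (n - s.1.length - 1) := by
      conv_lhs => rw [h1, List.take_append, List.take_of_length_le (by omega)]
      obtain ⟨j, hj⟩ : ∃ j, n - s.1.length = j + 1 := ⟨n - s.1.length - 1, by omega⟩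
      rw [hj, List.take_succ_cons]
      simp
    have h9 : removedCount (ex.take n) ≥ removedCount s.1 + s.2.1.1.length := by
      rw [h8, removedCount_append]
      simp [removedCount_eq]
    omega

omit [DecidableEq κ] in
theorem foldl_restStep (U : κ → Bool) (l : List (Edge κ)) (acc : List κ) :
    (l.foldl restStep (U, acc)).2 = ((edgeIds l).filter fun e => !U e).reverse ++ acc := by
  induction l generalizing acc with
  | nil => rfl
  | cons t l ih =>
    obtain ⟨fl, e, x, y⟩ := t
    rw [List.foldl_cons, restStep]
    cases h : U e <;> simp [h, ih, edgeIds]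

omit [DecidableEq κ] in
theorem mem_edgeIds_foldl_addedEdges {ex : List (Exch κ)} {acc : List (Edge κ)} {e : κ} :
    e ∈ edgeIds (ex.foldl addedEdges acc) ↔
      e ∈ edgeIds acc ∨ ∃ p ∈ ex, e ∈ edgeIds p.2 := by
  simp only [edgeIds, List.mem_map, mem_foldl_addedEdges]
  constructor
  · rintro ⟨t, ht | ⟨p, hp, ht⟩, rfl⟩
    · exact Or.inl ⟨t, ht, rfl⟩
    · exact Or.inr ⟨p, hp, t, ht, rfl⟩
  · rintro (⟨t, ht, rfl⟩ | ⟨p, hp, t, ht, rfl⟩)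
    · exact ⟨t, Or.inl ht, rfl⟩
    · exact ⟨t, Or.inr ⟨p, hp, ht⟩, rfl⟩

theorem applyExch_iff {U : κ → Bool} {X : Finset κ} (h : ∀ e, U e = true ↔ e ∈ X) (p : Exch κ)
    (e : κ) : applyExch U p e = true ↔
      e ∈ exchange X ((edgeIds p.1).toFinset, (edgeIds p.2).toFinset) := by
  rw [applyExch, setEdges_iff, setEdges_iff, exchange]
  simp only [Finset.mem_union, Finset.mem_sdiff, List.mem_toFinset]
  rw [← h e]
  split_ifs <;> simp_all

theorem foldl_applyExch_iff {U : κ → Bool} {X : Finset κ} (h : ∀ e, U e = true ↔ e ∈ X)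
    (ex : List (Exch κ)) (e : κ) :
    ex.foldl applyExch U e = true ↔ e ∈ (exIds ex).foldl exchange X := by
  induction ex generalizing U X with
  | nil => exact h e
  | cons p ex ih => exact ih fun e => applyExch_iff h p e

theorem foldl_exchange_subset {X Y : Finset κ} {ex : List (Finset κ × Finset κ)} (hX : X ⊆ Y)
    (h : ∀ p ∈ ex, p.2 ⊆ Y) : ex.foldl exchange X ⊆ Y := by
  induction ex generalizing X with
  | nil => exact hX
  | cons p ex ih =>
    exact ih (Finset.union_subset (Finset.sdiff_subset.trans hX) (h p List.mem_cons_self))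
      fun q hq => h q (List.mem_cons_of_mem _ hq)

theorem bases_subset {X Y : Finset κ} {ex : List (Finset κ × Finset κ)} (hX : X ⊆ Y)
    (h : ∀ p ∈ ex, p.2 ⊆ Y) : ∀ Z ∈ bases X ex, Z ⊆ Y := by
  induction ex generalizing X with
  | nil => simpa [bases] using hX
  | cons p ex ih =>
    intro Z hZ
    rcases List.mem_cons.1 hZ with rfl | hZ
    · exact hX
    · exact ih (Finset.union_subset (Finset.sdiff_subset.trans hX) (h p List.mem_cons_self))
        (fun q hq => h q (List.mem_cons_of_mem _ hq)) Z hZ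

/-- With nothing removed, the sets of the sequence can only grow. -/
theorem subset_of_mem_bases {X : Finset κ} {ex : List (Exch κ)} (h : removedCount ex = 0) :
    ∀ Z ∈ bases X (exIds ex), X ⊆ Z := by
  induction ex generalizing X with
  | nil => simp [exIds, bases]
  | cons p ex ih =>
    intro Z hZ
    have h0 : p.1 = [] ∧ removedCount ex = 0 := by
      simpa [removedCount_eq] using h
    rcases List.mem_cons.1 hZ with rfl | hZ
    · exact subset_rfl
    · refine subset_trans ?_ (ih h0.2 Z hZ)
      simp [exchange, h0.1, edgeIds]

theorem weightSum_eq (l : List ℝ≥0) : weightSum l = l.sum := by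
  cases l with
  | nil => rfl
  | cons a l =>
    have h := List.foldl_assoc (op := fun a b : ℝ≥0 => a + b) (l := l) (a₁ := a) (a₂ := 0)
    rw [add_zero] at h
    rw [weightSum, List.sum_cons, List.sum_eq_foldl]
    exact h

/-- The contracted instance and its two halves. -/
structure Division.Correct (D : Division κ) (ep : κ → Sym2 κ) (A X : Finset κ)
    (ex : List (Exch κ)) (δ : List ℝ≥0) (k : ℕ) : Prop where
  ends : HasEnds ep D.all
  subset : X ⊆ (edgeIds D.all).toFinset
  ends_left : HasEnds ep D.B
  ends_right : HasEnds ep D.B'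
  nodup_left : (edgeIds D.B).Nodup
  nodup_right : (edgeIds D.B').Nodup
  ids_left : (edgeIds D.B).toFinset = X
  ids_right : (edgeIds D.B').toFinset = ((exIds ex).take (k + 1)).foldl exchange X
  added : ∀ p ∈ exIds ex, p.2 ⊆ (edgeIds D.all).toFinset
  nodup_rest : D.rest.Nodup
  ids_rest : D.rest.toFinset = A
  left : exIds D.left = (exIds ex).take k
  right : exIds D.right = (exIds ex).drop (k + 1)
  exch : ∀ p, p ∈ D.left ∨ p ∈ D.right → HasEnds ep p.2 ∧ (edgeIds p.1).Nodup
  leftWeights : D.leftWeights = δ.take (k + 1)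
  rightWeights : D.rightWeights = δ.drop (k + 1)

theorem hasEnds_gather {U : κ → Bool} {l : List (Edge κ)} (h : HasEnds ep l) :
    HasEnds ep (gather U l) := fun t ht => by
  obtain ⟨-, t', ht', h'⟩ := of_mem_gather ht
  rw [← h']
  exact h t' ht'

/-- For the sets of removed edges only the identifiers count, for those of added edges also the
endpoints: edges of later trees are looked up among the edges of the first tree and the added ones.
Removed lists without repetitions are needed for the agreement of the split index. -/
theorem divide_correct [Fintype κ] {x : κ} {B : List (Edge κ)} {ex : List (Exch κ)}
    {δ : List ℝ≥0} (hB : IsTree ep V B) (hx : x ∈ V)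
    (hex : ∀ p ∈ ex, HasEnds ep p.2 ∧ (edgeIds p.1).Nodup) (hne : ex ≠ [])
    (hδ : δ.length = ex.length + 1) :
    ∃ φ : κ → κ, (∀ x y, φ x = φ y ↔
        Conn ep ((edgeIds B).toFinset \ touched (exIds ex) : Finset κ) x y) ∧
      (divide x B ex δ).Correct (fun e => (ep e).map φ)
        ((edgeIds B).toFinset \ touched (exIds ex)) ((edgeIds B).toFinset ∩ touched (exIds ex))
        ex δ (splitIndex (exIds ex)) := by
  have hU : ∀ e, ex.foldl markExch (fun _ => false) e = true ↔ e ∈ touched (exIds ex) := fun e => by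
    rw [foldl_markExch_iff, mem_touched_exIds]
    simp
  rw [divide]
  generalize ex.foldl markExch (fun _ => false) = U at *
  have hids : edgeIds (B.map (flagEdge U)) = edgeIds B := by
    simp [edgeIds, flagEdge, Function.comp_def]
  have hT : IsTree ep V (B.map (flagEdge U)) := by
    refine Spans.isTree ?_ (fun t ht => ?_) (hids ▸ hB.nodup) ?_
    · rw [idSet, hids]
      exact ⟨hB.acyc, hB.conn⟩
    · obtain ⟨⟨fl, e, x, y⟩, ht', rfl⟩ := List.mem_map.1 ht
      exact hB.ends (fl, e, x, y) ht'
    · intro e he x hx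
      rw [idSet, hids] at he
      obtain ⟨t, ht, rfl⟩ := mem_idSet.1 he
      rw [hB.ends t ht, Sym2.mem_iff] at hx
      rcases hx with rfl | rfl
      · exact (hB.mem t ht).1
      · exact (hB.mem t ht).2
  have hfl : ∀ b, flagIds b (B.map (flagEdge U)) = {e | e ∈ edgeIds B ∧ (!U e) = b} := by
    intro b
    ext e
    simp only [flagIds, Set.mem_ofPred_eq, List.mem_map, edgeIds]
    constructor
    · rintro ⟨_, ⟨⟨fl, e, x, y⟩, ht, rfl⟩, hb, rfl⟩
      exact ⟨⟨_, ht, rfl⟩, hb⟩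
    · rintro ⟨⟨⟨fl, e, x, y⟩, ht, rfl⟩, hb⟩
      exact ⟨_, ⟨_, ht, rfl⟩, hb, rfl⟩
  obtain ⟨hS, hflag, -⟩ := hT.search hx
  have hSr := rooted_search (B.map (flagEdge U)) x
  generalize search (B.map (flagEdge U)) x = S at *
  have hφ := contract_eq_iff hSr hS.ends
  have hce := hSr.hasEnds_contract hS.ends
  have hcid := idSet_contract S
  generalize contract S.reverse = c at *
  have hA : flagIds true S = (((edgeIds B).toFinset \ touched (exIds ex) : Finset κ) : Set κ) := by
    rw [hflag, hfl]
    ext e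
    have := hU e
    rw [Set.mem_ofPred_eq, Finset.mem_coe, Finset.mem_sdiff, List.mem_toFinset, ← this]
    simp
  have hX : flagIds false S = (((edgeIds B).toFinset ∩ touched (exIds ex) : Finset κ) : Set κ) := by
    rw [hflag, hfl]
    ext e
    have := hU e
    rw [Set.mem_ofPred_eq, Finset.mem_coe, Finset.mem_inter, List.mem_toFinset, ← this]
    simp
  rw [hA] at hφ
  rw [hX] at hcid
  set X := (edgeIds B).toFinset ∩ touched (exIds ex) with hXdef
  set ep' : κ → Sym2 κ := fun e => (ep e).map c.1
  have hne' : ex.map (relabelExch c.1) ≠ [] := by simpa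
  have hδ' : (ex.map (relabelExch c.1)).length ≤ δ.length := by simp; omega
  have hnd' : ∀ p ∈ ex.map (relabelExch c.1), HasEnds ep' p.2 ∧ (edgeIds p.1).Nodup := by
    intro p hp
    obtain ⟨q, hq, rfl⟩ := List.mem_map.1 hp
    refine ⟨hasEnds_relabel (hex q hq).1, ?_⟩
    rw [relabelExch, edgeIds_relabel]
    exact (hex q hq).2
  have hk := splitIndex_exIds hne' (fun p hp => (hnd' p hp).2) hδ'
  obtain ⟨s1, s2, s3, -, -⟩ := splitExch_spec (removedCount (ex.map (relabelExch c.1))) 0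
    (ex.map (relabelExch c.1)) δ hne' hδ' (Nat.zero_le _)
  have hexI := exIds_relabel c.1 ex
  rw [removedCount_relabel, hexI] at hk
  rw [removedCount_relabel] at s1 s2 s3
  generalize ex.map (relabelExch c.1) = ex' at *
  rw [hk]
  generalize splitExch (removedCount ex) 0 ex' δ = s at *
  have hBe : HasEnds ep' (gather U c.2) := hasEnds_gather hce
  have hBid : (edgeIds (gather U c.2)).toFinset = X := by
    ext e
    rw [List.mem_toFinset, mem_gather_ids, hU]
    have : e ∈ edgeIds c.2 ↔ e ∈ X := Set.ext_iff.1 hcid e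
    rw [this, hXdef, Finset.mem_inter]
    tauto
  have hall : HasEnds ep' (ex'.foldl addedEdges (gather U c.2)) := by
    intro t ht
    rcases mem_foldl_addedEdges.1 ht with ht | ⟨p, hp, ht⟩
    · exact hBe t ht
    · exact (hnd' p hp).1 t ht
  have hsub : X ⊆ (edgeIds (ex'.foldl addedEdges (gather U c.2))).toFinset := by
    intro e he
    rw [← hBid, List.mem_toFinset] at he
    exact List.mem_toFinset.2 (mem_edgeIds_foldl_addedEdges.2 (Or.inl he))
  have hadd : ∀ p ∈ exIds ex, p.2 ⊆ (edgeIds (ex'.foldl addedEdges (gather U c.2))).toFinset := by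
    intro p hp e he
    rw [← hexI] at hp
    obtain ⟨q, hq, rfl⟩ := List.mem_map.1 hp
    exact List.mem_toFinset.2 (mem_edgeIds_foldl_addedEdges.2
      (Or.inr ⟨q, hq, List.mem_toFinset.1 he⟩))
  have htake : exIds s.1 = (exIds ex).take s.1.length ∧
      exIds (s.1 ++ [s.2.1]) = (exIds ex).take (s.1.length + 1) ∧
      exIds s.2.2.1 = (exIds ex).drop (s.1.length + 1) := by
    rw [← hexI, exIds, exIds, exIds, exIds, ← List.map_take, ← List.map_take, ← List.map_drop]
    refine ⟨?_, ?_, ?_⟩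
    · conv_rhs => rw [s1]
      rw [List.take_left]
    · conv_rhs => rw [s1, List.append_cons]
      rw [List.take_left' (by simp)]
    · conv_rhs => rw [s1, List.append_cons]
      rw [List.drop_left' (by simp)]
  refine ⟨c.1, hφ, ⟨hall, hsub, hBe, hasEnds_gather hall, nodup_gather _ _, nodup_gather _ _, hBid,
    ?_, hadd, ?_, ?_, htake.1, htake.2.2, ?_, ?_, ?_⟩⟩
  · rw [← htake.2.1]
    have hmark : ∀ e, setEdges true (fun _ => false) (gather U c.2) e = true ↔ e ∈ X := fun e => by
      rw [setEdges_iff, ← hBid, List.mem_toFinset]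
      simp
    have hmark' : ∀ e, applyExch (s.1.foldl applyExch (setEdges true (fun _ => false)
        (gather U c.2))) s.2.1 e = true ↔ e ∈ (exIds (s.1 ++ [s.2.1])).foldl exchange X := fun e => by
      rw [← foldl_applyExch_iff hmark, List.foldl_append]
      rfl
    ext e
    rw [List.mem_toFinset, mem_gather_ids, hmark']
    refine and_iff_left_of_imp fun he => ?_
    refine List.mem_toFinset.1 (foldl_exchange_subset hsub (fun p hp => ?_) he)
    rw [htake.2.1] at hp
    exact hadd p (List.mem_of_mem_take hp)
  · rw [foldl_restStep, List.append_nil, List.nodup_reverse]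
    exact hB.nodup.filter _
  · rw [foldl_restStep, List.append_nil, List.toFinset_reverse]
    ext e
    have := hU e
    rw [List.mem_toFinset, List.mem_filter, Finset.mem_sdiff, List.mem_toFinset, ← this]
    simp
  · intro p hp
    refine hnd' p ?_
    rw [s1]
    rcases hp with hp | hp
    · simp [hp]
    · simp [hp]
  · conv_rhs => rw [s2]
    rw [List.take_left' s3]
  · conv_rhs => rw [s2]
    rw [List.drop_left' s3]

end Divide

/-! ### The recursion on trees as an instance of divide-swap -/

section DivideSpec

variable {κ : Type*} [DecidableEq κ] {ep : κ → Sym2 κ} {V W : Set κ}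

/-- The merging step thus depends on the results of the halves only through their sets of
identifiers, as a kernel on sets must. -/
theorem markIds_eq (l : List κ) : markIds l = fun e => decide (e ∈ l.toFinset) := by
  ext e
  rw [Bool.eq_iff_iff, markIds_iff]
  simp

theorem idSet_gather {X : Finset κ} {l : List (Edge κ)} (h : (X : Set κ) ⊆ idSet l) :
    idSet (gather (fun e => decide (e ∈ X)) l) = X := by
  ext e
  change e ∈ edgeIds _ ↔ _
  rw [mem_gather_ids, decide_eq_true_iff]
  exact and_iff_left_of_imp fun he => h he

/-- The algorithm on equal trees. -/
theorem pure_spec {I : Finset κ → Prop} (hWV : ∀ e ∈ W, ∀ x ∈ ep e, x ∈ V) {B : List (Edge κ)}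
    {ex : List (Exch κ)} {δ : List ℝ≥0} (hnd : (edgeIds B).Nodup)
    (hbases : ∀ X ∈ bases (edgeIds B).toFinset (exIds ex), Spans ep V X ∧ (X : Set κ) ⊆ W)
    (hδ : δ.length = ex.length + 1)
    (h : ∀ X ∈ bases (edgeIds B).toFinset (exIds ex), (edgeIds B).toFinset ⊆ X) :
    DivideSwapLaw I (edgeIds B).toFinset (exIds ex) δ
        ((PMF.pure (edgeIds B)).map List.toFinset) ∧
      ∀ Z ∈ (PMF.pure (edgeIds B)).support, Z.Nodup ∧ Spans ep V {x | x ∈ Z} ∧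
        {x | x ∈ Z} ⊆ W := by
  have hlenI : (exIds ex).length = ex.length := List.length_map _
  have hBs := hbases _ (mem_bases_self _ _)
  refine ⟨?_, fun Z hZ => ?_⟩
  · rw [PMF.pure_map]
    refine divideSwapLaw_of_forall_eq _ _ _ _ (by omega) fun X hX => ?_
    have h1 := hbases X hX
    exact Finset.coe_injective (hBs.1.eq_of_subset h1.1 (Finset.coe_subset.2 (h X hX))
      fun e he => hWV e (h1.2 he))
  · rw [PMF.support_pure, Set.mem_singleton_iff] at hZ
    subst hZ
    rw [coe_edgeIds] at hBs
    exact ⟨hnd, hBs⟩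

/-- The divide-and-conquer algorithm for trees is an instance of the abstract scheme. -/
theorem divideSwap_spec [Fintype κ] {I : Finset κ → Prop}
    (hI : ∀ X : Finset κ, (X : Set κ) ⊆ W → Acyc ep X → I X)
    (hWV : ∀ e ∈ W, ∀ x ∈ ep e, x ∈ V) {m d : ℕ} {B : List (Edge κ)} {ex : List (Exch κ)}
    {δ : List ℝ≥0} (hends : HasEnds ep B) (hnd : (edgeIds B).Nodup)
    (hex : ∀ p ∈ ex, HasEnds ep p.2 ∧ (edgeIds p.1).Nodup)
    (hbases : ∀ X ∈ bases (edgeIds B).toFinset (exIds ex), Spans ep V X ∧ (X : Set κ) ⊆ W)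
    (hδ : δ.length = ex.length + 1) (hd : removedCount ex < 2 ^ d) (hm : 2 * exSize ex ≤ 2 ^ m) :
    DivideSwapLaw I (edgeIds B).toFinset (exIds ex) δ
        ((divideSwap m d B ex δ).map List.toFinset) ∧
      ∀ Z ∈ (divideSwap m d B ex δ).support, Z.Nodup ∧ Spans ep V {x | x ∈ Z} ∧
        {x | x ∈ Z} ⊆ W := by
  induction d generalizing ep V W I B ex δ with
  | zero =>
    have h0 : removedCount ex = 0 := by simpa using hd
    rw [divideSwap_of_removedCount m 0 B δ h0]
    exact pure_spec hWV hnd hbases hδ (subset_of_mem_bases h0)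
  | succ d ih =>
    rcases B with _ | ⟨⟨fl, e, x, y⟩, B⟩
    · rw [divideSwap]
      exact pure_spec hWV hnd hbases hδ fun X _ => Finset.empty_subset X
    by_cases h0 : removedCount ex = 0
    · rw [divideSwap_of_removedCount m _ _ δ h0]
      exact pure_spec hWV hnd hbases hδ (subset_of_mem_bases h0)
    have hlenI : (exIds ex).length = ex.length := List.length_map _
    have hBs := hbases _ (mem_bases_self _ _)
    have hne : ex ≠ [] := by
      rintro rfl
      exact h0 rfl
    rw [divideSwap, if_neg h0]
    have hT : IsTree ep V ((fl, e, x, y) :: B) := by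
      rw [coe_edgeIds] at hBs
      exact hBs.1.isTree hends hnd fun e he => hWV e (hBs.2 he)
    obtain ⟨φ, hφ, hD⟩ := divide_correct (δ := δ) hT (hT.mem _ List.mem_cons_self).1 hex hne hδ
    have hbd := divide_bounded x ((fl, e, x, y) :: B) ex δ hne hδ
    generalize (fl, e, x, y) :: B = B at *
    generalize divide x B ex δ = D at *
    have hs := hbd.sizes
    have hall := hbd.all
    have hrl := hbd.removed_left
    have hrr := hbd.removed_right
    rw [pow_succ] at hd
    have hneI : exIds ex ≠ [] := by rwa [← List.length_pos_iff, hlenI, List.length_pos_iff]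
    have hk := splitIndex_lt hneI
    set U := touched (exIds ex) with hU
    set A := (edgeIds B).toFinset \ U with hA
    set X₀ := (edgeIds B).toFinset ∩ U with hX₀
    set ep' : κ → Sym2 κ := fun e => (ep e).map φ
    have hAU : Disjoint U A := Finset.disjoint_sdiff
    have hd1 : ∀ p ∈ exIds ex, Disjoint p.1 A ∧ Disjoint p.2 A := fun p hp =>
      ⟨hAU.mono_left (subset_touched hp).1, hAU.mono_left (subset_touched hp).2⟩
    have hBA : X₀ ∪ A = (edgeIds B).toFinset := by
      rw [Finset.union_comm]; exact Finset.sdiff_union_inter _ _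
    have hXA : Disjoint X₀ A := hAU.mono_left Finset.inter_subset_right
    have hbu := bases_union (A := A) X₀ (exIds ex) fun p hp => (hd1 p hp).1
    rw [hBA] at hbu
    have hAW : (A : Set κ) ⊆ W := (Finset.coe_subset.2 Finset.sdiff_subset).trans hBs.2
    have hAa : Acyc ep (A : Set κ) := hBs.1.acyc.mono (Finset.coe_subset.2 Finset.sdiff_subset)
    -- the contracted instance
    set W' : Set κ := (W \ A) ∩ idSet D.all with hW'
    have hI' : ∀ X : Finset κ, (X : Set κ) ⊆ W' → Acyc ep' X → contractIndep I A X := by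
      intro X hX hXa
      refine ⟨?_, hI _ ?_ ?_⟩
      · rw [Finset.disjoint_left]
        exact fun e he => (hX he).1.2
      · rw [Finset.coe_union]
        exact Set.union_subset (fun e he => (hX he).1.1) hAW
      · rw [Finset.coe_union]
        exact Acyc.of_contract hφ hAa X.finite_toSet hXa
    have hWV' : ∀ e ∈ W', ∀ x ∈ ep' e, x ∈ φ '' V := by
      intro e he x hx
      obtain ⟨y, hy, rfl⟩ := Sym2.mem_map.1 hx
      exact ⟨y, hWV e he.1.1 y hy, rfl⟩
    have hbases' : ∀ X ∈ bases X₀ (exIds ex), Spans ep' (φ '' V) X ∧ (X : Set κ) ⊆ W' := by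
      intro X hX
      have h1 := disjoint_bases hXA (fun p hp => (hd1 p hp).2) X hX
      have h2 := hbases (X ∪ A) (hbu ▸ List.mem_map_of_mem hX)
      rw [Finset.coe_union] at h2
      refine ⟨h2.1.contract hφ (Finset.disjoint_coe.2 h1), fun e he => ⟨⟨h2.2 (Or.inl he), ?_⟩, ?_⟩⟩
      · exact Finset.disjoint_left.1 h1 he
      · exact List.mem_toFinset.1 (bases_subset hD.subset hD.added X hX he)
    have hsplit := bases_split X₀ (exIds ex) hk
    obtain ⟨hL, hLs⟩ := ih hI' hWV' hD.ends_left hD.nodup_left (fun p hp => hD.exch p (Or.inl hp))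
      (by
        rw [hD.ids_left, hD.left]
        exact fun X hX => hbases' X (hsplit ▸ List.mem_append_left _ hX))
      hbd.leftWeights (by omega) (by omega)
    obtain ⟨hR, hRs⟩ := ih hI' hWV' hD.ends_right hD.nodup_right
      (fun p hp => hD.exch p (Or.inr hp))
      (by
        rw [hD.ids_right, hD.right]
        exact fun X hX => hbases' X (hsplit ▸ List.mem_append_right _ hX))
      hbd.rightWeights (by omega) (by omega)
    have hM : ∀ X Y : List κ, X ∈ (divideSwap m d D.B D.left D.leftWeights).support →
        Y ∈ (divideSwap m d D.B' D.right D.rightWeights).support →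
        MergeLaw (contractIndep I A) (weightSum D.leftWeights) (weightSum D.rightWeights)
          X.toFinset Y.toFinset ((mergeTrees m (weightSum D.leftWeights) (weightSum D.rightWeights)
            (gather (markIds X) D.all) (gather (markIds Y) D.all)).map List.toFinset) ∧
        ∀ Z ∈ (mergeTrees m (weightSum D.leftWeights) (weightSum D.rightWeights)
          (gather (markIds X) D.all) (gather (markIds Y) D.all)).support,
          Z.Nodup ∧ {x | x ∈ Z} ⊆ W' ∧ Spans ep' (φ '' V) {x | x ∈ Z} := by
      intro X Y hX hY
      obtain ⟨-, hX1, hX2⟩ := hLs X hX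
      obtain ⟨-, hY1, hY2⟩ := hRs Y hY
      -- The halves return bare identifiers. Their endpoints in the contracted graph are recovered
      -- from `D.all`, in which every identifier from `W'` occurs.
      have hgt : ∀ X : List κ, Spans ep' (φ '' V) {x | x ∈ X} → {x | x ∈ X} ⊆ W' →
          idSet (gather (markIds X) D.all) = {x | x ∈ X} ∧
          IsTree ep' (φ '' V) (gather (markIds X) D.all) := by
        intro X h1 h2
        have h3 : idSet (gather (markIds X) D.all) = {x | x ∈ X} := by
          rw [markIds_eq, idSet_gather]
          · simp
          · intro e he
            exact (h2 (List.mem_toFinset.1 he)).2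
        refine ⟨h3, Spans.isTree (h3 ▸ h1) (hasEnds_gather hD.ends) (nodup_gather _ _) ?_⟩
        rw [h3]
        exact fun e he => hWV' e (h2 he)
      obtain ⟨gX1, gX2⟩ := hgt X hX1 hX2
      obtain ⟨gY1, gY2⟩ := hgt Y hY1 hY2
      have hlen := length_gather_le (markIds X) D.all
      obtain ⟨h1, h2⟩ := mergeTrees_spec (m := m) hI' gX2 gY2 (fun t ht => (of_mem_gather ht).1)
        (by rw [gX1, gY1]; exact Set.union_subset hX2 hY2) (by omega) (weightSum D.leftWeights)
        (weightSum D.rightWeights)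
      have hto : ∀ X : List κ, idSet (gather (markIds X) D.all) = {x | x ∈ X} →
          (edgeIds (gather (markIds X) D.all)).toFinset = X.toFinset := fun X h => by
        rw [← Finset.coe_inj, coe_edgeIds, h]
        simp
      rw [hto X gX1, hto Y gY1] at h1
      refine ⟨h1, fun Z hZ => ?_⟩
      obtain ⟨h3, h4, h5, h6⟩ := h2 Z hZ
      refine ⟨h3, fun e he => ?_, h5, h6⟩
      have := h4 e he
      rw [gX1, gY1] at this
      exact this.elim (fun h => hX2 h) fun h => hY2 h
    refine ⟨?_, fun Z hZ => ?_⟩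
    · rw [hD.ids_left, hD.left, hD.leftWeights] at hL
      rw [hD.ids_right, hD.right, hD.rightWeights] at hR
      have hlaw := DivideSwapLaw.split I (edgeIds B).toFinset (exIds ex) δ _ _ _ _
        (fun X Y => (mergeTrees m (weightSum D.leftWeights) (weightSum D.rightWeights)
          (gather (fun e => decide (e ∈ X)) D.all) (gather (fun e => decide (e ∈ Y)) D.all)).map
            List.toFinset) hneI rfl rfl hL hR (by
          intro X hX Y hY
          rw [PMF.support_map] at hX hY
          obtain ⟨X, hX, rfl⟩ := hX
          obtain ⟨Y, hY, rfl⟩ := hY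
          rw [← hD.leftWeights] at hX
          rw [← hD.rightWeights] at hY
          have := (hM X Y hX hY).1
          rw [markIds_eq, markIds_eq] at this
          convert this using 1
          · rw [weightSum_eq, hD.leftWeights]
          · rw [weightSum_eq, hD.rightWeights])
      rw [← hD.leftWeights, ← hD.rightWeights] at hlaw
      convert hlaw using 1
      rw [PMF.map_bind, PMF.bind_map]
      congr 1
      ext1 X
      rw [Function.comp_apply, PMF.map_bind, PMF.bind_map]
      congr 1
      ext1 Y
      rw [Function.comp_apply, PMF.map_comp, PMF.map_comp, markIds_eq, markIds_eq]
      congr 1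
      ext1 Z
      rw [Function.comp_apply, Function.comp_apply, List.toFinset_append, List.toFinset_reverse,
        hD.ids_rest, Finset.union_comm]
    · simp only [PMF.mem_support_bind_iff, PMF.support_map] at hZ
      obtain ⟨X, hX, Y, hY, Z, hZ, rfl⟩ := hZ
      obtain ⟨h1, h2, h3⟩ := (hM X Y hX hY).2 Z hZ
      have hrest : ∀ e, e ∈ D.rest ↔ e ∈ A := fun e => by rw [← hD.ids_rest, List.mem_toFinset]
      have hset : {x | x ∈ D.rest.reverse ++ Z} = {x | x ∈ Z} ∪ (A : Set κ) := by
        ext e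
        simp [hrest, or_comm]
      rw [hset]
      refine ⟨?_, h3.of_contract hφ hAa (List.finite_toSet Z), ?_⟩
      · rw [List.nodup_append']
        refine ⟨List.nodup_reverse.2 hD.nodup_rest, h1, fun e he hZ => ?_⟩
        exact (h2 hZ).1.2 ((hrest e).1 (List.mem_reverse.1 he))
      · exact Set.union_subset (fun e he => (h2 he).1.1) hAW

end DivideSpec

/-! ### Forests and spanning trees of multigraphs -/

section Forests

variable {V E : Type*} {G : Graph V E} {ep : E → Sym2 V} {F : Finset E}

theorem conn_of_reachable {F' : Set E} (hG : ∀ e x y, G.IsLink e x y → ep e = s(x, y))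
    {x y : G.vertexSet} (h : (edgeGraph G F').Reachable x y) : Conn ep F' x y := by
  rw [SimpleGraph.reachable_iff_reflTransGen] at h
  induction h with
  | refl => rfl
  | tail _ h ih =>
    obtain ⟨-, e, he, h⟩ := h
    exact ih.trans (.of_mem he (hG e _ _ h))

theorem reachable_of_conn {F' : Set E} (hG : ∀ e ∈ F', ∀ x y, ep e = s(x, y) → G.IsLink e x y)
    {x y : G.vertexSet} (h : Conn ep F' x y) : (edgeGraph G F').Reachable x y := by
  have key : ∀ z, Conn ep F' x z → ∃ hz : z ∈ G.vertexSet,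
      (edgeGraph G F').Reachable x ⟨z, hz⟩ := by
    intro z hz
    induction hz with
    | refl => exact ⟨x.2, .refl _⟩
    | @tail b c _ h ih =>
      obtain ⟨e, he, h⟩ := h
      obtain ⟨hb, ih⟩ := ih
      have hl := hG e he _ _ h
      refine ⟨hl.right_mem, ?_⟩
      by_cases hbc : b = c
      · subst hbc
        exact ih
      · refine ih.trans (SimpleGraph.Adj.reachable ⟨fun h => hbc (congrArg Subtype.val h), e, he, hl⟩)
  exact (key y h).2

/-- Forests in terms of connectivity. -/
theorem isForest_iff (hG : ∀ e ∈ G.edgeSet, ∀ x y, G.IsLink e x y ↔ ep e = s(x, y)) :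
    IsForest G F ↔ (∀ e ∈ F, e ∈ G.edgeSet) ∧ Acyc ep F := by
  have hG' : ∀ e x y, G.IsLink e x y → ep e = s(x, y) := fun e x y h => (hG e h.edge_mem x y).1 h
  constructor
  · refine fun h => ⟨h.subset_edgeSet, fun e he x y hxy hc => ?_⟩
    have hl := (hG e (h.subset_edgeSet e he) x y).2 hxy
    have hr : (edgeGraph G ((F : Set E) \ {e})).Reachable ⟨x, hl.left_mem⟩ ⟨y, hl.right_mem⟩ :=
      reachable_of_conn (fun f hf x y => (hG f (h.subset_edgeSet f hf.1) x y).2) hc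
    have hadj : (edgeGraph G (F : Set E)).Adj ⟨x, hl.left_mem⟩ ⟨y, hl.right_mem⟩ := by
      refine ⟨fun hxy => ?_, e, he, hl⟩
      have : x = y := congrArg Subtype.val hxy
      subst this
      exact h.no_loop e he x hl
    -- In an acyclic simple graph every edge is a bridge. No other edge of `F` is parallel to `e`,
    -- so removing the identifier `e` amounts to removing its adjacency.
    refine SimpleGraph.isBridge_iff.1
      (SimpleGraph.isAcyclic_iff_forall_adj_isBridge.1 h.isAcyclic hadj) (hr.mono ?_)
    rintro a b ⟨hab, f, hf, hfl⟩
    rw [SimpleGraph.deleteEdges_adj]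
    refine ⟨⟨hab, f, hf.1, hfl⟩, fun heq => hf.2 ?_⟩
    rw [Set.mem_singleton_iff, Sym2.eq_iff] at heq
    rcases heq with ⟨rfl, rfl⟩ | ⟨rfl, rfl⟩
    · exact h.no_parallel f hf.1 e he _ _ hfl hl
    · exact h.no_parallel f hf.1 e he _ _ hfl.symm hl
  · rintro ⟨hF, h⟩
    refine ⟨hF, fun e he x hl => h e he x x (hG' e x x hl) (.refl _), fun e he f hf x y hel hfl => ?_,
      ?_⟩
    · by_contra hne
      exact h e he x y (hG' e x y hel) (.of_mem ⟨hf, Ne.symm hne⟩ (hG' f x y hfl))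
    · rw [SimpleGraph.isAcyclic_iff_forall_adj_isBridge]
      rintro x y ⟨-, e, he, hl⟩
      rw [SimpleGraph.isBridge_iff]
      refine fun hr => h e he x y (hG' e x y hl) (conn_of_reachable hG' (hr.mono ?_))
      intro a b hab
      rw [SimpleGraph.deleteEdges_adj] at hab
      obtain ⟨⟨hne, f, hf, hfl⟩, hn⟩ := hab
      refine ⟨hne, f, ⟨hf, ?_⟩, hfl⟩
      rintro rfl
      refine hn ?_
      have h1 := (hG' f _ _ hfl).symm.trans (hG' f _ _ hl)
      rw [Set.mem_singleton_iff, Sym2.eq_iff]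
      rw [Sym2.eq_iff] at h1
      simpa [Subtype.ext_iff] using h1

/-- Spanning trees in terms of connectivity. -/
theorem isSpanningTree_iff {V : Type*} {G : Graph V V} {ep : V → Sym2 V} {F : Finset V}
    (hG : ∀ e ∈ G.edgeSet, ∀ x y, G.IsLink e x y ↔ ep e = s(x, y)) :
    IsSpanningTree G F ↔
      (∀ e ∈ F, e ∈ G.edgeSet) ∧ Spans ep G.vertexSet F ∧ G.vertexSet.Nonempty := by
  have hG' : ∀ e x y, G.IsLink e x y → ep e = s(x, y) := fun e x y h => (hG e h.edge_mem x y).1 h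
  constructor
  · intro h
    have h1 := (isForest_iff hG).1 h.isForest
    exact ⟨h1.1, ⟨h1.2, fun x hx y hy =>
      conn_of_reachable hG' (h.connected.preconnected ⟨x, hx⟩ ⟨y, hy⟩)⟩,
      Set.nonempty_coe_sort.1 h.connected.nonempty⟩
  · rintro ⟨h1, h2, h3⟩
    refine ⟨(isForest_iff hG).2 ⟨h1, h2.acyc⟩, ?_⟩
    have : Nonempty G.vertexSet := h3.to_subtype
    exact ⟨fun x y => reachable_of_conn (fun e he x y => (hG e (h1 e he) x y).2)
      (h2.conn x x.2 y y.2)⟩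

end Forests

/-! ### Renaming -/

section Rename

variable {α β : Type*} [DecidableEq α] [DecidableEq β] {I : Finset α → Prop} {J : Finset β → Prop}
  (f : α ↪ β)

theorem MergeLaw.rename (hIJ : ∀ X, I X → J (X.map f)) {a b : ℝ≥0} {X Y : Finset α}
    {μ : PMF (Finset α)} (h : MergeLaw I a b X Y μ) :
    MergeLaw J a b (X.map f) (Y.map f) (μ.map (Finset.map f)) := by
  induction h with
  | done X Y h =>
    rw [PMF.pure_map]
    exact .done _ _ (by rw [← Finset.map_sdiff, h, Finset.map_empty])
  | swap X Y e e' μ μ' he he' h1 h2 _ _ ih1 ih2 =>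
    have e1 : insert (f e') ((X.map f).erase (f e)) = (insert e' (X.erase e)).map f := by
      rw [Finset.map_insert, Finset.map_erase]
    have e2 : insert (f e) ((Y.map f).erase (f e')) = (insert e (Y.erase e')).map f := by
      rw [Finset.map_insert, Finset.map_erase]
    have := MergeLaw.swap (Indep := J) (X.map f) (Y.map f) (f e) (f e') _ _
      (by rw [← Finset.map_sdiff]; exact Finset.mem_map_of_mem f he)
      (by rw [← Finset.map_sdiff]; exact Finset.mem_map_of_mem f he')
      (e1 ▸ hIJ _ h1) (e2 ▸ hIJ _ h2) (e2 ▸ ih1) (e1 ▸ ih2)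
    rw [PMF.map_bind]
    convert this using 3 with c
    cases c <;> rfl

/-- Exchange sets with other names. -/
def renameSets (ex : List (Finset α × Finset α)) : List (Finset β × Finset β) :=
  ex.map fun p => (p.1.map f, p.2.map f)

theorem touched_rename (ex : List (Finset α × Finset α)) :
    touched (renameSets f ex) = (touched ex).map f := by
  induction ex with
  | nil => rfl
  | cons p ex ih =>
    rw [renameSets, List.map_cons, touched, ← renameSets, ih, touched, Finset.map_union,
      Finset.map_union]

omit [DecidableEq α] [DecidableEq β] in
theorem splitIndex_rename (ex : List (Finset α × Finset α)) :
    splitIndex (renameSets f ex) = splitIndex ex := by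
  have h : ∀ ex : List (Finset α × Finset α), removedSize (renameSets f ex) = removedSize ex := by
    intro ex
    simp [removedSize, renameSets, Function.comp_def]
  have hk : ∀ k, removedSize ((renameSets f ex).take k) = removedSize (ex.take k) := by
    intro k
    rw [renameSets, ← List.map_take]
    exact h _
  have hl : (renameSets f ex).length = ex.length := List.length_map _
  simp only [splitIndex, h, hk, hl]

theorem exchange_rename (B : Finset α) (p : Finset α × Finset α) :
    exchange (B.map f) (p.1.map f, p.2.map f) = (exchange B p).map f := by
  rw [exchange, exchange, Finset.map_union, Finset.map_sdiff]

theorem foldl_exchange_rename (B : Finset α) (ex : List (Finset α × Finset α)) :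
    (renameSets f ex).foldl exchange (B.map f) = (ex.foldl exchange B).map f := by
  induction ex generalizing B with
  | nil => rfl
  | cons p ex ih =>
    rw [renameSets, List.map_cons, List.foldl_cons, exchange_rename, ← renameSets, ih]
    rfl

theorem bases_rename (B : Finset α) (ex : List (Finset α × Finset α)) :
    bases (B.map f) (renameSets f ex) = (bases B ex).map (Finset.map f) := by
  induction ex generalizing B with
  | nil => rfl
  | cons p ex ih =>
    rw [renameSets, List.map_cons, bases, exchange_rename, ← renameSets, ih]
    rfl

theorem DivideSwapLaw.rename (hIJ : ∀ X, I X → J (X.map f)) {B : Finset α}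
    {ex : List (Finset α × Finset α)} {δ : List ℝ≥0} {μ : PMF (Finset α)}
    (h : DivideSwapLaw I B ex δ μ) :
    DivideSwapLaw J (B.map f) (renameSets f ex) δ (μ.map (Finset.map f)) := by
  induction h generalizing J with
  | single I B a =>
    rw [PMF.pure_map]
    exact .single J _ a
  | split I B ex δ k U μL μR κ hne hk hU _ _ hκ ihL ihR =>
    have hc : ∀ X, contractIndep I (B \ U) X →
        contractIndep J (B.map f \ U.map f) (X.map f) := by
      rintro X ⟨h1, h2⟩
      rw [contractIndep, ← Finset.map_sdiff, ← Finset.map_union]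
      exact ⟨(Finset.disjoint_map f).2 h1, hIJ _ h2⟩
    have hL := ihL hc
    have hR := ihR hc
    rw [← foldl_exchange_rename] at hR
    rw [Finset.map_inter] at hL hR
    have e1 : renameSets f (ex.take k) = (renameSets f ex).take k := List.map_take
    have e2 : renameSets f (ex.take (k + 1)) = (renameSets f ex).take (k + 1) := List.map_take
    have e3 : renameSets f (ex.drop (k + 1)) = (renameSets f ex).drop (k + 1) := List.map_drop
    rw [e1] at hL
    rw [e2, e3] at hR
    -- The renamed kernel is defined by preimages under `f`; only its values on images matter, and
    -- there the preimage undoes the renaming.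
    have := DivideSwapLaw.split J (B.map f) (renameSets f ex) δ k (U.map f) _ _
      (fun X Y => (κ (X.preimage f f.injective.injOn) (Y.preimage f f.injective.injOn)).map
        (Finset.map f))
      (by simpa [renameSets] using hne) (by rw [splitIndex_rename, hk])
      (by rw [touched_rename, hU]) hL hR (by
        intro X hX Y hY
        rw [PMF.support_map] at hX hY
        obtain ⟨X, hX, rfl⟩ := hX
        obtain ⟨Y, hY, rfl⟩ := hY
        simp only [Finset.preimage_map]
        exact (hκ X hX Y hY).rename f hc)
    convert this using 1
    rw [PMF.map_bind, PMF.bind_map]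
    congr 1
    ext1 X
    rw [Function.comp_apply, PMF.map_bind, PMF.bind_map]
    congr 1
    ext1 Y
    rw [Function.comp_apply, PMF.map_comp, PMF.map_comp, Finset.preimage_map, Finset.preimage_map]
    congr 1
    ext1 Z
    simp [Finset.map_union, Finset.map_sdiff]

end Rename

/-! ### Connectivity under injective renaming -/

section Restrict

variable {ι V ι' V' : Type*} {ep : ι → Sym2 V} {ep' : ι' → Sym2 V'} {f : ι → ι'} {g : V → V'}
  {F : Set ι}

theorem conn_image (hg : Function.Injective g) (h : ∀ e ∈ F, (ep e).map g = ep' (f e)) {x y : V} :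
    Conn ep' (f '' F) (g x) (g y) ↔ Conn ep F x y := by
  constructor
  · intro hc
    generalize hy : g y = y' at hc
    induction hc generalizing y with
    | refl => rw [hg hy]
    | tail _ h' ih =>
      obtain ⟨_, ⟨e, he, rfl⟩, h'⟩ := h'
      obtain ⟨a, b, hab⟩ : ∃ a b, ep e = s(a, b) := by
        induction h : ep e with | _ p q => exact ⟨p, q, rfl⟩
      have h1 := h e he
      rw [hab, h', Sym2.map_mk, Sym2.eq_iff] at h1
      rcases h1 with ⟨h1, h2⟩ | ⟨h1, h2⟩
      · have hby : b = y := hg (h2.trans hy.symm)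
        subst hby
        exact (ih h1).trans (.of_mem he hab)
      · have hby : a = y := hg (h1.trans hy.symm)
        subst hby
        exact (ih h2).trans (.of_mem he (hab.trans Sym2.eq_swap))
  · intro hc
    induction hc with
    | refl => rfl
    | tail _ h' ih =>
      obtain ⟨e, he, h'⟩ := h'
      exact ih.trans (.of_mem ⟨e, he, rfl⟩ (by rw [← h e he, h', Sym2.map_mk]))

theorem acyc_image (hf : Function.Injective f) (hg : Function.Injective g)
    (h : ∀ e ∈ F, (ep e).map g = ep' (f e)) : Acyc ep' (f '' F) ↔ Acyc ep F := by
  have himg : ∀ e, f '' F \ {f e} = f '' (F \ {e}) := fun e => by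
    rw [Set.image_sdiff hf, Set.image_singleton]
  constructor
  · intro ha e he x y hxy hc
    refine ha (f e) ⟨e, he, rfl⟩ (g x) (g y) (by rw [← h e he, hxy, Sym2.map_mk]) ?_
    rw [himg, conn_image hg fun e he => h e he.1]
    exact hc
  · rintro ha _ ⟨e, he, rfl⟩ x' y' hxy hc
    obtain ⟨x, y, hxy'⟩ : ∃ a b, ep e = s(a, b) := by
      induction h : ep e with | _ p q => exact ⟨p, q, rfl⟩
    rw [← h e he, hxy', Sym2.map_mk, Sym2.eq_iff] at hxy
    refine ha e he x y hxy' ?_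
    rw [← conn_image hg fun e he => h e he.1, ← himg]
    rcases hxy with ⟨rfl, rfl⟩ | ⟨rfl, rfl⟩
    · exact hc
    · exact hc.symm

end Restrict

/-! ### Labels of the input as keys -/

/-- The existence statement is the one from which `keysOfSorted` chooses its tree; by proof
irrelevance the choice is the same. So the tree of the keys is the one that the iteration builds. -/
theorem exists_joinTrees_eq (u : List ℕ) (hu : u.Pairwise (· < ·)) (hne : u ≠ []) (n : ℕ)
    (h : u.length ≤ 2 ^ n) :
    ∃ m, (pairUp joinTrees)^[n] (u.attach.map fun k => (k, SearchTree.leaf k)) =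
      [(m, (keysOfSorted u hu hne n h).tree)] := by
  have ex := exists_balanced (num := fun k : {k // k ∈ u} => k.1) (u := u.attach)
    (List.pairwise_iff_getElem.2 fun i j hi hj hij => by
      simpa using List.pairwise_iff_getElem.1 hu i j (by simpa using hi) (by simpa using hj) hij)
    (by simpa) (n := n) (by simpa)
  exact ⟨ex.choose.1, ex.choose_spec.1⟩

section Label

variable {u : List ℕ} (h0 : 0 ∈ u)

/-- A label as a key; labels that are not in use are mapped to `0`. -/
def label (k : ℕ) : {k // k ∈ u} := if h : k ∈ u then ⟨k, h⟩ else ⟨0, h0⟩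

theorem val_label {k : ℕ} (h : k ∈ u) : (label h0 k).1 = k := by rw [label, dif_pos h]

def labelEdge (ends : ℕ → ℕ × ℕ) (e : ℕ) : {k // k ∈ u} × {k // k ∈ u} × {k // k ∈ u} :=
  (label h0 e, label h0 (ends e).1, label h0 (ends e).2)

def labelEdges (ends : ℕ → ℕ × ℕ) (l : List ℕ) :
    List ({k // k ∈ u} × {k // k ∈ u} × {k // k ∈ u}) := l.map (labelEdge h0 ends)

def labelExch (ends : ℕ → ℕ × ℕ) (ex : List (List ℕ × List ℕ)) : List (Exch {k // k ∈ u}) :=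
  ex.map fun p => (unflagged (labelEdges h0 ends p.1), unflagged (labelEdges h0 ends p.2))

theorem edgeIds_labelEdges (ends : ℕ → ℕ × ℕ) (l : List ℕ) :
    edgeIds (unflagged (labelEdges h0 ends l)) = l.map (label h0) := by
  simp [edgeIds, unflagged, labelEdges, labelEdge, Function.comp_def]

theorem map_val_label {l : List ℕ} (h : ∀ e ∈ l, e ∈ u) :
    (l.map (label h0)).map Subtype.val = l := by
  rw [List.map_map]
  conv_rhs => rw [← List.map_id l]
  exact List.map_congr_left fun e he => val_label h0 (h e he)

theorem toFinset_map_val (l : List {k // k ∈ u}) :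
    (l.map Subtype.val).toFinset = l.toFinset.map (Function.Embedding.subtype _) := by
  ext; simp

theorem toFinset_map_label {l : List ℕ} (h : ∀ e ∈ l, e ∈ u) :
    (l.map (label h0)).toFinset.map (Function.Embedding.subtype _) = l.toFinset := by
  rw [← toFinset_map_val, map_val_label h0 h]

theorem nodup_map_label {l : List ℕ} (h : ∀ e ∈ l, e ∈ u) (hl : l.Nodup) :
    (l.map (label h0)).Nodup :=
  List.Nodup.of_map Subtype.val (by rwa [map_val_label h0 h])

end Label

/-- The endpoints of an edge. -/
def endpoints (ends : ℕ → ℕ × ℕ) (e : ℕ) : Sym2 ℕ := s((ends e).1, (ends e).2)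

theorem isLink_iff_endpoints {G : Graph ℕ ℕ} {ends : ℕ → ℕ × ℕ}
    (hG : ∀ e ∈ G.edgeSet, G.IsLink e (ends e).1 (ends e).2) :
    ∀ e ∈ G.edgeSet, ∀ x y, G.IsLink e x y ↔ endpoints ends e = s(x, y) :=
  fun e he _ _ => (hG e he).isLink_iff_sym2_eq

/-- All the labels that occur in the input are in the list `u`. -/
structure Labels (u : List ℕ) (ends : ℕ → ℕ × ℕ) (T : List ℕ) (ex : List (List ℕ × List ℕ)) :
    Prop where
  zero : 0 ∈ u
  mem : ∀ e, (e ∈ T ∨ ∃ p ∈ ex, e ∈ p.1 ∨ e ∈ p.2) → e ∈ u ∧ (ends e).1 ∈ u ∧ (ends e).2 ∈ u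

/-! ### Correctness in terms of the input labels -/

section Labelled

variable {G : Graph ℕ ℕ} {ends : ℕ → ℕ × ℕ} {u T : List ℕ} {ex : List (List ℕ × List ℕ)}
  {δ : List ℝ≥0}

/-- A vertex that is not alone is an end of some edge of the first tree. The only vertex of a
one-vertex graph, however, need not occur in the input. -/
theorem mem_labels_of_isSpanningTree (hG : ∀ e ∈ G.edgeSet, G.IsLink e (ends e).1 (ends e).2)
    (hu : ∀ e ∈ T, (ends e).1 ∈ u ∧ (ends e).2 ∈ u) (hT : IsSpanningTree G T.toFinset)
    {x y : ℕ} (hx : x ∈ G.vertexSet) (hy : y ∈ G.vertexSet) (hxy : x ≠ y) : x ∈ u := by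
  have h := ((isSpanningTree_iff (isLink_iff_endpoints hG)).1 hT).2.1.conn x hx y hy
  rcases h.cases_head with rfl | ⟨z, ⟨e, he, h⟩, -⟩
  · exact absurd rfl hxy
  · have := hu e (by simpa using he)
    rcases Sym2.eq_iff.1 h with ⟨h, -⟩ | ⟨-, h⟩
    · exact h ▸ this.1
    · exact h ▸ this.2

theorem mem_of_mem_bases {α : Type*} [DecidableEq α] {B X : Finset α}
    {ex : List (Finset α × Finset α)} (hX : X ∈ bases B ex) {e : α} (he : e ∈ X) :
    e ∈ B ∨ ∃ p ∈ ex, e ∈ p.2 := by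
  induction ex generalizing B with
  | nil => exact Or.inl (List.mem_singleton.1 hX ▸ he)
  | cons q ex ih =>
    rcases List.mem_cons.1 hX with rfl | hX
    · exact Or.inl he
    · rcases ih hX with h | ⟨p, hp, h⟩
      · rcases Finset.mem_union.1 h with h | h
        · exact Or.inl (Finset.mem_sdiff.1 h).1
        · exact Or.inr ⟨q, List.mem_cons_self, h⟩
      · exact Or.inr ⟨p, List.mem_cons_of_mem _ hp, h⟩

theorem exIds_labelExch (h : Labels u ends T ex) :
    renameSets (Function.Embedding.subtype _) (exIds (labelExch h.zero ends ex)) =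
      exchangeSets ex := by
  rw [renameSets, exIds, labelExch, exchangeSets, List.map_map, List.map_map]
  refine List.map_congr_left fun p hp => ?_
  simp only [Function.comp_apply, edgeIds_labelEdges]
  rw [toFinset_map_label h.zero fun e he => (h.mem e (Or.inr ⟨p, hp, Or.inl he⟩)).1,
    toFinset_map_label h.zero fun e he => (h.mem e (Or.inr ⟨p, hp, Or.inr he⟩)).1]

theorem hasEnds_labelEdges (h0 : 0 ∈ u) {l : List ℕ} (hl : ∀ e ∈ l, e ∈ u) :
    HasEnds (fun e : {k // k ∈ u} => s(label h0 (ends e.1).1, label h0 (ends e.1).2))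
      (unflagged (labelEdges h0 ends l)) := by
  intro t ht
  simp only [unflagged, labelEdges, List.map_map, List.mem_map, Function.comp_apply] at ht
  obtain ⟨e, he, rfl⟩ := ht
  simp only [labelEdge]
  rw [val_label h0 (hl e he)]

theorem map_val_endpoints (h0 : 0 ∈ u) {e : {k // k ∈ u}} (h1 : (ends e.1).1 ∈ u)
    (h2 : (ends e.1).2 ∈ u) :
    (s(label h0 (ends e.1).1, label h0 (ends e.1).2)).map Subtype.val = endpoints ends e.1 := by
  rw [Sym2.map_mk, val_label h0 h1, val_label h0 h2, endpoints]

/-- The algorithm in terms of the labels. -/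
theorem divideSwap_labels (hG : ∀ e ∈ G.edgeSet, G.IsLink e (ends e).1 (ends e).2)
    (hT : T.Nodup) (hex : ∀ p ∈ ex, p.1.Nodup ∧ p.2.Nodup)
    (hB : ∀ X ∈ bases T.toFinset (exchangeSets ex), IsSpanningTree G X)
    (hδ : δ.length = ex.length + 1) (hu : Labels u ends T ex) :
    T.length ≤ G.vertexSet.ncard ∧ 1 ≤ G.vertexSet.ncard ∧
    ∀ m d, removedCount (labelExch hu.zero ends ex) < 2 ^ d →
      2 * exSize (labelExch hu.zero ends ex) ≤ 2 ^ m →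
      DivideSwapLaw (IsForest G) T.toFinset (exchangeSets ex) δ
        ((divideSwap m d (unflagged (labelEdges hu.zero ends T)) (labelExch hu.zero ends ex) δ).map
          fun l => (l.map Subtype.val).toFinset) ∧
      ∀ Z ∈ (divideSwap m d (unflagged (labelEdges hu.zero ends T)) (labelExch hu.zero ends ex)
        δ).support, (Z.map Subtype.val).Nodup ∧ IsSpanningTree G (Z.map Subtype.val).toFinset := by
  set ep := fun e : {k // k ∈ u} => s(label hu.zero (ends e.1).1, label hu.zero (ends e.1).2)
    with hep
  set W : Set {k // k ∈ u} := {e | e.1 ∈ G.edgeSet ∧ (ends e.1).1 ∈ u ∧ (ends e.1).2 ∈ u} with hW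
  set V : Set {k // k ∈ u} := {k | k.1 ∈ G.vertexSet} with hV
  have hlink := isLink_iff_endpoints hG
  have hTu : ∀ e ∈ T, e ∈ u := fun e he => (hu.mem e (Or.inl he)).1
  have hTree := hB _ (mem_bases_self _ _)
  have hvu : ∀ x ∈ G.vertexSet, ∀ y ∈ G.vertexSet, x ≠ y → x ∈ u := fun x hx y hy =>
    mem_labels_of_isSpanningTree hG (fun e he => (hu.mem e (Or.inl he)).2) hTree hx hy
  have hVne := ((isSpanningTree_iff hlink).1 hTree).2.2
  -- All vertices except possibly one are labels of the input.
  have hfin : G.vertexSet.Finite := by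
    obtain ⟨x, hx⟩ := hVne
    refine ((List.finite_toSet u).insert x).subset fun y hy => ?_
    by_cases hxy : y = x
    · exact Or.inl hxy
    · exact Or.inr (hvu y hy x hx hxy)
  have hmap : ∀ F : Set {k // k ∈ u}, F ⊆ W → ∀ e ∈ F,
      (ep e).map Subtype.val = endpoints ends (Function.Embedding.subtype _ e) := fun F hF e he =>
    map_val_endpoints hu.zero (hF he).2.1 (hF he).2.2
  have hacyc : ∀ X : Finset {k // k ∈ u}, (X : Set {k // k ∈ u}) ⊆ W →
      (Acyc (endpoints ends) ↑(X.map (Function.Embedding.subtype _)) ↔ Acyc ep X) := by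
    intro X hX
    rw [Finset.coe_map]
    exact acyc_image (Function.Embedding.injective _) Subtype.val_injective (hmap X hX)
  have hconn : ∀ X : Finset {k // k ∈ u}, (X : Set {k // k ∈ u}) ⊆ W → ∀ x y,
      (Conn (endpoints ends) ↑(X.map (Function.Embedding.subtype _)) x.1 y.1 ↔ Conn ep X x y) := by
    intro X hX x y
    rw [Finset.coe_map]
    exact conn_image Subtype.val_injective (hmap X hX)
  have hedge : ∀ X : Finset {k // k ∈ u}, (X : Set {k // k ∈ u}) ⊆ W →
      ∀ e ∈ X.map (Function.Embedding.subtype _), e ∈ G.edgeSet := by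
    intro X hX e he
    obtain ⟨e, he', rfl⟩ := Finset.mem_map.1 he
    exact (hX he').1
  have hWV : ∀ e ∈ W, ∀ x ∈ ep e, x ∈ V := by
    intro e he x hx
    have hl := hG e.1 he.1
    rw [hep, Sym2.mem_iff] at hx
    rcases hx with rfl | rfl
    · rw [hV, Set.mem_ofPred_eq, val_label _ he.2.1]
      exact hl.left_mem
    · rw [hV, Set.mem_ofPred_eq, val_label _ he.2.2]
      exact hl.right_mem
  have hidT : (edgeIds (unflagged (labelEdges hu.zero ends T))).toFinset.map
      (Function.Embedding.subtype _) = T.toFinset := by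
    rw [edgeIds_labelEdges, toFinset_map_label hu.zero hTu]
  have hused : ∀ X ∈ bases T.toFinset (exchangeSets ex), ∀ e ∈ X,
      (ends e).1 ∈ u ∧ (ends e).2 ∈ u := by
    intro X hX e he
    rcases mem_of_mem_bases hX he with he | ⟨p, hp, he⟩
    · exact (hu.mem e (Or.inl (List.mem_toFinset.1 he))).2
    · obtain ⟨p, hp', rfl⟩ := List.mem_map.1 hp
      exact (hu.mem e (Or.inr ⟨p, hp', Or.inr (List.mem_toFinset.1 he)⟩)).2
  have hbases : ∀ X ∈ bases (edgeIds (unflagged (labelEdges hu.zero ends T))).toFinset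
      (exIds (labelExch hu.zero ends ex)), Spans ep V X ∧ (X : Set {k // k ∈ u}) ⊆ W := by
    intro X hX
    have h1 := List.mem_map_of_mem (f := Finset.map (Function.Embedding.subtype _)) hX
    rw [← bases_rename, hidT, exIds_labelExch hu] at h1
    obtain ⟨h2, h3, -⟩ := (isSpanningTree_iff hlink).1 (hB _ h1)
    have hXW : (X : Set {k // k ∈ u}) ⊆ W := fun e he => by
      have he' := Finset.mem_map_of_mem (Function.Embedding.subtype _) he
      exact ⟨h2 _ he', hused _ h1 _ he'⟩
    exact ⟨⟨(hacyc X hXW).1 h3.acyc, fun x hx y hy => (hconn X hXW x y).1 (h3.conn _ hx _ hy)⟩, hXW⟩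
  have hends := hasEnds_labelEdges (ends := ends) hu.zero hTu
  have hnd : (edgeIds (unflagged (labelEdges hu.zero ends T))).Nodup := by
    rw [edgeIds_labelEdges]
    exact nodup_map_label hu.zero hTu hT
  refine ⟨?_, (Set.ncard_pos hfin).2 hVne,
    fun m d hd hm => ?_⟩
  · cases hl : T with
    | nil => simp
    | cons e T' =>
      have heT : e ∈ T := hl ▸ List.mem_cons_self
      rw [← hl]
      have hBs := hbases _ (mem_bases_self _ _)
      rw [coe_edgeIds] at hBs
      have hTr : IsTree ep V (unflagged (labelEdges hu.zero ends T)) :=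
        hBs.1.isTree hends hnd fun e he => hWV e (hBs.2 he)
      have hr : label hu.zero (ends e).1 ∈ V := (hTr.mem (false, labelEdge hu.zero ends e)
        (List.mem_map_of_mem (List.mem_map_of_mem heT))).1
      have hs := hTr.search hr
      have hn := (rooted_search (unflagged (labelEdges hu.zero ends T))
        (label hu.zero (ends e).1)).nodup
      generalize label hu.zero (ends e).1 = r at hr hs hn
      have h1 := hTr.length_search hr
      -- The rooted form of `T` lists `T.length + 1` different vertices of the graph.
      have h2 : ((verts r (search (unflagged (labelEdges hu.zero ends T)) r)).map
          Subtype.val).toFinset.card ≤ G.vertexSet.ncard := by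
        rw [← Set.ncard_coe_finset]
        refine Set.ncard_le_ncard (fun x hx => ?_) hfin
        rw [Finset.mem_coe, List.mem_toFinset, List.mem_map] at hx
        obtain ⟨x, hx, rfl⟩ := hx
        exact (hs.2.2 x).1 hx
      rw [List.toFinset_card_of_nodup (hn.map Subtype.val_injective)] at h2
      simp only [verts, List.length_map, List.length_cons, h1] at h2
      simp only [unflagged, labelEdges, List.length_map] at h2
      omega
  · obtain ⟨h1, h2⟩ := divideSwap_spec
      (I := fun X => IsForest G (X.map (Function.Embedding.subtype _)))
      (fun X hX ha => (isForest_iff hlink).2 ⟨hedge X hX, (hacyc X hX).2 ha⟩) hWV hends hnd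
      (fun p hp => by
        obtain ⟨p, hp', rfl⟩ := List.mem_map.1 hp
        replace hp := hp'
        refine ⟨hasEnds_labelEdges hu.zero fun e he => (hu.mem e (Or.inr ⟨p, hp, Or.inr he⟩)).1, ?_⟩
        rw [edgeIds_labelEdges]
        exact nodup_map_label hu.zero (fun e he => (hu.mem e (Or.inr ⟨p, hp, Or.inl he⟩)).1)
          (hex p hp).1)
      hbases (by rw [hδ, labelExch, List.length_map]) hd hm
    constructor
    · have h3 := h1.rename (Function.Embedding.subtype _) (J := IsForest G) fun X hX => hX
      rw [hidT, exIds_labelExch hu, PMF.map_comp] at h3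
      convert h3 using 2
      ext1 l
      exact toFinset_map_val l
    · intro Z hZ
      obtain ⟨h3, h4, h5⟩ := h2 Z hZ
      have hset : {x | x ∈ Z} = (Z.toFinset : Set {k // k ∈ u}) := by ext; simp
      rw [hset] at h4 h5
      refine ⟨h3.map Subtype.val_injective, ?_⟩
      rw [toFinset_map_val, isSpanningTree_iff hlink]
      refine ⟨hedge _ h5, ⟨(hacyc _ h5).2 h4.acyc, fun x hx y hy => ?_⟩, hVne⟩
      -- Two different vertices are labels of the input, so their connectivity can be transferred;
      -- equal vertices include the case of a one-vertex graph without labels.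
      by_cases hxy : x = y
      · subst hxy
        exact Conn.refl _
      · exact (hconn _ h5 ⟨x, hvu x hx y hy hxy⟩ ⟨y, hvu y hy x hx (Ne.symm hxy)⟩).2
          (h4.conn _ hx _ hy)

/-- The summand `1` for a non-trivial exchange is at most the size of that exchange, which is
counted twice therefore; a trivial exchange contributes just `1`. -/
theorem exSize_labelExch_le (h0 : 0 ∈ u) (hex : ∀ p ∈ ex, p.1.Nodup ∧ p.2.Nodup) :
    exSize (labelExch h0 ends ex) ≤
      2 * exchangeSize (exchangeSets ex) + trivialExchanges (exchangeSets ex) := by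
  induction ex with
  | nil => simp [labelExch]
  | cons p ex ih =>
    have h1 := ih fun p hp => hex p (List.mem_cons_of_mem _ hp)
    obtain ⟨hp1, hp2⟩ := hex p List.mem_cons_self
    simp only [labelExch, exchangeSets, List.map_cons, exSize_cons, exchangeSize, List.sum_cons,
      trivialExchanges, List.countP_cons, unflagged, labelEdges, List.length_map] at h1 ⊢
    rw [List.toFinset_card_of_nodup hp1, List.toFinset_card_of_nodup hp2]
    by_cases h : p.1 = [] ∧ p.2 = []
    · simp only [h.1, h.2, List.toFinset_nil, and_self, decide_true, if_true, List.length_nil]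
      omega
    · have : 1 ≤ p.1.length + p.2.length := by
        by_contra h2
        exact h ⟨List.length_eq_zero_iff.1 (by omega), List.length_eq_zero_iff.1 (by omega)⟩
      omega

end Labelled

/-! ### The program on encoded inputs -/

theorem encodeOutput_injective : Function.Injective encodeOutput := by
  intro l
  induction l with
  | nil => rintro (_ | ⟨b, l'⟩) h <;> simp_all [encodeOutput, Val.ofList]
  | cons a l ih =>
    rintro (_ | ⟨b, l'⟩) h
    · simp [encodeOutput, Val.ofList] at h
    · simp only [encodeOutput, List.map_cons, Val.ofList, Val.pair.injEq, Val.num.injEq] at h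
      rw [h.1, ih h.2]

/-- The constant is `10 ^ 12 * 7 ^ 3 * 3`, from `n + 1 ≤ 7 * (Nat.log 2 N + 1)` and `s + 1 ≤ 3 * N`.
-/
theorem running_time_le {s N n : ℕ} (hs : s ≤ 2 * N) (hN : 1 ≤ N) (hn : n = Nat.log 2 N + 6) :
    1000000000000 * ((n + 1) ^ 3 * (s + 1)) ≤
      1029000000000000 * N * (Nat.log 2 N + 1) ^ 3 := by
  have h1 : (n + 1) ^ 3 ≤ (7 * (Nat.log 2 N + 1)) ^ 3 := Nat.pow_le_pow_left (by omega) 3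
  calc 1000000000000 * ((n + 1) ^ 3 * (s + 1))
      ≤ 1000000000000 * ((7 * (Nat.log 2 N + 1)) ^ 3 * (3 * N)) := by
        gcongr
        omega
    _ = _ := by ring

/-- The program runs in near-linear time and implements the divide-and-conquer scheme. -/
theorem swapRounding_runs {G : Graph ℕ ℕ} {ends : ℕ → ℕ × ℕ} {T : List ℕ}
    {ex : List (List ℕ × List ℕ)} {δ : List ℝ≥0}
    (hG : ∀ e ∈ G.edgeSet, G.IsLink e (ends e).1 (ends e).2)
    (hT : T.Nodup) (hex : ∀ p ∈ ex, p.1.Nodup ∧ p.2.Nodup)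
    (hB : ∀ X ∈ bases T.toFinset (exchangeSets ex), IsSpanningTree G X)
    (hδ : δ.length = ex.length + 1) :
    ∃ ν : PMF (List ℕ × ℕ),
      swapRounding.Runs (encodeInput ends T ex δ) (ν.map fun r => (encodeOutput r.1, r.2)) ∧
      (∀ r ∈ ν.support, r.1.Nodup ∧ IsSpanningTree G r.1.toFinset) ∧
      DivideSwapLaw (IsForest G) T.toFinset (exchangeSets ex) δ (ν.map fun r => r.1.toFinset) ∧
      ∀ r ∈ ν.support, ∀ N : ℕ,
        N = G.vertexSet.ncard + exchangeSize (exchangeSets ex) +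
          trivialExchanges (exchangeSets ex) →
        r.2 ≤ 1029000000000000 * N * (Nat.log 2 N + 1) ^ 3 := by
  obtain ⟨N, hN⟩ : ∃ N, N = G.vertexSet.ncard + exchangeSize (exchangeSets ex) +
    trivialExchanges (exchangeSets ex) := ⟨_, rfl⟩
  obtain ⟨n, hn⟩ : ∃ n, n = Nat.log 2 N + 6 := ⟨_, rfl⟩
  let raw : ℕ → RawEdge := fun e => (e, (ends e).1, (ends e).2)
  let rex : List (List RawEdge × List RawEdge) := ex.map fun p => (p.1.map raw, p.2.map raw)
  obtain ⟨s, hs⟩ : ∃ s, s = T.length + rawSize rex := ⟨_, rfl⟩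
  have hsize : ∀ (v : List ℕ) (h0 : 0 ∈ v), exSize (labelExch h0 ends ex) = rawSize rex := by
    intro v h0
    simp [exSize, labelExch, rawSize, rex, unflagged, labelEdges, Function.comp_def]
  have hlabels : ∀ m, 8 * s + 1 ≤ 2 ^ m → ∃ u, (pairUp mergeUnion)^[m] (allLabels (T.map raw) rex) =
      [u] ∧ u.Pairwise (· < ·) ∧ Labels u ends T ex ∧ u.length ≤ 3 * s + 1 := by
    intro m hm
    obtain ⟨u, h1, h2, h3, h4, h5⟩ := exists_labels m (T.map raw) rex
      (by rwa [List.length_map, ← hs])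
    rw [List.length_map, ← hs] at h5
    refine ⟨u, h1, h2, ⟨h3, fun e he => h4 (raw e) ?_⟩, h5⟩
    rcases he with he | ⟨p, hp, he⟩
    · exact Or.inl (List.mem_map_of_mem he)
    · exact Or.inr ⟨_, List.mem_map_of_mem hp,
        he.imp (fun h => List.mem_map_of_mem h) fun h => List.mem_map_of_mem h⟩
  -- The bound of `s` in terms of `N` needs the number of vertices, which is compared with `T` by
  -- means of some list of labels. For this any large enough number of rounds will do; `8 * s + 1`
  -- avoids a circular use of `n`.
  have hsN : s ≤ 2 * N ∧ 1 ≤ N := by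
    obtain ⟨u, -, -, hu, -⟩ := hlabels (8 * s + 1) (Nat.lt_two_pow_self).le
    obtain ⟨h1, h2, -⟩ := divideSwap_labels hG hT hex hB hδ hu
    have h3 := exSize_labelExch_le (ends := ends) hu.zero hex
    rw [hsize] at h3
    omega
  -- The summand `6` in `n` is chosen for this: `2 ^ n` exceeds `32 * N`.
  have hsn : 8 * s + 1 ≤ 2 ^ n ∧ 3 * s + 1 ≤ 2 ^ n := by
    have h1 : N < 2 ^ (Nat.log 2 N + 1) := Nat.lt_pow_succ_log_self one_lt_two N
    rw [pow_succ] at h1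
    rw [hn, pow_add]
    omega
  obtain ⟨u, hu1, hu2, hu, hu3⟩ := hlabels n hsn.1
  have hul := hu3.trans hsn.2
  have hne : u ≠ [] := List.ne_nil_of_mem hu.zero
  -- From here on the keys are the labels of the given input, with the search tree that the program
  -- builds from them.
  let _ := keysOfSorted u hu2 hne n hul
  have hraw : ∀ l : List ℕ, (∀ e ∈ l, e ∈ u ∧ (ends e).1 ∈ u ∧ (ends e).2 ∈ u) →
      (labelEdges hu.zero ends l).map rawEdge = l.map raw := by
    intro l hl
    rw [labelEdges, List.map_map]
    refine List.map_congr_left fun e he => ?_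
    obtain ⟨h1, h2, h3⟩ := hl e he
    exact Prod.ext (val_label hu.zero h1) (Prod.ext (val_label hu.zero h2) (val_label hu.zero h3))
  have hrT := hraw T fun e he => hu.mem e (Or.inl he)
  let lex := ex.map fun p => (labelEdges hu.zero ends p.1, labelEdges hu.zero ends p.2)
  have hrex : (lex.map fun p => (p.1.map rawEdge, p.2.map rawEdge)) = rex := by
    simp only [lex, rex, List.map_map]
    refine List.map_congr_left fun p hp => ?_
    exact Prod.ext (hraw _ fun e he => hu.mem e (Or.inr ⟨p, hp, Or.inl he⟩))
      (hraw _ fun e he => hu.mem e (Or.inr ⟨p, hp, Or.inr he⟩))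
  have hlex : (lex.map fun p => (unflagged p.1, unflagged p.2)) = labelExch hu.zero ends ex := by
    simp only [lex, labelExch, List.map_map]
    rfl
  have hlen : (labelEdges hu.zero ends T).length = T.length := List.length_map _
  have hexs := hsize u hu.zero
  obtain ⟨m, hm⟩ := exists_joinTrees_eq u hu2 hne n hul
  obtain ⟨ν₀, hrun, hval, htime⟩ := rnd_main (P := swapRounding) n (labelEdges hu.zero ends T) lex δ
    (by simp [lex, hδ]) (s := s) (by rw [hlex, hexs, hlen, hs]) hsn.1 rfl u.attach (m := m)
    (by rwa [List.length_attach])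
    (by rw [hrT, hrex, hu1]; exact congrArg (fun l => [l]) (List.attach_map_subtype_val u).symm)
    hm
  rw [hlex] at hval
  obtain ⟨-, -, hspec⟩ := divideSwap_labels hG hT hex hB hδ hu
  have hn1 : n < 2 ^ n := Nat.lt_two_pow_self
  obtain ⟨hlaw, hsupp⟩ := hspec n n
    (by have := removedCount_le_exSize (labelExch hu.zero ends ex); omega) (by omega)
  generalize divideSwap n n (unflagged (labelEdges hu.zero ends T)) (labelExch hu.zero ends ex) δ =
    D at hval hlaw hsupp
  have henc : ∀ l : List {k // k ∈ u}, enc l = encodeOutput (l.map Subtype.val) := by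
    intro l
    rw [enc_list, encodeOutput, List.map_map]
    rfl
  have hin : Val.pair (enc (labelEdges hu.zero ends T)) (.pair (enc lex) (enc δ)) =
      encodeInput ends T ex δ := by
    have h1 : ∀ l : List ℕ, enc (l.map raw) = encodeEdges ends l := by
      intro l
      rw [enc_list, encodeEdges, List.map_map]
      rfl
    rw [← enc_rawEdges, hrT, ← enc_rawExch, hrex, h1, enc_list, enc_list, encodeInput]
    simp only [rex, List.map_map]
    congr 3
    refine List.map_congr_left fun p _ => ?_
    rw [Function.comp_apply, enc_pair, h1, h1]
  rw [hin] at hrun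
  have hdec : ∀ l, Function.invFun encodeOutput (encodeOutput l) = l :=
    Function.leftInverse_invFun encodeOutput_injective
  have hν : ∀ x ∈ ν₀.support, ∃ l ∈ D.support, x.1 = encodeOutput (l.map Subtype.val) := by
    intro x hx
    have h1 : x.1 ∈ (ν₀.map Prod.fst).support := by
      rw [PMF.support_map]
      exact ⟨x, hx, rfl⟩
    rw [hval, PMF.support_map] at h1
    obtain ⟨l, hl, h1⟩ := h1
    exact ⟨l, hl, by rw [← h1, henc]⟩
  -- The law of the machine values is decoded by `Function.invFun`; on its support all values are
  -- encoded outputs, so nothing is lost.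
  refine ⟨ν₀.map fun x => (Function.invFun encodeOutput x.1, x.2), ?_, ?_, ?_, ?_⟩
  · rw [PMF.map_comp]
    have h1 : ν₀.map ((fun r : List ℕ × ℕ => (encodeOutput r.1, r.2)) ∘
        fun x => (Function.invFun encodeOutput x.1, x.2)) = ν₀.map id :=
      map_congr_support fun x hx => by
        obtain ⟨l, -, h⟩ := hν x hx
        rw [Function.comp_apply, h, hdec, ← h, id]
    rw [h1, PMF.map_id]
    exact hrun
  · intro r hr
    rw [PMF.support_map] at hr
    obtain ⟨x, hx, rfl⟩ := hr
    obtain ⟨l, hl, h⟩ := hν x hx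
    beta_reduce
    rw [h, hdec]
    exact hsupp l hl
  · rw [PMF.map_comp]
    have h1 : ν₀.map ((fun r : List ℕ × ℕ => r.1.toFinset) ∘
        fun x => (Function.invFun encodeOutput x.1, x.2)) =
        (ν₀.map Prod.fst).map fun v => (Function.invFun encodeOutput v).toFinset := by
      rw [PMF.map_comp]
      rfl
    rw [h1, hval, PMF.map_comp]
    convert hlaw using 2
    ext1 l
    rw [Function.comp_apply, henc, hdec]
  · rintro r hr N' rfl
    rw [PMF.support_map] at hr
    obtain ⟨x, hx, rfl⟩ := hr
    rw [← hN]
    exact (htime x hx).trans (running_time_le hsN.1 hsN.2 hn)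

end SwapRounding

open SwapRounding

theorem theorem3p3 :
    -- the divide-and-conquer scheme can always be carried out, and all of its possible
    -- output laws are output laws of swap rounding
    (∀ (α : Type*) [DecidableEq α] (M : Matroid α) (B : Finset α)
        (ex : List (Finset α × Finset α)) (δ : List ℝ≥0),
      IsImplicitCombination (fun X => M.IsBase (X : Set α)) B ex δ →
        (∃ μ, DivideSwapLaw (fun X => M.Indep (X : Set α)) B ex δ μ) ∧
        ∀ μ, DivideSwapLaw (fun X => M.Indep (X : Set α)) B ex δ μ →
          SwapRoundLaw (fun X => M.Indep (X : Set α)) (δ.zip (bases B ex)) μ) ∧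
    -- one algorithm that implements it for spanning trees in near-linear time
    ∃ (P : Program) (C c : ℕ),
      ∀ (G : Graph ℕ ℕ) (ends : ℕ → ℕ × ℕ) (T : List ℕ) (ex : List (List ℕ × List ℕ))
        (δ : List ℝ≥0),
        (∀ e ∈ G.edgeSet, G.IsLink e (ends e).1 (ends e).2) →
        T.Nodup → (∀ p ∈ ex, p.1.Nodup ∧ p.2.Nodup) →
        IsImplicitCombination (IsSpanningTree G) T.toFinset (exchangeSets ex) δ →
        ∃ ν : PMF (List ℕ × ℕ),
          P.Runs (encodeInput ends T ex δ) (ν.map fun r => (encodeOutput r.1, r.2)) ∧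
          (∀ r ∈ ν.support, r.1.Nodup ∧ IsSpanningTree G r.1.toFinset) ∧
          SwapRoundLaw (IsForest G) (δ.zip (bases T.toFinset (exchangeSets ex)))
            (ν.map fun r => r.1.toFinset) ∧
          (IsTight T.toFinset (exchangeSets ex) →
            DivideSwapLaw (IsForest G) T.toFinset (exchangeSets ex) δ
              (ν.map fun r => r.1.toFinset)) ∧
          ∀ r ∈ ν.support, ∀ N : ℕ,
            N = G.vertexSet.ncard + exchangeSize (exchangeSets ex) +
              trivialExchanges (exchangeSets ex) →
            r.2 ≤ C * N * (Nat.log 2 N + 1) ^ c := by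
  refine ⟨fun α _ M B ex δ h => ⟨?_, fun μ hμ => hμ.swapRoundLaw h.length_eq⟩, swapRounding,
    1029000000000000, 3, fun G ends T ex δ hG hT hex h => ?_⟩
  · obtain ⟨μ, hμ, -⟩ := exists_divideSwapLaw M B ex δ h.length_eq h.isBase
    exact ⟨μ, hμ⟩
  · obtain ⟨ν, h1, h2, h3, h4⟩ := swapRounding_runs hG hT hex h.isBase
      (by rw [h.length_eq, exchangeSets, List.length_map])
    exact ⟨ν, h1, h2, h3.swapRoundLaw h.length_eq, fun _ => h3, h4⟩
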